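/- Let $V\in L^3(\mathbb R^3)$ be real-valued, non-negative, spherically symmetric and compactly supported. Let $a_0$ be its scattering length: the solution $f_0$ of $(-\Delta+\tfrac12 V)f_0=0$ on $\mathbb R^3$ with $f_0(x)\to1$ as $|x|\to\infty$ has the form $f_0(x)=1-a_0/|x|$ outside a ball containing the support of $V$. Fix $\ell>0$ and $\varphi\in H^1(\mathbb R^3)$. For an integer $N\ge 1$: - let $f_\ell$ be the ground state of the Neumann problem $(-\Delta+\tfrac12V)f_\ell=\lambda_\ell f_\ell$ on the ball $|x|\le N\ell$, normalized by $f_\ell(x)=1$ for $|x|=N\ell$ and extended by $f_\ell(x)=1$ for $|x|>N\ell$; put $w_\ell=1-f_\ell$ ($f_\ell,\lambda_\ell,w_\ell$ depend on $N$); - let $t\mapsto\widetilde\varphi_t$ be the solution in $C(\mathbb R,H^1(\mathbb R^3))\cap C^1(\mathbb R,H^{-1}(\mathbb R^3))$ of the modified Gross-Pitaevskii equation $$i\partial_t\widetilde\varphi_t=-\Delta\widetilde\varphi_t+\big(N^3V(N\cdot)f_\ell(N\cdot)*|\widetilde\varphi_t|^2\big)\widetilde\varphi_t,\qquad \widetilde\varphi_{t=0}=\varphi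 ;$$ - put $k_t(x;y)=-Nw_\ell(N(x-y))\,\widetilde\varphi_t(x)\,\widetilde\varphi_t(y)$ and $$\begin{aligned}C_{N,t}=\;&\tfrac12\big\langle\widetilde\varphi_t,\big([N^3V(N\cdot)(N-1-2Nf_\ell(N\cdot))]*|\widetilde\varphi_t|^2\big)\widetilde\varphi_t\big\rangle\\&+\int dx\,dy\,|\nabla_xk_t(x;y)|^2+\tfrac12\int dx\,dy\,N^2V(N(x-y))|k_t(x;y)|^2\\&+\operatorname{Re}\int dx\,dy\,N^3V(N(x-y))\,\overline{\widetilde\varphi_t(x)}\;\overline{\widetilde\varphi_t(y)}\,k_t(x;y).\end{aligned}$$ Then $k_t$ has a square-integrable weak gradient $\nabla_x k_t$ for all $N\ge 1$ and $t\in\mathbb R$, and there is a constant $C>0$, independent of $N$ and $t$, such that for all $N\ge1$ and $t\in\mathbb R$ $$\Big|\big[C_{N,t}+N\langle i\partial_t\widetilde\varphi_t,\widetilde\varphi_t\rangle\big]-N\mathcal E_{\mathrm{GP}}(\varphi)\Big|\le C,\qquad \mathcal E_{\mathrm{GP}}(\varphi)=\int\big[|\nabla\varphi|^2+4\pi a_0|\varphi|^4\big]dx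 ,$$ where $\langle\cdot,\cdot\rangle$ is antilinear in the first argument and $\langle i\partial_t\widetilde\varphi_t,\widetilde\varphi_t\rangle$ is the duality pairing between $H^{-1}(\mathbb R^3)$ and $H^1(\mathbb R^3)$. -/

import Mathlib

open MeasureTheory Set Filter Topology
open scoped ContDiff Gradient

noncomputable section

namespace GP

/-- Physical space `ℝ³`. -/
abbrev R3 : Type := EuclideanSpace ℝ (Fin 3)

/-- The `i`-th standard basis vector of `ℝ³`. -/
def e (i : Fin 3) : R3 := EuclideanSpace.single i 1

/-- On the set `Ω` (meant to be open), `g` is the weak derivative of `u` in the direction `v`.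
It is used for locally integrable `u` and `g` only. -/
def IsWeakDeriv {X F : Type*} [NormedAddCommGroup X] [NormedSpace ℝ X] [MeasureSpace X]
    [NormedAddCommGroup F] [NormedSpace ℝ F] (Ω : Set X) (v : X) (u g : X → F) : Prop :=
  ∀ ψ : X → ℝ, ContDiff ℝ ∞ ψ → HasCompactSupport ψ → tsupport ψ ⊆ Ω →
    ∫ x in Ω, (fderiv ℝ ψ x v) • u x = -∫ x in Ω, ψ x • g x

/-! ### Scattering theory -/

/-- `f` solves `(-Δ + V/2) f = 0` on `ℝ³` (weakly, with locally square-integrable weak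
gradient `G`), and `f (x) → 1` as `|x| → ∞`; `f` is the continuous representative. -/
structure IsZeroEnergySolution (V f : R3 → ℝ) : Prop where
  continuous : Continuous f
  weak_eq : ∃ G : R3 → R3,
    (∀ r : ℝ, MemLp G 2 (volume.restrict (Metric.ball 0 r))) ∧
    (∀ i, IsWeakDeriv univ (e i) f (fun x => G x i)) ∧
    ∀ ψ : R3 → ℝ, ContDiff ℝ ∞ ψ → HasCompactSupport ψ →
      ∫ x, (inner ℝ (G x) (∇ ψ x) + 1 / 2 * V x * f x * ψ x) = 0
  tendsto_one : Tendsto f (cocompact R3) (𝓝 1)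

/-- `a` is the scattering length of the compactly supported potential `V`: the zero-energy
solution has the form `f (x) = 1 - a / |x|` outside a ball that contains the support of `V`. -/
def IsScatteringLength (V : R3 → ℝ) (a : ℝ) : Prop :=
  ∃ f : R3 → ℝ, IsZeroEnergySolution V f ∧
    ∃ R : ℝ, ∀ x, R < ‖x‖ → V x = 0 ∧ f x = 1 - a / ‖x‖

/-- `f` is the ground state of `-Δ + V/2` on the ball `|x| < r` with Neumann boundary
conditions, with eigenvalue `lam`, normalized by `f = 1` for `|x| = r` and extended by `1`
to `|x| > r`; `f` is the continuous representative.
The Neumann boundary condition is encoded, as usual, in the fact that the test functions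
in the weak eigenvalue equation need not vanish on the boundary of the ball.
The last field says that `lam` is the bottom of the spectrum. -/
structure IsNeumannGroundState (V : R3 → ℝ) (r lam : ℝ) (f : R3 → ℝ) : Prop where
  continuous : Continuous f
  eq_one : ∀ x, r ≤ ‖x‖ → f x = 1
  weak_eq : ∃ G : R3 → R3,
    MemLp G 2 (volume.restrict (Metric.ball 0 r)) ∧
    (∀ i, IsWeakDeriv (Metric.ball 0 r) (e i) f (fun x => G x i)) ∧
    ∀ g : R3 → ℝ, ContDiff ℝ ∞ g →
      ∫ x in Metric.ball 0 r, (inner ℝ (G x) (∇ g x) + 1 / 2 * V x * f x * g x)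
        = lam * ∫ x in Metric.ball 0 r, f x * g x
  lowest : ∀ g : R3 → ℝ, ContDiff ℝ ∞ g →
    lam * ∫ x in Metric.ball 0 r, g x ^ 2
      ≤ ∫ x in Metric.ball 0 r, (‖∇ g x‖ ^ 2 + 1 / 2 * V x * g x ^ 2)

/-! ### The Sobolev space `H¹(ℝ³)` and its dual -/

/-- `L²(ℝ³; ℂ)`. -/
abbrev L2 : Type := Lp ℂ 2 (volume : Measure R3)

theorem integrable_contDiff_smul_L2 {ψ : R3 → ℝ} (hψ : Continuous ψ)
    (hc : HasCompactSupport ψ) (u : L2) : Integrable (fun x => ψ x • u x) := by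
  have h1 : MemLp ψ 2 (volume : Measure R3) := hψ.memLp_of_hasCompactSupport hc
  exact (memLp_one_iff_integrable (μ := volume)).1
    (MemLp.smul (p := 2) (q := 2) (r := 1) (Lp.memLp u) h1)

theorem integrable_fderiv_smul_L2 {ψ : R3 → ℝ} (hψ : ContDiff ℝ ∞ ψ)
    (hc : HasCompactSupport ψ) (v : R3) (u : L2) :
    Integrable (fun x => (fderiv ℝ ψ x v) • u x) :=
  integrable_contDiff_smul_L2 (ψ := fun x => fderiv ℝ ψ x v)
    ((hψ.continuous_fderiv (by simp)).clm_apply continuous_const)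
    (hc.fderiv_apply (𝕜 := ℝ) v) u

/-- `H¹(ℝ³; ℂ)`: the pairs `(u, ∇u)` of a function in `L²` and its weak gradient in `L²`, with
`‖u‖²_{H¹} = ‖u‖²_{L²} + ‖∇u‖²_{L²}`. -/
def H1 : Submodule ℂ (WithLp 2 (L2 × PiLp 2 (fun _ : Fin 3 => L2))) where
  carrier := {p | ∀ i, IsWeakDeriv univ (e i) (p.fst : R3 → ℂ) (p.snd i : R3 → ℂ)}
  zero_mem' := by
    intro i ψ _ _ _
    simp
  add_mem' := by
    intro p q hp hq i ψ h1 h2 h3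
    have hpi := hp i ψ h1 h2 h3
    have hqi := hq i ψ h1 h2 h3
    simp only [Measure.restrict_univ] at hpi hqi ⊢
    have ha : ∀ c : R3 → ℝ, ∀ a b : L2,
        (fun x => c x • ((a + b : L2) : R3 → ℂ) x) =ᵐ[volume]
          fun x => c x • a x + c x • b x := by
      intro c a b
      filter_upwards [Lp.coeFn_add a b] with x hx
      rw [hx, Pi.add_apply, smul_add]
    have e1 := integral_congr_ae (ha (fun x => fderiv ℝ ψ x (e i)) p.fst q.fst)
    have e2 := integral_congr_ae (ha ψ (p.snd i) (q.snd i))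
    rw [integral_add (integrable_fderiv_smul_L2 h1 h2 _ _)
      (integrable_fderiv_smul_L2 h1 h2 _ _)] at e1
    rw [integral_add (integrable_contDiff_smul_L2 h1.continuous h2 _)
      (integrable_contDiff_smul_L2 h1.continuous h2 _)] at e2
    refine e1.trans (Eq.trans ?_ (congrArg Neg.neg e2).symm)
    rw [hpi, hqi, neg_add]
  smul_mem' := by
    intro c p hp i ψ h1 h2 h3
    have hpi := hp i ψ h1 h2 h3
    simp only [Measure.restrict_univ] at hpi ⊢
    have ha : ∀ d : R3 → ℝ, ∀ a : L2,
        (fun x => d x • ((c • a : L2) : R3 → ℂ) x) =ᵐ[volume] fun x => c • (d x • a x) := by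
      intro d a
      filter_upwards [Lp.coeFn_smul c a] with x hx
      rw [hx, Pi.smul_apply, smul_comm]
    have e1 := integral_congr_ae (ha (fun x => fderiv ℝ ψ x (e i)) p.fst)
    have e2 := integral_congr_ae (ha ψ (p.snd i))
    rw [integral_smul] at e1 e2
    refine e1.trans (Eq.trans ?_ (congrArg Neg.neg e2).symm)
    rw [hpi, smul_neg]

/-- The embedding `H¹ → L²`. -/
def toL2 : H1 →L[ℂ] L2 := (WithLp.fstL 2 ℂ L2 (PiLp 2 (fun _ : Fin 3 => L2))).comp H1.subtypeL

/-- The weak gradient of an `H¹`-function. -/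
def grad (u : H1) : PiLp 2 (fun _ : Fin 3 => L2) := (u : WithLp 2 (L2 × _)).snd

/-- `H⁻¹(ℝ³)`, the dual space of `H¹(ℝ³)`. -/
abbrev HMinus1 : Type := H1 →L[ℂ] ℂ

/-- The embedding `L² → H⁻¹`, `f ↦ ⟨f, ·⟩`. Inner products are antilinear in the first
argument, so that `⟨F, v⟩` is written `F v` for `F` in `HMinus1` and `v` in `H1`. -/
def toHMinus1 (f : L2) : HMinus1 := (innerSL ℂ f).comp toL2

/-! ### The modified Gross-Pitaevskii equation -/

/-- The convolution `W * |u|²`. -/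
def convSq (W : R3 → ℝ) (u : H1) : R3 → ℝ :=
  convolution W (fun y => ‖toL2 u y‖ ^ 2) (ContinuousLinearMap.mul ℝ ℝ) volume

/-- The potential `N³ V(N x) f(N x)`. -/
def modPotential (V f : R3 → ℝ) (N : ℕ) (x : R3) : ℝ :=
  (N : ℝ) ^ 3 * V ((N : ℝ) • x) * f ((N : ℝ) • x)

/-- The time derivative `i ∂ₜ u(t)` in `H⁻¹(ℝ³)` of a curve `u` in `H¹(ℝ³)`. -/
def iTimeDeriv (u : ℝ → H1) (t : ℝ) : HMinus1 :=
  deriv (fun s => toHMinus1 (Complex.I • toL2 (u s))) t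

/-- `u` is the solution in `C(ℝ, H¹(ℝ³)) ∩ C¹(ℝ, H⁻¹(ℝ³))` of
`i ∂ₜ u = -Δ u + (N³ V(N·) f(N·) * |u|²) u` with `u(0) = φ`. -/
structure IsModifiedGPSolution (V f : R3 → ℝ) (N : ℕ) (φ : H1) (u : ℝ → H1) : Prop where
  continuous : Continuous u
  initial : u 0 = φ
  differentiable : Differentiable ℝ (fun s => toHMinus1 (Complex.I • toL2 (u s)))
  equation : ∀ t : ℝ, ∀ v : H1,
    iTimeDeriv u t v = inner ℂ (grad (u t)) (grad v)
      + ∫ x, (starRingEnd ℂ) ((convSq (modPotential V f N) (u t) x : ℂ) * toL2 (u t) x)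
          * toL2 v x

/-! ### The constant `C_{N,t}` and the Gross-Pitaevskii energy -/

/-- The kernel `k(x;y) = -N w(N(x-y)) u(x) u(y)` with `w = 1 - f`. -/
def kernel (f : R3 → ℝ) (N : ℕ) (u : H1) (p : R3 × R3) : ℂ :=
  -((N * (1 - f ((N : ℝ) • (p.1 - p.2))) : ℝ) : ℂ) * toL2 u p.1 * toL2 u p.2

/-- `G` is the weak gradient of `k(x;y)` with respect to `x`, and it is square-integrable. -/
def IsGradX (k : R3 × R3 → ℂ) (G : Fin 3 → R3 × R3 → ℂ) : Prop :=
  ∀ i, MemLp (G i) 2 (volume : Measure (R3 × R3)) ∧ IsWeakDeriv univ ((e i, 0) : R3 × R3) k (G i)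

open Classical in
/-- `∫ dx dy |∇ₓ k(x;y)|²`, set to `0` if `k` has no square-integrable weak `x`-gradient. -/
def gradXSq (k : R3 × R3 → ℂ) : ℝ :=
  if h : ∃ G, IsGradX k G then ∫ p, ∑ i, ‖h.choose i p‖ ^ 2 else 0

/-- The constant `C_{N,t}`, as a function of `u = φ̃ₜ`. -/
def constC (V f : R3 → ℝ) (N : ℕ) (u : H1) : ℝ :=
  1 / 2 * (∫ x, convSq (fun z => (N : ℝ) ^ 3 * V ((N : ℝ) • z)
      * ((N : ℝ) - 1 - 2 * N * f ((N : ℝ) • z))) u x * ‖toL2 u x‖ ^ 2)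
  + gradXSq (kernel f N u)
  + 1 / 2 * (∫ p : R3 × R3, (N : ℝ) ^ 2 * V ((N : ℝ) • (p.1 - p.2)) * ‖kernel f N u p‖ ^ 2)
  + (∫ p : R3 × R3, (((N : ℝ) ^ 3 * V ((N : ℝ) • (p.1 - p.2)) : ℝ) : ℂ)
      * (starRingEnd ℂ) (toL2 u p.1) * (starRingEnd ℂ) (toL2 u p.2) * kernel f N u p).re

/-- The Gross-Pitaevskii energy `∫ (|∇φ|² + 4π a |φ|⁴)`. -/
def energyGP (a : ℝ) (φ : H1) : ℝ :=
  ∫ x, ((∑ i, ‖grad φ i x‖ ^ 2) + 4 * Real.pi * a * ‖toL2 φ x‖ ^ 4)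

end GP

end

/-!
Write `p = f(N ·)` for the dilated ground state, `Ψ` for the correlation
`Ψ(z) = ∫ |u(x)|² |u(x - z)|² dx` of the density of `u = u(t)` with itself, and `W = N³ V(N ·) p`
for the interaction in the modified equation. All the terms of the constant except `∫ |∇ₓ k|²` are
integrals `∫ N³ V(N z) q(z) Ψ(z) dz` with `q` a polynomial in `p` whose coefficients depend on `N`.

In `∫ |∇ₓ k|²` the derivative falls on `1 - p` or on `u(x)`. The square of the first contribution
and the cross term add up to `N² (∫ |∇p|² Ψ - ∫ (1 - p) ∇p · ∇Ψ)`, which up to its sign is the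
gradient part of the equation for `p` tested with `(1 - p) Ψ`; so it equals
`N² ∫ (N² V(N z) / 2 - N² lam) p (1 - p) Ψ` over the ball (`IsProfile.test_densityCorr`,
`IsProfile.integral_kernelGrad`). The leading contributions then add up, through
`1/2 - p + p (1 - p)/2 + (1 - p)²/2 - (1 - p) = -p/2`, to `-(N/2) ∫ W Ψ`, with an error made of
`∫ N³ V(N z) Ψ / 2`, of the eigenvalue term `N⁴ lam ∫ p (1 - p) Ψ`, and of
`N² ∫∫ (1 - p(x - y))² |∇u(x)|² |u(y)|²` (`DilatedBounds.constC_eq`). Since the duality pairing is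
`∫ |∇u|² + ∫ W Ψ`, the bracket in the theorem is `N (∫ |∇u|² + ½ ∫ W Ψ)` up to this error, that is,
`N` times the conserved energy of the modified equation, which may be evaluated at time zero. There
`∫ W = ∫ V f` is `8 π a₀ + O(1/N)`, and `Ψ` is Lipschitz, so that the energy is `E_GP(φ) + O(1/N)`
(`DilatedBounds.abs_hartreeEnergy_sub_energyGP_le`).

The error terms and the last step rest on bounds for the ground state which are uniform in `N`
(`IsPotential.exists_groundStateBounds`): `0 ≤ f ≤ C`, `lam ≤ C N⁻³`, `|1 - f(x)| ≤ C / |x|` and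
`|∫ V f / 2 - 4 π a₀| ≤ C / N`. Since `f` is continuous and equal to one outside the ball, its
zero-extended gradient is a weak gradient on `ℝ³`, and the Neumann condition makes `1 - f` the
Newtonian potential of `(V/2 - lam) f` restricted to the ball. With the variational bound
`lam = O(N⁻³)` this gives the upper bounds. Positivity and uniqueness of the ground state come from
one fact: a non-negative solution that vanishes outside the ball is zero
(`IsPotential.eq_zero_of_negLap`), applied to `|f| - f` and to `|f - f'|`. Uniqueness also makes `f`
even, and it makes the constants for the finitely many small `N` depend on `N` only. The scattering
length enters through Green's identity with the zero energy solution. The term with `|∇u|²` is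
bounded by Hardy's inequality, as `N |1 - f(N z)| ≤ C / |z|`.

Bounds uniform in time need conservation of mass and energy. The solution is only a continuous curve
in `H¹`, differentiable in `H⁻¹`, so the energy is not obviously differentiable along it. Its time
averages are `C¹` in `H¹` and solve the averaged equation; the derivative of the energy along them
contains the commutator of the nonlinearity with averaging, which tends to zero because
`u ↦ (W * |u|²) u` is continuous on `H¹` (`continuous_hartree`, `eq_of_hasDerivAt_timeAverage`).
-/

namespace GP

noncomputable section

open scoped ENNReal NNReal
set_option linter.unusedSectionVars false

section

/-! ### Mollification -/

/-- A sequence of smooth bump functions at the origin with supports shrinking to a point. -/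
def bump (n : ℕ) : ContDiffBump (0 : R3) where
  rIn := 1 / (2 * (n + 1))
  rOut := 1 / (n + 1)
  rIn_pos := by positivity
  rIn_lt_rOut := by
    have : (0 : ℝ) < n + 1 := by positivity
    rw [div_lt_div_iff₀ (by positivity) this]
    linarith

/-- The smooth mollifier of mass one supported in the ball of radius `1 / (n + 1)`. -/
def moll (n : ℕ) : R3 → ℝ := (bump n).normed volume

set_option linter.unusedSectionVars false

variable {E : Type*} [NormedAddCommGroup E] [NormedSpace ℝ E]

/-- The mollification of a function. -/
def smoothen (n : ℕ) (u : R3 → E) : R3 → E :=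
  convolution (moll n) u (ContinuousLinearMap.lsmul ℝ ℝ) volume

theorem contDiff_moll (n : ℕ) : ContDiff ℝ ∞ (moll n) := (bump n).contDiff_normed

theorem hasCompactSupport_moll (n : ℕ) : HasCompactSupport (moll n) :=
  (bump n).hasCompactSupport_normed

theorem moll_nonneg (n : ℕ) (x : R3) : 0 ≤ moll n x := (bump n).nonneg_normed x

theorem integral_moll (n : ℕ) : ∫ x, moll n x = 1 := (bump n).integral_normed

theorem integrable_moll (n : ℕ) : Integrable (moll n) := (bump n).integrable_normed

theorem moll_eq_zero {n : ℕ} {x : R3} (hx : 1 / ((n : ℝ) + 1) ≤ ‖x‖) : moll n x = 0 := by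
  have h : x ∉ Function.support (moll n) := by
    rw [moll, ContDiffBump.support_normed_eq]
    simpa [bump] using hx
  simpa using h

theorem tendsto_bump_rOut : Tendsto (fun n => (bump n).rOut) atTop (𝓝 0) :=
  tendsto_one_div_add_atTop_nhds_zero_nat

theorem smoothen_apply (n : ℕ) (u : R3 → E) (x : R3) :
    smoothen n u x = ∫ y, moll n (x - y) • u y := convolution_lsmul_swap

theorem smoothen_apply' (n : ℕ) (u : R3 → E) (x : R3) :
    smoothen n u x = ∫ y, moll n y • u (x - y) := rfl

theorem contDiff_smoothen (n : ℕ) {u : R3 → E} (hu : LocallyIntegrable u) :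
    ContDiff ℝ ∞ (smoothen n u) :=
  (hasCompactSupport_moll n).contDiff_convolution_left _ (contDiff_moll n) hu

theorem integrable_moll_smul (n : ℕ) {u : R3 → E} (hu : LocallyIntegrable u) (x : R3) :
    Integrable (fun y => moll n (x - y) • u y) :=
  hu.integrable_smul_left_of_hasCompactSupport
    ((contDiff_moll n).continuous.comp (continuous_const.sub continuous_id))
    ((hasCompactSupport_moll n).comp_homeomorph (Homeomorph.subLeft x))

theorem integrable_moll_smul' (n : ℕ) {u : R3 → E} (hu : LocallyIntegrable u) (x : R3) :
    Integrable (fun y => moll n y • u (x - y)) := by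
  simpa using (integrable_moll_smul n hu x).comp_sub_left x

theorem hasCompactSupport_smoothen (n : ℕ) {u : R3 → E} (hu : HasCompactSupport u) :
    HasCompactSupport (smoothen n u) :=
  HasCompactSupport.convolution _ (hasCompactSupport_moll n) hu

theorem smoothen_eq_zero {n : ℕ} {u : R3 → E} {r : ℝ} (hu : ∀ x, r ≤ ‖x‖ → u x = 0) {x : R3}
    (hx : r + 1 / ((n : ℝ) + 1) ≤ ‖x‖) : smoothen n u x = 0 := by
  rw [smoothen_apply']
  refine integral_eq_zero_of_ae (Eventually.of_forall fun y => ?_)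
  by_cases hy : 1 / ((n : ℝ) + 1) ≤ ‖y‖
  · simp [moll_eq_zero hy]
  · have : r ≤ ‖x - y‖ := by
      have := norm_sub_norm_le x y
      push Not at hy
      linarith
    simp [hu _ this]

theorem tendstoUniformly_smoothen {u : R3 → E} [CompleteSpace E] (hu : UniformContinuous u) :
    TendstoUniformly (fun n => smoothen n u) u atTop := by
  rw [Metric.tendstoUniformly_iff]
  intro ε hε
  obtain ⟨δ, hδ, h⟩ := Metric.uniformContinuous_iff.1 hu (ε / 2) (by positivity)
  filter_upwards [tendsto_bump_rOut.eventually (gt_mem_nhds hδ)] with n hn x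
  rw [dist_comm]
  refine lt_of_le_of_lt ((bump n).dist_normed_convolution_le (ε := ε / 2)
    hu.continuous.aestronglyMeasurable fun y hy => ?_) (by linarith)
  exact (h (lt_trans hy hn)).le

/-! ### Weak derivatives -/

theorem isWeakDeriv_of_contDiff {X : Type*} [NormedAddCommGroup X] [NormedSpace ℝ X]
    [MeasureSpace X] [BorelSpace X] [FiniteDimensional ℝ X]
    [(volume : Measure X).IsAddHaarMeasure] {u : X → E} (hu : ContDiff ℝ 1 u) (v : X) :
    IsWeakDeriv univ v u (fun x => fderiv ℝ u x v) := by
  intro ψ hψ hc _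
  have hdψ : Continuous fun x => fderiv ℝ ψ x v :=
    (hψ.continuous_fderiv (by simp)).clm_apply continuous_const
  have hdu : Continuous fun x => fderiv ℝ u x v :=
    (hu.continuous_fderiv (by simp)).clm_apply continuous_const
  have hcd : HasCompactSupport fun x => fderiv ℝ ψ x v := hc.fderiv_apply (𝕜 := ℝ) v
  have := integral_smul_fderiv_eq_neg_fderiv_smul_of_integrable (μ := (volume : Measure X))
    (f := ψ) (g := u) (v := v)
    ((hdψ.smul hu.continuous).integrable_of_hasCompactSupport hcd.smul_right)
    ((hψ.continuous.smul hdu).integrable_of_hasCompactSupport hc.smul_right)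
    ((hψ.continuous.smul hu.continuous).integrable_of_hasCompactSupport hc.smul_right)
    (fun x _ => (hψ.differentiable (by simp)).differentiableAt)
    (fun x _ => (hu.differentiable (by simp)).differentiableAt)
  simp only [Measure.restrict_univ]
  rw [this, neg_neg]

theorem fderiv_smoothen {u g : R3 → E} {v : R3} (hu : LocallyIntegrable u)
    (h : IsWeakDeriv univ v u g) (n : ℕ) (x : R3) :
    fderiv ℝ (smoothen n u) x v = smoothen n g x := by
  have h1 := ((hasCompactSupport_moll n).hasFDerivAt_convolution_left
    (ContinuousLinearMap.lsmul ℝ ℝ) ((contDiff_moll n).of_le (by simp)) hu x).fderiv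
  have hint : Integrable (fun t => ((ContinuousLinearMap.lsmul ℝ ℝ (E := E)).precompL R3)
      (fderiv ℝ (moll n) t) (u (x - t))) :=
    ((hasCompactSupport_moll n).fderiv ℝ).convolutionExists_left
      ((ContinuousLinearMap.lsmul ℝ ℝ (E := E)).precompL R3)
      ((contDiff_moll n).continuous_fderiv (by simp)) hu x
  rw [smoothen, h1, convolution_def, ContinuousLinearMap.integral_apply hint]
  simp only [ContinuousLinearMap.precompL_apply, ContinuousLinearMap.lsmul_apply]
  have h2 := h (fun y => moll n (x - y))
    ((contDiff_moll n).comp (contDiff_const.sub contDiff_id))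
    ((hasCompactSupport_moll n).comp_homeomorph (Homeomorph.subLeft x)) (subset_univ _)
  simp only [Measure.restrict_univ] at h2
  have h3 : ∀ y, fderiv ℝ (fun y => moll n (x - y)) y v = - fderiv ℝ (moll n) (x - y) v := by
    intro y
    have := ((((contDiff_moll n).differentiable (by simp)) (x - y)).hasFDerivAt.comp y
      ((hasFDerivAt_const x y).sub (hasFDerivAt_id y))).fderiv
    simpa [Function.comp_def] using congrArg (fun L => L v) this
  simp only [h3, neg_smul, integral_neg, neg_inj] at h2
  rw [smoothen_apply, ← h2, ← integral_sub_left_eq_self _ volume x]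
  simp

/-! ### Convergence of mollifications in `L²` -/

theorem tendsto_eLpNorm_translate_sub {u : R3 → E} (hu : MemLp u 2 volume) :
    Tendsto (fun y : R3 => eLpNorm (fun x => u (x - y) - u x) 2 volume) (𝓝 0) (𝓝 0) := by
  let T : R3 → C(R3, R3) := fun y => ⟨fun x => x - y, by fun_prop⟩
  have hT : Continuous T :=
    ContinuousMap.continuous_of_continuous_uncurry _ (by
      change Continuous fun p : R3 × R3 => p.2 - p.1
      fun_prop)
  have hm : ∀ y, MeasurePreserving (T y) volume volume := fun y => measurePreserving_sub_right volume y
  have h := (Continuous.compMeasurePreservingLp (f := fun _ : R3 => hu.toLp u) continuous_const hT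
    hm (by simp)).tendsto 0
  rw [Lp.tendsto_Lp_iff_tendsto_eLpNorm'] at h
  refine h.congr fun y => eLpNorm_congr_ae ?_
  have e1 := Lp.coeFn_compMeasurePreserving (hu.toLp u) (hm y)
  have e0 := Lp.coeFn_compMeasurePreserving (hu.toLp u) (hm 0)
  have e2 := (hm y).quasiMeasurePreserving.ae_eq_comp hu.coeFn_toLp
  have e3 := (hm 0).quasiMeasurePreserving.ae_eq_comp hu.coeFn_toLp
  filter_upwards [e1, e0, e2, e3] with x h1 h0 h2 h3
  rw [Pi.sub_apply, h1, h0, h2, h3]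
  simp [T]

theorem aestronglyMeasurable_comp_sub {u : R3 → E} (hu : AEStronglyMeasurable u volume) :
    AEStronglyMeasurable (fun p : R3 × R3 => u (p.1 - p.2)) volume :=
  hu.comp_quasiMeasurePreserving (quasiMeasurePreserving_sub volume volume)

/-- Jensen's inequality for a mollification. -/
theorem enorm_smoothen_sub_sq_le (n : ℕ) [CompleteSpace E] {u : R3 → E}
    (hu : LocallyIntegrable u) (x : R3) :
    ‖smoothen n u x - u x‖ₑ ^ (2 : ℝ)
      ≤ ∫⁻ y, ENNReal.ofReal (moll n y) * ‖u (x - y) - u x‖ₑ ^ (2 : ℝ) := by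
  have h0 : smoothen n u x - u x = ∫ y, moll n y • (u (x - y) - u x) := by
    simp_rw [smul_sub]
    rw [integral_sub (integrable_moll_smul' n hu x) ((integrable_moll n).smul_const _),
      integral_smul_const, integral_moll, one_smul, smoothen_apply']
  have hφm : Measurable fun y => ENNReal.ofReal (moll n y) :=
    (contDiff_moll n).continuous.measurable.ennreal_ofReal
  have hmass : ∫⁻ y, ENNReal.ofReal (moll n y) = 1 := by
    rw [← ofReal_integral_eq_lintegral_ofReal (integrable_moll n)
      (Eventually.of_forall (moll_nonneg n)), integral_moll, ENNReal.ofReal_one]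
  have hd : AEMeasurable (fun y => ‖u (x - y) - u x‖ₑ) volume := by
    have : AEStronglyMeasurable (fun y => u (x - y)) volume :=
      hu.aestronglyMeasurable.comp_measurePreserving (Measure.measurePreserving_sub_left volume x)
    exact (this.sub aestronglyMeasurable_const).enorm
  have h1 : ‖smoothen n u x - u x‖ₑ
      ≤ ∫⁻ y, ENNReal.ofReal (moll n y) ^ (1 / 2 : ℝ)
        * (ENNReal.ofReal (moll n y) ^ (1 / 2 : ℝ) * ‖u (x - y) - u x‖ₑ) := by
    rw [h0]
    refine (enorm_integral_le_lintegral_enorm _).trans (lintegral_mono fun y => ?_)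
    rw [enorm_smul, ← mul_assoc, ← ENNReal.rpow_add_of_nonneg _ _ (by norm_num) (by norm_num),
      Real.enorm_eq_ofReal (moll_nonneg n y)]
    norm_num
  have h2 := ENNReal.lintegral_mul_le_Lp_mul_Lq (volume : Measure R3) Real.HolderConjugate.two_two
    (hφm.pow_const (1 / 2 : ℝ)).aemeasurable
    ((hφm.pow_const (1 / 2 : ℝ)).aemeasurable.mul hd)
  have h3 := h1.trans h2
  simp only [Pi.mul_apply, ← ENNReal.rpow_mul,
    ENNReal.mul_rpow_of_nonneg _ _ (zero_le_two : (0 : ℝ) ≤ 2)] at h3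
  norm_num [hmass] at h3
  calc ‖smoothen n u x - u x‖ₑ ^ (2 : ℝ) ≤ _ := ENNReal.rpow_le_rpow h3 (by norm_num)
    _ = _ := by rw [← ENNReal.rpow_mul]; norm_num

/-- A mollification is as close to the function in `L²` as the translates by the small vectors are:
Jensen's inequality, then Tonelli. -/
theorem eLpNorm_smoothen_sub_le [CompleteSpace E] {u : R3 → E} (hu : MemLp u 2 volume) (n : ℕ)
    {ε : ℝ≥0∞} (h : ∀ y : R3, ‖y‖ < 1 / ((n : ℝ) + 1) →
      eLpNorm (fun x => u (x - y) - u x) 2 volume ≤ ε) :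
    eLpNorm (smoothen n u - u) 2 volume ≤ ε := by
  have hloc : LocallyIntegrable u := hu.locallyIntegrable (by norm_num)
  have key : ∫⁻ x, ‖smoothen n u x - u x‖ₑ ^ (2 : ℝ) ≤ ε ^ (2 : ℝ) := by
    calc ∫⁻ x, ‖smoothen n u x - u x‖ₑ ^ (2 : ℝ)
        ≤ ∫⁻ x, ∫⁻ y, ENNReal.ofReal (moll n y) * ‖u (x - y) - u x‖ₑ ^ (2 : ℝ) :=
          lintegral_mono fun x => enorm_smoothen_sub_sq_le n hloc x
      _ = ∫⁻ y, ∫⁻ x, ENNReal.ofReal (moll n y) * ‖u (x - y) - u x‖ₑ ^ (2 : ℝ) := by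
          refine lintegral_lintegral_swap ?_
          have m1 : AEStronglyMeasurable (fun p : R3 × R3 => u (p.1 - p.2) - u p.1)
              (volume.prod volume) :=
            (aestronglyMeasurable_comp_sub hu.1).sub hu.1.comp_fst
          have m2 : Measurable fun p : R3 × R3 => ENNReal.ofReal (moll n p.2) :=
            ((contDiff_moll n).continuous.measurable.comp measurable_snd).ennreal_ofReal
          exact m2.aemeasurable.mul (m1.enorm.pow_const _)
      _ ≤ ∫⁻ y, ENNReal.ofReal (moll n y) * ε ^ (2 : ℝ) := by
          refine lintegral_mono fun y => ?_
          rw [lintegral_const_mul' _ _ ENNReal.ofReal_ne_top]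
          by_cases hy : 1 / ((n : ℝ) + 1) ≤ ‖y‖
          · simp [moll_eq_zero hy]
          · have h5 := h y (not_le.1 hy)
            rw [eLpNorm_eq_lintegral_rpow_enorm_toReal (by simp) (by simp)] at h5
            gcongr
            have h6 := ENNReal.rpow_le_rpow h5 (zero_le_two : (0 : ℝ) ≤ 2)
            rw [← ENNReal.rpow_mul] at h6
            simpa using h6
      _ = ε ^ (2 : ℝ) := by
          rw [lintegral_mul_const _
            (contDiff_moll n).continuous.measurable.ennreal_ofReal,
            ← ofReal_integral_eq_lintegral_ofReal (integrable_moll n)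
            (Eventually.of_forall (moll_nonneg n)), integral_moll]
          simp
  rw [eLpNorm_eq_lintegral_rpow_enorm_toReal (by simp) (by simp)]
  have h6 := ENNReal.rpow_le_rpow key (z := 1 / 2) (by norm_num)
  rw [← ENNReal.rpow_mul] at h6
  simpa using h6

theorem tendsto_eLpNorm_smoothen_sub [CompleteSpace E] {u : R3 → E} (hu : MemLp u 2 volume) :
    Tendsto (fun n => eLpNorm (smoothen n u - u) 2 volume) atTop (𝓝 0) := by
  rw [ENNReal.tendsto_nhds_zero]
  intro ε hε
  have h := ENNReal.tendsto_nhds_zero.1 (tendsto_eLpNorm_translate_sub hu) ε hε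
  obtain ⟨δ, hδ, hball⟩ := Metric.eventually_nhds_iff.1 h
  filter_upwards [tendsto_bump_rOut.eventually (gt_mem_nhds hδ)] with n hn
  have hn' : 1 / ((n : ℝ) + 1) < δ := hn
  exact eLpNorm_smoothen_sub_le hu n fun y hy => hball (by rw [dist_zero_right]; linarith)

theorem memLp_smoothen [CompleteSpace E] {u : R3 → E} (hu : MemLp u 2 volume) (n : ℕ) :
    MemLp (smoothen n u) 2 volume := by
  have hloc : LocallyIntegrable u := hu.locallyIntegrable (by norm_num)
  have hm : AEStronglyMeasurable (smoothen n u - u) volume :=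
    (contDiff_smoothen n hloc).continuous.aestronglyMeasurable.sub hu.1
  have h : MemLp (smoothen n u - u) 2 volume := by
    refine ⟨hm, (eLpNorm_smoothen_sub_le hu n (ε := 2 * eLpNorm u 2 volume) fun y _ => ?_).trans_lt
      (ENNReal.mul_lt_top (by simp) hu.2)⟩
    have hp : MeasurePreserving (fun x : R3 => x - y) volume volume :=
      measurePreserving_sub_right volume y
    refine (eLpNorm_sub_le (hu.1.comp_measurePreserving hp) hu.1 (by norm_num)).trans (le_of_eq ?_)
    rw [eLpNorm_comp_measurePreserving hu.1 hp, two_mul]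
  simpa using h.add hu

/-- The integral of a product is continuous with respect to convergence in `L²`. -/
theorem tendsto_integral_mul_of_L2 {X : Type*} [MeasurableSpace X] {m : Measure X}
    {a b : ℕ → X → ℝ} {a' b' : X → ℝ}
    (ha : ∀ n, MemLp (a n) 2 m) (hb : ∀ n, MemLp (b n) 2 m) (ha' : MemLp a' 2 m)
    (hb' : MemLp b' 2 m) (h1 : Tendsto (fun n => eLpNorm (a n - a') 2 m) atTop (𝓝 0))
    (h2 : Tendsto (fun n => eLpNorm (b n - b') 2 m) atTop (𝓝 0)) :
    Tendsto (fun n => ∫ x, a n x * b n x ∂m) atTop (𝓝 (∫ x, a' x * b' x ∂m)) := by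
  have e : ∀ {f g : X → ℝ} (hf : MemLp f 2 m) (hg : MemLp g 2 m),
      ∫ x, f x * g x ∂m = inner ℝ (hg.toLp g) (hf.toLp f) := by
    intro f g hf hg
    rw [L2.inner_def]
    refine integral_congr_ae ?_
    filter_upwards [hf.coeFn_toLp, hg.coeFn_toLp] with x h1 h2
    simp [h1, h2]
  simp only [e (ha _) (hb _), e ha' hb']
  have t1 : Tendsto (fun n => (ha n).toLp (a n)) atTop (𝓝 (ha'.toLp a')) :=
    (Lp.tendsto_Lp_iff_tendsto_eLpNorm'' _ ha _ ha').2 h1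
  have t2 : Tendsto (fun n => (hb n).toLp (b n)) atTop (𝓝 (hb'.toLp b')) :=
    (Lp.tendsto_Lp_iff_tendsto_eLpNorm'' _ hb _ hb').2 h2
  exact t2.inner t1

end

section

/-! ### Partial derivatives, cutoff functions and the distributional Laplacian -/

section PartialDerivatives

variable {E : Type*} [NormedAddCommGroup E] [NormedSpace ℝ E]

/-- The `i`-th partial derivative. -/
def pd (i : Fin 3) (u : R3 → E) (x : R3) : E := fderiv ℝ u x (e i)

/-- The Laplacian, in Cartesian coordinates. -/
def lap (u : R3 → E) (x : R3) : E := ∑ i, pd i (pd i u) x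

theorem contDiff_pd {u : R3 → E} (hu : ContDiff ℝ ∞ u) (i : Fin 3) : ContDiff ℝ ∞ (pd i u) :=
  (hu.fderiv_right (by simp)).clm_apply contDiff_const

theorem hasCompactSupport_pd {u : R3 → E} (hu : HasCompactSupport u) (i : Fin 3) :
    HasCompactSupport (pd i u) :=
  hu.fderiv_apply (𝕜 := ℝ) (e i)

theorem continuous_lap {u : R3 → E} (hu : ContDiff ℝ ∞ u) : Continuous (lap u) :=
  continuous_finsetSum _ fun i _ => (contDiff_pd (contDiff_pd hu i) i).continuous

theorem hasCompactSupport_lap {u : R3 → E} (hu : HasCompactSupport u) :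
    HasCompactSupport (lap u) := by
  have h : lap u = ∑ i, pd i (pd i u) := by
    ext x; simp [lap]
  rw [h, Fin.sum_univ_three]
  exact ((hasCompactSupport_pd (hasCompactSupport_pd hu 0) 0).add
    (hasCompactSupport_pd (hasCompactSupport_pd hu 1) 1)).add
    (hasCompactSupport_pd (hasCompactSupport_pd hu 2) 2)

theorem pd_congr {u v : R3 → E} {x : R3} (h : u =ᶠ[𝓝 x] v) (i : Fin 3) :
    pd i u =ᶠ[𝓝 x] pd i v :=
  (h.fderiv (𝕜 := ℝ)).mono fun y hy => by rw [pd, pd, hy]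

theorem lap_congr {u v : R3 → E} {x : R3} (h : u =ᶠ[𝓝 x] v) : lap u x = lap v x :=
  Finset.sum_congr rfl fun i _ => (pd_congr (pd_congr h i) i).eq_of_nhds

theorem weakDeriv_pd {u : R3 → E} (hu : ContDiff ℝ ∞ u) (i : Fin 3) :
    IsWeakDeriv univ (e i) u (pd i u) :=
  isWeakDeriv_of_contDiff (hu.of_le (by simp)) (e i)

theorem exists_cutoff (R : ℝ) : ∃ χ : R3 → ℝ, ContDiff ℝ ∞ χ ∧ HasCompactSupport χ ∧
    (∀ x, ‖x‖ ≤ R → χ x = 1) ∧ ∀ x, χ x ∈ Icc (0 : ℝ) 1 := by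
  let b : ContDiffBump (0 : R3) := ⟨|R| + 1, |R| + 2, by positivity, by linarith⟩
  refine ⟨b, b.contDiff, b.hasCompactSupport, fun x hx => b.one_of_mem_closedBall ?_,
    fun x => ⟨b.nonneg, b.le_one⟩⟩
  simp only [mem_closedBall_zero_iff]
  exact hx.trans ((le_abs_self R).trans (by simp [b]))

end PartialDerivatives

/-- `-Δ w = μ` in the sense of distributions on `ℝ³`. -/
def NegLap (w μ : R3 → ℝ) : Prop :=
  ∀ ψ : R3 → ℝ, ContDiff ℝ ∞ ψ → HasCompactSupport ψ → ∫ x, w x * lap ψ x = -∫ x, μ x * ψ x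

theorem negLap_of_weak_gradient {w μ : R3 → ℝ} {g : Fin 3 → R3 → ℝ}
    (hg : ∀ i, IsWeakDeriv univ (e i) w (g i)) (hwl : LocallyIntegrable w)
    (h : ∀ ψ : R3 → ℝ, ContDiff ℝ ∞ ψ → HasCompactSupport ψ →
      ∑ i, ∫ x, g i x * pd i ψ x = ∫ x, μ x * ψ x) : NegLap w μ := by
  intro ψ hψ hc
  rw [← h ψ hψ hc, ← Finset.sum_neg_distrib]
  simp only [lap, Finset.mul_sum]
  rw [integral_finsetSum]
  · refine Finset.sum_congr rfl fun i _ => ?_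
    have := hg i (pd i ψ) (contDiff_pd hψ i) (hasCompactSupport_pd hc i) (subset_univ _)
    simp only [Measure.restrict_univ, smul_eq_mul] at this
    simp only [mul_comm (g i _)]
    rw [← this]
    exact integral_congr_ae (Eventually.of_forall fun x => mul_comm _ _)
  · intro i _
    have := hwl.integrable_smul_left_of_hasCompactSupport
      (contDiff_pd (contDiff_pd hψ i) i).continuous
      (hasCompactSupport_pd (hasCompactSupport_pd hc i) i)
    exact this.congr (Eventually.of_forall fun x => mul_comm _ _)

theorem negLap_of_contDiff {w : R3 → ℝ} (hw : ContDiff ℝ ∞ w) :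
    NegLap w (fun x => - lap w x) := by
  refine negLap_of_weak_gradient (weakDeriv_pd hw)
    hw.continuous.locallyIntegrable fun ψ hψ hc => ?_
  simp only [lap, neg_mul, integral_neg, Finset.sum_mul]
  rw [integral_finsetSum, ← Finset.sum_neg_distrib]
  · refine Finset.sum_congr rfl fun i _ => ?_
    have := weakDeriv_pd (contDiff_pd hw i) i ψ hψ hc (subset_univ _)
    simp only [Measure.restrict_univ, smul_eq_mul] at this
    simp only [mul_comm _ (ψ _)]
    rw [← this]
    exact integral_congr_ae (Eventually.of_forall fun x => mul_comm _ _)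
  · intro i _
    exact ((contDiff_pd (contDiff_pd hw i) i).continuous.mul
      hψ.continuous).integrable_of_hasCompactSupport hc.mul_left

/-! ### The Newton potential -/

/-- The Newtonian potential of a charge density. -/
def newton (μ : R3 → ℝ) (x : R3) : ℝ := ∫ y, (4 * Real.pi * ‖x - y‖)⁻¹ * μ y

/-- The Plummer potential, a smooth regularization of `1 / (4 π |z|)` at length scale `1 / c`. -/
def plummer (c : ℝ) (z : R3) : ℝ := (4 * Real.pi)⁻¹ * (‖z‖ ^ 2 + (c⁻¹) ^ 2) ^ (-(1 / 2) : ℝ)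

/-- The charge density of the Plummer potential at unit scale. -/
def plummerDensity (z : R3) : ℝ := 3 * (4 * Real.pi)⁻¹ * (1 + ‖z‖ ^ 2) ^ (-(5 / 2) : ℝ)

theorem volume_real_ball (r : ℝ) (hr : 0 ≤ r) :
    (volume : Measure R3).real (Metric.ball 0 r) = 4 / 3 * Real.pi * r ^ 3 := by
  have h := InnerProductSpace.volume_ball_of_dim_odd (E := R3) (k := 1) (by simp) 0 r
  rw [Measure.real, h]
  simp only [finrank_euclideanSpace, Fintype.card_fin, ENNReal.toReal_mul, ENNReal.toReal_pow,
    ENNReal.toReal_ofReal hr]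
  rw [ENNReal.toReal_ofReal (by positivity)]
  norm_num [Nat.doubleFactorial]
  ring

theorem hasDerivAt_plummer_mass (y : ℝ) :
    HasDerivAt (fun y : ℝ => 3⁻¹ * (y ^ 3 * (1 + y ^ 2) ^ (-(3 / 2) : ℝ)))
      (y ^ 2 * (1 + y ^ 2) ^ (-(5 / 2) : ℝ)) y := by
  have hs : (0 : ℝ) < 1 + y ^ 2 := by positivity
  have h1 : HasDerivAt (fun y : ℝ => 1 + y ^ 2) (2 * y) y := by
    simpa using (hasDerivAt_pow 2 y).const_add 1
  have h2 := h1.rpow_const (p := (-(3 / 2) : ℝ)) (Or.inl hs.ne')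
  have h3 := ((hasDerivAt_pow 3 y).mul h2).const_mul (3⁻¹ : ℝ)
  convert! h3 using 1
  have e1 : (1 + y ^ 2) ^ (-(3 / 2) : ℝ) = (1 + y ^ 2) * (1 + y ^ 2) ^ (-(5 / 2) : ℝ) := by
    rw [mul_comm, ← Real.rpow_add_one hs.ne']; norm_num
  have e2 : (-(3 / 2) : ℝ) - 1 = -(5 / 2) := by norm_num
  rw [e1, e2]
  push_cast
  ring

theorem tendsto_plummer_mass :
    Tendsto (fun y : ℝ => 3⁻¹ * (y ^ 3 * (1 + y ^ 2) ^ (-(3 / 2) : ℝ))) atTop (𝓝 3⁻¹) := by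
  have h1 : Tendsto (fun y : ℝ => (1 + (y⁻¹) ^ 2) ^ (-(3 / 2) : ℝ)) atTop (𝓝 1) := by
    have h : Tendsto (fun y : ℝ => 1 + (y⁻¹) ^ 2) atTop (𝓝 (1 + 0 ^ 2)) :=
      (tendsto_inv_atTop_zero.pow 2).const_add 1
    have := h.rpow_const (p := (-(3 / 2) : ℝ)) (Or.inl (by norm_num))
    simpa using this
  have h2 := h1.const_mul (3⁻¹ : ℝ)
  rw [mul_one] at h2
  refine h2.congr' ?_
  filter_upwards [eventually_gt_atTop 0] with y hy
  have e : 1 + y ^ 2 = y ^ 2 * (1 + (y⁻¹) ^ 2) := by field_simp; ring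
  rw [e, Real.mul_rpow (by positivity) (by positivity), ← mul_assoc (y ^ 3), ← Real.rpow_natCast y 2,
    ← Real.rpow_mul hy.le, ← Real.rpow_natCast y 3, ← Real.rpow_add hy]
  norm_num

theorem integral_plummerDensity : ∫ x, plummerDensity x = 1 := by
  have h := integral_fun_norm_addHaar (volume : Measure R3)
    (fun s => 3 * (4 * Real.pi)⁻¹ * (1 + s ^ 2) ^ (-(5 / 2) : ℝ))
  rw [show (∫ x, plummerDensity x)
    = ∫ x : R3, (fun s => 3 * (4 * Real.pi)⁻¹ * (1 + s ^ 2) ^ (-(5 / 2) : ℝ)) ‖x‖ from rfl, h,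
    volume_real_ball 1 zero_le_one]
  have h2 := integral_Ioi_of_hasDerivAt_of_nonneg' (a := 0)
    (fun y _ => hasDerivAt_plummer_mass y) (fun y _ => by positivity) tendsto_plummer_mass
  simp only [finrank_euclideanSpace, Fintype.card_fin, smul_eq_mul, nsmul_eq_mul]
  have h3 : ∫ y in Ioi (0 : ℝ), y ^ (3 - 1) * (3 * (4 * Real.pi)⁻¹ * (1 + y ^ 2) ^ (-(5 / 2) : ℝ))
      = 3 * (4 * Real.pi)⁻¹ * ∫ y in Ioi (0 : ℝ), y ^ 2 * (1 + y ^ 2) ^ (-(5 / 2) : ℝ) := by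
    rw [← integral_const_mul]
    refine integral_congr_ae (Eventually.of_forall fun y => ?_)
    simp only
    ring
  rw [h3, h2]
  have := Real.pi_ne_zero
  norm_num
  field_simp

theorem contDiff_plummer {c : ℝ} (hc : 0 < c) (x : R3) :
    ContDiff ℝ ∞ (fun y => plummer c (x - y)) := by
  refine contDiff_const.mul (ContDiff.rpow_const_of_ne ?_ fun y => ?_)
  · exact ((contDiff_const.sub contDiff_id).norm_sq ℝ).add contDiff_const
  · positivity

theorem pd_normSq_rpow {s : ℝ} (hs : 0 < s) (x : R3) (a : ℝ) (i : Fin 3) (y : R3) :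
    pd i (fun y => (‖x - y‖ ^ 2 + s) ^ a) y
      = 2 * a * (‖x - y‖ ^ 2 + s) ^ (a - 1) * (y i - x i) := by
  have h1 : HasFDerivAt (fun y : R3 => ‖x - y‖ ^ 2 + s)
      (2 • (innerSL ℝ (x - y)).comp (-ContinuousLinearMap.id ℝ R3)) y := by
    have h0 : HasFDerivAt (fun y : R3 => x - y) (-ContinuousLinearMap.id ℝ R3) y := by
      have := (hasFDerivAt_id (𝕜 := ℝ) y).const_sub x
      exact this
    exact h0.norm_sq.add_const s
  have h2 := (h1.rpow_const (p := a) (Or.inl (by positivity))).fderiv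
  rw [pd, h2]
  simp [e, EuclideanSpace.inner_single_right]
  ring

/-- `-Δ` of the Plummer potential is an approximate identity. -/
theorem lap_plummer {c : ℝ} (hc : 0 < c) (x y : R3) :
    lap (fun y => plummer c (x - y)) y = -(c ^ 3 * plummerDensity (c • (x - y))) := by
  have hs : (0 : ℝ) < (c⁻¹) ^ 2 := by positivity
  set s := (c⁻¹) ^ 2 with hsdef
  have h1 : ∀ i, pd i (fun y => plummer c (x - y))
      = fun y => -(4 * Real.pi)⁻¹ * ((‖x - y‖ ^ 2 + s) ^ (-(3 / 2) : ℝ) * (y i - x i)) := by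
    intro i
    ext y
    have hd : DifferentiableAt ℝ (fun y : R3 => (‖x - y‖ ^ 2 + s) ^ (-(1 / 2) : ℝ)) y := by
      refine DifferentiableAt.rpow_const ?_ (Or.inl (by positivity))
      exact ((differentiableAt_id.const_sub x).norm_sq ℝ).add_const s
    have h2 := pd_normSq_rpow hs x (-(1 / 2)) i y
    rw [pd] at h2
    rw [pd]
    change (fderiv ℝ (fun y => (4 * Real.pi)⁻¹ * (‖x - y‖ ^ 2 + s) ^ (-(1 / 2) : ℝ)) y) (e i) = _
    rw [fderiv_const_mul hd, smul_apply, h2]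
    norm_num
  have hpos : 0 < ‖x - y‖ ^ 2 + s := by positivity
  have h2 : ∀ i, pd i (pd i (fun y => plummer c (x - y))) y
      = -(4 * Real.pi)⁻¹ * ((‖x - y‖ ^ 2 + s) ^ (-(3 / 2) : ℝ)
        - 3 * (‖x - y‖ ^ 2 + s) ^ (-(5 / 2) : ℝ) * (y i - x i) ^ 2) := by
    intro i
    rw [h1]
    have hd : DifferentiableAt ℝ (fun y : R3 => (‖x - y‖ ^ 2 + s) ^ (-(3 / 2) : ℝ)) y := by
      refine DifferentiableAt.rpow_const ?_ (Or.inl (by positivity))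
      exact ((differentiableAt_id.const_sub x).norm_sq ℝ).add_const s
    have hl : HasFDerivAt (fun y : R3 => y i - x i) (EuclideanSpace.proj i : R3 →L[ℝ] ℝ) y :=
      (EuclideanSpace.proj (𝕜 := ℝ) i).hasFDerivAt.sub_const (x i)
    have h3 := pd_normSq_rpow hs x (-(3 / 2)) i y
    rw [pd] at h3
    have h4 := (hd.hasFDerivAt.mul hl).const_mul (-(4 * Real.pi)⁻¹)
    have h5 : fderiv ℝ (fun y : R3 => -(4 * Real.pi)⁻¹ * ((‖x - y‖ ^ 2 + s) ^ (-(3 / 2) : ℝ)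
        * (y i - x i))) y = _ := h4.fderiv
    rw [pd, h5]
    simp only [smul_apply, add_apply, h3, smul_eq_mul]
    have : (EuclideanSpace.proj i : R3 →L[ℝ] ℝ) (e i) = 1 := by simp [e]
    rw [this]
    norm_num
    ring
  have h5 : ∑ i, (y i - x i) ^ 2 = ‖x - y‖ ^ 2 := by
    rw [EuclideanSpace.norm_sq_eq]
    refine Finset.sum_congr rfl fun i _ => ?_
    simp only [PiLp.sub_apply, Real.norm_eq_abs, sq_abs]
    ring
  rw [lap, Finset.sum_congr rfl fun i _ => h2 i, ← Finset.mul_sum, Finset.sum_sub_distrib,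
    ← Finset.mul_sum, h5]
  have e1 : (‖x - y‖ ^ 2 + s) ^ (-(3 / 2) : ℝ)
      = (‖x - y‖ ^ 2 + s) * (‖x - y‖ ^ 2 + s) ^ (-(5 / 2) : ℝ) := by
    rw [mul_comm, ← Real.rpow_add_one hpos.ne']; norm_num
  have e2 : 1 + ‖c • (x - y)‖ ^ 2 = c ^ 2 * (‖x - y‖ ^ 2 + s) := by
    rw [norm_smul, mul_pow, Real.norm_eq_abs, sq_abs, hsdef]
    field_simp
    ring
  have e3 : c ^ 3 * (c ^ 2) ^ (-(5 / 2) : ℝ) = s := by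
    rw [← Real.rpow_natCast c 2, ← Real.rpow_mul hc.le, ← Real.rpow_natCast c 3, ← Real.rpow_add hc,
      hsdef, ← Real.rpow_natCast, Real.inv_rpow hc.le, ← Real.rpow_neg hc.le]
    norm_num
  rw [plummerDensity, e2, Real.mul_rpow (by positivity) hpos.le, e1]
  simp only [Finset.sum_const, Finset.card_univ, Fintype.card_fin, nsmul_eq_mul]
  push_cast
  linear_combination (-3 * (4 * Real.pi)⁻¹ * (‖x - y‖ ^ 2 + s) ^ (-(5 / 2) : ℝ)) * (-e3)

theorem plummer_nonneg (c : ℝ) (z : R3) : 0 ≤ plummer c z := by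
  unfold plummer; positivity

theorem plummer_le (c : ℝ) {z : R3} (hz : z ≠ 0) :
    plummer c z ≤ (4 * Real.pi * ‖z‖)⁻¹ := by
  have hz' : 0 < ‖z‖ := norm_pos_iff.2 hz
  rw [plummer, mul_inv (4 * Real.pi) ‖z‖]
  gcongr
  calc (‖z‖ ^ 2 + (c⁻¹) ^ 2) ^ (-(1 / 2) : ℝ) ≤ (‖z‖ ^ 2) ^ (-(1 / 2) : ℝ) :=
        Real.rpow_le_rpow_of_nonpos (by positivity) (by linarith [sq_nonneg c⁻¹]) (by norm_num)
    _ = ‖z‖⁻¹ := by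
        rw [← Real.rpow_natCast, ← Real.rpow_mul hz'.le, ← Real.rpow_neg_one]
        norm_num

theorem tendsto_plummer {z : R3} (hz : z ≠ 0) :
    Tendsto (fun c => plummer c z) atTop (𝓝 (4 * Real.pi * ‖z‖)⁻¹) := by
  have hz' : 0 < ‖z‖ := norm_pos_iff.2 hz
  have h : Tendsto (fun c : ℝ => ‖z‖ ^ 2 + (c⁻¹) ^ 2) atTop (𝓝 (‖z‖ ^ 2 + 0 ^ 2)) :=
    (tendsto_inv_atTop_zero.pow 2).const_add _
  have h2 := (h.rpow_const (p := (-(1 / 2) : ℝ)) (Or.inl (by positivity))).const_mul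
    (4 * Real.pi)⁻¹
  convert! h2 using 2
  rw [mul_inv (4 * Real.pi) ‖z‖]
  congr 1
  rw [show ‖z‖ ^ 2 + 0 ^ 2 = ‖z‖ ^ 2 by ring, ← Real.rpow_natCast, ← Real.rpow_mul hz'.le,
    ← Real.rpow_neg_one]
  norm_num

theorem tendsto_integral_plummerDensity {w : R3 → ℝ} (hw : Continuous w)
    (hwi : Integrable w) (x : R3) :
    Tendsto (fun c : ℝ => ∫ y, w y * (c ^ 3 * plummerDensity (c • (x - y)))) atTop (𝓝 (w x)) := by
  have hdecay : Tendsto (fun x : R3 => ‖x‖ ^ Module.finrank ℝ R3 * plummerDensity x)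
      (Bornology.cobounded R3) (𝓝 0) := by
    have h1 : Tendsto (fun x : R3 => 3 * (4 * Real.pi)⁻¹ * (‖x‖⁻¹) ^ 2)
        (Bornology.cobounded R3) (𝓝 (3 * (4 * Real.pi)⁻¹ * 0 ^ 2)) :=
      ((tendsto_inv_atTop_zero.comp tendsto_norm_cobounded_atTop).pow 2).const_mul _
    rw [show 3 * (4 * Real.pi)⁻¹ * (0 : ℝ) ^ 2 = 0 by ring] at h1
    refine squeeze_zero' (Eventually.of_forall fun x => ?_) ?_ h1
    · unfold plummerDensity; positivity
    · filter_upwards [tendsto_norm_cobounded_atTop.eventually (eventually_gt_atTop 0)] with x hx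
      rw [plummerDensity, finrank_euclideanSpace, Fintype.card_fin, mul_left_comm]
      gcongr
      calc ‖x‖ ^ 3 * (1 + ‖x‖ ^ 2) ^ (-(5 / 2) : ℝ)
          ≤ ‖x‖ ^ 3 * (‖x‖ ^ 2) ^ (-(5 / 2) : ℝ) := by
            gcongr ?_ * ?_
            exact Real.rpow_le_rpow_of_nonpos (by positivity) (by linarith) (by norm_num)
        _ = (‖x‖⁻¹) ^ 2 := by
            rw [← Real.rpow_natCast ‖x‖ 2, ← Real.rpow_mul hx.le, ← Real.rpow_natCast ‖x‖ 3,
              ← Real.rpow_add hx, ← Real.rpow_natCast ‖x‖⁻¹ 2, Real.inv_rpow hx.le,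
              ← Real.rpow_neg hx.le]
            norm_num
  have := tendsto_integral_comp_smul_smul_of_integrable' (μ := (volume : Measure R3))
    (φ := plummerDensity) (fun x => by unfold plummerDensity; positivity) integral_plummerDensity
    hdecay hwi hw.continuousAt (x₀ := x)
  refine this.congr fun c => integral_congr_ae (Eventually.of_forall fun y => ?_)
  simp [mul_comm]

/-- A continuous compactly supported function is the Newtonian potential of its distributional
Laplacian: test against a cut-off translate of the Plummer potential, and remove the
regularization. -/
theorem eq_newton_of_negLap {w μ : R3 → ℝ} (hw : Continuous w) {R : ℝ}
    (hwR : ∀ x, R ≤ ‖x‖ → w x = 0) (hμR : ∀ x, R ≤ ‖x‖ → μ x = 0)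
    (hμ : AEStronglyMeasurable μ volume)
    (h : NegLap w μ) (x : R3) (hμi : Integrable fun y => ‖x - y‖⁻¹ * μ y) :
    w x = newton μ x := by
  obtain ⟨χ, hχ, hχc, hχ1, -⟩ := exists_cutoff (R + 1)
  have hwc : HasCompactSupport w := HasCompactSupport.of_support_subset_isCompact
    (isCompact_closedBall (0 : R3) R) fun y hy => by
      by_contra hcon
      exact hy (hwR y (by simpa using (not_le.1 (by simpa using hcon)).le))
  have key : ∀ c : ℝ, 0 < c → ∫ y, w y * (c ^ 3 * plummerDensity (c • (x - y)))
      = ∫ y, plummer c (x - y) * μ y := by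
    intro c hc
    have h1 := h (fun y => χ y * plummer c (x - y)) (hχ.mul (contDiff_plummer hc x)) hχc.mul_right
    have h2 : ∫ y, w y * lap (fun y => χ y * plummer c (x - y)) y
        = -∫ y, w y * (c ^ 3 * plummerDensity (c • (x - y))) := by
      rw [← integral_neg]
      refine integral_congr_ae (Eventually.of_forall fun y => ?_)
      simp only
      by_cases hy : R ≤ ‖y‖
      · simp [hwR y hy]
      · have hev : (fun y => χ y * plummer c (x - y)) =ᶠ[𝓝 y] fun y => plummer c (x - y) := by
          have : Metric.ball (0 : R3) (R + 1) ∈ 𝓝 y :=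
            Metric.isOpen_ball.mem_nhds (by simp; linarith)
          filter_upwards [this] with z hz
          rw [hχ1 z (by simpa using (mem_ball_zero_iff.1 hz).le), one_mul]
        rw [lap_congr hev, lap_plummer hc]
        ring
    rw [h2, neg_inj] at h1
    rw [h1]
    refine integral_congr_ae (Eventually.of_forall fun y => ?_)
    simp only
    by_cases hy : R ≤ ‖y‖
    · simp [hμR y hy]
    · rw [hχ1 y (by linarith)]
      ring
  have t1 := tendsto_integral_plummerDensity hw (hw.integrable_of_hasCompactSupport hwc) x
  have hne : ∀ᵐ y : R3, x - y ≠ 0 := by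
    have : ∀ᵐ y : R3, y ≠ x := by simp [ae_iff]
    filter_upwards [this] with y hy
    exact sub_ne_zero.2 hy.symm
  have t2 : Tendsto (fun c : ℝ => ∫ y, plummer c (x - y) * μ y) atTop (𝓝 (newton μ x)) := by
    refine tendsto_integral_filter_of_dominated_convergence
      (fun y => (4 * Real.pi)⁻¹ * ‖‖x - y‖⁻¹ * μ y‖) ?_ ?_ (hμi.norm.const_mul _) ?_
    · filter_upwards [eventually_gt_atTop 0] with c hc
      exact (contDiff_plummer hc x).continuous.aestronglyMeasurable.mul hμ
    · filter_upwards [eventually_gt_atTop 0] with c hc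
      filter_upwards [hne] with y hy
      have := plummer_le c hy
      rw [norm_mul, norm_mul, Real.norm_of_nonneg (plummer_nonneg _ _), norm_inv, norm_norm,
        ← mul_assoc, ← mul_inv]
      gcongr
    · filter_upwards [hne] with y hy
      exact (tendsto_plummer hy).mul_const _
  refine tendsto_nhds_unique t1 (t2.congr' ?_)
  filter_upwards [eventually_gt_atTop 0] with c hc
  exact (key c hc).symm

end

/-! ### Bounds for Newtonian potentials -/

theorem integrable_indicator_norm_rpow {s : ℝ} {f : ℝ → ℝ}
    (hf : IntegrableOn (fun y => y ^ 2 * f y) (Ioo 0 s)) :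
    Integrable (fun x : R3 => (Metric.ball (0 : R3) s).indicator (fun x => f ‖x‖) x) ∧
      ∫ x : R3, (Metric.ball (0 : R3) s).indicator (fun x => f ‖x‖) x
        = 4 * Real.pi * ∫ y in Ioo 0 s, y ^ 2 * f y := by
  have hfun : (fun x : R3 => (Metric.ball (0 : R3) s).indicator (fun x => f ‖x‖) x)
      = fun x : R3 => (Iio s).indicator f ‖x‖ := by
    ext x
    simp [indicator]
  constructor
  · rw [integrable_indicator_iff measurableSet_ball, integrableOn_fun_norm_addHaar]
    simpa using hf
  · rw [hfun, integral_fun_norm_addHaar, volume_real_ball 1 zero_le_one]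
    have : ∫ y in Ioi (0 : ℝ), y ^ (Module.finrank ℝ R3 - 1) • (Iio s).indicator f y
        = ∫ y in Ioo 0 s, y ^ 2 * f y := by
      rw [← integral_indicator measurableSet_Ioi, ← integral_indicator measurableSet_Ioo]
      refine integral_congr_ae (Eventually.of_forall fun y => ?_)
      by_cases h1 : 0 < y <;> by_cases h2 : y < s <;> simp [indicator, h1, h2]
    rw [this]
    simp only [finrank_euclideanSpace, Fintype.card_fin, nsmul_eq_mul, smul_eq_mul]
    push_cast
    ring

theorem indicator_ball_inv_sq :
    Integrable (fun x : R3 => (Metric.ball (0 : R3) 1).indicator (fun x => (‖x‖⁻¹) ^ 2) x) ∧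
      ∫ x : R3, (Metric.ball (0 : R3) 1).indicator (fun x => (‖x‖⁻¹) ^ 2) x = 4 * Real.pi := by
  have h : ∀ y ∈ Ioo (0 : ℝ) 1, y ^ 2 * (y⁻¹) ^ 2 = 1 := by
    intro y hy
    have := hy.1.ne'
    field_simp
  have h1 : IntegrableOn (fun y : ℝ => y ^ 2 * (y⁻¹) ^ 2) (Ioo 0 1) :=
    (integrableOn_congr_fun h measurableSet_Ioo).2 (by simp [integrableOn_const_iff])
  refine ⟨(integrable_indicator_norm_rpow h1).1, ?_⟩
  rw [(integrable_indicator_norm_rpow h1).2, setIntegral_congr_fun measurableSet_Ioo h]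
  simp

theorem indicator_ball_inv {s : ℝ} (hs : 0 ≤ s) :
    Integrable (fun x : R3 => (Metric.ball (0 : R3) s).indicator (fun x => ‖x‖⁻¹) x) ∧
      ∫ x : R3, (Metric.ball (0 : R3) s).indicator (fun x => ‖x‖⁻¹) x = 2 * Real.pi * s ^ 2 := by
  have h : ∀ y ∈ Ioo (0 : ℝ) s, y ^ 2 * y⁻¹ = y := by
    intro y hy
    have := hy.1.ne'
    field_simp
  have h0 : IntegrableOn (fun y : ℝ => y) (Ioo 0 s) :=
    (continuous_id.integrableOn_Icc (a := 0) (b := s)).mono_set Ioo_subset_Icc_self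
  have h1 : IntegrableOn (fun y : ℝ => y ^ 2 * y⁻¹) (Ioo 0 s) :=
    (integrableOn_congr_fun h measurableSet_Ioo).2 h0
  refine ⟨(integrable_indicator_norm_rpow h1).1, ?_⟩
  rw [(integrable_indicator_norm_rpow h1).2, setIntegral_congr_fun measurableSet_Ioo h,
    ← integral_Ioc_eq_integral_Ioo, ← intervalIntegral.integral_of_le hs, integral_id]
  ring

theorem inv_norm_mul_le (z : R3) (a : ℝ) :
    ‖z‖⁻¹ * |a| ≤ |a| + a ^ 2 + (Metric.ball (0 : R3) 1).indicator (fun x => (‖x‖⁻¹) ^ 2) z := by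
  by_cases hz : ‖z‖ < 1
  · rw [indicator_of_mem (by simpa using hz)]
    nlinarith [sq_nonneg (‖z‖⁻¹ - |a|), abs_nonneg a, sq_abs a, sq_nonneg (‖z‖⁻¹),
      mul_nonneg (inv_nonneg.2 (norm_nonneg z)) (abs_nonneg a)]
  · rw [indicator_of_notMem (by simpa using hz)]
    have : ‖z‖⁻¹ ≤ 1 := inv_le_one_of_one_le₀ (not_lt.1 hz)
    nlinarith [sq_nonneg a, abs_nonneg a, mul_le_mul_of_nonneg_right this (abs_nonneg a)]

theorem integrable_inv_norm_mul {μ : R3 → ℝ} (h1 : Integrable μ) (h2 : Integrable (fun x => μ x ^ 2))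
    (x : R3) : Integrable (fun y => ‖x - y‖⁻¹ * μ y) := by
  have h3 := (h1.abs.add h2).add (indicator_ball_inv_sq.1.comp_sub_left x)
  refine h3.mono ?_ (Eventually.of_forall fun y => ?_)
  · exact ((continuous_const.sub continuous_id).norm.measurable.inv.aestronglyMeasurable).mul h1.1
  · simp only [Pi.add_apply]
    rw [norm_mul, norm_inv, norm_norm, Real.norm_eq_abs]
    exact (inv_norm_mul_le (x - y) (μ y)).trans (le_abs_self _)

theorem integral_inv_norm_mul_le {μ : R3 → ℝ} (h1 : Integrable μ)
    (h2 : Integrable (fun x => μ x ^ 2)) (x : R3) :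
    ∫ y, ‖x - y‖⁻¹ * |μ y| ≤ (∫ y, |μ y|) + (∫ y, μ y ^ 2) + 4 * Real.pi := by
  have hI := indicator_ball_inv_sq.1.comp_sub_left x
  have hI2 : ∫ y : R3, (Metric.ball (0 : R3) 1).indicator (fun x => (‖x‖⁻¹) ^ 2) (x - y)
      = 4 * Real.pi := by
    rw [integral_sub_left_eq_self (fun z => (Metric.ball (0 : R3) 1).indicator
      (fun x => (‖x‖⁻¹) ^ 2) z) volume x, indicator_ball_inv_sq.2]
  have hs : Integrable fun y => |μ y| + μ y ^ 2 := h1.abs.add h2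
  rw [← hI2, ← integral_add h1.abs h2, ← integral_add hs hI]
  refine integral_mono ?_ (hs.add hI) fun y => inv_norm_mul_le (x - y) (μ y)
  exact integrable_inv_norm_mul h1.abs (by simpa using h2) x

/-- The Newtonian potential of a ball, bounded by enclosing the ball in one of radius `2 r` centred
at the singularity. -/
theorem setIntegral_ball_inv_norm_le {r : ℝ} (hr : 0 ≤ r) {x : R3} (hx : ‖x‖ ≤ r) :
    IntegrableOn (fun y => ‖x - y‖⁻¹) (Metric.ball 0 r) ∧
    ∫ y in Metric.ball (0 : R3) r, ‖x - y‖⁻¹ ≤ 8 * Real.pi * r ^ 2 := by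
  have h := indicator_ball_inv (s := 2 * r) (by linarith)
  have h1 := h.1.comp_sub_left x
  have h2 := integral_sub_left_eq_self (fun z => (Metric.ball (0 : R3) (2 * r)).indicator
      (fun x => ‖x‖⁻¹) z) volume x
  have hle : ∀ y, (Metric.ball (0 : R3) r).indicator (fun y => ‖x - y‖⁻¹) y
      ≤ (Metric.ball (0 : R3) (2 * r)).indicator (fun x => ‖x‖⁻¹) (x - y) := by
    intro y
    by_cases hy : ‖y‖ < r
    · have : ‖x - y‖ < 2 * r := (norm_sub_le x y).trans_lt (by linarith)
      rw [indicator_of_mem (by simpa using hy), indicator_of_mem (by simpa using this)]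
    · rw [indicator_of_notMem (by simpa using hy)]
      exact indicator_nonneg (fun _ _ => by positivity) _
  have h3 : Integrable ((Metric.ball (0 : R3) r).indicator (fun y => ‖x - y‖⁻¹)) := by
    refine h1.mono ?_ (Eventually.of_forall fun y => ?_)
    · exact ((continuous_const.sub continuous_id).norm.measurable.inv.indicator
        measurableSet_ball).aestronglyMeasurable
    · rw [Real.norm_of_nonneg (indicator_nonneg (fun _ _ => by positivity) _)]
      exact (hle y).trans (le_abs_self _)
  refine ⟨(integrable_indicator_iff measurableSet_ball).1 h3, ?_⟩
  rw [← integral_indicator measurableSet_ball]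
  calc _ ≤ _ := integral_mono h3 h1 hle
    _ = _ := by rw [h2, h.2]; ring

theorem locallyIntegrable_inv_norm : LocallyIntegrable (fun z : R3 => (4 * Real.pi * ‖z‖)⁻¹) := by
  rw [locallyIntegrable_iff]
  intro K hK
  obtain ⟨s, hs⟩ := hK.isBounded.subset_ball (0 : R3)
  have h := (integrable_indicator_iff measurableSet_ball).1
    (indicator_ball_inv (s := max s 0) (le_max_right _ _)).1
  have h2 : IntegrableOn (fun z : R3 => (4 * Real.pi)⁻¹ * ‖z‖⁻¹) K :=
    (h.mono_set (hs.trans (Metric.ball_subset_ball (le_max_left _ _)))).const_mul _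
  exact h2.congr (Eventually.of_forall fun z => by simp only [mul_inv])

theorem newton_eq_convolution (μ : R3 → ℝ) : newton μ
    = convolution μ (fun z : R3 => (4 * Real.pi * ‖z‖)⁻¹) (ContinuousLinearMap.mul ℝ ℝ) volume := by
  ext x
  simp only [newton, convolution_def, ContinuousLinearMap.mul_apply', mul_comm]

theorem contDiff_newton {μ : R3 → ℝ} (hμ : ContDiff ℝ ∞ μ) (hc : HasCompactSupport μ) :
    ContDiff ℝ ∞ (newton μ) := by
  rw [newton_eq_convolution]
  exact hc.contDiff_convolution_left _ hμ locallyIntegrable_inv_norm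

theorem pd_newton {μ : R3 → ℝ} (hμ : ContDiff ℝ ∞ μ) (hc : HasCompactSupport μ) (i : Fin 3) :
    pd i (newton μ) = newton (pd i μ) := by
  ext x
  have h1 := (hc.hasFDerivAt_convolution_left (ContinuousLinearMap.mul ℝ ℝ)
    (hμ.of_le (by simp)) locallyIntegrable_inv_norm x).fderiv
  have hint := (hc.fderiv ℝ).convolutionExists_left ((ContinuousLinearMap.mul ℝ ℝ).precompL R3)
    (hμ.continuous_fderiv (by simp)) locallyIntegrable_inv_norm x
  rw [pd, newton_eq_convolution, h1, convolution_def, ContinuousLinearMap.integral_apply hint,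
    newton_eq_convolution, convolution_def]
  rfl

/-- The Newtonian potential inverts the Laplacian on test functions. -/
theorem lap_newton {μ : R3 → ℝ} (hμ : ContDiff ℝ ∞ μ) (hc : HasCompactSupport μ) (x : R3) :
    lap (newton μ) x = - μ x := by
  obtain ⟨R, hR⟩ := hc.isCompact.isBounded.subset_ball (0 : R3)
  have hR' : ∀ x, R ≤ ‖x‖ → x ∉ tsupport μ := fun x hx hmem => by
    have := hR hmem
    rw [mem_ball_zero_iff] at this
    linarith
  have hl := continuous_lap hμ
  have hlc := hasCompactSupport_lap hc
  have hl1 : Integrable (fun x => - lap μ x) := (hl.integrable_of_hasCompactSupport hlc).neg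
  have hl2 : Integrable (fun x => (- lap μ x) ^ 2) := by
    have e : (fun x => (- lap μ x) ^ 2) = fun x => lap μ x * lap μ x := by
      ext x; ring
    rw [e]
    exact (hl.mul hl).integrable_of_hasCompactSupport hlc.mul_left
  have h := eq_newton_of_negLap hμ.continuous (R := R)
    (fun x hx => image_eq_zero_of_notMem_tsupport (hR' x hx))
    (μ := fun x => - lap μ x) (fun x hx => by
      have : μ =ᶠ[𝓝 x] 0 := notMem_tsupport_iff_eventuallyEq.1 (hR' x hx)
      rw [lap_congr this]
      simp [lap, pd, show pd _ (0 : R3 → ℝ) = fun _ => 0 from funext fun x => by simp [pd]])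
    hl1.1 (negLap_of_contDiff hμ) x (integrable_inv_norm_mul hl1 hl2 x)
  rw [h]
  have h4 : ∀ i, pd i (pd i (newton μ)) = newton (pd i (pd i μ)) := fun i => by
    rw [pd_newton hμ hc, pd_newton (contDiff_pd hμ i) (hasCompactSupport_pd hc i)]
  simp only [lap, h4, newton]
  rw [← integral_finsetSum, ← integral_neg]
  · refine integral_congr_ae (Eventually.of_forall fun y => ?_)
    simp only [← Finset.mul_sum]
    ring
  · intro i _
    have hd := contDiff_pd (contDiff_pd hμ i) i
    have hdc := hasCompactSupport_pd (hasCompactSupport_pd hc i) i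
    exact hdc.convolutionExists_left (ContinuousLinearMap.mul ℝ ℝ) hd.continuous
      locallyIntegrable_inv_norm x |>.congr (Eventually.of_forall fun y => by
        simp [mul_comm])

section

/-! ### Extension of weak derivatives by zero across a sphere -/

theorem uniformContinuous_of_const_off_ball {p : R3 → ℝ} {r c : ℝ} (hp : Continuous p)
    (hc : ∀ x, r ≤ ‖x‖ → p x = c) : UniformContinuous p := by
  have h : HasCompactSupport fun x => p x - c := HasCompactSupport.of_support_subset_isCompact
    (isCompact_closedBall (0 : R3) r) fun y hy => by
      by_contra hcon
      exact hy (by simp [hc y (not_le.1 (by simpa using hcon)).le])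
  have h2 := h.uniformContinuous_of_continuous (hp.sub continuous_const)
  have h3 := h2.add (uniformContinuous_const (b := c))
  refine h3.congr fun x => ?_
  simp

theorem exists_deriv_smoothTransition_bound :
    ∃ K : ℝ, 0 < K ∧ ∀ t, |deriv Real.smoothTransition t| ≤ K := by
  have hcont : Continuous (deriv Real.smoothTransition) :=
    (Real.smoothTransition.contDiff (n := 1)).continuous_deriv le_rfl
  obtain ⟨K, hK⟩ := (isCompact_Icc (a := (0 : ℝ)) (b := 1)).exists_bound_of_continuousOn
    hcont.continuousOn
  refine ⟨|K| + 1, by positivity, fun t => ?_⟩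
  by_cases ht : t ∈ Icc (0 : ℝ) 1
  · exact (hK t ht).trans ((le_abs_self K).trans (by linarith))
  · have h0 : deriv Real.smoothTransition t = 0 := by
      rcases lt_or_ge t 0 with h | h
      · have : Real.smoothTransition =ᶠ[𝓝 t] fun _ => 0 := by
          filter_upwards [gt_mem_nhds h] with s hs
          exact Real.smoothTransition.zero_of_nonpos hs.le
        rw [this.deriv_eq, deriv_const]
      · have h' : 1 < t := by
          by_contra hcon
          exact ht ⟨h, not_lt.1 hcon⟩
        have : Real.smoothTransition =ᶠ[𝓝 t] fun _ => 1 := by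
          filter_upwards [lt_mem_nhds h'] with s hs
          exact Real.smoothTransition.one_of_one_le hs.le
        rw [this.deriv_eq, deriv_const]
    rw [h0, abs_zero]
    positivity

/-- A smooth radial cutoff that equals one for `‖x‖ ≤ s` and vanishes near `‖x‖ = r`. -/
def radialCutoff (r s : ℝ) (x : R3) : ℝ :=
  Real.smoothTransition (2 * (r ^ 2 - ‖x‖ ^ 2) / (r ^ 2 - s ^ 2) - 1)

theorem contDiff_radialCutoff (r s : ℝ) : ContDiff ℝ ∞ (radialCutoff r s) :=
  (Real.smoothTransition.contDiff (n := ⊤)).comp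
    (((contDiff_const.mul (contDiff_const.sub (contDiff_norm_sq ℝ))).div_const _).sub contDiff_const)

section
variable {r s : ℝ} (hs : 0 < s) (hsr : s < r)
include hs hsr

theorem sq_sub_sq_pos_of_lt : 0 < r ^ 2 - s ^ 2 := by nlinarith

theorem radialCutoff_eq_one {x : R3} (hx : ‖x‖ ≤ s) : radialCutoff r s x = 1 := by
  apply Real.smoothTransition.one_of_one_le
  have h := sq_sub_sq_pos_of_lt hs hsr
  have : ‖x‖ ^ 2 ≤ s ^ 2 := by gcongr
  have : 2 ≤ 2 * (r ^ 2 - ‖x‖ ^ 2) / (r ^ 2 - s ^ 2) := by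
    rw [le_div_iff₀ h]; linarith
  linarith

theorem radialCutoff_eq_zero {x : R3} (hx : (r ^ 2 + s ^ 2) / 2 ≤ ‖x‖ ^ 2) :
    radialCutoff r s x = 0 := by
  apply Real.smoothTransition.zero_of_nonpos
  have h := sq_sub_sq_pos_of_lt hs hsr
  have : 2 * (r ^ 2 - ‖x‖ ^ 2) / (r ^ 2 - s ^ 2) ≤ 1 := by
    rw [div_le_one h]; linarith
  linarith

theorem tsupport_radialCutoff_subset : tsupport (radialCutoff r s) ⊆ Metric.ball 0 r := by
  have hcl : IsClosed {x : R3 | ‖x‖ ^ 2 ≤ (r ^ 2 + s ^ 2) / 2} :=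
    isClosed_le (by fun_prop) continuous_const
  have hsub : tsupport (radialCutoff r s) ⊆ {x : R3 | ‖x‖ ^ 2 ≤ (r ^ 2 + s ^ 2) / 2} :=
    closure_minimal (fun x hx => by
      by_contra hcon
      exact hx (radialCutoff_eq_zero hs hsr (not_le.1 hcon).le)) hcl
  intro x hx
  have hx : ‖x‖ ^ 2 ≤ (r ^ 2 + s ^ 2) / 2 := hsub hx
  rw [mem_ball_zero_iff]
  exact lt_of_pow_lt_pow_left₀ 2 (hs.trans hsr).le (by nlinarith)

/-- The gradient of the cutoff is at most of order `1 / (r - s)`. -/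
theorem abs_fderiv_radialCutoff_le {K : ℝ} (hK : ∀ t, |deriv Real.smoothTransition t| ≤ K)
    (i : Fin 3) {x : R3} (hx : ‖x‖ < r) :
    |fderiv ℝ (radialCutoff r s) x (e i)| ≤ 4 * K / (r - s) := by
  have h := sq_sub_sq_pos_of_lt hs hsr
  have hr : 0 < r := hs.trans hsr
  have h1 : HasFDerivAt (fun x : R3 => 2 * (r ^ 2 - ‖x‖ ^ 2) / (r ^ 2 - s ^ 2) - 1)
      ((-(4 * (r ^ 2 - s ^ 2)⁻¹)) • (innerSL ℝ x : R3 →L[ℝ] ℝ)) x := by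
    have h0 : HasFDerivAt (fun x : R3 => ‖x‖ ^ 2) (2 • (innerSL ℝ x : R3 →L[ℝ] ℝ)) x :=
      (hasStrictFDerivAt_norm_sq x).hasFDerivAt
    have := (((h0.const_sub (r ^ 2)).const_mul 2).mul_const (r ^ 2 - s ^ 2)⁻¹).sub_const 1
    convert! this using 1
    ext y
    simp
    ring
  have h2 : HasDerivAt Real.smoothTransition
      (deriv Real.smoothTransition (2 * (r ^ 2 - ‖x‖ ^ 2) / (r ^ 2 - s ^ 2) - 1))
      (2 * (r ^ 2 - ‖x‖ ^ 2) / (r ^ 2 - s ^ 2) - 1) :=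
    ((Real.smoothTransition.contDiff (n := 1)).differentiable (by simp) _).hasDerivAt
  have h3 : fderiv ℝ (radialCutoff r s) x = _ := (h2.comp_hasFDerivAt x h1).fderiv
  rw [h3]
  have hxi : |x i| ≤ r := (PiLp.norm_apply_le x i).trans hx.le
  have hin : inner ℝ x (e i) = x i := by simp [e, EuclideanSpace.inner_single_right]
  simp only [smul_apply, innerSL_apply_apply, hin, smul_eq_mul, abs_mul,
    abs_neg, abs_inv, abs_of_pos h]
  set D := |deriv Real.smoothTransition (2 * (r ^ 2 - ‖x‖ ^ 2) / (r ^ 2 - s ^ 2) - 1)|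
  have hD : D ≤ K := hK _
  have hD0 : 0 ≤ D := abs_nonneg _
  have hK0 : 0 ≤ K := hD0.trans hD
  have hrs : 0 < r - s := by linarith
  have hq : r * (r - s) ≤ r ^ 2 - s ^ 2 := by nlinarith [mul_pos hs hrs]
  calc D * (|4| * (r ^ 2 - s ^ 2)⁻¹ * |x i|)
      ≤ K * (|4| * (r * (r - s))⁻¹ * r) := by
        gcongr
    _ = 4 * K / (r - s) := by rw [abs_of_pos (by norm_num : (0 : ℝ) < 4)]; field_simp

theorem volume_shell_le : (volume : Measure R3).real
    (Metric.ball 0 r \ Metric.ball 0 s) ≤ 4 * Real.pi * r ^ 2 * (r - s) := by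
  rw [measureReal_sdiff (Metric.ball_subset_ball hsr.le) measurableSet_ball,
    volume_real_ball r (hs.trans hsr).le, volume_real_ball s hs.le]
  have h3 : r ^ 3 - s ^ 3 ≤ 3 * r ^ 2 * (r - s) := by
    have : r ^ 3 - s ^ 3 = (r - s) * (r ^ 2 + r * s + s ^ 2) := by ring
    rw [this]
    have h1 : 0 < r - s := by linarith
    nlinarith [mul_pos hs h1, mul_pos (hs.trans hsr) h1]
  nlinarith [Real.pi_pos]

end

/-- If a continuous function is constant on and outside a sphere, then its weak derivative inside
the ball, extended by zero, is its weak derivative on the whole space: the cutoff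
costs a gradient of order `1 / (r - s)` on a shell of volume of order `r - s`,
where the function is almost equal to its boundary value. -/
theorem isWeakDeriv_extend {p g : R3 → ℝ} {r c : ℝ} (hr : 0 < r) (hp : Continuous p)
    (hc : ∀ x, r ≤ ‖x‖ → p x = c) (hg : MemLp g 2 (volume.restrict (Metric.ball 0 r))) (i : Fin 3)
    (h : IsWeakDeriv (Metric.ball 0 r) (e i) p g) :
    IsWeakDeriv univ (e i) p ((Metric.ball 0 r).indicator g) := by
  intro ψ hψ hψc _
  have : IsFiniteMeasure (volume.restrict (Metric.ball (0 : R3) r)) :=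
    ⟨by rw [Measure.restrict_apply_univ]; exact measure_ball_lt_top⟩
  have hgi : IntegrableOn g (Metric.ball 0 r) := hg.integrable (by norm_num)
  have hdψ : Continuous fun x => fderiv ℝ ψ x (e i) := (contDiff_pd hψ i).continuous
  have hdψc : HasCompactSupport fun x => fderiv ℝ ψ x (e i) := hasCompactSupport_pd hψc i
  obtain ⟨K, hK0, hK⟩ := exists_deriv_smoothTransition_bound
  obtain ⟨M, hM⟩ := hψ.continuous.bounded_above_of_compact_support hψc
  have hM0 : 0 ≤ M := (norm_nonneg _).trans (hM 0)
  let s : ℕ → ℝ := fun n => r - r / (n + 2)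
  have hn2 : ∀ n : ℕ, (0 : ℝ) < n + 2 := fun n => by positivity
  have hs0 : ∀ n, 0 < s n := fun n => by
    have : r / (n + 2) < r := by
      rw [div_lt_iff₀ (hn2 n)]
      nlinarith [Nat.cast_nonneg (α := ℝ) n]
    simp only [s]; linarith
  have hsr : ∀ n, s n < r := fun n => by
    have : 0 < r / (n + 2) := div_pos hr (hn2 n)
    simp only [s]; linarith
  have hslim : Tendsto s atTop (𝓝 r) := by
    have h1 : Tendsto (fun n : ℕ => r / ((n : ℝ) + 2)) atTop (𝓝 0) :=
      tendsto_const_nhds.div_atTop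
        (tendsto_atTop_add_const_right _ _ tendsto_natCast_atTop_atTop)
    simpa using tendsto_const_nhds (x := r) |>.sub h1
  have hpc : Continuous fun x => p x - c := hp.sub continuous_const
  have hθ : ∀ n, ContDiff ℝ ∞ (radialCutoff r (s n)) := fun n => contDiff_radialCutoff _ _
  have hθc : ∀ n, HasCompactSupport (radialCutoff r (s n)) := fun n =>
    (isCompact_closedBall (0 : R3) r).of_isClosed_subset (isClosed_tsupport _)
      ((tsupport_radialCutoff_subset (hs0 n) (hsr n)).trans Metric.ball_subset_closedBall)
  have hpd : ∀ n x, fderiv ℝ (fun x => radialCutoff r (s n) x * ψ x) x (e i)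
      = radialCutoff r (s n) x * fderiv ℝ ψ x (e i)
        + ψ x * fderiv ℝ (radialCutoff r (s n)) x (e i) := fun n x => by
    have h1 := ((hθ n).differentiable (by simp) x).hasFDerivAt.mul
      (hψ.differentiable (by simp) x).hasFDerivAt
    have h2 : fderiv ℝ (fun x => radialCutoff r (s n) x * ψ x) x = _ := h1.fderiv
    rw [h2]
    simp
  have hdθ : ∀ n, Continuous fun x => fderiv ℝ (radialCutoff r (s n)) x (e i) :=
    fun n => (contDiff_pd (hθ n) i).continuous
  -- the weak formulation in the ball, with the test function cut off near the sphere
  have key : ∀ n, (∫ x in Metric.ball 0 r, radialCutoff r (s n) x *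
        (fderiv ℝ ψ x (e i) * (p x - c)))
      + ∫ x in Metric.ball 0 r, radialCutoff r (s n) x * (ψ x * g x)
      = -∫ x in Metric.ball 0 r, fderiv ℝ (radialCutoff r (s n)) x (e i) * (ψ x * (p x - c)) := by
    intro n
    have hts : tsupport (fun x => radialCutoff r (s n) x * ψ x) ⊆ Metric.ball 0 r :=
      (tsupport_mul_subset_left).trans (tsupport_radialCutoff_subset (hs0 n) (hsr n))
    have hcd : ContDiff ℝ ∞ fun x => radialCutoff r (s n) x * ψ x := (hθ n).mul hψ
    have hcc : HasCompactSupport fun x => radialCutoff r (s n) x * ψ x := hψc.mul_left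
    have h1 := h _ hcd hcc hts
    have h2 : ∫ x, fderiv ℝ (fun x => radialCutoff r (s n) x * ψ x) x (e i) = 0 := by
      have := isWeakDeriv_of_contDiff (u := fun _ : R3 => (1 : ℝ)) contDiff_const (e i) _ hcd hcc
        (subset_univ _)
      simpa using this
    have h3 : ∫ x in Metric.ball 0 r,
        fderiv ℝ (fun x => radialCutoff r (s n) x * ψ x) x (e i) = 0 := by
      rw [← h2]
      refine setIntegral_eq_integral_of_forall_compl_eq_zero fun x hx => ?_
      have : (fun x => radialCutoff r (s n) x * ψ x) =ᶠ[𝓝 x] 0 :=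
        notMem_tsupport_iff_eventuallyEq.1 fun hmem => hx (hts hmem)
      rw [this.fderiv_eq]
      simp
    simp only [smul_eq_mul, hpd] at h1 h3
    have i0 : ∀ {q : R3 → ℝ}, Continuous q → IntegrableOn q (Metric.ball (0 : R3) r) := fun hq =>
      (hq.continuousOn.integrableOn_compact (isCompact_closedBall (0 : R3) r)).mono_set
        Metric.ball_subset_closedBall
    have i1 : IntegrableOn (fun x => (radialCutoff r (s n) x * fderiv ℝ ψ x (e i)
        + ψ x * fderiv ℝ (radialCutoff r (s n)) x (e i)) * p x) (Metric.ball 0 r) :=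
      i0 ((((hθ n).continuous.mul hdψ).add (hψ.continuous.mul (hdθ n))).mul hp)
    have i2 : IntegrableOn (fun x => radialCutoff r (s n) x * fderiv ℝ ψ x (e i)
        + ψ x * fderiv ℝ (radialCutoff r (s n)) x (e i)) (Metric.ball 0 r) :=
      i0 (((hθ n).continuous.mul hdψ).add (hψ.continuous.mul (hdθ n)))
    have i3 : IntegrableOn (fun x => radialCutoff r (s n) x * (fderiv ℝ ψ x (e i) * (p x - c)))
      (Metric.ball 0 r) := i0 ((hθ n).continuous.mul (hdψ.mul hpc))
    have i4 : IntegrableOn (fun x => fderiv ℝ (radialCutoff r (s n)) x (e i) * (ψ x * (p x - c)))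
      (Metric.ball 0 r) := i0 ((hdθ n).mul (hψ.continuous.mul hpc))
    have h4 : (∫ x in Metric.ball 0 r, radialCutoff r (s n) x * (fderiv ℝ ψ x (e i) * (p x - c)))
        + ∫ x in Metric.ball 0 r, fderiv ℝ (radialCutoff r (s n)) x (e i) * (ψ x * (p x - c))
        = -∫ x in Metric.ball 0 r, radialCutoff r (s n) x * ψ x * g x := by
      rw [← h1, ← integral_add i3 i4]
      have h5 := integral_sub i1 (i2.mul_const c)
      rw [integral_mul_const, h3, zero_mul, sub_zero] at h5
      rw [← h5]
      refine integral_congr_ae (Eventually.of_forall fun x => ?_)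
      simp only
      ring
    simp only [mul_assoc] at h4
    linarith
  -- both sides converge
  have hθ1 : ∀ x ∈ Metric.ball (0 : R3) r,
      Tendsto (fun n => radialCutoff r (s n) x) atTop (𝓝 1) := by
    intro x hx
    refine tendsto_const_nhds.congr' ?_
    filter_upwards [hslim.eventually (lt_mem_nhds (mem_ball_zero_iff.1 hx))] with n hn
    exact (radialCutoff_eq_one (hs0 n) (hsr n) hn.le).symm
  have hθb : ∀ n x, ‖radialCutoff r (s n) x‖ ≤ 1 := fun n x => by
    rw [radialCutoff, Real.norm_of_nonneg (Real.smoothTransition.nonneg _)]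
    exact Real.smoothTransition.le_one _
  have hlim : ∀ {q : R3 → ℝ}, IntegrableOn q (Metric.ball 0 r) →
      Tendsto (fun n => ∫ x in Metric.ball 0 r, radialCutoff r (s n) x * q x) atTop
        (𝓝 (∫ x in Metric.ball 0 r, q x)) := by
    intro q hq
    refine tendsto_integral_of_dominated_convergence (fun x => ‖q x‖)
      (fun n => (hθ n).continuous.aestronglyMeasurable.mul hq.1) hq.norm
      (fun n => Eventually.of_forall fun x => ?_) ?_
    · rw [norm_mul]
      exact mul_le_of_le_one_left (norm_nonneg _) (hθb n x)
    · filter_upwards [ae_restrict_mem measurableSet_ball] with x hx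
      simpa using (hθ1 x hx).mul_const (q x)
  have hq1 : IntegrableOn (fun x => fderiv ℝ ψ x (e i) * (p x - c)) (Metric.ball 0 r) :=
    ((hdψ.mul hpc).integrable_of_hasCompactSupport hdψc.mul_right).integrableOn
  have hq2 : IntegrableOn (fun x => ψ x * g x) (Metric.ball 0 r) :=
    hgi.bdd_mul (c := M) hψ.continuous.aestronglyMeasurable (Eventually.of_forall hM)
  have hL := (hlim hq1).add (hlim hq2)
  -- The right-hand side is an integral over a shell of volume `O(r - s)`; the factor `1 / (r - s)`
  -- from the cutoff is compensated by the volume, and `p - c` is uniformly small on the shell.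
  have hR : Tendsto (fun n => -∫ x in Metric.ball 0 r,
      fderiv ℝ (radialCutoff r (s n)) x (e i) * (ψ x * (p x - c))) atTop (𝓝 0) := by
    rw [Metric.tendsto_atTop]
    intro ε hε
    set A := 16 * Real.pi * K * r ^ 2 * M with hA
    have hA0 : 0 ≤ A := by positivity
    obtain ⟨δ, hδ, hu⟩ := Metric.uniformContinuous_iff.1
      (uniformContinuous_of_const_off_ball hp hc) (ε / (A + 1)) (by positivity)
    have hev : ∀ᶠ n in atTop, r - δ < s n :=
      hslim.eventually (lt_mem_nhds (by linarith))
    obtain ⟨n₀, hn₀⟩ := eventually_atTop.1 hev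
    refine ⟨n₀, fun n hn => ?_⟩
    have hrs : 0 < r - s n := by linarith [hsr n]
    rw [dist_zero_right, norm_neg]
    have hzero : ∀ x ∈ Metric.ball (0 : R3) r, x ∉ Metric.ball (0 : R3) r \ Metric.ball 0 (s n) →
        fderiv ℝ (radialCutoff r (s n)) x (e i) * (ψ x * (p x - c)) = 0 := by
      intro x hx hx2
      have hxs : x ∈ Metric.ball (0 : R3) (s n) := by
        by_contra hcon
        exact hx2 ⟨hx, hcon⟩
      have : radialCutoff r (s n) =ᶠ[𝓝 x] fun _ => 1 := by
        filter_upwards [Metric.isOpen_ball.mem_nhds hxs] with y hy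
        exact radialCutoff_eq_one (hs0 n) (hsr n) (mem_ball_zero_iff.1 hy).le
      rw [this.fderiv_eq]
      simp
    rw [setIntegral_eq_of_subset_of_forall_sdiff_eq_zero measurableSet_ball
      (sdiff_subset (s := Metric.ball (0 : R3) r) (t := Metric.ball 0 (s n)))
      fun x hx => hzero x hx.1 hx.2]
    have hb : ∀ x ∈ Metric.ball (0 : R3) r \ Metric.ball 0 (s n),
        ‖fderiv ℝ (radialCutoff r (s n)) x (e i) * (ψ x * (p x - c))‖
          ≤ 4 * K / (r - s n) * (M * (ε / (A + 1))) := by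
      intro x hx
      have hx1 : ‖x‖ < r := mem_ball_zero_iff.1 hx.1
      have hx2 : s n ≤ ‖x‖ := by simpa using hx.2
      have hx0 : 0 < ‖x‖ := (hs0 n).trans_le hx2
      rw [norm_mul, norm_mul]
      gcongr
      · exact abs_fderiv_radialCutoff_le (hs0 n) (hsr n) hK i hx1
      · exact hM x
      · have hy : ‖(r / ‖x‖) • x‖ = r := by
          rw [norm_smul, Real.norm_of_nonneg (by positivity)]
          field_simp
        have hd : dist x ((r / ‖x‖) • x) < δ := by
          rw [dist_eq_norm, show x - (r / ‖x‖) • x = (1 - r / ‖x‖) • x by rw [sub_smul, one_smul],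
            norm_smul, Real.norm_eq_abs, abs_of_nonpos
              (by rw [sub_nonpos, one_le_div hx0]; exact hx1.le)]
          have : -(1 - r / ‖x‖) * ‖x‖ = r - ‖x‖ := by field_simp; ring
          rw [this]
          linarith [hn₀ n hn]
        have := hu hd
        rw [hc _ hy.ge, Real.dist_eq] at this
        exact this.le
    have hfin : (volume : Measure R3) (Metric.ball (0 : R3) r \ Metric.ball 0 (s n)) < ⊤ :=
      (measure_mono sdiff_subset).trans_lt measure_ball_lt_top
    calc _ ≤ 4 * K / (r - s n) * (M * (ε / (A + 1))) * (volume : Measure R3).real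
          (Metric.ball (0 : R3) r \ Metric.ball 0 (s n)) := norm_setIntegral_le_of_norm_le_const hfin hb
      _ ≤ 4 * K / (r - s n) * (M * (ε / (A + 1))) * (4 * Real.pi * r ^ 2 * (r - s n)) := by
          gcongr
          exact volume_shell_le (hs0 n) (hsr n)
      _ = ε * (A / (A + 1)) := by
          rw [hA]
          field_simp
          ring
      _ < ε := by
          have : A / (A + 1) < 1 := by rw [div_lt_one (by positivity)]; linarith
          nlinarith
  -- In the limit the identity `key` contains `p - c` in place of `p`, which is harmless as a constant
  -- has weak gradient zero.
  have hfinal := tendsto_nhds_unique (hL.congr key) hR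
  have e1 : ∫ x in Metric.ball 0 r, fderiv ℝ ψ x (e i) * (p x - c)
      = ∫ x, fderiv ℝ ψ x (e i) * p x := by
    rw [setIntegral_eq_integral_of_forall_compl_eq_zero fun x hx => by
      rw [hc x (by simpa using hx), sub_self, mul_zero]]
    have := isWeakDeriv_of_contDiff (u := fun _ : R3 => c) contDiff_const (e i) _ hψ hψc
      (subset_univ _)
    simp only [Measure.restrict_univ, smul_eq_mul, fderiv_fun_const, Pi.zero_apply,
      zero_apply, mul_zero, integral_zero, neg_zero] at this
    have i1 : Integrable fun x => fderiv ℝ ψ x (e i) * p x :=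
      (hdψ.mul hp).integrable_of_hasCompactSupport hdψc.mul_right
    have i2 : Integrable fun x => fderiv ℝ ψ x (e i) * c :=
      (hdψ.mul continuous_const).integrable_of_hasCompactSupport hdψc.mul_right
    simp only [mul_sub]
    rw [integral_sub i1 i2, this, sub_zero]
  have e2 : ∫ x in Metric.ball 0 r, ψ x * g x
      = ∫ x, ψ x * (Metric.ball (0 : R3) r).indicator g x := by
    rw [← integral_indicator measurableSet_ball]
    refine integral_congr_ae (Eventually.of_forall fun x => ?_)
    by_cases hx : x ∈ Metric.ball (0 : R3) r <;> simp [hx]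
  simp only [Measure.restrict_univ, smul_eq_mul]
  rw [e1, e2] at hfinal
  linarith

end

section

/-! ### Neumann eigenfunctions as profiles on the whole space -/

theorem gradient_apply (ψ : R3 → ℝ) (x : R3) (i : Fin 3) : (∇ ψ x) i = pd i ψ x := by
  have h := congrArg (fun L => L (e i)) (toDual_gradient (𝕜 := ℝ) (f := ψ) (x := x))
  simp only [InnerProductSpace.toDual_apply_apply] at h
  rw [pd, ← h, e, EuclideanSpace.inner_single_right]
  simp

theorem inner_gradient_eq_sum (G : R3) (ψ : R3 → ℝ) (x : R3) :
    inner ℝ G (∇ ψ x) = ∑ i, G i * pd i ψ x := by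
  rw [PiLp.inner_apply]
  refine Finset.sum_congr rfl fun i _ => ?_
  rw [gradient_apply]
  simp [mul_comm]

theorem norm_gradient_sq (ψ : R3 → ℝ) (x : R3) : ‖∇ ψ x‖ ^ 2 = ∑ i, pd i ψ x ^ 2 := by
  rw [EuclideanSpace.norm_sq_eq]
  simp [gradient_apply]

theorem norm_smoothen_le {E : Type*} [NormedAddCommGroup E] [NormedSpace ℝ E] {u : R3 → E} {M : ℝ}
    (hM : ∀ x, ‖u x‖ ≤ M) (n : ℕ) (x : R3) : ‖smoothen n u x‖ ≤ M := by
  rw [smoothen_apply']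
  calc ‖∫ y, moll n y • u (x - y)‖ ≤ ∫ y, moll n y * M := by
        refine norm_integral_le_of_norm_le ((integrable_moll n).mul_const M)
          (Eventually.of_forall fun y => ?_)
        rw [norm_smul, Real.norm_of_nonneg (moll_nonneg n y)]
        exact mul_le_mul_of_nonneg_left (hM _) (moll_nonneg n y)
    _ = M := by rw [integral_mul_const, integral_moll, one_mul]

/-- `p` is continuous, equals `c` on and outside the sphere of radius `r`, and is a weak solution of
`(-Δ + V/2) p = lam p` in the ball with Neumann boundary conditions; `g` is its weak gradient,
extended by zero. -/
structure IsProfile (V : R3 → ℝ) (r lam c : ℝ) (p : R3 → ℝ) (g : Fin 3 → R3 → ℝ) : Prop where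
  cont : Continuous p
  eq_c : ∀ x, r ≤ ‖x‖ → p x = c
  memLp : ∀ i, MemLp (g i) 2 volume
  g_zero : ∀ i x, r ≤ ‖x‖ → g i x = 0
  weak : ∀ i, IsWeakDeriv univ (e i) p (g i)
  eqn : ∀ ψ : R3 → ℝ, ContDiff ℝ ∞ ψ → (∑ i, ∫ x, g i x * pd i ψ x)
    + ∫ x in Metric.ball 0 r, (1 / 2 * V x - lam) * (p x * ψ x) = 0

/-- `lam` is at most the lowest Neumann eigenvalue of `-Δ + V/2` in the ball of radius `r`. -/
def IsLowerBound (V : R3 → ℝ) (r lam : ℝ) : Prop :=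
  ∀ ψ : R3 → ℝ, ContDiff ℝ ∞ ψ → 0 ≤ (∑ i, ∫ x in Metric.ball 0 r, pd i ψ x ^ 2)
    + ∫ x in Metric.ball 0 r, (1 / 2 * V x - lam) * (ψ x * ψ x)

theorem integrableOn_potential {V q : R3 → ℝ} (hV : Integrable V) (hq : Continuous q) (r lam : ℝ) :
    IntegrableOn (fun x => (1 / 2 * V x - lam) * q x) (Metric.ball 0 r) := by
  have h : IntegrableOn (fun x => 1 / 2 * V x - lam) (Metric.closedBall 0 r) :=
    (hV.const_mul _).integrableOn.sub
      (continuous_const.continuousOn.integrableOn_compact (isCompact_closedBall _ _))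
  exact (h.mul_continuousOn hq.continuousOn (isCompact_closedBall _ _)).mono_set
    Metric.ball_subset_closedBall

theorem tendsto_potential {V : R3 → ℝ} (hV : Integrable V) {r lam M : ℝ} {q : ℕ → R3 → ℝ}
    {q' : R3 → ℝ} (hq : ∀ n, Continuous (q n)) (hM : ∀ n x, ‖x‖ < r → |q n x| ≤ M)
    (hlim : ∀ x, Tendsto (fun n => q n x) atTop (𝓝 (q' x))) :
    Tendsto (fun n => ∫ x in Metric.ball 0 r, (1 / 2 * V x - lam) * q n x) atTop
      (𝓝 (∫ x in Metric.ball 0 r, (1 / 2 * V x - lam) * q' x)) := by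
  refine tendsto_integral_of_dominated_convergence
    (fun x => ‖(1 / 2 * V x - lam) * M‖) (fun n => (integrableOn_potential hV (hq n) r lam).1)
    (integrableOn_potential hV continuous_const r lam).norm (fun n => ?_)
    (Eventually.of_forall fun x => (hlim x).const_mul _)
  filter_upwards [ae_restrict_mem measurableSet_ball] with x hx
  rw [norm_mul, norm_mul]
  gcongr
  exact (hM n x (mem_ball_zero_iff.1 hx)).trans (le_abs_self _)

theorem integrableOn_ball_of_continuous {q : R3 → ℝ} (hq : Continuous q) (r : ℝ) :
    IntegrableOn q (Metric.ball 0 r) :=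
  (hq.continuousOn.integrableOn_compact (isCompact_closedBall (0 : R3) r)).mono_set
    Metric.ball_subset_closedBall

theorem memLp_ball_of_continuous {q : R3 → ℝ} (hq : Continuous q) (r : ℝ) :
    MemLp q 2 (volume.restrict (Metric.ball 0 r)) := by
  obtain ⟨M, hM⟩ := (isCompact_closedBall (0 : R3) r).exists_bound_of_continuousOn hq.continuousOn
  have : IsFiniteMeasure (volume.restrict (Metric.ball (0 : R3) r)) :=
    isFiniteMeasure_restrict.2 measure_ball_lt_top.ne
  refine MemLp.of_bound hq.aestronglyMeasurable M ?_
  filter_upwards [ae_restrict_mem measurableSet_ball] with x hx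
  exact hM x (Metric.ball_subset_closedBall hx)

theorem IsNeumannGroundState.isLowerBound {V f : R3 → ℝ} {r lam : ℝ} (hV : Integrable V)
    (h : IsNeumannGroundState V r lam f) : IsLowerBound V r lam := by
  intro ψ hψ
  have h1 := h.lowest ψ hψ
  have i1 : ∀ i, IntegrableOn (fun x => pd i ψ x ^ 2) (Metric.ball 0 r) := fun i =>
    integrableOn_ball_of_continuous ((contDiff_pd hψ i).continuous.pow 2) r
  have i3 : IntegrableOn (fun x => ψ x ^ 2) (Metric.ball 0 r) :=
    integrableOn_ball_of_continuous (hψ.continuous.pow 2) r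
  have i2 := integrableOn_potential hV (hψ.continuous.fun_mul hψ.continuous) r lam
  have e1 : (∑ i, ∫ x in Metric.ball 0 r, pd i ψ x ^ 2)
      + ∫ x in Metric.ball 0 r, (1 / 2 * V x - lam) * (ψ x * ψ x)
      = (∫ x in Metric.ball 0 r, (‖∇ ψ x‖ ^ 2 + 1 / 2 * V x * ψ x ^ 2))
        - lam * ∫ x in Metric.ball 0 r, ψ x ^ 2 := by
    rw [← integral_finsetSum _ fun i _ => i1 i, ← integral_add (integrable_finsetSum _ fun i _ => i1 i)
      i2, ← integral_const_mul, ← integral_sub _ (i3.const_mul lam)]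
    · refine integral_congr_ae (Eventually.of_forall fun x => ?_)
      simp only [norm_gradient_sq]
      ring
    · have := ((integrable_finsetSum Finset.univ fun i _ => i1 i).add i2).add (i3.const_mul lam)
      refine this.congr (Eventually.of_forall fun x => ?_)
      simp only [Pi.add_apply, norm_gradient_sq]
      ring
  rw [e1]
  linarith

/-- The weak gradient of a Neumann ground state in the ball, extended by zero, is a weak gradient on
the whole space because the ground state is constant on and outside the sphere. -/
theorem IsNeumannGroundState.exists_profile {V f : R3 → ℝ} {r lam : ℝ} (hr : 0 < r)
    (hV : Integrable V) (h : IsNeumannGroundState V r lam f) :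
    ∃ g, IsProfile V r lam 1 f g := by
  obtain ⟨G, hG, hGw, hGe⟩ := h.weak_eq
  have hGi : ∀ i, MemLp (fun x => G x i) 2 (volume.restrict (Metric.ball (0 : R3) r)) := fun i =>
    hG.mono ((EuclideanSpace.proj (𝕜 := ℝ) i).continuous.comp_aestronglyMeasurable hG.1)
      (Eventually.of_forall fun x => PiLp.norm_apply_le _ i)
  refine ⟨fun i => (Metric.ball 0 r).indicator fun x => G x i, h.continuous, h.eq_one,
    fun i => (memLp_indicator_iff_restrict measurableSet_ball).2 (hGi i),
    fun i x hx => indicator_of_notMem (by simpa using hx) _,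
    fun i => isWeakDeriv_extend hr h.continuous h.eq_one (hGi i) i (hGw i), fun ψ hψ => ?_⟩
  have h1 := hGe ψ hψ
  have i1 : ∀ i, IntegrableOn (fun x => G x i * pd i ψ x) (Metric.ball 0 r) := fun i => by
    exact (hGi i).integrable_mul (memLp_ball_of_continuous (contDiff_pd hψ i).continuous r)
  have i2 := integrableOn_potential hV (h.continuous.fun_mul hψ.continuous) r lam
  have i3 : IntegrableOn (fun x => f x * ψ x) (Metric.ball 0 r) :=
    integrableOn_ball_of_continuous (h.continuous.mul hψ.continuous) r
  have e0 : ∀ i, ∫ x, (Metric.ball (0 : R3) r).indicator (fun x => G x i) x * pd i ψ x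
      = ∫ x in Metric.ball 0 r, G x i * pd i ψ x := fun i => by
    rw [← integral_indicator measurableSet_ball]
    refine integral_congr_ae (Eventually.of_forall fun x => ?_)
    by_cases hx : x ∈ Metric.ball (0 : R3) r <;> simp [hx]
  simp only [e0]
  rw [← integral_finsetSum _ fun i _ => i1 i, ← integral_add (integrable_finsetSum _ fun i _ => i1 i)
      i2, ← sub_eq_zero.2 h1, ← integral_const_mul, ← integral_sub _ (i3.const_mul lam)]
  · refine integral_congr_ae (Eventually.of_forall fun x => ?_)
    simp only [inner_gradient_eq_sum]
    ring
  · have := ((integrable_finsetSum Finset.univ fun i _ => i1 i).add i2).add (i3.const_mul lam)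
    refine this.congr (Eventually.of_forall fun x => ?_)
    simp only [Pi.add_apply, inner_gradient_eq_sum]
    ring

namespace IsProfile

variable {V : R3 → ℝ} {r lam c : ℝ} {p : R3 → ℝ} {g : Fin 3 → R3 → ℝ}

theorem uniformContinuous (h : IsProfile V r lam c p g) : UniformContinuous p :=
  uniformContinuous_of_const_off_ball h.cont h.eq_c

theorem exists_bound (h : IsProfile V r lam c p g) : ∃ M : ℝ, ∀ x, |p x| ≤ M := by
  obtain ⟨M, hM⟩ := (isCompact_closedBall (0 : R3) r).exists_bound_of_continuousOn
    h.cont.continuousOn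
  refine ⟨max M |c|, fun x => ?_⟩
  rcases le_total ‖x‖ r with hx | hx
  · exact (hM x (by simpa using hx)).trans (le_max_left _ _)
  · rw [h.eq_c x hx]
    exact le_max_right _ _

theorem contDiff_smoothen (h : IsProfile V r lam c p g) (n : ℕ) : ContDiff ℝ ∞ (smoothen n p) :=
  GP.contDiff_smoothen n h.cont.locallyIntegrable

theorem pd_smoothen (h : IsProfile V r lam c p g) (n : ℕ) (i : Fin 3) :
    pd i (smoothen n p) = smoothen n (g i) :=
  funext fun x => fderiv_smoothen h.cont.locallyIntegrable (h.weak i) n x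

theorem memLp_pd_smoothen (h : IsProfile V r lam c p g) (n : ℕ) (i : Fin 3) :
    MemLp (pd i (smoothen n p)) 2 volume := by
  rw [h.pd_smoothen]
  exact memLp_smoothen (h.memLp i) n

theorem tendsto_pd_smoothen (h : IsProfile V r lam c p g) (i : Fin 3) :
    Tendsto (fun n => eLpNorm (pd i (smoothen n p) - g i) 2 volume) atTop (𝓝 0) := by
  simp only [h.pd_smoothen]
  exact tendsto_eLpNorm_smoothen_sub (h.memLp i)

theorem tendsto_smoothen (h : IsProfile V r lam c p g) (x : R3) :
    Tendsto (fun n => smoothen n p x) atTop (𝓝 (p x)) :=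
  (tendstoUniformly_smoothen h.uniformContinuous).tendsto_at x

/-- The quadratic form of a profile vanishes: test the equation with its mollifications. -/
theorem energy_eq_zero (h : IsProfile V r lam c p g) (hV : Integrable V) :
    (∑ i, ∫ x, g i x * g i x) + ∫ x in Metric.ball 0 r, (1 / 2 * V x - lam) * (p x * p x) = 0 := by
  obtain ⟨M, hM⟩ := h.exists_bound
  have h1 : ∀ i, Tendsto (fun n => ∫ x, g i x * pd i (smoothen n p) x) atTop
      (𝓝 (∫ x, g i x * g i x)) := fun i =>
    tendsto_integral_mul_of_L2 (fun _ => h.memLp i) (fun n => h.memLp_pd_smoothen n i) (h.memLp i)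
      (h.memLp i) (by simp) (h.tendsto_pd_smoothen i)
  have h2 : Tendsto (fun n => ∫ x in Metric.ball 0 r,
      (1 / 2 * V x - lam) * (p x * smoothen n p x)) atTop
      (𝓝 (∫ x in Metric.ball 0 r, (1 / 2 * V x - lam) * (p x * p x))) := by
    refine tendsto_potential hV (M := M * M)
      (fun n => h.cont.mul (h.contDiff_smoothen n).continuous) (fun n x _ => ?_)
      fun x => (h.tendsto_smoothen x).const_mul _
    rw [abs_mul]
    have hs := norm_smoothen_le (fun x => (Real.norm_eq_abs _).trans_le (hM x)) n x
    exact mul_le_mul (hM x) hs (abs_nonneg _) ((abs_nonneg _).trans (hM x))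
  have h3 := (tendsto_finsetSum Finset.univ fun i _ => h1 i).add h2
  refine tendsto_nhds_unique h3 ?_
  simp only [h.eqn _ (h.contDiff_smoothen _)]
  exact tendsto_const_nhds

theorem sub {p' : R3 → ℝ} {g' : Fin 3 → R3 → ℝ} {c' : ℝ} (hV : Integrable V)
    (h : IsProfile V r lam c p g)
    (h' : IsProfile V r lam c' p' g') :
    IsProfile V r lam (c - c') (fun x => p x - p' x) (fun i x => g i x - g' i x) where
  cont := h.cont.sub h'.cont
  eq_c x hx := by rw [h.eq_c x hx, h'.eq_c x hx]
  memLp i := (h.memLp i).sub (h'.memLp i)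
  g_zero i x hx := by rw [h.g_zero i x hx, h'.g_zero i x hx, sub_zero]
  weak i := by
    intro ψ hψ hc hs
    have e1 := h.weak i ψ hψ hc hs
    have e2 := h'.weak i ψ hψ hc hs
    simp only [Measure.restrict_univ, smul_eq_mul] at *
    have hd : Continuous fun x => fderiv ℝ ψ x (e i) := (contDiff_pd hψ i).continuous
    have hdc : HasCompactSupport fun x => fderiv ℝ ψ x (e i) := hasCompactSupport_pd hc i
    simp only [mul_sub]
    rw [integral_sub ((hd.fun_mul h.cont).integrable_of_hasCompactSupport hdc.mul_right)
      ((hd.fun_mul h'.cont).integrable_of_hasCompactSupport hdc.mul_right), e1, e2, integral_sub]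
    · ring
    · exact (hψ.continuous.memLp_of_hasCompactSupport (p := 2) hc).integrable_mul (h.memLp i)
    · exact (hψ.continuous.memLp_of_hasCompactSupport (p := 2) hc).integrable_mul (h'.memLp i)
  eqn ψ hψ := by
    have e1 := h.eqn ψ hψ
    have e2 := h'.eqn ψ hψ
    have hint : ∀ {q : R3 → ℝ}, (∀ x, r ≤ ‖x‖ → q x = 0) → MemLp q 2 volume → ∀ i,
        Integrable fun x => q x * pd i ψ x := by
      intro q hq0 hq i
      obtain ⟨χ, hχ, hχc, hχ1, -⟩ := exists_cutoff r
      have hm : MemLp (fun x => χ x * pd i ψ x) 2 volume :=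
        (hχ.continuous.mul (contDiff_pd hψ i).continuous).memLp_of_hasCompactSupport hχc.mul_right
      refine (hq.integrable_mul hm).congr (Eventually.of_forall fun x => ?_)
      rcases le_total ‖x‖ r with hx | hx
      · simp [hχ1 x hx]
      · simp [hq0 x hx]
    have e3 : ∀ i, ∫ x, (g i x - g' i x) * pd i ψ x
        = (∫ x, g i x * pd i ψ x) - ∫ x, g' i x * pd i ψ x := fun i => by
      rw [← integral_sub (hint (h.g_zero i) (h.memLp i) i) (hint (h'.g_zero i) (h'.memLp i) i)]
      simp only [sub_mul]
    have e4 : ∫ x in Metric.ball 0 r, (1 / 2 * V x - lam) * ((p x - p' x) * ψ x)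
        = (∫ x in Metric.ball 0 r, (1 / 2 * V x - lam) * (p x * ψ x))
          - ∫ x in Metric.ball 0 r, (1 / 2 * V x - lam) * (p' x * ψ x) := by
      rw [← integral_sub (integrableOn_potential hV (h.cont.fun_mul hψ.continuous) r lam)
        (integrableOn_potential hV (h'.cont.fun_mul hψ.continuous) r lam)]
      refine integral_congr_ae (Eventually.of_forall fun x => ?_)
      simp only
      ring
    simp only [e3, Finset.sum_sub_distrib]
    rw [e4]
    linarith

theorem negLap (h : IsProfile V r lam c p g) :
    NegLap p ((Metric.ball 0 r).indicator fun x => (lam - 1 / 2 * V x) * p x) := by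
  refine negLap_of_weak_gradient h.weak h.cont.locallyIntegrable fun ψ hψ _ => ?_
  have h1 := h.eqn ψ hψ
  have h2 : ∫ x, (Metric.ball (0 : R3) r).indicator (fun x => (lam - 1 / 2 * V x) * p x) x * ψ x
      = -∫ x in Metric.ball 0 r, (1 / 2 * V x - lam) * (p x * ψ x) := by
    rw [← integral_neg, ← integral_indicator measurableSet_ball]
    refine integral_congr_ae (Eventually.of_forall fun x => ?_)
    by_cases hx : x ∈ Metric.ball (0 : R3) r
    · simp only [indicator_of_mem hx]; ring
    · simp [hx]
  rw [h2]
  linarith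

theorem setIntegral_sq_pos (h : IsProfile V r lam c p g) (hr : 0 < r) (hc : c ≠ 0) :
    0 < ∫ x in Metric.ball 0 r, p x * p x := by
  have hcont : Continuous fun x => p x * p x := h.cont.mul h.cont
  have h0 : 0 ≤ ∫ x in Metric.ball 0 r, p x * p x := integral_nonneg fun x => mul_self_nonneg _
  refine lt_of_le_of_ne h0 fun heq => hc ?_
  have h1 := (setIntegral_eq_zero_iff_of_nonneg_ae (Eventually.of_forall fun x => mul_self_nonneg _)
    (integrableOn_ball_of_continuous hcont r)).1 heq.symm
  have h2 : EqOn (fun x => p x * p x) 0 (Metric.ball 0 r) :=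
    Measure.eqOn_open_of_ae_eq h1 Metric.isOpen_ball hcont.continuousOn continuousOn_const
  have h3 := h2.closure hcont continuous_const
  rw [closure_ball _ hr.ne'] at h3
  have hx : ‖r • e 0‖ = r := by simp [e, norm_smul, abs_of_pos hr]
  have h4 := h3 (show r • e 0 ∈ Metric.closedBall (0 : R3) r by
    rw [mem_closedBall_zero_iff, hx])
  simp only [Pi.zero_apply, mul_self_eq_zero] at h4
  rw [← h.eq_c _ hx.ge, h4]

theorem split_potential (hV : Integrable V) {q : R3 → ℝ} (hq : Continuous q) :
    ∫ x in Metric.ball 0 r, (1 / 2 * V x - lam) * q x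
      = (∫ x in Metric.ball 0 r, 1 / 2 * V x * q x) - lam * ∫ x in Metric.ball 0 r, q x := by
  have i1 := integrableOn_potential hV hq r 0
  simp only [sub_zero] at i1
  rw [← integral_const_mul, ← integral_sub i1 ((integrableOn_ball_of_continuous hq r).const_mul lam)]
  refine integral_congr_ae (Eventually.of_forall fun x => ?_)
  simp only
  ring

theorem lam_nonneg (h : IsProfile V r lam c p g) (hV : Integrable V) (hV0 : ∀ x, 0 ≤ V x)
    (hr : 0 < r) (hc : c ≠ 0) : 0 ≤ lam := by
  have h1 := h.energy_eq_zero hV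
  rw [split_potential hV (h.cont.fun_mul h.cont)] at h1
  have h2 : 0 ≤ ∑ i, ∫ x, g i x * g i x :=
    Finset.sum_nonneg fun i _ => integral_nonneg fun x => mul_self_nonneg _
  have h3 : 0 ≤ ∫ x in Metric.ball 0 r, 1 / 2 * V x * (p x * p x) :=
    integral_nonneg fun x => mul_nonneg (by linarith [hV0 x]) (mul_self_nonneg _)
  exact nonneg_of_mul_nonneg_left (by linarith) (h.setIntegral_sq_pos hr hc)

theorem tendsto_setIntegral_pd_sq (h : IsProfile V r lam c p g) (i : Fin 3) :
    Tendsto (fun n => ∫ x in Metric.ball 0 r, pd i (smoothen n p) x ^ 2) atTop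
      (𝓝 (∫ x, g i x * g i x)) := by
  have h0 : ∫ x, g i x * g i x = ∫ x in Metric.ball 0 r, g i x * g i x :=
    (setIntegral_eq_integral_of_forall_compl_eq_zero fun x hx => by
      rw [h.g_zero i x (by simpa using hx), mul_zero]).symm
  rw [h0]
  simp only [sq]
  have ht : Tendsto (fun n => eLpNorm (pd i (smoothen n p) - g i) 2
      (volume.restrict (Metric.ball 0 r))) atTop (𝓝 0) :=
    tendsto_of_tendsto_of_tendsto_of_le_of_le tendsto_const_nhds (h.tendsto_pd_smoothen i)
      (fun _ => zero_le) fun n => eLpNorm_mono_measure _ Measure.restrict_le_self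
  exact tendsto_integral_mul_of_L2 (fun n => (h.memLp_pd_smoothen n i).restrict _)
    (fun n => (h.memLp_pd_smoothen n i).restrict _) ((h.memLp i).restrict _)
    ((h.memLp i).restrict _) ht ht

/-- A profile is admissible in the variational principle for another eigenvalue. -/
theorem lam_le (h : IsProfile V r lam c p g) (hV : Integrable V) (hr : 0 < r) (hc : c ≠ 0)
    {lam' : ℝ} (hlow : IsLowerBound V r lam') : lam' ≤ lam := by
  obtain ⟨M, hM⟩ := h.exists_bound
  have h1 := tendsto_finsetSum Finset.univ fun i _ => h.tendsto_setIntegral_pd_sq i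
  have h2 : Tendsto (fun n => ∫ x in Metric.ball 0 r,
      (1 / 2 * V x - lam') * (smoothen n p x * smoothen n p x)) atTop
      (𝓝 (∫ x in Metric.ball 0 r, (1 / 2 * V x - lam') * (p x * p x))) := by
    refine tendsto_potential hV (M := M * M)
      (fun n => (h.contDiff_smoothen n).continuous.mul (h.contDiff_smoothen n).continuous)
      (fun n x _ => ?_) fun x => (h.tendsto_smoothen x).mul (h.tendsto_smoothen x)
    rw [abs_mul]
    have hs := norm_smoothen_le (fun x => (Real.norm_eq_abs _).trans_le (hM x)) n x
    exact mul_le_mul hs hs (abs_nonneg _) ((abs_nonneg _).trans (hM x))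
  have h3 := ge_of_tendsto' (h1.add h2) fun n => hlow _ (h.contDiff_smoothen n)
  have h4 := h.energy_eq_zero hV
  rw [split_potential hV (h.cont.fun_mul h.cont)] at h3 h4
  have h5 := h.setIntegral_sq_pos hr hc
  nlinarith

end IsProfile

end

section

/-! ### Positivity and uniqueness of the Neumann ground state -/

theorem integral_mul_lap {s ψ : R3 → ℝ} (hs : ContDiff ℝ ∞ s) (hψ : ContDiff ℝ ∞ ψ)
    (hc : HasCompactSupport ψ) : ∫ x, s x * lap ψ x = -∑ i, ∫ x, pd i s x * pd i ψ x := by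
  have h1 : ∀ i, ∫ x, s x * pd i (pd i ψ) x = -∫ x, pd i s x * pd i ψ x := fun i => by
    have := weakDeriv_pd hs i _ (contDiff_pd hψ i) (hasCompactSupport_pd hc i) (subset_univ _)
    simp only [Measure.restrict_univ, smul_eq_mul] at this
    simp only [mul_comm (s _), mul_comm (pd i s _)]
    exact this
  simp only [lap, Finset.mul_sum]
  rw [integral_finsetSum, ← Finset.sum_neg_distrib]
  · exact Finset.sum_congr rfl fun i _ => h1 i
  · intro i _
    exact (hs.continuous.mul (contDiff_pd (contDiff_pd hψ i) i).continuous).integrable_of_hasCompactSupport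
      (hasCompactSupport_pd (hasCompactSupport_pd hc i) i).mul_left

/-- A smooth approximation of `|u|`. -/
def softAbs (a : ℝ) (u : R3 → ℝ) (x : R3) : ℝ := √(u x ^ 2 + a ^ 2)

section softAbs

variable {a : ℝ} (ha : 0 < a) {u : R3 → ℝ} (hu : ContDiff ℝ ∞ u)
include ha hu

theorem contDiff_softAbs : ContDiff ℝ ∞ (softAbs a u) :=
  ((hu.pow 2).add contDiff_const).sqrt fun x => by positivity

theorem abs_pd_softAbs_le (i : Fin 3) (x : R3) : |pd i (softAbs a u) x| ≤ |pd i u x| := by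
  have hpos : 0 < u x ^ 2 + a ^ 2 := by positivity
  have h1 : HasFDerivAt u (fderiv ℝ u x) x := (hu.differentiable (by simp) x).hasFDerivAt
  have h2 : fderiv ℝ (softAbs a u) x = _ := (((h1.pow 2).add_const (a ^ 2)).sqrt hpos.ne').fderiv
  have h3 : pd i (softAbs a u) x = (u x / √(u x ^ 2 + a ^ 2)) * pd i u x := by
    rw [pd, h2]
    simp only [smul_apply, smul_eq_mul, pd]
    field_simp
    simp
  rw [h3, abs_mul]
  refine mul_le_of_le_one_left (abs_nonneg _) ?_
  rw [abs_div, abs_of_nonneg (Real.sqrt_nonneg _), div_le_one (Real.sqrt_pos.2 hpos)]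
  exact Real.abs_le_sqrt (by nlinarith)

end softAbs

theorem eq_zero_of_forall_quadratic {a b : ℝ} (h : ∀ t : ℝ, 0 ≤ 2 * t * a + t ^ 2 * b) : a = 0 := by
  have h1 : discrim b (2 * a) 0 ≤ 0 := discrim_le_zero fun t => by
    have := h t
    nlinarith
  rw [discrim] at h1
  nlinarith [sq_nonneg a]

namespace IsProfile

variable {V : R3 → ℝ} {r lam c : ℝ} {p : R3 → ℝ} {g : Fin 3 → R3 → ℝ}

/-- If `lam` is the lowest eigenvalue, `|p|` minimizes the quadratic form together with `p`, and so
satisfies the same equation (in the sense of distributions, across the boundary of the ball). -/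
theorem abs_negLap (h : IsProfile V r lam c p g) (hV : Integrable V)
    (hlow : IsLowerBound V r lam) :
    NegLap (fun x => |p x|) ((Metric.ball 0 r).indicator fun x => (lam - 1 / 2 * V x) * |p x|) := by
  intro ψ hψ hψc
  obtain ⟨M, hM⟩ := h.exists_bound
  obtain ⟨D, hD⟩ := hψc.exists_bound_of_continuous hψ.continuous
  have ha : ∀ n : ℕ, 0 < 1 / ((n : ℝ) + 1) := fun n => by positivity
  set s : ℕ → R3 → ℝ := fun n => softAbs (1 / ((n : ℝ) + 1)) (smoothen n p) with hs
  have hsm : ∀ n, ContDiff ℝ ∞ (s n) := fun n => contDiff_softAbs (ha n) (h.contDiff_smoothen n)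
  have hpdle : ∀ n i x, |pd i (s n) x| ≤ |pd i (smoothen n p) x| := fun n =>
    abs_pd_softAbs_le (ha n) (h.contDiff_smoothen n)
  have hslim : ∀ x, Tendsto (fun n => s n x) atTop (𝓝 |p x|) := fun x => by
    have := (((h.tendsto_smoothen x).pow 2).add
      ((tendsto_one_div_add_atTop_nhds_zero_nat (𝕜 := ℝ)).pow 2)).sqrt
    simpa [hs, softAbs, Real.sqrt_sq_eq_abs] using this
  have hsb : ∀ n x, |s n x| ≤ M + 1 := fun n x => by
    have h1 : |smoothen n p x| ≤ M :=
      norm_smoothen_le (fun x => (Real.norm_eq_abs _).trans_le (hM x)) n x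
    have h2 : 1 / ((n : ℝ) + 1) ≤ 1 := by
      rw [div_le_one (by positivity)]
      linarith [Nat.cast_nonneg (α := ℝ) n]
    have h0 := abs_nonneg (smoothen n p x)
    simp only [hs, softAbs]
    rw [abs_of_nonneg (Real.sqrt_nonneg _)]
    refine Real.sqrt_le_iff.2 ⟨by linarith, ?_⟩
    have h3 : smoothen n p x ^ 2 ≤ M ^ 2 := by
      rw [← sq_abs]
      gcongr
    have h4 : (1 / ((n : ℝ) + 1)) ^ 2 ≤ 1 := pow_le_one₀ (ha n).le h2
    nlinarith
  -- the part of the Dirichlet form outside of the ball disappears in the limit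
  have hout : ∀ i, Tendsto (fun n => ∫ x in (Metric.ball 0 r)ᶜ, pd i (s n) x * pd i ψ x) atTop
      (𝓝 0) := fun i => by
    have hm : MemLp (fun x => |pd i ψ x|) 2 (volume.restrict (Metric.ball (0 : R3) r)ᶜ) :=
      (((contDiff_pd hψ i).continuous.memLp_of_hasCompactSupport
        (hasCompactSupport_pd hψc i)).restrict _).abs
    have hlim : Tendsto (fun n => ∫ x in (Metric.ball 0 r)ᶜ, |pd i (smoothen n p) x| * |pd i ψ x|)
        atTop (𝓝 (∫ x in (Metric.ball 0 r)ᶜ, |g i x| * |pd i ψ x|)) := by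
      refine tendsto_integral_mul_of_L2 (fun n => ((h.memLp_pd_smoothen n i).restrict _).abs)
        (fun _ => hm) ((h.memLp i).restrict _).abs hm ?_ (by simp)
      refine tendsto_of_tendsto_of_tendsto_of_le_of_le tendsto_const_nhds (h.tendsto_pd_smoothen i)
        (fun _ => zero_le) fun n => ?_
      refine (eLpNorm_mono fun x => ?_).trans (eLpNorm_mono_measure _ Measure.restrict_le_self)
      simpa using abs_abs_sub_abs_le_abs_sub _ _
    have hz : ∫ x in (Metric.ball 0 r)ᶜ, |g i x| * |pd i ψ x| = 0 :=
      setIntegral_eq_zero_of_forall_eq_zero fun x hx => by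
        rw [h.g_zero i x (by simpa using hx), abs_zero, zero_mul]
    rw [hz] at hlim
    refine squeeze_zero_norm (fun n => ?_) hlim
    refine norm_integral_le_of_norm_le ((((h.memLp_pd_smoothen n i).restrict _).abs).integrable_mul hm)
      (Eventually.of_forall fun x => ?_)
    rw [norm_mul]
    exact mul_le_mul_of_nonneg_right (hpdle n i x) (abs_nonneg _)
  have hin : Tendsto (fun n => ∑ i, ∫ x in Metric.ball 0 r, pd i (s n) x * pd i ψ x) atTop
      (𝓝 (-∫ x, |p x| * lap ψ x)) := by
    have h1 : Tendsto (fun n => ∫ x, s n x * lap ψ x) atTop (𝓝 (∫ x, |p x| * lap ψ x)) := by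
      refine tendsto_integral_of_dominated_convergence (fun x => (M + 1) * |lap ψ x|)
        (fun n => ((hsm n).continuous.mul (continuous_lap hψ)).aestronglyMeasurable)
        (((continuous_lap hψ).integrable_of_hasCompactSupport
          (hasCompactSupport_lap hψc)).abs.const_mul _) (fun n => Eventually.of_forall fun x => ?_)
        (Eventually.of_forall fun x => (hslim x).mul_const _)
      rw [norm_mul]
      exact mul_le_mul_of_nonneg_right (hsb n x) (abs_nonneg _)
    have h2 := h1.neg.sub (tendsto_finsetSum Finset.univ fun i _ => hout i)
    simp only [Finset.sum_const_zero, sub_zero] at h2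
    refine h2.congr fun n => ?_
    rw [integral_mul_lap (hsm n) hψ hψc, neg_neg, ← Finset.sum_sub_distrib]
    refine Finset.sum_congr rfl fun i _ => ?_
    have hi : Integrable fun x => pd i (s n) x * pd i ψ x :=
      ((contDiff_pd (hsm n) i).continuous.mul
        (contDiff_pd hψ i).continuous).integrable_of_hasCompactSupport
          (hasCompactSupport_pd hψc i).mul_left
    rw [← integral_add_compl measurableSet_ball hi]
    ring
  have hcψ : ∀ i, Continuous (pd i ψ) := fun i => (contDiff_pd hψ i).continuous
  set b : ℝ := (∑ i, ∫ x in Metric.ball 0 r, pd i ψ x ^ 2)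
    + ∫ x in Metric.ball 0 r, (1 / 2 * V x - lam) * (ψ x * ψ x)
  -- The lowest eigenvalue bound for `s n + t ψ`, in the limit. Since `|∇(s n)| ≤ |∇p_n|`, the part of
  -- order zero in `t` is at most the quadratic form of `p`, which vanishes.
  have hquad : ∀ t : ℝ, 0 ≤ 2 * t * ((-∫ x, |p x| * lap ψ x)
      + ∫ x in Metric.ball 0 r, (1 / 2 * V x - lam) * (|p x| * ψ x)) + t ^ 2 * b := by
    intro t
    have l1 := tendsto_finsetSum Finset.univ fun i _ => h.tendsto_setIntegral_pd_sq i
    have l2 : Tendsto (fun n => ∫ x in Metric.ball 0 r,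
        (1 / 2 * V x - lam) * ((s n x + t * ψ x) * (s n x + t * ψ x))) atTop
        (𝓝 (∫ x in Metric.ball 0 r,
          (1 / 2 * V x - lam) * ((|p x| + t * ψ x) * (|p x| + t * ψ x)))) := by
      refine tendsto_potential hV (M := (M + 1 + |t| * D) * (M + 1 + |t| * D)) (fun n => ?_)
        (fun n x _ => ?_) fun x => ((hslim x).add_const _).mul ((hslim x).add_const _)
      · have := (hsm n).continuous
        have := hψ.continuous
        fun_prop
      · rw [abs_mul]
        have h1 : |s n x + t * ψ x| ≤ M + 1 + |t| * D := by
          refine (abs_add_le _ _).trans (add_le_add (hsb n x) ?_)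
          rw [abs_mul]
          exact mul_le_mul_of_nonneg_left (hD x) (abs_nonneg _)
        exact mul_le_mul h1 h1 (abs_nonneg _) ((abs_nonneg _).trans h1)
    have l3 := ((l1.add (hin.const_mul (2 * t))).add_const
      (t ^ 2 * ∑ i, ∫ x in Metric.ball 0 r, pd i ψ x ^ 2)).add l2
    have l4 := ge_of_tendsto' l3 fun n => by
      refine (hlow (fun x => s n x + t * ψ x) ((hsm n).add (contDiff_const.mul hψ))).trans ?_
      refine add_le_add_left ?_ _
      rw [Finset.mul_sum, Finset.mul_sum, ← Finset.sum_add_distrib, ← Finset.sum_add_distrib]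
      refine Finset.sum_le_sum fun i _ => ?_
      have hcs : Continuous (pd i (s n)) := (contDiff_pd (hsm n) i).continuous
      have hcp : Continuous (pd i (smoothen n p)) :=
        (contDiff_pd (h.contDiff_smoothen n) i).continuous
      have hψi := hcψ i
      rw [← integral_const_mul, ← integral_const_mul, ← integral_add, ← integral_add]
      · refine setIntegral_mono (integrableOn_ball_of_continuous ?_ r)
          (integrableOn_ball_of_continuous ?_ r) fun x => ?_
        · exact (contDiff_pd ((hsm n).add (contDiff_const.mul hψ)) i).continuous.pow 2
        · fun_prop
        · have hpd : pd i (fun x => s n x + t * ψ x) x = pd i (s n) x + t * pd i ψ x := by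
            have d1 := ((hsm n).differentiable (by simp) x).hasFDerivAt
            have d2 := (hψ.differentiable (by simp) x).hasFDerivAt
            rw [pd, (d1.fun_add (d2.const_mul t)).fderiv]
            simp [pd]
          have hle : pd i (s n) x ^ 2 ≤ pd i (smoothen n p) x ^ 2 := sq_le_sq.2 (hpdle n i x)
          simp only [hpd]
          nlinarith
      all_goals exact integrableOn_ball_of_continuous (by fun_prop) r
    have h5 := h.energy_eq_zero hV
    have e1 : ∫ x in Metric.ball 0 r, (1 / 2 * V x - lam) * ((|p x| + t * ψ x) * (|p x| + t * ψ x))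
        = (∫ x in Metric.ball 0 r, (1 / 2 * V x - lam) * (p x * p x))
          + 2 * t * (∫ x in Metric.ball 0 r, (1 / 2 * V x - lam) * (|p x| * ψ x))
          + t ^ 2 * ∫ x in Metric.ball 0 r, (1 / 2 * V x - lam) * (ψ x * ψ x) := by
      have j1 := integrableOn_potential hV (h.cont.fun_mul h.cont) r lam
      have j2 := integrableOn_potential hV (h.cont.abs.fun_mul hψ.continuous) r lam
      have j3 := integrableOn_potential hV (hψ.continuous.fun_mul hψ.continuous) r lam
      rw [← integral_const_mul, ← integral_const_mul, ← integral_add j1 (j2.const_mul _),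
        ← integral_add (j1.fun_add (j2.const_mul _)) (j3.const_mul _)]
      refine integral_congr_ae (Eventually.of_forall fun x => ?_)
      have := abs_mul_abs_self (p x)
      simp only
      linear_combination (1 / 2 * V x - lam) * this
    rw [e1] at l4
    simp only [b]
    linarith
  have h6 := eq_zero_of_forall_quadratic hquad
  have e2 : ∫ x, (Metric.ball (0 : R3) r).indicator (fun x => (lam - 1 / 2 * V x) * |p x|) x * ψ x
      = -∫ x in Metric.ball 0 r, (1 / 2 * V x - lam) * (|p x| * ψ x) := by
    rw [← integral_neg, ← integral_indicator measurableSet_ball]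
    refine integral_congr_ae (Eventually.of_forall fun x => ?_)
    by_cases hx : x ∈ Metric.ball (0 : R3) r
    · simp only [indicator_of_mem hx]; ring
    · simp [hx]
  rw [e2]
  linarith

end IsProfile

end

section

theorem smoothen_nonneg {V : R3 → ℝ} (hV0 : ∀ x, 0 ≤ V x) (n : ℕ) (x : R3) :
    0 ≤ smoothen n V x := by
  rw [smoothen_apply]
  exact integral_nonneg fun y => mul_nonneg (moll_nonneg n _) (hV0 y)

theorem newton_nonneg {μ : R3 → ℝ} (h : ∀ x, 0 ≤ μ x) (x : R3) : 0 ≤ newton μ x :=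
  integral_nonneg fun y => mul_nonneg (by positivity) (h y)

theorem newton_eq (μ : R3 → ℝ) (x : R3) :
    newton μ x = (4 * Real.pi)⁻¹ * ∫ y, ‖x - y‖⁻¹ * μ y := by
  rw [newton, ← integral_const_mul]
  simp only [mul_inv, mul_assoc]

theorem abs_newton_le {μ : R3 → ℝ} (h1 : Integrable μ) (h2 : Integrable (fun x => μ x ^ 2))
    (x : R3) : |newton μ x| ≤ (∫ y, |μ y|) + (∫ y, μ y ^ 2) + 4 * Real.pi := by
  rw [newton_eq, abs_mul]
  have hπ := Real.pi_gt_three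
  have h3 : |∫ y, ‖x - y‖⁻¹ * μ y| ≤ (∫ y, |μ y|) + (∫ y, μ y ^ 2) + 4 * Real.pi := by
    refine (abs_integral_le_integral_abs).trans ?_
    simp only [abs_mul, abs_inv, abs_norm]
    exact integral_inv_norm_mul_le h1 h2 x
  have h4 : |(4 * Real.pi)⁻¹| ≤ 1 := by
    rw [abs_of_pos (by positivity)]
    exact inv_le_one_of_one_le₀ (by linarith)
  exact (mul_le_of_le_one_left (abs_nonneg _) h4).trans h3

theorem NegLap.sub {w w' μ μ' : R3 → ℝ} (hw : Continuous w) (hw' : Continuous w')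
    (hμ : LocallyIntegrable μ) (hμ' : LocallyIntegrable μ') (h : NegLap w μ) (h' : NegLap w' μ') :
    NegLap (fun x => w x - w' x) (fun x => μ x - μ' x) := by
  intro ψ hψ hc
  have hl := continuous_lap hψ
  have hlc := hasCompactSupport_lap hc
  have i1 : ∀ {m : R3 → ℝ}, LocallyIntegrable m → Integrable fun x => m x * ψ x := fun hm => by
    simpa only [smul_eq_mul, mul_comm] using
      hm.integrable_smul_left_of_hasCompactSupport hψ.continuous hc
  simp only [sub_mul]
  rw [integral_sub ((hw.fun_mul hl).integrable_of_hasCompactSupport hlc.mul_left)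
    ((hw'.fun_mul hl).integrable_of_hasCompactSupport hlc.mul_left), h ψ hψ hc, h' ψ hψ hc,
    integral_sub (i1 hμ) (i1 hμ')]
  ring

theorem pd_exp {φ : R3 → ℝ} (hφ : ContDiff ℝ ∞ φ) (i : Fin 3) :
    pd i (fun x => Real.exp (φ x)) = fun x => Real.exp (φ x) * pd i φ x := by
  ext x
  rw [pd, ((hφ.differentiable (by simp) x).hasFDerivAt.exp).fderiv]
  simp [pd]

theorem lap_exp {φ : R3 → ℝ} (hφ : ContDiff ℝ ∞ φ) (x : R3) :
    lap (fun x => Real.exp (φ x)) x = Real.exp (φ x) * (lap φ x + ∑ i, pd i φ x ^ 2) := by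
  simp only [lap]
  rw [mul_add, Finset.mul_sum, Finset.mul_sum, ← Finset.sum_add_distrib]
  refine Finset.sum_congr rfl fun i _ => ?_
  rw [pd_exp hφ, pd]
  have h1 := (hφ.differentiable (by simp) x).hasFDerivAt.exp
  have h2 := ((contDiff_pd hφ i).differentiable (by simp) x).hasFDerivAt
  rw [(h1.fun_mul h2).fderiv]
  simp [pd]
  ring

theorem lap_const_mul {φ : R3 → ℝ} (hφ : ContDiff ℝ ∞ φ) (a : ℝ) (x : R3) :
    lap (fun x => a * φ x) x = a * lap φ x := by
  have h1 : ∀ {φ : R3 → ℝ}, ContDiff ℝ ∞ φ → ∀ i, pd i (fun x => a * φ x) = fun x => a * pd i φ x :=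
    fun hφ i => by
      ext x
      rw [pd, ((hφ.differentiable (by simp) x).hasFDerivAt.const_mul a).fderiv]
      simp [pd]
  simp only [lap, h1 hφ, h1 (contDiff_pd hφ _), Finset.mul_sum]

theorem integrable_of_continuous_ball {h : R3 → ℝ} (hc : Continuous h) {r : ℝ}
    (h0 : ∀ x, r ≤ ‖x‖ → h x = 0) : Integrable h :=
  hc.integrable_of_hasCompactSupport (HasCompactSupport.intro (isCompact_closedBall (0 : R3) r)
    fun x hx => h0 x (by simpa using (not_le.1 (by simpa using hx)).le))

theorem memLp_of_continuous_ball {h : R3 → ℝ} (hc : Continuous h) {r : ℝ}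
    (h0 : ∀ x, r ≤ ‖x‖ → h x = 0) : MemLp h 2 volume :=
  hc.memLp_of_hasCompactSupport (HasCompactSupport.intro (isCompact_closedBall (0 : R3) r)
    fun x hx => h0 x (by simpa using (not_le.1 (by simpa using hx)).le))

/-- The standing assumptions on the interaction potential. Of its spherical symmetry only evenness is
kept. -/
structure IsPotential (V : R3 → ℝ) : Prop where
  memLp : MemLp V 3 volume
  nonneg : ∀ x, 0 ≤ V x
  compact : HasCompactSupport V
  even : ∀ x, V (-x) = V x

namespace IsPotential

variable {V : R3 → ℝ} (hV : IsPotential V)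
include hV

theorem memLp_of_le {q : ℝ≥0∞} (hq : q ≤ 3) : MemLp V q volume := by
  have hfin : IsFiniteMeasure (volume.restrict (tsupport V)) :=
    isFiniteMeasure_restrict.2 hV.compact.isCompact.measure_lt_top.ne
  have h1 : MemLp V q (volume.restrict (tsupport V)) := (hV.memLp.restrict _).mono_exponent hq
  have h2 := (memLp_indicator_iff_restrict (isClosed_tsupport V).measurableSet).2 h1
  rwa [indicator_eq_self.2 (subset_tsupport V)] at h2

theorem integrable : Integrable V :=
  memLp_one_iff_integrable.1 (hV.memLp_of_le (by norm_num))

theorem memLp_two : MemLp V 2 volume :=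
  hV.memLp_of_le (by norm_num)

theorem integrable_sq : Integrable fun x => V x ^ 2 :=
  hV.memLp_two.integrable_sq

theorem exists_radius : ∃ R : ℝ, 0 < R ∧ ∀ x, R < ‖x‖ → V x = 0 := by
  obtain ⟨R, hR⟩ := hV.compact.isCompact.isBounded.subset_closedBall (0 : R3)
  refine ⟨max R 1, by positivity, fun x hx => image_eq_zero_of_notMem_tsupport fun h => ?_⟩
  have := mem_closedBall_zero_iff.1 (hR h)
  exact absurd (this.trans (le_max_left R 1)) (not_le.2 hx)

/-- The Newton potentials of the mollifications of the potential are bounded uniformly. -/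
theorem exists_newton_smoothen_le : ∃ K : ℝ, ∀ n x, newton (smoothen n V) x ≤ K := by
  obtain ⟨R, hR0, hR⟩ := hV.exists_radius
  have hm := fun n => memLp_smoothen hV.memLp_two n
  have ht : Tendsto (fun n => ∫ x, smoothen n V x * smoothen n V x) atTop (𝓝 (∫ x, V x * V x)) :=
    tendsto_integral_mul_of_L2 hm hm hV.memLp_two hV.memLp_two
      (tendsto_eLpNorm_smoothen_sub hV.memLp_two) (tendsto_eLpNorm_smoothen_sub hV.memLp_two)
  obtain ⟨B, hB⟩ := ht.bddAbove_range
  have hB' : ∀ n, ∫ x, smoothen n V x ^ 2 ≤ B := fun n => by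
    simpa only [sq] using hB (mem_range_self n)
  set I := ∫ x : R3, (Metric.ball (0 : R3) (R + 2)).indicator (fun _ => (1 : ℝ)) x
  refine ⟨I + B + B + 4 * Real.pi, fun n x => ?_⟩
  have hc : HasCompactSupport (smoothen n V) := hasCompactSupport_smoothen n hV.compact
  have hs : Continuous (smoothen n V) :=
    (contDiff_smoothen n hV.integrable.locallyIntegrable).continuous
  have hi := hs.integrable_of_hasCompactSupport hc (μ := volume)
  have hi2 : Integrable fun x => smoothen n V x ^ 2 := (hm n).integrable_sq
  have hle : ∫ x, |smoothen n V x| ≤ I + B := by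
    have hind : Integrable fun x : R3 => (Metric.ball (0 : R3) (R + 2)).indicator
        (fun _ => (1 : ℝ)) x :=
      (integrable_indicator_iff measurableSet_ball).2
        (integrableOn_const measure_ball_lt_top.ne)
    refine (integral_mono hi.abs (hind.add hi2) fun x => ?_).trans ?_
    · simp only [Pi.add_apply]
      by_cases hx : x ∈ Metric.ball (0 : R3) (R + 2)
      · rw [indicator_of_mem hx]
        nlinarith [sq_abs (smoothen n V x), sq_nonneg (|smoothen n V x| - 1),
          abs_nonneg (smoothen n V x)]
      · rw [smoothen_eq_zero (r := R + 1 / 2) (fun y hy => hR y (by linarith)), indicator_of_notMem hx]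
        · simp
        · have h1 : 1 / ((n : ℝ) + 1) ≤ 1 := by
            rw [div_le_one (by positivity)]
            linarith [Nat.cast_nonneg (α := ℝ) n]
          have h2 : R + 2 ≤ ‖x‖ := by simpa using hx
          linarith
    · rw [integral_add' hind hi2]
      exact add_le_add_right (hB' n) _
  have := abs_newton_le hi hi2 x
  have := le_abs_self (newton (smoothen n V) x)
  have := hB' n
  linarith

/-- A non-negative solution that vanishes outside of the ball is zero.
For `lam > 0` the equation is tested with the strictly positive functions `exp (-Φ / 2)`, where `Φ` is
the Newton potential of a mollification of `V`; these are almost subsolutions of `-Δ + V/2`. -/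
theorem eq_zero_of_negLap {h : R3 → ℝ} {r lam : ℝ} (hh : Continuous h) (h0 : ∀ x, 0 ≤ h x)
    (hr : ∀ x, r ≤ ‖x‖ → h x = 0) (hlam : 0 ≤ lam)
    (heq : NegLap h ((Metric.ball 0 r).indicator fun x => (lam - 1 / 2 * V x) * h x)) (x : R3) :
    h x = 0 := by
  obtain ⟨M, hM⟩ : ∃ M, ∀ x, h x ≤ M := by
    obtain ⟨M, hM⟩ := (HasCompactSupport.intro (isCompact_closedBall (0 : R3) r)
      fun x hx => hr x (by simpa using (not_le.1 (by simpa using hx)).le)).exists_bound_of_continuous hh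
    exact ⟨M, fun x => (le_abs_self _).trans (hM x)⟩
  have hhi := integrable_of_continuous_ball hh hr
  have hVi := hV.integrable
  have hVh : Integrable fun x => V x * h x := by
    refine (hVi.mul_const M).mono (hVi.1.mul hh.aestronglyMeasurable)
      (Eventually.of_forall fun x => ?_)
    rw [norm_mul, norm_mul, Real.norm_of_nonneg (h0 x),
      Real.norm_of_nonneg ((h0 x).trans (hM x))]
    exact mul_le_mul_of_nonneg_left (hM x) (norm_nonneg _)
  have hind : ((Metric.ball 0 r).indicator fun x => (lam - 1 / 2 * V x) * h x)
      = fun x => lam * h x - 1 / 2 * (V x * h x) := by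
    ext x
    by_cases hx : x ∈ Metric.ball (0 : R3) r
    · rw [indicator_of_mem hx]; ring
    · rw [indicator_of_notMem hx, hr x (by simpa using hx)]; simp
  rw [hind] at heq
  -- For `lam = 0` the function `h` is the Newtonian potential of `-V h / 2 ≤ 0`.
  rcases hlam.eq_or_lt with rfl | hlam
  · have hμ1 : Integrable fun x => 0 * h x - 1 / 2 * (V x * h x) :=
      (hhi.const_mul 0).sub (hVh.const_mul (1 / 2))
    have hμ2 : Integrable fun x => (0 * h x - 1 / 2 * (V x * h x)) ^ 2 := by
      refine (hV.integrable_sq.mul_const (M ^ 2)).mono (hμ1.1.pow 2)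
        (Eventually.of_forall fun x => ?_)
      rw [Real.norm_of_nonneg (sq_nonneg _), Real.norm_of_nonneg (by positivity)]
      have : h x ^ 2 ≤ M ^ 2 := pow_le_pow_left₀ (h0 x) (hM x) 2
      nlinarith [mul_le_mul_of_nonneg_left this (sq_nonneg (V x)),
        mul_nonneg (sq_nonneg (V x)) (sq_nonneg (h x))]
    have h1 := eq_newton_of_negLap hh hr (fun x hx => by rw [hr x hx]; simp) hμ1.1 heq x
      (integrable_inv_norm_mul hμ1 hμ2 x)
    refine le_antisymm ?_ (h0 x)
    rw [h1]
    refine integral_nonpos fun y => mul_nonpos_of_nonneg_of_nonpos (by positivity) ?_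
    have := mul_nonneg (hV.nonneg y) (h0 y)
    simp only
    linarith
  · obtain ⟨K, hK⟩ := hV.exists_newton_smoothen_le
    obtain ⟨χ, hχ, hχc, hχ1, -⟩ := exists_cutoff (r + 1)
    set Φ : ℕ → R3 → ℝ := fun n => newton (smoothen n V)
    have hΦ0 : ∀ n x, 0 ≤ Φ n x := fun n => newton_nonneg (smoothen_nonneg hV.nonneg n)
    have hsm : ∀ n, ContDiff ℝ ∞ (smoothen n V) := fun n =>
      contDiff_smoothen n hVi.locallyIntegrable
    have hΦs : ∀ n, ContDiff ℝ ∞ (Φ n) := fun n =>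
      contDiff_newton (hsm n) (hasCompactSupport_smoothen n hV.compact)
    set F : ℕ → R3 → ℝ := fun n x => Real.exp (-(1 / 2) * Φ n x)
    have hFs : ∀ n, ContDiff ℝ ∞ (F n) := fun n => (contDiff_const.mul (hΦs n)).exp
    have hF1 : ∀ n x, F n x ≤ 1 := fun n x => Real.exp_le_one_iff.2 (by linarith [hΦ0 n x])
    have hF0 : ∀ n x, 0 < F n x := fun n x => Real.exp_pos _
    have hFK : ∀ n x, Real.exp (-(1 / 2) * K) ≤ F n x := fun n x =>
      Real.exp_le_exp.2 (by linarith [hK n x])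
    -- `Δ exp φ = exp φ (Δφ + |∇φ|²)`, where `φ = -Φ / 2` has `Δφ = V_n / 2`.
    have hlapF : ∀ n x, F n x * (1 / 2 * smoothen n V x) ≤ lap (F n) x := fun n x => by
      simp only [F]
      rw [lap_exp (contDiff_const.mul (hΦs n)), lap_const_mul (hΦs n),
        lap_newton (hsm n) (hasCompactSupport_smoothen n hV.compact)]
      refine mul_le_mul_of_nonneg_left ?_ (Real.exp_pos _).le
      have : 0 ≤ ∑ i, pd i (fun x => -(1 / 2) * Φ n x) x ^ 2 :=
        Finset.sum_nonneg fun i _ => sq_nonneg _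
      linarith
    -- `lam ∫ h F = ∫ h (-Δ + V/2) F ≤ ½ ∫ h (V - V_n) F`, and `F` is bounded from below.
    have key : ∀ n, Real.exp (-(1 / 2) * K) * lam * ∫ x, h x
        ≤ 1 / 2 * ∫ x, |smoothen n V x - V x| * h x := fun n => by
      have h1 := heq (fun x => χ x * F n x) (hχ.mul (hFs n)) hχc.mul_right
      have e1 : ∀ x, h x * lap (fun x => χ x * F n x) x = h x * lap (F n) x := fun x => by
        by_cases hx : ‖x‖ < r
        · rw [lap_congr (v := F n)]
          filter_upwards [(isOpen_lt continuous_norm continuous_const).mem_nhds hx] with y hy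
          rw [hχ1 y (by linarith [show ‖y‖ < r from hy]), one_mul]
        · rw [hr x (not_lt.1 hx), zero_mul, zero_mul]
      have e2 : ∀ x, (lam * h x - 1 / 2 * (V x * h x)) * (χ x * F n x)
          = lam * (h x * F n x) - 1 / 2 * (V x * h x * F n x) := fun x => by
        by_cases hx : ‖x‖ < r
        · rw [hχ1 x (by linarith)]; ring
        · rw [hr x (not_lt.1 hx)]; ring
      simp only [e1, e2] at h1
      have hFc := (hFs n).continuous
      have hsc := (hsm n).continuous
      have hz : ∀ {q : R3 → ℝ}, Continuous q → Integrable fun x => h x * q x := fun hq =>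
        integrable_of_continuous_ball (hh.fun_mul hq) fun x hx => by rw [hr x hx, zero_mul]
      have i1 : Integrable fun x => h x * F n x := hz hFc
      have i2 : Integrable fun x => V x * h x * F n x := by
        refine hVh.mono (hVh.1.mul hFc.aestronglyMeasurable) (Eventually.of_forall fun x => ?_)
        rw [norm_mul, Real.norm_of_nonneg (hF0 n x).le]
        exact mul_le_of_le_one_right (norm_nonneg _) (hF1 n x)
      rw [integral_sub (i1.const_mul _) (i2.const_mul _), integral_const_mul,
        integral_const_mul] at h1
      have i3 : Integrable fun x => h x * (F n x * (1 / 2 * smoothen n V x)) := hz (by fun_prop)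
      have h2 : ∫ x, h x * (F n x * (1 / 2 * smoothen n V x)) ≤ ∫ x, h x * lap (F n) x :=
        integral_mono i3 (hz (continuous_lap (hFs n))) fun x =>
          mul_le_mul_of_nonneg_left (hlapF n x) (h0 x)
      have i4 : Integrable fun x => |smoothen n V x - V x| * h x := by
        have : Integrable fun x => smoothen n V x * h x - V x * h x :=
          Integrable.sub (by simpa only [mul_comm] using hz hsc) hVh
        refine this.abs.congr (Eventually.of_forall fun x => ?_)
        simp only
        rw [← sub_mul, abs_mul, abs_of_nonneg (h0 x)]
      have h3 : (∫ x, 1 / 2 * (V x * h x * F n x) - h x * (F n x * (1 / 2 * smoothen n V x)))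
          ≤ ∫ x, 1 / 2 * (|smoothen n V x - V x| * h x) := by
        refine integral_mono ((i2.const_mul _).sub i3) (i4.const_mul _) fun x => ?_
        have hx1 := neg_abs_le (smoothen n V x - V x)
        have hx2 : 0 ≤ h x * F n x := mul_nonneg (h0 x) (hF0 n x).le
        have hx3 := mul_le_mul_of_nonneg_left hx1 hx2
        have hx4 := mul_le_of_le_one_right (mul_nonneg (abs_nonneg (smoothen n V x - V x)) (h0 x))
          (hF1 n x)
        simp only
        linarith
      rw [integral_sub (i2.const_mul _) i3, integral_const_mul, integral_const_mul] at h3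
      have h4 : Real.exp (-(1 / 2) * K) * ∫ x, h x ≤ ∫ x, h x * F n x := by
        rw [← integral_const_mul]
        refine integral_mono (hhi.const_mul _) i1 fun x => ?_
        simp only
        rw [mul_comm]
        exact mul_le_mul_of_nonneg_left (hFK n x) (h0 x)
      have h5 := mul_le_mul_of_nonneg_left h4 hlam.le
      linarith
    have hlim : Tendsto (fun n => 1 / 2 * ∫ x, |smoothen n V x - V x| * h x) atTop (𝓝 0) := by
      have hm := memLp_of_continuous_ball hh hr
      have := (tendsto_integral_mul_of_L2 (a := fun n x => |smoothen n V x - V x|)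
        (b := fun _ => h) (a' := fun _ => 0)
        (fun n => ((memLp_smoothen hV.memLp_two n).sub hV.memLp_two).abs) (fun _ => hm)
        (MemLp.zero (ε := ℝ)) hm (by
          refine (tendsto_eLpNorm_smoothen_sub hV.memLp_two).congr fun n => ?_
          refine eLpNorm_congr_norm_ae (Eventually.of_forall fun x => ?_)
          simp) (by simp)).const_mul (1 / 2)
      simpa using this
    have h6 := ge_of_tendsto' hlim key
    have h7 : ∫ x, h x = 0 := by
      refine le_antisymm ?_ (integral_nonneg h0)
      by_contra hcon
      have : 0 < Real.exp (-(1 / 2) * K) * lam * ∫ x, h x :=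
        mul_pos (mul_pos (Real.exp_pos _) hlam) (not_le.1 hcon)
      linarith
    by_contra hx
    exact (hh.integral_pos_of_hasCompactSupport_nonneg_nonzero
      (HasCompactSupport.intro (isCompact_closedBall (0 : R3) r)
        fun x hx => hr x (by simpa using (not_le.1 (by simpa using hx)).le)) h0 hx).ne' h7

end IsPotential

end

section

theorem locallyIntegrable_potential {V q : R3 → ℝ} (hV : Integrable V) (hq : Continuous q)
    (r lam : ℝ) :
    LocallyIntegrable ((Metric.ball 0 r).indicator fun x => (lam - 1 / 2 * V x) * q x) := by
  refine ((integrable_indicator_iff measurableSet_ball).2 ?_).locallyIntegrable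
  refine (integrableOn_potential hV hq r lam).neg.congr_fun (fun x _ => ?_) measurableSet_ball
  simp only [Pi.neg_apply]
  ring

namespace IsProfile

variable {V : R3 → ℝ} {r lam c : ℝ} {p : R3 → ℝ} {g : Fin 3 → R3 → ℝ}

/-- The ground state is non-negative: apply `IsPotential.eq_zero_of_negLap` to `|p| - p`. -/
theorem nonneg (h : IsProfile V r lam c p g) (hV : IsPotential V) (hlow : IsLowerBound V r lam)
    (hr : 0 < r) (hc : 0 < c) (x : R3) : 0 ≤ p x := by
  have h1 := (h.abs_negLap hV.integrable hlow).sub h.cont.abs h.cont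
    (locallyIntegrable_potential hV.integrable h.cont.abs r lam)
    (locallyIntegrable_potential hV.integrable h.cont r lam) h.negLap
  have h2 := hV.eq_zero_of_negLap (h := fun x => |p x| - p x) (r := r) (lam := lam)
    (h.cont.abs.sub h.cont) (fun x => sub_nonneg.2 (le_abs_self _))
    (fun x hx => by rw [h.eq_c x hx, abs_of_pos hc, sub_self])
    (h.lam_nonneg hV.integrable hV.nonneg hr hc.ne') (by
      convert h1 using 1
      ext x
      by_cases hx : x ∈ Metric.ball (0 : R3) r
      · simp only [indicator_of_mem hx]; ring
      · simp only [indicator_of_notMem hx, sub_zero]) x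
  rw [← sub_eq_zero.1 h2]
  exact abs_nonneg _

/-- The lowest eigenvalue and the ground state with given boundary value are unique: the difference
of two ground states has boundary value zero, and its absolute value is again a solution. -/
theorem unique (h : IsProfile V r lam c p g) (hV : IsPotential V) (hlow : IsLowerBound V r lam)
    (hr : 0 < r) (hc : c ≠ 0) {lam' : ℝ} {p' : R3 → ℝ} {g' : Fin 3 → R3 → ℝ}
    (h' : IsProfile V r lam' c p' g') (hlow' : IsLowerBound V r lam') :
    lam = lam' ∧ p = p' := by
  obtain rfl : lam = lam' := le_antisymm (h'.lam_le hV.integrable hr hc hlow)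
    (h.lam_le hV.integrable hr hc hlow')
  refine ⟨rfl, funext fun x => ?_⟩
  have h1 := h.sub hV.integrable h'
  have h2 := hV.eq_zero_of_negLap h1.cont.abs (fun x => abs_nonneg _)
    (fun x hx => by rw [h1.eq_c x hx, sub_self, abs_zero])
    (h.lam_nonneg hV.integrable hV.nonneg hr hc) (h1.abs_negLap hV.integrable hlow) x
  exact sub_eq_zero.1 (abs_eq_zero.1 h2)

theorem pd_comp_neg {ψ : R3 → ℝ} (i : Fin 3) (x : R3) :
    pd i (fun y => ψ (-y)) x = -pd i ψ (-x) := by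
  have := (ContinuousLinearEquiv.neg ℝ (M := R3)).comp_right_fderiv (f := ψ) (x := x)
  rw [pd, show (fun y => ψ (-y)) = ψ ∘ ContinuousLinearEquiv.neg ℝ (M := R3) from rfl, this]
  simp [pd]

theorem comp_neg (h : IsProfile V r lam c p g) (hV : ∀ x, V (-x) = V x) :
    IsProfile V r lam c (fun x => p (-x)) (fun i x => -g i (-x)) where
  cont := h.cont.comp continuous_neg
  eq_c x hx := h.eq_c _ (by rwa [norm_neg])
  memLp i := ((h.memLp i).comp_measurePreserving (Measure.measurePreserving_neg volume)).neg
  g_zero i x hx := by rw [h.g_zero i _ (by rwa [norm_neg]), neg_zero]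
  weak i := by
    intro ψ hψ hc _
    have h1 := h.weak i (fun y => ψ (-y)) (hψ.comp contDiff_neg)
      (hc.comp_homeomorph (Homeomorph.neg R3)) (subset_univ _)
    have hp : ∀ x, fderiv ℝ (fun y => ψ (-y)) x (e i) = -fderiv ℝ ψ (-x) (e i) := pd_comp_neg i
    simp only [Measure.restrict_univ, smul_eq_mul, hp] at h1 ⊢
    rw [← integral_neg_eq_self, ← integral_neg_eq_self (fun x => ψ x * _)]
    simp only [neg_neg, neg_mul, mul_neg, integral_neg] at h1 ⊢
    linarith
  eqn ψ hψ := by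
    have h1 := h.eqn (fun y => ψ (-y)) (hψ.comp contDiff_neg)
    have e1 : ∀ i, ∫ x, -g i (-x) * pd i ψ x = ∫ x, g i x * pd i (fun y => ψ (-y)) x := fun i => by
      rw [← integral_neg_eq_self]
      simp only [neg_neg, pd_comp_neg, neg_mul, mul_neg]
    have e2 : ∫ x in Metric.ball 0 r, (1 / 2 * V x - lam) * (p (-x) * ψ x)
        = ∫ x in Metric.ball 0 r, (1 / 2 * V x - lam) * (p x * ψ (-x)) := by
      rw [← integral_indicator measurableSet_ball, ← integral_indicator measurableSet_ball,
        ← integral_neg_eq_self]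
      refine integral_congr_ae (Eventually.of_forall fun x => ?_)
      have hn : -x ∈ Metric.ball (0 : R3) r ↔ x ∈ Metric.ball (0 : R3) r := by simp
      by_cases hx : x ∈ Metric.ball (0 : R3) r
      · simp only [indicator_of_mem hx, indicator_of_mem (hn.2 hx), neg_neg, hV]
      · simp only [indicator_of_notMem hx, indicator_of_notMem (mt hn.1 hx)]
    simp only [e1, e2]
    exact h1

/-- The ground state is even, by uniqueness. -/
theorem even (h : IsProfile V r lam c p g) (hV : IsPotential V) (hlow : IsLowerBound V r lam)
    (hr : 0 < r) (hc : c ≠ 0) (x : R3) : p (-x) = p x :=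
  (congrFun (h.unique hV hlow hr hc (h.comp_neg hV.even) hlow).2 x).symm

end IsProfile

/-! ### Quantitative bounds on the Neumann ground state -/

/-- The constant function in the variational principle gives `lam = O(r⁻³)`. -/
theorem IsLowerBound.mul_volume_le {V : R3 → ℝ} {r lam : ℝ} (hlow : IsLowerBound V r lam)
    (hV : IsPotential V) (hr : 0 < r) : lam * (4 / 3 * Real.pi * r ^ 3) ≤ 1 / 2 * ∫ x, V x := by
  have h1 := hlow (fun _ => 1) contDiff_const
  have h2 : ∀ i, ∫ x in Metric.ball (0 : R3) r, pd i (fun _ => (1 : ℝ)) x ^ 2 = 0 := fun i => by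
    simp [pd]
  simp only [h2, Finset.sum_const_zero, zero_add, mul_one] at h1
  rw [integral_sub (hV.integrable.const_mul _).integrableOn
    (integrableOn_const measure_ball_lt_top.ne), setIntegral_const, volume_real_ball r hr.le,
    integral_const_mul, smul_eq_mul] at h1
  have h3 : ∫ x in Metric.ball 0 r, V x ≤ ∫ x, V x :=
    setIntegral_le_integral hV.integrable (Eventually.of_forall hV.nonneg)
  linarith

namespace IsProfile

variable {V : R3 → ℝ} {r lam : ℝ} {p : R3 → ℝ} {g : Fin 3 → R3 → ℝ}

/-- The charge density of `1 - p`. -/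
def charge (V : R3 → ℝ) (r lam : ℝ) (p : R3 → ℝ) : R3 → ℝ :=
  (Metric.ball 0 r).indicator fun x => (1 / 2 * V x - lam) * p x

theorem integrable_charge (h : IsProfile V r lam 1 p g) (hV : IsPotential V) :
    Integrable (charge V r lam p) :=
  (integrable_indicator_iff measurableSet_ball).2
    (integrableOn_potential hV.integrable h.cont r lam)

theorem memLp_charge (h : IsProfile V r lam 1 p g) (hV : IsPotential V) :
    MemLp (charge V r lam p) 2 volume := by
  refine (memLp_indicator_iff_restrict measurableSet_ball).2 ?_
  obtain ⟨M, hM⟩ := h.exists_bound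
  have h1 : MemLp (fun x => 1 / 2 * V x - lam) 2 (volume.restrict (Metric.ball 0 r)) :=
    ((hV.memLp_two.const_mul (1 / 2)).restrict _).sub (memLp_ball_of_continuous continuous_const r)
  refine (h1.const_mul M).mono (h1.1.mul h.cont.aestronglyMeasurable)
    (Eventually.of_forall fun x => ?_)
  rw [norm_mul, norm_mul, mul_comm]
  exact mul_le_mul_of_nonneg_right ((hM x).trans (le_abs_self M)) (norm_nonneg _)

theorem charge_eq_zero {x : R3} (hx : r ≤ ‖x‖) : charge V r lam p x = 0 :=
  indicator_of_notMem (by simpa using hx) _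

theorem negLap_one_sub (h : IsProfile V r lam 1 p g) (hV : IsPotential V) :
    NegLap (fun x => 1 - p x) (charge V r lam p) := by
  have h1 : NegLap (fun _ : R3 => (1 : ℝ)) (fun _ => 0) := by
    have := negLap_of_contDiff (w := fun _ : R3 => (1 : ℝ)) contDiff_const
    have h0 : ∀ i, pd i (fun _ : R3 => (1 : ℝ)) = fun _ => 0 := fun i => by ext x; simp [pd]
    have h0' : ∀ i, pd i (fun _ : R3 => (0 : ℝ)) = fun _ => 0 := fun i => by ext x; simp [pd]
    simpa [lap, h0, h0'] using this
  have h2 := h1.sub continuous_const h.cont (locallyIntegrable_const 0)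
    (locallyIntegrable_potential hV.integrable h.cont r lam) h.negLap
  convert h2 using 1
  ext x
  by_cases hx : x ∈ Metric.ball (0 : R3) r
  · simp only [charge, indicator_of_mem hx]; ring
  · simp only [charge, indicator_of_notMem hx, sub_zero]

/-- Because of the Neumann condition `1 - p` has no surface charge on the sphere, so it is the
Newtonian potential of its charge density in the ball. -/
theorem one_sub_eq_newton (h : IsProfile V r lam 1 p g) (hV : IsPotential V) (x : R3) :
    1 - p x = newton (charge V r lam p) x :=
  eq_newton_of_negLap (w := fun x => 1 - p x)
    (continuous_const.sub h.cont) (R := r) (fun x hx => by rw [h.eq_c x hx, sub_self]) (fun _ => charge_eq_zero)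
    (h.integrable_charge hV).1 (h.negLap_one_sub hV) x
    (integrable_inv_norm_mul (h.integrable_charge hV) (h.memLp_charge hV).integrable_sq x)

/-- For large radius the ground state is at most `2`: by the Newton potential representation,
`p ≤ 1 + 2 lam r² sup p`, and `lam = O(r⁻³)`. -/
theorem le_two (h : IsProfile V r lam 1 p g) (hV : IsPotential V) (hlow : IsLowerBound V r lam)
    (hr : 0 < r) (hlarge : ∫ x, V x ≤ r) (x : R3) : p x ≤ 2 := by
  have hp0 := h.nonneg hV hlow hr one_pos
  have hlam := h.lam_nonneg hV.integrable hV.nonneg hr one_ne_zero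
  have hvol := hlow.mul_volume_le hV hr
  have hπ := Real.pi_gt_three
  have hlr : 2 * lam * r ^ 2 ≤ 1 / 2 := by
    have h1 : lam * (4 / 3 * Real.pi * r ^ 3) ≤ 1 / 2 * r := by linarith
    have h2 : lam * (4 / 3 * Real.pi * r ^ 2) ≤ 1 / 2 := by
      by_contra hcon
      have := mul_lt_mul_of_pos_right (not_le.1 hcon) hr
      nlinarith
    have h3 : 0 ≤ lam * r ^ 2 := by positivity
    nlinarith
  have hM : ∀ M : ℝ, (∀ x, p x ≤ M) → ∀ x, p x ≤ 1 + 1 / 2 * M := by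
    intro M hM x
    have hM0 : 0 ≤ M := (hp0 x).trans (hM x)
    rcases le_total r ‖x‖ with hx | hx
    · rw [h.eq_c x hx]; linarith
    · have h1 := h.one_sub_eq_newton hV x
      obtain ⟨hi, hb⟩ := setIntegral_ball_inv_norm_le hr.le hx
      have h2 : -(lam * M * (8 * Real.pi * r ^ 2)) ≤ ∫ y, ‖x - y‖⁻¹ * charge V r lam p y := by
        have hi' : Integrable ((Metric.ball (0 : R3) r).indicator fun y => ‖x - y‖⁻¹) :=
          (integrable_indicator_iff measurableSet_ball).2 hi
        calc -(lam * M * (8 * Real.pi * r ^ 2))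
            ≤ -(lam * M) * ∫ y in Metric.ball (0 : R3) r, ‖x - y‖⁻¹ := by
              have := mul_le_mul_of_nonneg_left hb (mul_nonneg hlam hM0)
              linarith
          _ = ∫ y, -(lam * M) * (Metric.ball (0 : R3) r).indicator (fun y => ‖x - y‖⁻¹) y := by
              rw [integral_const_mul, integral_indicator measurableSet_ball]
          _ ≤ _ := by
              refine integral_mono (hi'.const_mul _)
                (integrable_inv_norm_mul (h.integrable_charge hV)
                  (h.memLp_charge hV).integrable_sq x) fun y => ?_
              by_cases hy : y ∈ Metric.ball (0 : R3) r
              · simp only [charge, indicator_of_mem hy]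
                have h3 : 0 ≤ V y * p y := mul_nonneg (hV.nonneg y) (hp0 y)
                have h4 : lam * p y ≤ lam * M := mul_le_mul_of_nonneg_left (hM y) hlam
                have h5 : -(lam * M) ≤ (1 / 2 * V y - lam) * p y := by linarith
                have := mul_le_mul_of_nonneg_left h5 (inv_nonneg.2 (norm_nonneg (x - y)))
                linarith
              · simp [charge, indicator_of_notMem hy]
      rw [newton_eq] at h1
      have h6 := mul_le_mul_of_nonneg_left h2 (show 0 ≤ (4 * Real.pi)⁻¹ by positivity)
      have h7 : (4 * Real.pi)⁻¹ * -(lam * M * (8 * Real.pi * r ^ 2)) = -(2 * lam * r ^ 2 * M) := by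
        field_simp
        ring
      rw [h7] at h6
      have := mul_le_mul_of_nonneg_right hlr hM0
      linarith
  have hbdd : BddAbove (range p) := by
    obtain ⟨M, hM⟩ := h.exists_bound
    exact ⟨M, by rintro _ ⟨x, rfl⟩; exact (le_abs_self _).trans (hM x)⟩
  -- `hM` for `M = sup p`
  have h1 : sSup (range p) ≤ 1 + 1 / 2 * sSup (range p) :=
    csSup_le (range_nonempty p) (by
      rintro _ ⟨x, rfl⟩
      exact hM _ (fun x => le_csSup hbdd (mem_range_self x)) x)
  exact (le_csSup hbdd (mem_range_self x)).trans (by linarith)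

end IsProfile

/-- The Newtonian potential of a compactly supported potential decays like `1 / |x|`. -/
theorem IsPotential.exists_norm_mul_integral_le {V : R3 → ℝ} (hV : IsPotential V) :
    ∃ K : ℝ, 0 ≤ K ∧ ∀ x, ‖x‖ * ∫ y, ‖x - y‖⁻¹ * V y ≤ K := by
  obtain ⟨R, hR0, hR⟩ := hV.exists_radius
  set K₀ := (∫ y, |V y|) + (∫ y, V y ^ 2) + 4 * Real.pi
  have hK₀ : ∀ x, ∫ y, ‖x - y‖⁻¹ * V y ≤ K₀ := fun x => by
    have := integral_inv_norm_mul_le hV.integrable hV.integrable_sq x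
    rwa [integral_congr_ae (Eventually.of_forall fun y =>
      show ‖x - y‖⁻¹ * |V y| = ‖x - y‖⁻¹ * V y by rw [abs_of_nonneg (hV.nonneg y)])] at this
  have h0 : ∀ x, 0 ≤ ∫ y, ‖x - y‖⁻¹ * V y := fun x =>
    integral_nonneg fun y => mul_nonneg (by positivity) (hV.nonneg y)
  have hI : 0 ≤ ∫ y, V y := integral_nonneg hV.nonneg
  have hK0 : 0 ≤ K₀ := (h0 0).trans (hK₀ 0)
  refine ⟨2 * R * K₀ + 2 * ∫ y, V y, by positivity, fun x => ?_⟩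
  rcases le_total ‖x‖ (2 * R) with hx | hx
  · have := mul_le_mul hx (hK₀ x) (h0 x) (by positivity)
    linarith
  · have h1 : ‖x‖ * ∫ y, ‖x - y‖⁻¹ * V y ≤ 2 * ∫ y, V y := by
      rw [← integral_const_mul, ← integral_const_mul]
      refine integral_mono ((integrable_inv_norm_mul hV.integrable hV.integrable_sq x).const_mul _)
        (hV.integrable.const_mul _) fun y => ?_
      rcases le_or_gt ‖y‖ R with hy | hy
      · have h2 : ‖x‖ ≤ 2 * ‖x - y‖ := by
          have := norm_sub_norm_le x y
          linarith
        have hxp : 0 < ‖x - y‖ := by linarith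
        simp only
        rw [← mul_assoc, ← div_eq_mul_inv]
        refine mul_le_mul_of_nonneg_right ?_ (hV.nonneg y)
        rw [div_le_iff₀ hxp]
        exact h2
      · simp [hR y hy]
    have : 0 ≤ 2 * R * K₀ := by positivity
    linarith

/-- `|1 - p(x)| ≤ K / |x|` with `K` independent of the radius: the charge density of `1 - p` is at most
`V + 2 lam` in the ball, and `lam r³` is bounded. -/
theorem IsProfile.norm_mul_one_sub_le {V : R3 → ℝ} (hV : IsPotential V) : ∃ K : ℝ, 0 ≤ K ∧
    ∀ {r lam : ℝ} {p : R3 → ℝ} {g : Fin 3 → R3 → ℝ}, 0 < r → IsProfile V r lam 1 p g →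
      IsLowerBound V r lam → (∀ x, p x ≤ 2) → ∀ x, ‖x‖ * |1 - p x| ≤ K := by
  obtain ⟨K, hK0, hK⟩ := hV.exists_norm_mul_integral_le
  have hI : 0 ≤ ∫ y, V y := integral_nonneg hV.nonneg
  refine ⟨K + 2 * ∫ y, V y, by positivity, fun {r lam p g} hr h hlow h2 x => ?_⟩
  rcases le_total r ‖x‖ with hx | hx
  · rw [h.eq_c x hx]; simp; positivity
  have hp0 := h.nonneg hV hlow hr one_pos
  have hlam := h.lam_nonneg hV.integrable hV.nonneg hr one_ne_zero
  have hvol := hlow.mul_volume_le hV hr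
  have hπ := Real.pi_gt_three
  obtain ⟨hi, hb⟩ := setIntegral_ball_inv_norm_le hr.le hx
  have hi' : Integrable ((Metric.ball (0 : R3) r).indicator fun y => ‖x - y‖⁻¹) :=
    (integrable_indicator_iff measurableSet_ball).2 hi
  have hiV := integrable_inv_norm_mul hV.integrable hV.integrable_sq x
  have h3 : |∫ y, ‖x - y‖⁻¹ * charge V r lam p y|
      ≤ (∫ y, ‖x - y‖⁻¹ * V y) + 2 * lam * (8 * Real.pi * r ^ 2) := by
    calc |∫ y, ‖x - y‖⁻¹ * charge V r lam p y|
        ≤ ∫ y, (‖x - y‖⁻¹ * V y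
            + 2 * lam * (Metric.ball (0 : R3) r).indicator (fun y => ‖x - y‖⁻¹) y) := by
          rw [← Real.norm_eq_abs]
          refine norm_integral_le_of_norm_le (hiV.add (hi'.const_mul (2 * lam)))
            (Eventually.of_forall fun y => ?_)
          rw [norm_mul, Real.norm_of_nonneg (inv_nonneg.2 (norm_nonneg _))]
          have hi0 := inv_nonneg.2 (norm_nonneg (x - y))
          by_cases hy : y ∈ Metric.ball (0 : R3) r
          · simp only [charge, indicator_of_mem hy]
            have h4 : ‖(1 / 2 * V y - lam) * p y‖ ≤ V y + 2 * lam := by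
              rw [Real.norm_eq_abs, abs_le]
              have h5 := mul_le_mul_of_nonneg_left (h2 y) (hV.nonneg y)
              have h6 := mul_le_mul_of_nonneg_left (h2 y) hlam
              have h7 := mul_nonneg (hV.nonneg y) (hp0 y)
              have h8 := mul_nonneg hlam (hp0 y)
              have h9 := hV.nonneg y
              constructor <;> linarith
            have := mul_le_mul_of_nonneg_left h4 hi0
            linarith
          · simp only [charge, indicator_of_notMem hy, norm_zero, mul_zero, add_zero]
            exact mul_nonneg hi0 (hV.nonneg y)
      _ = (∫ y, ‖x - y‖⁻¹ * V y) + 2 * lam * ∫ y in Metric.ball (0 : R3) r, ‖x - y‖⁻¹ := by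
          rw [integral_add hiV (hi'.const_mul _), integral_const_mul,
            integral_indicator measurableSet_ball]
      _ ≤ _ := by gcongr
  rw [h.one_sub_eq_newton hV, newton_eq, abs_mul, abs_of_pos (by positivity)]
  have h4 : ‖x‖ * ((∫ y, ‖x - y‖⁻¹ * V y) + 2 * lam * (8 * Real.pi * r ^ 2))
      ≤ K + 16 * Real.pi * lam * r ^ 3 := by
    have h5 : ‖x‖ * (16 * Real.pi * lam * r ^ 2) ≤ r * (16 * Real.pi * lam * r ^ 2) :=
      mul_le_mul_of_nonneg_right hx (by positivity)
    have := hK x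
    linarith
  calc ‖x‖ * ((4 * Real.pi)⁻¹ * |∫ y, ‖x - y‖⁻¹ * charge V r lam p y|)
      = (4 * Real.pi)⁻¹ * (‖x‖ * |∫ y, ‖x - y‖⁻¹ * charge V r lam p y|) := by ring
    _ ≤ (4 * Real.pi)⁻¹ * (K + 16 * Real.pi * lam * r ^ 3) := by
        refine mul_le_mul_of_nonneg_left ?_ (by positivity)
        exact (mul_le_mul_of_nonneg_left h3 (norm_nonneg x)).trans h4
    _ = (4 * Real.pi)⁻¹ * K + 4 * (lam * r ^ 3) := by field_simp; ring
    _ ≤ K + 2 * ∫ y, V y := by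
        have h5 : (4 * Real.pi)⁻¹ * K ≤ K :=
          mul_le_of_le_one_left hK0 (inv_le_one_of_one_le₀ (by linarith))
        have h6 : 0 ≤ lam * r ^ 3 := by positivity
        nlinarith

end

section

/-! ### Comparison with the scattering length -/

theorem pd_convolution {k u : R3 → ℝ} (hk : ContDiff ℝ ∞ k) (hc : HasCompactSupport k)
    (hu : LocallyIntegrable u) (i : Fin 3) :
    pd i (convolution k u (ContinuousLinearMap.mul ℝ ℝ) volume)
      = convolution (pd i k) u (ContinuousLinearMap.mul ℝ ℝ) volume := by
  ext x
  have h1 := (hc.hasFDerivAt_convolution_left (ContinuousLinearMap.mul ℝ ℝ)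
    (hk.of_le (by simp)) hu x).fderiv
  have hint := (hc.fderiv ℝ).convolutionExists_left ((ContinuousLinearMap.mul ℝ ℝ).precompL R3)
    (hk.continuous_fderiv (by simp)) hu x
  rw [pd, h1, convolution_def, ContinuousLinearMap.integral_apply hint, convolution_def]
  rfl

theorem pd_comp_const_sub (ψ : R3 → ℝ) (i : Fin 3) (x : R3) :
    pd i (fun y => ψ (x - y)) = fun y => -pd i ψ (x - y) := by
  ext y
  have h1 : (fun y => ψ (x - y)) = fun y => (fun z => ψ (x + z)) (-y) := by
    ext y; simp [sub_eq_add_neg]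
  rw [h1, IsProfile.pd_comp_neg (ψ := fun z => ψ (x + z)), pd, fderiv_comp_add_left, sub_eq_add_neg]
  rfl

theorem pd_neg (ψ : R3 → ℝ) (i : Fin 3) : pd i (fun y => -ψ y) = fun y => -pd i ψ y := by
  ext y
  rw [pd, fderiv_fun_neg]
  rfl

theorem lap_smoothen {w μ : R3 → ℝ} (hw : LocallyIntegrable w) (h : NegLap w μ) (n : ℕ) (x : R3) :
    lap (smoothen n w) x = -smoothen n μ x := by
  have hm := contDiff_moll n
  have hc := hasCompactSupport_moll n
  have h1 : ∀ i, pd i (pd i (smoothen n w)) x = ∫ y, w y * pd i (pd i (moll n)) (x - y) := fun i => by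
    have e1 : smoothen n w = convolution (moll n) w (ContinuousLinearMap.mul ℝ ℝ) volume := rfl
    rw [e1, pd_convolution hm hc hw, pd_convolution (contDiff_pd hm i) (hasCompactSupport_pd hc i) hw,
      convolution_def, ← integral_sub_left_eq_self _ volume x]
    refine integral_congr_ae (Eventually.of_forall fun y => ?_)
    simp [mul_comm]
  have h2 := h (fun y => moll n (x - y)) (hm.comp (contDiff_const.sub contDiff_id))
    (hc.comp_homeomorph (Homeomorph.subLeft x))
  have h3 : ∀ i, pd i (pd i fun y => moll n (x - y)) = fun y => pd i (pd i (moll n)) (x - y) := fun i => by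
    rw [pd_comp_const_sub, pd_neg, pd_comp_const_sub]
    simp
  simp only [lap, h1, h3, Finset.mul_sum] at h2 ⊢
  rw [← integral_finsetSum, h2, smoothen_apply]
  · simp only [smul_eq_mul, mul_comm]
  · intro i _
    have hd := contDiff_pd (contDiff_pd hm i) i
    have hdc := hasCompactSupport_pd (hasCompactSupport_pd hc i) i
    refine (hw.integrable_smul_left_of_hasCompactSupport
      (hd.continuous.comp (continuous_const.sub continuous_id))
      (hdc.comp_homeomorph (Homeomorph.subLeft x))).congr (Eventually.of_forall fun y => ?_)
    simp [mul_comm]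

namespace IsPotential

variable {V : R3 → ℝ} (hV : IsPotential V)
include hV

theorem integrable_mul {q : R3 → ℝ} (hq : Continuous q) : Integrable fun x => V x * q x := by
  have h1 : IntegrableOn (fun x => V x * q x) (tsupport V) :=
    hV.integrable.integrableOn.mul_continuousOn hq.continuousOn hV.compact.isCompact
  refine (integrableOn_iff_integrable_of_support_subset ?_).1 h1
  exact (Function.support_mul_subset_left _ _).trans (subset_tsupport V)

/-- The zero energy solution satisfies `-Δ(1 - f₀) = V f₀ / 2` as a distribution. -/
theorem negLap_zeroEnergy {f : R3 → ℝ} (h : IsZeroEnergySolution V f) :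
    NegLap (fun x => 1 - f x) (fun x => 1 / 2 * V x * f x) := by
  have hVf := hV.integrable_mul h.continuous
  obtain ⟨G, hG, hGw, hGe⟩ := h.weak_eq
  have h1 : NegLap f (fun x => -(1 / 2 * V x * f x)) := by
    refine negLap_of_weak_gradient hGw h.continuous.locallyIntegrable fun ψ hψ hc => ?_
    have i2 : Integrable fun x => 1 / 2 * V x * f x * ψ x := by
      refine ((hV.integrable_mul (h.continuous.fun_mul hψ.continuous)).const_mul (1 / 2)).congr
        (Eventually.of_forall fun x => ?_)
      simp only
      ring
    have i1 : ∀ i, Integrable fun x => G x i * pd i ψ x := fun i => by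
      have hdc := hasCompactSupport_pd hc i
      obtain ⟨r, hr⟩ := hdc.isCompact.isBounded.subset_ball (0 : R3)
      have hGi : MemLp (fun x => G x i) 2 (volume.restrict (Metric.ball (0 : R3) r)) :=
        (hG r).mono ((EuclideanSpace.proj (𝕜 := ℝ) i).continuous.comp_aestronglyMeasurable (hG r).1)
          (Eventually.of_forall fun x => PiLp.norm_apply_le _ i)
      have h2 : IntegrableOn (fun x => G x i * pd i ψ x) (Metric.ball 0 r) :=
        hGi.integrable_mul (memLp_ball_of_continuous (contDiff_pd hψ i).continuous r)
      exact (integrableOn_iff_integrable_of_support_subset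
        ((Function.support_mul_subset_right _ _).trans ((subset_tsupport _).trans hr))).1 h2
    have h3 := hGe ψ hψ hc
    simp only [inner_gradient_eq_sum] at h3
    rw [integral_add (integrable_finsetSum _ fun i _ => i1 i) i2,
      integral_finsetSum _ fun i _ => i1 i] at h3
    simp only [neg_mul, integral_neg]
    linarith
  have h0 : NegLap (fun _ : R3 => (1 : ℝ)) (fun _ => 0) := by
    have := negLap_of_contDiff (w := fun _ : R3 => (1 : ℝ)) contDiff_const
    have h0 : ∀ i, pd i (fun _ : R3 => (1 : ℝ)) = fun _ => 0 := fun i => by ext x; simp [pd]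
    have h0' : ∀ i, pd i (fun _ : R3 => (0 : ℝ)) = fun _ => 0 := fun i => by ext x; simp [pd]
    simpa [lap, h0, h0'] using this
  have h2 := h0.sub continuous_const h.continuous (locallyIntegrable_const 0)
    ((hVf.const_mul (-(1 / 2))).congr (Eventually.of_forall fun x => by
      simp only; ring)).locallyIntegrable h1
  simpa using h2

/-- `∫ V f₀ / 2 = 4 π a₀`: the flux of `∇ f₀` through a large sphere, computed with a cutoff. -/
theorem integral_zeroEnergy {f : R3 → ℝ} (h : IsZeroEnergySolution V f) {a R : ℝ}
    (hR : ∀ x, R < ‖x‖ → V x = 0 ∧ f x = 1 - a / ‖x‖) :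
    ∫ x, 1 / 2 * V x * f x = 4 * Real.pi * a := by
  -- Where `Δχ ≠ 0` the solution is explicit, `1 - f₀ = a / |x|`, and `∫ Δχ / |x| = -4 π` is the
  -- representation of `χ` as a Newtonian potential, at the origin.
  obtain ⟨χ, hχ, hχc, hχ1, -⟩ := exists_cutoff (|R| + 1)
  have hl := continuous_lap hχ
  have hlc := hasCompactSupport_lap hχc
  have hl0 : ∀ x, ‖x‖ < |R| + 1 → lap χ x = 0 := fun x hx => by
    have : χ =ᶠ[𝓝 x] fun _ => 1 := by
      filter_upwards [(isOpen_lt continuous_norm continuous_const).mem_nhds hx] with y hy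
      exact hχ1 y (le_of_lt hy)
    have h0 : ∀ i, pd i (fun _ : R3 => (1 : ℝ)) = fun _ => 0 := fun i => by ext x; simp [pd]
    have h0' : ∀ i, pd i (fun _ : R3 => (0 : ℝ)) = fun _ => 0 := fun i => by ext x; simp [pd]
    rw [lap_congr this]
    simp [lap, h0, h0']
  have h1 := hV.negLap_zeroEnergy h χ hχ hχc
  have e1 : ∀ x, (1 - f x) * lap χ x = a * (‖x‖⁻¹ * lap χ x) := fun x => by
    rcases lt_or_ge ‖x‖ (|R| + 1) with hx | hx
    · rw [hl0 x hx]; ring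
    · rw [(hR x (by linarith [le_abs_self R])).2]
      ring
  have e2 : ∀ x, 1 / 2 * V x * f x * χ x = 1 / 2 * V x * f x := fun x => by
    rcases le_or_gt ‖x‖ (|R| + 1) with hx | hx
    · rw [hχ1 x hx, mul_one]
    · rw [(hR x (by linarith [le_abs_self R])).1]
      ring
  simp only [e1, e2, integral_const_mul] at h1
  obtain ⟨S, hS⟩ := hχc.isCompact.isBounded.subset_ball (0 : R3)
  have hS0 : ∀ x, S ≤ ‖x‖ → χ =ᶠ[𝓝 x] 0 := fun x hx => by
    refine notMem_tsupport_iff_eventuallyEq.1 fun hmem => ?_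
    have := mem_ball_zero_iff.1 (hS hmem)
    linarith
  have hi1 : Integrable fun x => -lap χ x := (hl.integrable_of_hasCompactSupport hlc).neg
  have hi2 : Integrable fun x => (-lap χ x) ^ 2 := by
    have : MemLp (fun x => -lap χ x) 2 (volume : Measure R3) :=
      (hl.memLp_of_hasCompactSupport hlc).neg
    exact this.integrable_sq
  have h2 := eq_newton_of_negLap hχ.continuous (R := S) (fun x hx => (hS0 x hx).eq_of_nhds)
    (μ := fun x => -lap χ x) (fun x hx => by
      rw [lap_congr (hS0 x hx)]
      simp [lap, pd, show pd _ (0 : R3 → ℝ) = fun _ => 0 from funext fun x => by simp [pd]])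
    hi1.1 (negLap_of_contDiff hχ) 0 (integrable_inv_norm_mul hi1 hi2 0)
  rw [hχ1 0 (by simp; positivity), newton_eq] at h2
  simp only [zero_sub, norm_neg, mul_neg, integral_neg] at h2
  have h3 : ∫ x, ‖x‖⁻¹ * lap χ x = -(4 * Real.pi) := by
    have hπ := Real.pi_pos
    have h3 : (4 * Real.pi)⁻¹ * ∫ x, ‖x‖⁻¹ * lap χ x = -1 := by linarith
    rw [inv_mul_eq_iff_eq_mul₀ (by positivity)] at h3
    linarith
  rw [h3] at h1
  have e3 : ∫ x, 1 / 2 * V x * f x = 1 / 2 * ∫ x, V x * f x := by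
    rw [← integral_const_mul]
    simp only [mul_assoc]
  simp only [mul_assoc, integral_const_mul] at h1 ⊢
  linarith

/-- Green's identity for the Neumann ground state and the zero energy solution. -/
theorem green {f : R3 → ℝ} (h : IsZeroEnergySolution V f) {r lam : ℝ} {p : R3 → ℝ}
    {g : Fin 3 → R3 → ℝ} (hp : IsProfile V r lam 1 p g) :
    ∫ x, (1 - f x) * IsProfile.charge V r lam p x = ∫ x, 1 / 2 * V x * f x * (1 - p x) := by
  set w : R3 → ℝ := fun x => 1 - p x
  have hw : Continuous w := continuous_const.sub hp.cont
  have hw0 : ∀ x, r ≤ ‖x‖ → w x = 0 := fun x hx => by simp only [w, hp.eq_c x hx, sub_self]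
  have hwc : HasCompactSupport w := HasCompactSupport.intro (isCompact_closedBall (0 : R3) r)
    fun x hx => hw0 x (by simpa using (not_le.1 (by simpa using hx)).le)
  have hf1 : Continuous fun x => 1 - f x := continuous_const.sub h.continuous
  set μ := IsProfile.charge V r lam p
  have hμ := hp.memLp_charge hV
  obtain ⟨M, hM⟩ := hwc.exists_bound_of_continuous hw
  obtain ⟨χ, hχ, hχc, hχ1, -⟩ := exists_cutoff (r + 1)
  -- The equation for `f₀` is tested with mollifications of `1 - p`. The cutoff `χ` only serves to
  -- make `1 - f₀` square integrable.
  have key : ∀ n, ∫ x, (χ x * (1 - f x)) * smoothen n μ x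
      = ∫ x, 1 / 2 * V x * f x * smoothen n w x := fun n => by
    have h1 := hV.negLap_zeroEnergy h (smoothen n w) (contDiff_smoothen n hw.locallyIntegrable)
      (hasCompactSupport_smoothen n hwc)
    simp only [lap_smoothen hw.locallyIntegrable (hp.negLap_one_sub hV), mul_neg, integral_neg,
      neg_inj] at h1
    rw [← h1]
    refine integral_congr_ae (Eventually.of_forall fun x => ?_)
    simp only
    rcases le_total ‖x‖ (r + 1) with hx | hx
    · rw [hχ1 x hx, one_mul]
    · rw [smoothen_eq_zero (r := r) (fun x hx => IsProfile.charge_eq_zero hx)]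
      · simp
      · have h1 : 1 / ((n : ℝ) + 1) ≤ 1 := by
          rw [div_le_one (by positivity)]
          linarith [Nat.cast_nonneg (α := ℝ) n]
        linarith
  have hm : MemLp (fun x => χ x * (1 - f x)) 2 (volume : Measure R3) :=
    (hχ.continuous.mul hf1).memLp_of_hasCompactSupport hχc.mul_right
  have l1 := tendsto_integral_mul_of_L2 (fun _ => hm) (fun n => memLp_smoothen hμ n) hm hμ
    (by simp) (tendsto_eLpNorm_smoothen_sub hμ)
  have l2 : Tendsto (fun n => ∫ x, 1 / 2 * V x * f x * smoothen n w x) atTop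
      (𝓝 (∫ x, 1 / 2 * V x * f x * w x)) := by
    have hVf : Integrable fun x => 1 / 2 * V x * f x := by
      refine ((hV.integrable_mul h.continuous).const_mul (1 / 2)).congr
        (Eventually.of_forall fun x => ?_)
      simp only
      ring
    refine tendsto_integral_of_dominated_convergence (fun x => |1 / 2 * V x * f x| * M)
      (fun n => hVf.1.mul (contDiff_smoothen n hw.locallyIntegrable).continuous.aestronglyMeasurable)
      (hVf.abs.mul_const M) (fun n => Eventually.of_forall fun x => ?_)
      (Eventually.of_forall fun x => ((tendstoUniformly_smoothen
        (uniformContinuous_of_const_off_ball hw hw0)).tendsto_at x).const_mul _)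
    rw [norm_mul]
    exact mul_le_mul_of_nonneg_left (norm_smoothen_le hM n x) (norm_nonneg _)
  have h2 := tendsto_nhds_unique (l1.congr key) l2
  rw [← h2]
  refine integral_congr_ae (Eventually.of_forall fun x => ?_)
  simp only
  rcases le_total ‖x‖ r with hx | hx
  · rw [hχ1 x (by linarith), one_mul]
  · simp only [μ, IsProfile.charge_eq_zero hx, mul_zero]

end IsPotential

/-- By Green's identity, `∫ V p / 2 - 4 π a = lam ∫ (1 - f₀) p` over the ball, which is `O(lam r²)`
as `1 - f₀ = O(1 / |x|)`. -/
theorem IsPotential.exists_scattering_bound {V : R3 → ℝ} (hV : IsPotential V) {a : ℝ}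
    (ha : IsScatteringLength V a) : ∃ K R : ℝ, 0 ≤ K ∧
    ∀ {r lam : ℝ} {p : R3 → ℝ} {g : Fin 3 → R3 → ℝ}, R < r → 0 < r → IsProfile V r lam 1 p g →
      IsLowerBound V r lam → (∀ x, p x ≤ 2) →
      |(∫ x, 1 / 2 * V x * p x) - 4 * Real.pi * a| ≤ K * (lam * r ^ 2) := by
  obtain ⟨f, hf, R, hR⟩ := ha
  have hf1 : Continuous fun x => 1 - f x := continuous_const.sub hf.continuous
  obtain ⟨M, hM⟩ := (isCompact_closedBall (0 : R3) |R|).exists_bound_of_continuousOn hf1.continuousOn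
  have hM0 : 0 ≤ M := (norm_nonneg _).trans (hM 0 (by simp))
  set K := M * |R| + |a|
  have hK0 : 0 ≤ K := by positivity
  have hK : ∀ x, x ≠ 0 → |1 - f x| ≤ K * ‖x‖⁻¹ := fun x hx => by
    have hx0 : 0 < ‖x‖ := norm_pos_iff.2 hx
    rw [← div_eq_mul_inv, le_div_iff₀ hx0]
    rcases le_or_gt ‖x‖ |R| with h | h
    · have := mul_le_mul (hM x (by simpa using h)) h hx0.le hM0
      have h2 := abs_nonneg a
      rw [Real.norm_eq_abs] at this
      linarith
    · rw [(hR x ((le_abs_self R).trans_lt h)).2]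
      have : |1 - (1 - a / ‖x‖)| * ‖x‖ = |a| := by
        rw [sub_sub_cancel, abs_div, abs_norm]
        field_simp
      rw [this]
      have : 0 ≤ M * |R| := by positivity
      linarith
  refine ⟨4 * Real.pi * K, R, by positivity, fun {r lam p g} hRr hr h hlow h2 => ?_⟩
  have hp0 := h.nonneg hV hlow hr one_pos
  have hlam := h.lam_nonneg hV.integrable hV.nonneg hr one_ne_zero
  have hG := hV.green hf h
  rw [← hV.integral_zeroEnergy hf hR]
  have hc1 : Continuous fun x => (1 - f x) * p x := hf1.mul h.cont
  have e1 : ∫ x, (1 - f x) * IsProfile.charge V r lam p x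
      = (∫ x, 1 / 2 * (V x * ((1 - f x) * p x)))
        - lam * ∫ x in Metric.ball 0 r, (1 - f x) * p x := by
    rw [← integral_const_mul, ← integral_indicator measurableSet_ball, ← integral_sub]
    · refine integral_congr_ae (Eventually.of_forall fun x => ?_)
      by_cases hx : x ∈ Metric.ball (0 : R3) r
      · simp only [IsProfile.charge, indicator_of_mem hx]; ring
      · have : V x = 0 := (hR x (hRr.trans_le (by simpa using hx))).1
        simp only [IsProfile.charge, indicator_of_notMem hx, this]; ring
    · exact (hV.integrable_mul hc1).const_mul _
    · exact (integrable_indicator_iff measurableSet_ball).2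
        ((integrableOn_ball_of_continuous hc1 r).const_mul _)
  have e2 : (∫ x, 1 / 2 * V x * p x) - ∫ x, 1 / 2 * V x * f x
      = (∫ x, 1 / 2 * (V x * ((1 - f x) * p x))) - ∫ x, 1 / 2 * V x * f x * (1 - p x) := by
    have i1 : ∀ {q : R3 → ℝ}, Continuous q → Integrable fun x => 1 / 2 * V x * q x := fun hq => by
      simpa only [mul_assoc] using (hV.integrable_mul hq).const_mul (1 / 2)
    have hfc := hf.continuous
    have hpc := h.cont
    rw [← integral_sub (i1 hpc) (i1 hfc), ← integral_sub ((hV.integrable_mul hc1).const_mul _)]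
    · refine integral_congr_ae (Eventually.of_forall fun x => ?_)
      simp only
      ring
    · refine (i1 (hfc.fun_mul ((continuous_const (y := (1 : ℝ))).sub hpc))).congr (Eventually.of_forall fun x => ?_)
      simp only [Pi.sub_apply]
      ring
  have e3 : (∫ x, 1 / 2 * V x * p x) - ∫ x, 1 / 2 * V x * f x
      = lam * ∫ x in Metric.ball 0 r, (1 - f x) * p x := by
    rw [e2]
    linarith
  rw [e3, abs_mul, abs_of_nonneg hlam]
  obtain ⟨j1, j2⟩ := indicator_ball_inv hr.le
  have h3 : |∫ x in Metric.ball 0 r, (1 - f x) * p x| ≤ 4 * Real.pi * K * r ^ 2 := by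
    have j3 : IntegrableOn (fun x : R3 => ‖x‖⁻¹) (Metric.ball 0 r) :=
      (integrable_indicator_iff measurableSet_ball).1 j1
    rw [integral_indicator measurableSet_ball] at j2
    calc |∫ x in Metric.ball 0 r, (1 - f x) * p x|
        ≤ ∫ x in Metric.ball (0 : R3) r, 2 * K * ‖x‖⁻¹ := by
          rw [← Real.norm_eq_abs]
          refine norm_integral_le_of_norm_le (j3.const_mul (2 * K)) ?_
          have hne : ∀ᵐ x ∂(volume.restrict (Metric.ball (0 : R3) r)), x ≠ 0 :=
            ae_restrict_of_ae (by simp [ae_iff])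
          filter_upwards [hne] with x hx
          rw [norm_mul, Real.norm_eq_abs, Real.norm_of_nonneg (hp0 x)]
          have := mul_le_mul (hK x hx) (h2 x) (hp0 x) (by positivity)
          linarith
      _ = 4 * Real.pi * K * r ^ 2 := by
          rw [integral_const_mul, j2]
          ring
  have := mul_le_mul_of_nonneg_left h3 hlam
  linarith

/-- What is used about the Neumann ground state: its profile, and bounds which are uniform in `N`. -/
structure GroundStateBounds (V : R3 → ℝ) (l a : ℝ) (N : ℕ) (C lam : ℝ) (f : R3 → ℝ) : Prop where
  nonneg : ∀ x, 0 ≤ f x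
  le : ∀ x, f x ≤ C
  lam_nonneg : 0 ≤ lam
  lam_le : lam * (N : ℝ) ^ 3 ≤ C
  one_sub_le : ∀ x, ‖x‖ * |1 - f x| ≤ C
  scattering : |(∫ x, 1 / 2 * V x * f x) - 4 * Real.pi * a| * N ≤ C
  even : ∀ x, f (-x) = f x
  profile : ∃ g, IsProfile V (N * l) lam 1 f g

theorem GroundStateBounds.mono {V : R3 → ℝ} {l a : ℝ} {N : ℕ} {C C' lam : ℝ} {f : R3 → ℝ}
    (h : GroundStateBounds V l a N C lam f) (hC : C ≤ C') : GroundStateBounds V l a N C' lam f where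
  nonneg := h.nonneg
  le x := (h.le x).trans hC
  lam_nonneg := h.lam_nonneg
  lam_le := h.lam_le.trans hC
  one_sub_le x := (h.one_sub_le x).trans hC
  scattering := h.scattering.trans hC
  even := h.even
  profile := h.profile

/-- For fixed `N` the bounds hold because the ground state is unique; this serves the finitely many
`N` for which the ball is not large enough for `IsProfile.le_two`. -/
theorem IsPotential.exists_groundStateBounds_single {V : R3 → ℝ} (hV : IsPotential V) {l : ℝ}
    (hl : 0 < l) (a : ℝ) {N : ℕ} (hN : 1 ≤ N) : ∃ C, ∀ lam f,
      IsNeumannGroundState V (N * l) lam f → GroundStateBounds V l a N C lam f := by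
  have hr : 0 < (N : ℝ) * l := by
    have : (1 : ℝ) ≤ N := by exact_mod_cast hN
    positivity
  by_cases hex : ∃ lam f, IsNeumannGroundState V (N * l) lam f
  swap
  · exact ⟨0, fun lam f h => (hex ⟨lam, f, h⟩).elim⟩
  obtain ⟨lam, f, h⟩ := hex
  obtain ⟨g, hg⟩ := h.exists_profile hr hV.integrable
  have hlow := h.isLowerBound hV.integrable
  obtain ⟨M, hM⟩ := hg.exists_bound
  have hc : Continuous fun x => ‖x‖ * |1 - f x| :=
    continuous_norm.mul (continuous_const.sub hg.cont).abs
  obtain ⟨B, hB⟩ := (HasCompactSupport.intro (isCompact_closedBall (0 : R3) (N * l))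
    fun x hx => show ‖x‖ * |1 - f x| = 0 by
      rw [hg.eq_c x (by simpa using (not_le.1 (by simpa using hx)).le)]
      simp).exists_bound_of_continuous hc
  set S := |(∫ x, 1 / 2 * V x * f x) - 4 * Real.pi * a| * N
  refine ⟨max (max M (lam * (N : ℝ) ^ 3)) (max B S), fun lam' f' h' => ?_⟩
  obtain ⟨g', hg'⟩ := h'.exists_profile hr hV.integrable
  obtain ⟨rfl, rfl⟩ := hg.unique hV hlow hr one_ne_zero hg' (h'.isLowerBound hV.integrable)
  exact {
    nonneg := hg.nonneg hV hlow hr one_pos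
    le := fun x => (le_abs_self _).trans
      ((hM x).trans ((le_max_left _ _).trans (le_max_left _ _)))
    lam_nonneg := hg.lam_nonneg hV.integrable hV.nonneg hr one_ne_zero
    lam_le := (le_max_right _ _).trans (le_max_left _ _)
    one_sub_le := fun x => (le_abs_self _).trans
      ((hB x).trans ((le_max_left _ _).trans (le_max_right _ _)))
    scattering := (le_max_right _ _).trans (le_max_right _ _)
    even := hg.even hV hlow hr one_ne_zero
    profile := ⟨g, hg⟩ }

/-- The bounds on the ground state, uniformly in `N`. -/
theorem IsPotential.exists_groundStateBounds {V : R3 → ℝ} (hV : IsPotential V) {l : ℝ}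
    (hl : 0 < l) {a : ℝ} (ha : IsScatteringLength V a) : ∃ C, ∀ N : ℕ, 1 ≤ N → ∀ lam f,
      IsNeumannGroundState V (N * l) lam f → GroundStateBounds V l a N C lam f := by
  obtain ⟨K, hK0, hK⟩ := IsProfile.norm_mul_one_sub_le hV
  obtain ⟨S, R, hS0, hS⟩ := hV.exists_scattering_bound ha
  set I := ∫ x, V x
  have hI : 0 ≤ I := integral_nonneg hV.nonneg
  set C := 2 + I / l ^ 3 + K + S * I / l
  obtain ⟨N₀, hN₀⟩ := exists_nat_gt ((I + |R|) / l)
  have hlarge : ∀ N : ℕ, N₀ ≤ N → 1 ≤ N → ∀ lam f,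
      IsNeumannGroundState V (N * l) lam f → GroundStateBounds V l a N C lam f := by
    intro N hN hN1 lam f h
    have hN1' : (1 : ℝ) ≤ N := by exact_mod_cast hN1
    have hr : 0 < (N : ℝ) * l := by positivity
    have hNl : I + |R| < N * l := by
      rw [div_lt_iff₀ hl] at hN₀
      refine hN₀.trans_le (mul_le_mul_of_nonneg_right (by exact_mod_cast hN) hl.le)
    obtain ⟨g, hg⟩ := h.exists_profile hr hV.integrable
    have hlow := h.isLowerBound hV.integrable
    have h2 := hg.le_two hV hlow hr (by linarith [abs_nonneg R])
    have hlam := hg.lam_nonneg hV.integrable hV.nonneg hr one_ne_zero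
    have hvol := hlow.mul_volume_le hV hr
    have hπ := Real.pi_gt_three
    have h3 : lam * (N : ℝ) ^ 3 * l ^ 3 ≤ I := by
      have : 0 ≤ lam * (N : ℝ) ^ 3 * l ^ 3 := by positivity
      have e : lam * (4 / 3 * Real.pi * (N * l) ^ 3)
        = 4 / 3 * Real.pi * (lam * (N : ℝ) ^ 3 * l ^ 3) := by ring
      rw [e] at hvol
      nlinarith
    have hC1 : 0 ≤ I / l ^ 3 := by positivity
    have hC2 : 0 ≤ S * I / l := by positivity
    exact {
      nonneg := hg.nonneg hV hlow hr one_pos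
      le := fun x => (h2 x).trans (by linarith)
      lam_nonneg := hlam
      lam_le := by
        have : lam * (N : ℝ) ^ 3 ≤ I / l ^ 3 := by rwa [le_div_iff₀ (by positivity)]
        linarith
      one_sub_le := fun x => (hK hr hg hlow h2 x).trans (by linarith)
      scattering := by
        have h4 := hS (by linarith [le_abs_self R]) hr hg hlow h2
        have h5 := mul_le_mul_of_nonneg_right h4 (show (0 : ℝ) ≤ N by positivity)
        have h6 : S * (lam * (N * l) ^ 2) * N ≤ S * I / l := by
          rw [le_div_iff₀ hl]
          calc S * (lam * (N * l) ^ 2) * N * l = S * (lam * (N : ℝ) ^ 3 * l ^ 3) := by ring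
            _ ≤ S * I := mul_le_mul_of_nonneg_left h3 hS0
        linarith
      even := hg.even hV hlow hr one_ne_zero
      profile := ⟨g, hg⟩ }
  have hsmall := fun N : ℕ => fun hN : 1 ≤ N => hV.exists_groundStateBounds_single hl a hN
  choose B hB using hsmall
  set B' : ℕ → ℝ := fun N => if hN : 1 ≤ N then |B N hN| else 0
  refine ⟨|C| + ∑ N ∈ Finset.range N₀, B' N, fun N hN lam f h => ?_⟩
  have hB0 : ∀ N, 0 ≤ B' N := fun N => by
    simp only [B']
    split_ifs
    · exact abs_nonneg _
    · exact le_rfl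
  rcases le_or_gt N₀ N with h1 | h1
  · exact (hlarge N h1 hN lam f h).mono (by
      have := Finset.sum_nonneg fun N (_ : N ∈ Finset.range N₀) => hB0 N
      linarith [le_abs_self C])
  · refine (hB N hN lam f h).mono ?_
    have h2 := Finset.single_le_sum (fun N _ => hB0 N) (Finset.mem_range.2 h1)
    have h3 : B' N = |B N hN| := dif_pos hN
    linarith [le_abs_self (B N hN), abs_nonneg C]

end

section

/-! ### The Sobolev space: completeness and density of test functions -/

/-- The pairing of an `L²`-function with a real test function. -/
def testPairing (ψ : R3 → ℝ) (hψ : MemLp ψ 2 volume) : L2 →L[ℝ] ℂ :=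
  ContinuousLinearMap.lpPairing volume 2 2 (ContinuousLinearMap.lsmul ℝ ℝ) (hψ.toLp ψ)

theorem testPairing_apply (ψ : R3 → ℝ) (hψ : MemLp ψ 2 volume) (u : L2) :
    testPairing ψ hψ u = ∫ x, ψ x • u x := by
  rw [testPairing, ContinuousLinearMap.lpPairing_eq_integral]
  refine integral_congr_ae ?_
  filter_upwards [hψ.coeFn_toLp] with x hx
  rw [hx]
  rfl

theorem memLp_pd {ψ : R3 → ℝ} (hψ : ContDiff ℝ ∞ ψ) (hc : HasCompactSupport ψ) (i : Fin 3) :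
    MemLp (pd i ψ) 2 (volume : Measure R3) :=
  (contDiff_pd hψ i).continuous.memLp_of_hasCompactSupport (hasCompactSupport_pd hc i)

theorem isClosed_H1 : IsClosed (H1 : Set (WithLp 2 (L2 × PiLp 2 (fun _ : Fin 3 => L2)))) := by
  have h : (H1 : Set (WithLp 2 (L2 × PiLp 2 (fun _ : Fin 3 => L2))))
      = ⋂ (i : Fin 3) (ψ : R3 → ℝ) (h1 : ContDiff ℝ ∞ ψ) (h2 : HasCompactSupport ψ),
        {p | testPairing (pd i ψ) (memLp_pd h1 h2 i) p.fst
          = -testPairing ψ (h1.continuous.memLp_of_hasCompactSupport h2) (p.snd i)} := by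
    ext p
    simp only [mem_iInter, mem_ofPred_eq, testPairing_apply]
    constructor
    · intro h i ψ h1 h2
      simpa [pd] using h i ψ h1 h2 (subset_univ _)
    · intro h i ψ h1 h2 _
      simpa [pd] using h i ψ h1 h2
  rw [h]
  refine isClosed_iInter fun i => isClosed_iInter fun ψ => isClosed_iInter fun h1 =>
    isClosed_iInter fun h2 => isClosed_eq ?_ ?_
  · exact (ContinuousLinearMap.continuous _).comp (WithLp.fstL 2 ℂ L2 _).continuous
  · exact ((ContinuousLinearMap.continuous _).comp
      ((PiLp.proj (𝕜 := ℂ) 2 (fun _ : Fin 3 => L2) i).continuous.comp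
        (WithLp.sndL 2 ℂ L2 _).continuous)).neg

instance : CompleteSpace H1 := isClosed_H1.completeSpace_coe

/-- The weak partial derivative, as a continuous linear map. -/
def gradL (i : Fin 3) : H1 →L[ℂ] L2 :=
  (PiLp.proj (𝕜 := ℂ) 2 (fun _ : Fin 3 => L2) i).comp ((WithLp.sndL 2 ℂ L2 _).comp H1.subtypeL)

theorem gradL_apply (i : Fin 3) (u : H1) : gradL i u = grad u i := rfl

theorem isWeakDeriv_gradL (u : H1) (i : Fin 3) : IsWeakDeriv univ (e i) (toL2 u) (gradL i u) :=
  u.2 i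

theorem norm_sq_H1 (u : H1) : ‖u‖ ^ 2 = ‖toL2 u‖ ^ 2 + ∑ i, ‖gradL i u‖ ^ 2 := by
  have h := WithLp.prod_norm_sq_eq_of_L2 (u : WithLp 2 (L2 × PiLp 2 (fun _ : Fin 3 => L2)))
  rw [PiLp.norm_sq_eq_of_L2] at h
  exact h

theorem norm_toL2_le (u : H1) : ‖toL2 u‖ ≤ ‖u‖ := by
  have h := norm_sq_H1 u
  have : 0 ≤ ∑ i, ‖gradL i u‖ ^ 2 := Finset.sum_nonneg fun i _ => sq_nonneg _
  exact abs_le_of_sq_le_sq' (by linarith) (norm_nonneg _) |>.2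

theorem inner_grad (u v : H1) : inner ℂ (grad u) (grad v) = ∑ i, inner ℂ (gradL i u) (gradL i v) :=
  PiLp.inner_apply _ _

theorem tendsto_H1 {ι : Type*} {l : Filter ι} {u : ι → H1} {v : H1}
    (h0 : Tendsto (fun n => toL2 (u n)) l (𝓝 (toL2 v)))
    (h : ∀ i, Tendsto (fun n => gradL i (u n)) l (𝓝 (gradL i v))) : Tendsto u l (𝓝 v) := by
  rw [tendsto_iff_norm_sub_tendsto_zero] at h0 ⊢
  have h1 : Tendsto (fun n => ‖toL2 (u n) - toL2 v‖ ^ 2 + ∑ i, ‖gradL i (u n) - gradL i v‖ ^ 2) l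
      (𝓝 (0 ^ 2 + ∑ i : Fin 3, 0 ^ 2)) :=
    (h0.pow 2).add (tendsto_finsetSum _ fun i _ =>
      (tendsto_iff_norm_sub_tendsto_zero.1 (h i)).pow 2)
  have h2 := h1.sqrt
  simp only [← map_sub, ← norm_sq_H1, Real.sqrt_sq (norm_nonneg _)] at h2
  simpa using h2

/-- An `L²`-function together with its weak gradient, as an element of `H¹`. -/
def mkH1 (u : L2) (g : Fin 3 → L2) (h : ∀ i, IsWeakDeriv univ (e i) u (g i)) : H1 :=
  ⟨WithLp.toLp 2 (u, WithLp.toLp 2 g), h⟩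

theorem IsWeakDeriv.congr {X F : Type*} [NormedAddCommGroup X] [NormedSpace ℝ X] [MeasureSpace X]
    [NormedAddCommGroup F] [NormedSpace ℝ F] {v : X} {u u' g g' : X → F}
    (h : IsWeakDeriv univ v u g) (hu : u' =ᵐ[volume] u) (hg : g' =ᵐ[volume] g) :
    IsWeakDeriv univ v u' g' := by
  intro ψ h1 h2 h3
  have := h ψ h1 h2 h3
  simp only [Measure.restrict_univ] at this ⊢
  rw [integral_congr_ae (g := fun x => fderiv ℝ ψ x v • u x) (by filter_upwards [hu] with x hx; rw [hx]),
    this, integral_congr_ae (g := fun x => ψ x • g' x) (by filter_upwards [hg] with x hx; rw [hx])]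

/-- Limits of sequences in `H¹`, in `L²` together with the candidates for the weak gradients, stay
in `H¹`. -/
theorem exists_H1_of_tendsto {u : ℕ → H1} {v : L2} {g : Fin 3 → L2}
    (h0 : Tendsto (fun n => toL2 (u n)) atTop (𝓝 v))
    (h : ∀ i, Tendsto (fun n => gradL i (u n)) atTop (𝓝 (g i))) :
    ∀ i, IsWeakDeriv univ (e i) v (g i) := by
  have h1 : Tendsto (fun n => ((u n : H1) : WithLp 2 (L2 × PiLp 2 (fun _ : Fin 3 => L2)))) atTop
      (𝓝 (WithLp.toLp 2 (v, WithLp.toLp 2 g))) := by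
    have h2 : Tendsto (fun n => (toL2 (u n), WithLp.toLp 2 fun i => gradL i (u n))) atTop
        (𝓝 (v, WithLp.toLp 2 g)) :=
      h0.prodMk_nhds (((PiLp.continuous_toLp 2 (fun _ : Fin 3 => L2)).tendsto g).comp
        (tendsto_pi_nhds.2 h))
    exact ((WithLp.prod_continuous_toLp 2 L2 (PiLp 2 (fun _ : Fin 3 => L2))).tendsto _).comp h2
  exact isClosed_H1.mem_of_tendsto h1 (Eventually.of_forall fun n => (u n).2)

section ofSmooth

variable {u : R3 → ℂ} (hu : ContDiff ℝ ∞ u) (hc : HasCompactSupport u)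

include hu hc in
theorem memLp_of_smooth {q : ℝ≥0∞} : MemLp u q volume := hu.continuous.memLp_of_hasCompactSupport hc

include hu hc in
theorem memLp_pd_of_smooth {q : ℝ≥0∞} (i : Fin 3) : MemLp (pd i u) q volume :=
  (contDiff_pd hu i).continuous.memLp_of_hasCompactSupport (hasCompactSupport_pd hc i)

/-- A test function as an element of `H¹`. -/
def ofSmooth : H1 :=
  mkH1 ((memLp_of_smooth hu hc).toLp u) (fun i => (memLp_pd_of_smooth hu hc i).toLp _) fun i =>
    (weakDeriv_pd hu i).congr (MemLp.coeFn_toLp _) (MemLp.coeFn_toLp _)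

theorem coeFn_ofSmooth : toL2 (ofSmooth hu hc) =ᵐ[volume] u :=
  (memLp_of_smooth hu hc).coeFn_toLp

theorem coeFn_gradL_ofSmooth (i : Fin 3) : gradL i (ofSmooth hu hc) =ᵐ[volume] pd i u :=
  (memLp_pd_of_smooth hu hc i).coeFn_toLp

end ofSmooth

/-- Cutting off at larger and larger radii does not affect convergence in `L²`. -/
theorem tendsto_eLpNorm_smul_sub {E : Type*} [NormedAddCommGroup E] [NormedSpace ℝ E]
    {c : ℕ → R3 → ℝ} (hc : ∀ n, Continuous (c n)) (hb : ∀ n x, |c n x| ≤ 1)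
    (hlim : ∀ x, ∀ᶠ n in atTop, c n x = 1) {v : ℕ → R3 → E} {u : R3 → E}
    (hv : ∀ n, AEStronglyMeasurable (v n) volume)
    (hu : MemLp u 2 volume) (h : Tendsto (fun n => eLpNorm (v n - u) 2 volume) atTop (𝓝 0)) :
    Tendsto (fun n => eLpNorm ((fun x => c n x • v n x) - u) 2 volume) atTop (𝓝 0) := by
  have htail : Tendsto (fun n => eLpNorm (fun x => (c n x - 1) • u x) 2 volume) atTop (𝓝 0) := by
    have hn : (∫⁻ x, ‖(2 : ℝ) • u x‖ₑ ^ (2 : ℝ)) ≠ ⊤ := by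
      have := (hu.const_smul (2 : ℝ)).2
      rw [eLpNorm_eq_lintegral_rpow_enorm_toReal (by norm_num) (by norm_num)] at this
      simpa [ENNReal.rpow_lt_top_iff_of_pos, lt_top_iff_ne_top] using this
    have h1 : Tendsto (fun n => ∫⁻ x, ‖(c n x - 1) • u x‖ₑ ^ (2 : ℝ)) atTop (𝓝 (∫⁻ _ : R3, 0)) := by
      refine tendsto_lintegral_of_dominated_convergence' (fun x => ‖(2 : ℝ) • u x‖ₑ ^ (2 : ℝ))
        (fun n => ((((hc n).sub continuous_const).aestronglyMeasurable.smul hu.1).enorm.pow_const _))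
        (fun n => Eventually.of_forall fun x => ?_) hn (Eventually.of_forall fun x => ?_)
      · refine ENNReal.rpow_le_rpow ?_ (by norm_num)
        rw [enorm_smul, enorm_smul]
        gcongr
        rw [enorm_le_iff_norm_le, Real.norm_eq_abs, Real.norm_eq_abs, abs_of_pos (by norm_num : (0:ℝ) < 2)]
        have := abs_le.1 (hb n x)
        rw [abs_le]
        constructor <;> linarith
      · refine tendsto_const_nhds.congr' ?_
        filter_upwards [hlim x] with n hn
        simp [hn]
    rw [lintegral_zero] at h1
    have h2 := (ENNReal.continuous_rpow_const (y := 1 / 2)).tendsto 0 |>.comp h1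
    simp only [Function.comp_def, one_div, inv_pos, Nat.ofNat_pos, ENNReal.zero_rpow_of_pos] at h2
    refine h2.congr fun n => ?_
    rw [eLpNorm_eq_lintegral_rpow_enorm_toReal (by norm_num) (by norm_num)]
    simp
  have h3 := h.add htail
  rw [add_zero] at h3
  refine tendsto_of_tendsto_of_tendsto_of_le_of_le tendsto_const_nhds h3 (fun _ => zero_le) fun n => ?_
  have hcm := (hc n).aestronglyMeasurable (μ := volume)
  have e1 : (fun x => c n x • v n x) - u
      = (fun x => c n x • (v n - u) x) + fun x => (c n x - 1) • u x := by
    ext x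
    simp only [Pi.sub_apply, Pi.add_apply, smul_sub, sub_smul, one_smul]
    abel
  simp only [e1]
  refine (eLpNorm_add_le (hcm.smul ((hv n).sub hu.1))
    ((hcm.sub aestronglyMeasurable_const).smul hu.1) (by norm_num)).trans
    (add_le_add_left (eLpNorm_mono fun x => ?_) _)
  rw [Pi.smul_apply', norm_smul]
  exact mul_le_of_le_one_left (norm_nonneg _) (hb n x)

theorem pd_smul {χ : R3 → ℝ} {u : R3 → ℂ} (hχ : ContDiff ℝ ∞ χ) (hu : ContDiff ℝ ∞ u) (i : Fin 3)
    (x : R3) : pd i (fun x => χ x • u x) x = χ x • pd i u x + pd i χ x • u x := by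
  rw [pd, ((hχ.differentiable (by simp) x).hasFDerivAt.fun_smul
    (hu.differentiable (by simp) x).hasFDerivAt).fderiv]
  simp [pd]

/-- Test functions are dense in `H¹`: mollify and cut off. -/
theorem exists_tendsto_ofSmooth (u : H1) : ∃ (v : ℕ → R3 → ℂ) (hv : ∀ n, ContDiff ℝ ∞ (v n))
    (hc : ∀ n, HasCompactSupport (v n)),
    Tendsto (fun n => ofSmooth (hv n) (hc n)) atTop (𝓝 u) := by
  obtain ⟨χ, hχ, hχc, hχ1, hχ01⟩ := exists_cutoff 1
  have ha : ∀ n : ℕ, (0 : ℝ) < (n : ℝ) + 1 := fun n => by positivity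
  set c : ℕ → R3 → ℝ := fun n x => χ (((n : ℝ) + 1)⁻¹ • x)
  have hcs : ∀ n, ContDiff ℝ ∞ (c n) := fun n => hχ.comp (contDiff_const_smul _)
  have hcc : ∀ n, HasCompactSupport (c n) := fun n => hχc.comp_smul (inv_ne_zero (ha n).ne')
  have hcb : ∀ n x, |c n x| ≤ 1 := fun n x => by
    rw [abs_of_nonneg (hχ01 _).1]
    exact (hχ01 _).2
  have hclim : ∀ x, ∀ᶠ n in atTop, c n x = 1 := fun x => by
    obtain ⟨m, hm⟩ := exists_nat_ge ‖x‖
    filter_upwards [eventually_ge_atTop m] with n hn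
    refine hχ1 _ ?_
    rw [norm_smul, norm_inv, Real.norm_of_nonneg (ha n).le, inv_mul_le_iff₀ (ha n), mul_one]
    have : (m : ℝ) ≤ n := by exact_mod_cast hn
    linarith
  have hcd : ∀ i n x, pd i (c n) x = ((n : ℝ) + 1)⁻¹ * pd i χ (((n : ℝ) + 1)⁻¹ • x) := fun i n x => by
    rw [pd, fderiv_comp_smul]
    simp [pd]
  set m : ℕ → R3 → ℂ := fun n => smoothen n (toL2 u)
  have hui : LocallyIntegrable (toL2 u : R3 → ℂ) :=
    (Lp.memLp (toL2 u)).locallyIntegrable (by norm_num)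
  have hm : ∀ n, ContDiff ℝ ∞ (m n) := fun n => contDiff_smoothen n hui
  have hmL := fun n => memLp_smoothen (Lp.memLp (toL2 u)) n
  have hpm : ∀ n i, pd i (m n) = smoothen n (gradL i u) := fun n i =>
    funext fun x => fderiv_smoothen hui (isWeakDeriv_gradL u i) n x
  have hv : ∀ n, ContDiff ℝ ∞ fun x => c n x • m n x := fun n => (hcs n).smul (hm n)
  have hvc : ∀ n, HasCompactSupport fun x => c n x • m n x := fun n => (hcc n).smul_right
  refine ⟨fun n x => c n x • m n x, hv, hvc, tendsto_H1 ?_ fun i => ?_⟩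
  · rw [Lp.tendsto_Lp_iff_tendsto_eLpNorm']
    refine (tendsto_eLpNorm_smul_sub (fun n => (hcs n).continuous) hcb hclim
      (fun n => (hm n).continuous.aestronglyMeasurable) (Lp.memLp (toL2 u))
      (tendsto_eLpNorm_smoothen_sub (Lp.memLp (toL2 u)))).congr fun n => ?_
    exact eLpNorm_congr_ae ((coeFn_ofSmooth (hv n) (hvc n)).symm.sub (ae_eq_refl _))
  · rw [Lp.tendsto_Lp_iff_tendsto_eLpNorm']
    have h1 := tendsto_eLpNorm_smul_sub (fun n => (hcs n).continuous) hcb hclim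
      (v := fun n => pd i (m n))
      (fun n => (contDiff_pd (hm n) i).continuous.aestronglyMeasurable) (Lp.memLp (gradL i u))
      (by simp only [hpm]; exact tendsto_eLpNorm_smoothen_sub (Lp.memLp (gradL i u)))
    obtain ⟨D, hD⟩ := (hasCompactSupport_pd hχc i).exists_bound_of_continuous
      (contDiff_pd hχ i).continuous
    have hD0 : 0 ≤ D := (norm_nonneg _).trans (hD 0)
    obtain ⟨B, hB, hBb⟩ : ∃ B : ℝ≥0∞, B ≠ ⊤ ∧ ∀ n, eLpNorm (m n) 2 volume ≤ B := by
      obtain ⟨n₀, hn₀⟩ := eventually_atTop.1 ((tendsto_eLpNorm_smoothen_sub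
        (Lp.memLp (toL2 u))).eventually_le_const (zero_lt_one (α := ℝ≥0∞)))
      refine ⟨(1 + eLpNorm (toL2 u) 2 volume) + ∑ n ∈ Finset.range n₀, eLpNorm (m n) 2 volume, ?_,
        fun n => ?_⟩
      · exact ENNReal.add_ne_top.2 ⟨ENNReal.add_ne_top.2 ⟨by simp, (Lp.memLp (toL2 u)).2.ne⟩,
          (ENNReal.sum_lt_top.2 fun n _ => (hmL n).2).ne⟩
      · rcases lt_or_ge n n₀ with h | h
        · exact (Finset.single_le_sum (f := fun n => eLpNorm (m n) 2 volume) (fun _ _ => zero_le)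
            (Finset.mem_range.2 h)).trans le_add_self
        · refine le_trans ?_ le_self_add
          have e1 : m n = (fun x => m n x - toL2 u x) + fun x => toL2 u x := by ext x; simp
          rw [e1]
          exact (eLpNorm_add_le ((hmL n).1.sub (Lp.memLp _).1) (Lp.memLp _).1 (by norm_num)).trans
            (add_le_add_left (hn₀ n h) _)
    -- The gradient falling on the cutoff contributes a term of order `1 / (n + 1)`.
    have h2 : Tendsto (fun n => eLpNorm (fun x => pd i (c n) x • m n x) 2 volume) atTop (𝓝 0) := by
      have h3 : Tendsto (fun n : ℕ => ENNReal.ofReal (((n : ℝ) + 1)⁻¹ * D) * B) atTop (𝓝 0) := by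
        have h4 : Tendsto (fun n : ℕ => ((n : ℝ) + 1)⁻¹ * D) atTop (𝓝 0) := by
          simpa using (tendsto_one_div_add_atTop_nhds_zero_nat (𝕜 := ℝ)).mul_const D
        have h5 := ENNReal.Tendsto.mul_const (ENNReal.tendsto_ofReal h4) (Or.inr hB)
        simpa using h5
      refine tendsto_of_tendsto_of_tendsto_of_le_of_le tendsto_const_nhds h3 (fun _ => zero_le)
        fun n => ?_
      refine (eLpNorm_le_mul_eLpNorm_of_ae_le_mul (g := m n) (c := ((n : ℝ) + 1)⁻¹ * D)
        (Eventually.of_forall fun x => ?_) 2).trans (mul_le_mul_right (hBb n) _)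
      rw [norm_smul, hcd, norm_mul, norm_inv, Real.norm_of_nonneg (ha n).le]
      gcongr
      exact hD _
    have h6 := h1.add h2
    rw [add_zero] at h6
    refine tendsto_of_tendsto_of_tendsto_of_le_of_le tendsto_const_nhds h6 (fun _ => zero_le)
      fun n => ?_
    have hmeas := (contDiff_pd (hm n) i).continuous
    have hmeas2 := (contDiff_pd (hcs n) i).continuous
    have hc0 := (hcs n).continuous
    have hm0 := (hm n).continuous
    set G : R3 → ℂ := fun x => gradL i u x
    have e2 : (fun x => gradL i (ofSmooth (hv n) (hvc n)) x - G x)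
        =ᵐ[volume] ((fun x => c n x • pd i (m n) x) - G) + fun x => pd i (c n) x • m n x := by
      filter_upwards [coeFn_gradL_ofSmooth (hv n) (hvc n) i] with x hx
      simp only [Pi.sub_apply, Pi.add_apply, hx, pd_smul (hcs n) (hm n)]
      ring
    refine (eLpNorm_congr_ae e2).trans_le ?_
    exact eLpNorm_add_le ((hc0.smul hmeas).aestronglyMeasurable.sub (Lp.memLp _).1)
      (hmeas2.smul hm0).aestronglyMeasurable (by norm_num)

/-- Two continuous maps on `H¹` which agree on test functions are equal. -/
theorem eq_of_eq_on_smooth {Y : Type*} [TopologicalSpace Y] [T2Space Y] {F G : H1 → Y}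
    (hF : Continuous F) (hG : Continuous G)
    (h : ∀ (v : R3 → ℂ) (hv : ContDiff ℝ ∞ v) (hc : HasCompactSupport v),
      F (ofSmooth hv hc) = G (ofSmooth hv hc)) (u : H1) : F u = G u := by
  obtain ⟨v, hv, hc, hlim⟩ := exists_tendsto_ofSmooth u
  have h1 := (hF.tendsto u).comp hlim
  have h2 := (hG.tendsto u).comp hlim
  refine tendsto_nhds_unique h1 (h2.congr fun n => ?_)
  exact (h (v n) (hv n) (hc n)).symm

/-- A closed condition on `H¹` which holds for test functions holds everywhere. -/
theorem le_of_le_on_smooth {F G : H1 → ℝ} (hF : Continuous F) (hG : Continuous G)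
    (h : ∀ (v : R3 → ℂ) (hv : ContDiff ℝ ∞ v) (hc : HasCompactSupport v),
      F (ofSmooth hv hc) ≤ G (ofSmooth hv hc)) (u : H1) : F u ≤ G u := by
  obtain ⟨v, hv, hc, hlim⟩ := exists_tendsto_ofSmooth u
  exact le_of_tendsto_of_tendsto' ((hF.tendsto u).comp hlim) ((hG.tendsto u).comp hlim)
    fun n => h (v n) (hv n) (hc n)

end

section

/-! ### The Sobolev and Hardy inequalities -/

theorem exists_tendsto_ofSmooth_ae (u : H1) : ∃ (v : ℕ → R3 → ℂ) (hv : ∀ n, ContDiff ℝ ∞ (v n))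
    (hc : ∀ n, HasCompactSupport (v n)),
    Tendsto (fun n => ofSmooth (hv n) (hc n)) atTop (𝓝 u) ∧
      ∀ᵐ x, Tendsto (fun n => v n x) atTop (𝓝 (toL2 u x)) := by
  obtain ⟨v, hv, hc, hlim⟩ := exists_tendsto_ofSmooth u
  obtain ⟨ns, hns, hae⟩ := (tendstoInMeasure_of_tendsto_Lp
    ((toL2.continuous.tendsto u).comp hlim)).exists_seq_tendsto_ae
  refine ⟨fun n => v (ns n), fun n => hv _, fun n => hc _, hlim.comp hns.tendsto_atTop, ?_⟩
  filter_upwards [hae, ae_all_iff.2 fun n => coeFn_ofSmooth (hv n) (hc n)] with x hx1 hx2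
  refine hx1.congr fun n => ?_
  exact hx2 (ns n)

theorem norm_fderiv_le_sum {E : Type*} [NormedAddCommGroup E] [NormedSpace ℝ E] {u : R3 → E} (x : R3) : ‖fderiv ℝ u x‖ ≤ ∑ i, ‖pd i u x‖ := by
  refine ContinuousLinearMap.opNorm_le_bound _ (Finset.sum_nonneg fun i _ => norm_nonneg _) fun y => ?_
  have hy : y = ∑ i, y i • e i := by
    have := (EuclideanSpace.basisFun (Fin 3) ℝ).sum_repr y
    simpa [e] using this.symm
  calc ‖fderiv ℝ u x y‖ = ‖∑ i, y i • pd i u x‖ := by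
        conv_lhs => rw [hy]
        rw [map_sum]
        simp [pd]
    _ ≤ ∑ i, ‖y i • pd i u x‖ := norm_sum_le _ _
    _ ≤ ∑ i, ‖pd i u x‖ * ‖y‖ := by
        refine Finset.sum_le_sum fun i _ => ?_
        rw [norm_smul, mul_comm]
        exact mul_le_mul_of_nonneg_left (PiLp.norm_apply_le y i) (norm_nonneg _)
    _ = _ := by rw [Finset.sum_mul]

/-- The Sobolev inequality, extended from test functions by Fatou's lemma. -/
theorem exists_eLpNorm_six_le : ∃ C : ℝ≥0, ∀ u : H1,
    eLpNorm (toL2 u) 6 volume ≤ C * ∑ i, ‖gradL i u‖ₑ := by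
  refine ⟨SNormLESNormFDerivOfEqConst ℂ (volume : Measure R3) 2, fun u => ?_⟩
  set C := SNormLESNormFDerivOfEqConst ℂ (volume : Measure R3) 2
  obtain ⟨v, hv, hc, hlim, hae⟩ := exists_tendsto_ofSmooth_ae u
  have h1 : ∀ n, eLpNorm (v n) 6 volume ≤ C * ∑ i, ‖gradL i (ofSmooth (hv n) (hc n))‖ₑ := fun n => by
    have h2 := eLpNorm_le_eLpNorm_fderiv_of_eq (volume : Measure R3) ((hv n).of_le (by simp)) (hc n)
      (p := 2) (p' := 6) (by norm_num) (by simp) (by simp; norm_num)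
    refine h2.trans (mul_le_mul_right ?_ _)
    calc eLpNorm (fderiv ℝ (v n)) 2 volume
        ≤ eLpNorm (∑ i, fun x => ‖pd i (v n) x‖) 2 volume :=
          eLpNorm_mono_real fun x => by
            rw [Finset.sum_apply]
            exact norm_fderiv_le_sum x
      _ ≤ ∑ i, eLpNorm (fun x => ‖pd i (v n) x‖) 2 volume :=
          eLpNorm_sum_le (fun i _ => (contDiff_pd (hv n) i).continuous.norm.aestronglyMeasurable)
            (by norm_num)
      _ = ∑ i, ‖gradL i (ofSmooth (hv n) (hc n))‖ₑ := by
          refine Finset.sum_congr rfl fun i _ => ?_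
          rw [eLpNorm_norm, Lp.enorm_def]
          exact eLpNorm_congr_ae (coeFn_gradL_ofSmooth (hv n) (hc n) i).symm
  have h2 : Tendsto (fun n => (C : ℝ≥0∞) * ∑ i, ‖gradL i (ofSmooth (hv n) (hc n))‖ₑ) atTop
      (𝓝 (C * ∑ i, ‖gradL i u‖ₑ)) := by
    refine ENNReal.Tendsto.const_mul (tendsto_finsetSum _ fun i _ => ?_) (Or.inr ENNReal.coe_ne_top)
    exact ((continuous_enorm.comp (gradL i).continuous).tendsto u).comp hlim
  refine (Lp.eLpNorm_lim_le_liminf_eLpNorm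
    (fun n => (hv n).continuous.aestronglyMeasurable) _ hae).trans ?_
  rw [← h2.liminf_eq]
  exact liminf_le_liminf (Eventually.of_forall h1)

theorem memLp_six (u : H1) : MemLp (toL2 u) 6 volume := by
  obtain ⟨C, hC⟩ := exists_eLpNorm_six_le
  refine ⟨(Lp.memLp (toL2 u)).1, (hC u).trans_lt ?_⟩
  exact ENNReal.mul_lt_top ENNReal.coe_lt_top (ENNReal.sum_lt_top.2 fun i _ => enorm_lt_top)

theorem norm_gradL_le (u : H1) (i : Fin 3) : ‖gradL i u‖ ≤ ‖u‖ := by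
  have h := norm_sq_H1 u
  have h1 : ‖gradL i u‖ ^ 2 ≤ ∑ i, ‖gradL i u‖ ^ 2 :=
    Finset.single_le_sum (f := fun i => ‖gradL i u‖ ^ 2) (fun i _ => sq_nonneg _) (Finset.mem_univ i)
  exact (abs_le_of_sq_le_sq' (by nlinarith [sq_nonneg ‖toL2 u‖]) (norm_nonneg _)).2

instance : Fact ((1 : ℝ≥0∞) ≤ 6) := ⟨by norm_num⟩

/-- The Sobolev embedding `H¹ → L⁶`. -/
def toL6 : H1 →L[ℂ] Lp ℂ 6 (volume : Measure R3) :=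
  LinearMap.mkContinuousOfExistsBound
    { toFun := fun u => (memLp_six u).toLp _
      map_add' := fun u v => by
        rw [← MemLp.toLp_add (memLp_six u) (memLp_six v)]
        refine MemLp.toLp_congr _ _ ?_
        rw [map_add]
        exact Lp.coeFn_add _ _
      map_smul' := fun c u => by
        rw [RingHom.id_apply, ← MemLp.toLp_const_smul c (memLp_six u)]
        refine MemLp.toLp_congr _ _ ?_
        rw [map_smul]
        exact Lp.coeFn_smul _ _ } <| by
    obtain ⟨C, hC⟩ := exists_eLpNorm_six_le
    refine ⟨C * 3, fun u => ?_⟩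
    change ‖(memLp_six u).toLp _‖ ≤ _
    rw [Lp.norm_toLp]
    refine (ENNReal.toReal_mono ?_ (hC u)).trans ?_
    · exact (ENNReal.mul_lt_top ENNReal.coe_lt_top
        (ENNReal.sum_lt_top.2 fun i _ => enorm_lt_top)).ne
    · rw [ENNReal.toReal_mul, ENNReal.toReal_sum fun i _ => enorm_ne_top]
      simp only [toReal_enorm, ENNReal.coe_toReal]
      rw [mul_assoc]
      refine mul_le_mul_of_nonneg_left ?_ C.2
      calc ∑ i, ‖gradL i u‖ ≤ ∑ _i : Fin 3, ‖u‖ := Finset.sum_le_sum fun i _ => norm_gradL_le u i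
        _ = 3 * ‖u‖ := by simp

theorem coeFn_toL6 (u : H1) : toL6 u =ᵐ[volume] toL2 u := (memLp_six u).coeFn_toLp

theorem norm_sq_L2 (f : L2) : ‖f‖ ^ 2 = ∫ x, ‖f x‖ ^ 2 := by
  have h1 := L2.inner_def (𝕜 := ℂ) f f
  simp only [inner_self_eq_norm_sq_to_K] at h1
  have h2 : ∫ x, ((‖f x‖ : ℂ)) ^ 2 = ((∫ x, ‖f x‖ ^ 2 : ℝ) : ℂ) := by
    rw [← integral_complex_ofReal]
    simp
  rw [show (∫ x, ((RCLike.ofReal ‖f x‖ : ℂ)) ^ 2) = _ from h2] at h1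
  apply Complex.ofReal_injective
  rw [← h1]
  simp

theorem integrable_norm_sq_L2 (f : L2) : Integrable fun x => ‖f x‖ ^ 2 :=
  (Lp.memLp f).integrable_norm_pow (by norm_num)

theorem pd_norm_sq {v : R3 → ℂ} (hv : ContDiff ℝ ∞ v) (i : Fin 3) (y : R3) :
    pd i (fun y => ‖v y‖ ^ 2) y = 2 * inner ℝ (v y) (pd i v y) := by
  rw [pd, ((hv.differentiable (by simp) y).hasFDerivAt.norm_sq).fderiv]
  simp [pd]
  ring

/-- The square of the Hardy weight, with a regularized singularity at `x`. -/
def hardyWeight (x : R3) (ε : ℝ) (y : R3) : ℝ := (‖x - y‖ ^ 2 + ε) ^ (-1 : ℝ)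

section hardyWeight

variable (x : R3) {ε : ℝ} (hε : 0 < ε)
include hε

theorem hardyWeight_pos (y : R3) : 0 < hardyWeight x ε y := by
  have : 0 < ‖x - y‖ ^ 2 + ε := by positivity
  exact Real.rpow_pos_of_pos this _

theorem norm_sq_mul_hardyWeight_le (y : R3) : ‖x - y‖ ^ 2 * hardyWeight x ε y ≤ 1 := by
  have : 0 < ‖x - y‖ ^ 2 + ε := by positivity
  rw [hardyWeight, Real.rpow_neg_one, ← div_eq_mul_inv, div_le_one this]
  linarith

theorem contDiff_hardyWeight : ContDiff ℝ ∞ (hardyWeight x ε) := by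
  refine ContDiff.rpow_const_of_ne ?_ fun y => by positivity
  exact ((contDiff_const.sub contDiff_id).norm_sq ℝ).add contDiff_const

theorem pd_hardyWeight (i : Fin 3) (y : R3) :
    pd i (hardyWeight x ε) y = -2 * hardyWeight x ε y ^ 2 * (y i - x i) := by
  have hpos : 0 < ‖x - y‖ ^ 2 + ε := by positivity
  have h1 := pd_normSq_rpow hε x (-1) i y
  have h2 : (‖x - y‖ ^ 2 + ε) ^ ((-1 : ℝ) - 1) = hardyWeight x ε y ^ 2 := by
    rw [show ((-1 : ℝ) - 1) = (-1) * 2 by norm_num, Real.rpow_mul hpos.le, hardyWeight]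
    norm_num
  rw [h2] at h1
  change pd i (hardyWeight x ε) y = _ at h1
  rw [h1]
  ring

theorem pd_coord_mul_hardyWeight (i : Fin 3) (y : R3) :
    pd i (fun y => (y i - x i) * hardyWeight x ε y) y
      = hardyWeight x ε y - 2 * (y i - x i) ^ 2 * hardyWeight x ε y ^ 2 := by
  have h1 := ((contDiff_hardyWeight x hε).differentiable (by simp) y).hasFDerivAt
  have h2 : HasFDerivAt (fun y : R3 => y i - x i) (EuclideanSpace.proj (𝕜 := ℝ) i : R3 →L[ℝ] ℝ) y :=
    (EuclideanSpace.proj (𝕜 := ℝ) i).hasFDerivAt.sub_const _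
  have h3 := pd_hardyWeight x hε i y
  rw [pd] at h3
  rw [pd, (h2.fun_mul h1).fderiv]
  simp only [add_apply, smul_apply, smul_eq_mul, h3]
  simp [e]
  ring

end hardyWeight

/-- Hardy's inequality with a regularized singularity, by completing the square. -/
theorem hardy_regularized {v : R3 → ℂ} (hv : ContDiff ℝ ∞ v) (hc : HasCompactSupport v) (x : R3)
    {ε : ℝ} (hε : 0 < ε) :
    ∫ y, hardyWeight x ε y * ‖v y‖ ^ 2 ≤ 4 * ∑ i, ∫ y, ‖pd i v y‖ ^ 2 := by
  set q : R3 → ℝ := hardyWeight x ε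
  have hq0 : ∀ y, 0 < q y := hardyWeight_pos x hε
  have hqq : ∀ y, ‖x - y‖ ^ 2 * q y ≤ 1 := norm_sq_mul_hardyWeight_le x hε
  have hnorm : ∀ y : R3, ‖x - y‖ ^ 2 = ∑ i, (y i - x i) ^ 2 := fun y => by
    rw [norm_sub_rev, EuclideanSpace.norm_sq_eq]
    simp
  have hqs : ContDiff ℝ ∞ q := contDiff_hardyWeight x hε
  -- The vector field `X = (y - x) q` has divergence at least `q`, since `|y - x|² q ≤ 1`.
  set X : Fin 3 → R3 → ℝ := fun i y => (y i - x i) * q y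
  have hcoord : ∀ i : Fin 3, ContDiff ℝ ∞ fun y : R3 => y i - x i := fun i =>
    (EuclideanSpace.proj (𝕜 := ℝ) i).contDiff.sub contDiff_const
  have hX : ∀ i, ContDiff ℝ ∞ (X i) := fun i => (hcoord i).mul hqs
  have hpdX : ∀ i y, pd i (X i) y = q y - 2 * (y i - x i) ^ 2 * q y ^ 2 := fun i y =>
    pd_coord_mul_hardyWeight x hε i y
  set ψ : R3 → ℝ := fun y => ‖v y‖ ^ 2
  have hψ : ContDiff ℝ ∞ ψ := hv.norm_sq ℝ
  have hψc : HasCompactSupport ψ := hc.comp_left (g := fun z : ℂ => ‖z‖ ^ 2) (by simp)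
  have hψ0 : ∀ y, 0 ≤ ψ y := fun y => sq_nonneg _
  have hparts : ∀ i, ∫ y, pd i (X i) y * ψ y = -∫ y, pd i ψ y * X i y := fun i => by
    have := weakDeriv_pd (hX i) i ψ hψ hψc (subset_univ _)
    simp only [Measure.restrict_univ, smul_eq_mul] at this
    simp only [mul_comm _ (ψ _), pd] at this ⊢
    linarith
  have hψcont := hψ.continuous
  have hqcont := hqs.continuous
  have hdv : ∀ i, Continuous (pd i v) := fun i => (contDiff_pd hv i).continuous
  have hi0 : Integrable fun y => q y * ψ y :=
    (hqcont.mul hψcont).integrable_of_hasCompactSupport hψc.mul_left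
  have hi1 : ∀ i, Integrable fun y => pd i (X i) y * ψ y := fun i =>
    ((contDiff_pd (hX i) i).continuous.mul hψcont).integrable_of_hasCompactSupport hψc.mul_left
  have hi2 : ∀ i, Integrable fun y => pd i ψ y * X i y := fun i =>
    ((contDiff_pd hψ i).continuous.mul (hX i).continuous).integrable_of_hasCompactSupport
      (hasCompactSupport_pd hψc i).mul_right
  have hi3 : ∀ i, Integrable fun y => ‖pd i v y‖ ^ 2 := fun i => by
    have h1 : Continuous fun y => ‖pd i v y‖ ^ 2 := by
      have := hdv i
      fun_prop
    have h2 : HasCompactSupport fun y => ‖pd i v y‖ ^ 2 :=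
      (hasCompactSupport_pd hc i).comp_left (g := fun z : ℂ => ‖z‖ ^ 2) (by simp)
    exact h1.integrable_of_hasCompactSupport h2
  have h1 : ∫ y, q y * ψ y ≤ ∑ i, ∫ y, pd i (X i) y * ψ y := by
    rw [← integral_finsetSum _ fun i _ => hi1 i]
    refine integral_mono hi0 (integrable_finsetSum _ fun i _ => hi1 i) fun y => ?_
    simp only [hpdX, ← Finset.sum_mul]
    refine mul_le_mul_of_nonneg_right ?_ (hψ0 y)
    rw [Finset.sum_sub_distrib, ← Finset.sum_mul, ← Finset.mul_sum, ← hnorm]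
    have := mul_le_mul_of_nonneg_right (hqq y) (hq0 y).le
    simp only [Finset.sum_const, Finset.card_univ, Fintype.card_fin, nsmul_eq_mul]
    push_cast
    nlinarith
  -- `|∇|v|²| |X| ≤ 2 |v| |∇v| |X| ≤ ½ |v|² |X|² + 2 |∇v|²` and `|X|² ≤ q`
  have h2 : -∑ i, ∫ y, pd i ψ y * X i y
      ≤ 1 / 2 * (∫ y, q y * ψ y) + 2 * ∑ i, ∫ y, ‖pd i v y‖ ^ 2 := by
    rw [← integral_finsetSum _ fun i _ => hi2 i, ← integral_neg, ← integral_const_mul,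
      ← integral_finsetSum _ fun i _ => hi3 i, ← integral_const_mul,
      ← integral_add (hi0.const_mul _) ((integrable_finsetSum _ fun i _ => hi3 i).const_mul _)]
    refine integral_mono (integrable_finsetSum _ fun i _ => hi2 i).neg
      ((hi0.const_mul _).add ((integrable_finsetSum _ fun i _ => hi3 i).const_mul _)) fun y => ?_
    have hb : ∀ i, -(pd i ψ y * X i y)
        ≤ 1 / 2 * (ψ y * ((y i - x i) ^ 2 * q y ^ 2)) + 2 * ‖pd i v y‖ ^ 2 := fun i => by
      have h3 : |pd i ψ y| ≤ 2 * (‖v y‖ * ‖pd i v y‖) := by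
        rw [show pd i ψ y = _ from pd_norm_sq hv i y, abs_mul, abs_of_pos (by norm_num : (0 : ℝ) < 2)]
        exact mul_le_mul_of_nonneg_left (abs_real_inner_le_norm _ _) (by norm_num)
      have h4 : -(pd i ψ y * X i y) ≤ 2 * (‖v y‖ * ‖pd i v y‖) * |X i y| := by
        refine (neg_le_abs _).trans ?_
        rw [abs_mul]
        exact mul_le_mul_of_nonneg_right h3 (abs_nonneg _)
      have h5 : |X i y| ^ 2 = (y i - x i) ^ 2 * q y ^ 2 := by
        rw [sq_abs, mul_pow]
      have h6 : ψ y = ‖v y‖ ^ 2 := rfl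
      rw [h6, ← h5]
      nlinarith [sq_nonneg (‖v y‖ * |X i y| - 2 * ‖pd i v y‖)]
    calc -(∑ i, pd i ψ y * X i y) = ∑ i, -(pd i ψ y * X i y) := by rw [Finset.sum_neg_distrib]
      _ ≤ ∑ i, (1 / 2 * (ψ y * ((y i - x i) ^ 2 * q y ^ 2)) + 2 * ‖pd i v y‖ ^ 2) :=
          Finset.sum_le_sum fun i _ => hb i
      _ = 1 / 2 * (ψ y * (‖x - y‖ ^ 2 * q y * q y)) + 2 * ∑ i, ‖pd i v y‖ ^ 2 := by
          rw [Finset.sum_add_distrib, ← Finset.mul_sum, ← Finset.mul_sum, ← Finset.mul_sum,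
            ← Finset.sum_mul, ← hnorm]
          ring
      _ ≤ _ := by
          have h7 := mul_le_mul_of_nonneg_right (hqq y) (hq0 y).le
          have h8 := mul_le_mul_of_nonneg_left h7 (hψ0 y)
          linarith
  simp only [hparts, Finset.sum_neg_distrib] at h1
  linarith

/-- Hardy's inequality, from the regularized inequality for test functions by Fatou's lemma. -/
theorem hardy (u : H1) (x : R3) :
    ∫⁻ y, ENNReal.ofReal ((‖x - y‖ ^ 2)⁻¹ * ‖toL2 u y‖ ^ 2)
      ≤ ENNReal.ofReal (4 * ∑ i, ‖gradL i u‖ ^ 2) := by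
  obtain ⟨v, hv, hc, hlim, hae⟩ := exists_tendsto_ofSmooth_ae u
  have hne : ∀ᵐ y : R3, y ≠ x := by simp [ae_iff]
  set F : ℕ → R3 → ℝ≥0∞ := fun n y =>
    ENNReal.ofReal (hardyWeight x (1 / ((n : ℝ) + 1)) y * ‖v n y‖ ^ 2)
  have hε : ∀ n : ℕ, 0 < 1 / ((n : ℝ) + 1) := fun n => by positivity
  have hcw : ∀ n : ℕ, Continuous fun y => hardyWeight x (1 / ((n : ℝ) + 1)) y * ‖v n y‖ ^ 2 := fun n => by
    have h1 := (contDiff_hardyWeight x (hε n)).continuous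
    have h2 := (hv n).continuous
    fun_prop
  have hcont : ∀ n, Continuous (F n) := fun n => ENNReal.continuous_ofReal.comp (hcw n)
  have h1 : ∀ n, ∫⁻ y, F n y ≤ ENNReal.ofReal (4 * ∑ i, ‖gradL i (ofSmooth (hv n) (hc n))‖ ^ 2) :=
    fun n => by
      have h2 := hardy_regularized (hv n) (hc n) x (hε n)
      have h3 : ∀ i, ‖gradL i (ofSmooth (hv n) (hc n))‖ ^ 2 = ∫ y, ‖pd i (v n) y‖ ^ 2 := fun i => by
        rw [norm_sq_L2]
        refine integral_congr_ae ?_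
        filter_upwards [coeFn_gradL_ofSmooth (hv n) (hc n) i] with y hy
        rw [hy]
      simp only [h3]
      rw [← ofReal_integral_eq_lintegral_ofReal]
      · exact ENNReal.ofReal_le_ofReal h2
      · have h4 : HasCompactSupport fun y => ‖v n y‖ ^ 2 :=
          (hc n).comp_left (g := fun z : ℂ => ‖z‖ ^ 2) (by simp)
        exact (hcw n).integrable_of_hasCompactSupport h4.mul_left
      · exact Eventually.of_forall fun y =>
          mul_nonneg (hardyWeight_pos x (hε n) y).le (sq_nonneg _)
  have h2 : Tendsto (fun n => ENNReal.ofReal (4 * ∑ i, ‖gradL i (ofSmooth (hv n) (hc n))‖ ^ 2)) atTop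
      (𝓝 (ENNReal.ofReal (4 * ∑ i, ‖gradL i u‖ ^ 2))) := by
    refine ENNReal.tendsto_ofReal ((tendsto_finsetSum _ fun i _ => ?_).const_mul 4)
    exact (((gradL i).continuous.norm.pow 2).tendsto u).comp hlim
  have hpt : ∀ y, y ≠ x → Tendsto (fun n => v n y) atTop (𝓝 (toL2 u y)) →
      Tendsto (fun n : ℕ => hardyWeight x (1 / ((n : ℝ) + 1)) y * ‖v n y‖ ^ 2) atTop
        (𝓝 ((‖x - y‖ ^ 2)⁻¹ * ‖toL2 u y‖ ^ 2)) := fun y hy1 hy2 => by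
    have hpos : 0 < ‖x - y‖ ^ 2 := by
      have := norm_pos_iff.2 (sub_ne_zero.2 hy1.symm)
      positivity
    have h3 := ((tendsto_const_nhds (x := ‖x - y‖ ^ 2)).add
      (tendsto_one_div_add_atTop_nhds_zero_nat (𝕜 := ℝ)))
    rw [add_zero] at h3
    have h4 : Tendsto (fun n : ℕ => hardyWeight x (1 / ((n : ℝ) + 1)) y) atTop
        (𝓝 (‖x - y‖ ^ 2)⁻¹) := by
      simpa only [hardyWeight, Real.rpow_neg_one] using h3.inv₀ hpos.ne'
    exact h4.mul (hy2.norm.pow 2)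
  calc ∫⁻ y, ENNReal.ofReal ((‖x - y‖ ^ 2)⁻¹ * ‖toL2 u y‖ ^ 2)
      = ∫⁻ y, liminf (fun n => F n y) atTop := by
        refine lintegral_congr_ae ?_
        filter_upwards [hne, hae] with y hy1 hy2
        exact (ENNReal.tendsto_ofReal (hpt y hy1 hy2)).liminf_eq.symm
    _ ≤ liminf (fun n => ∫⁻ y, F n y) atTop := lintegral_liminf_le fun n => (hcont n).measurable
    _ ≤ liminf (fun n => ENNReal.ofReal (4 * ∑ i, ‖gradL i (ofSmooth (hv n) (hc n))‖ ^ 2)) atTop :=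
        liminf_le_liminf (Eventually.of_forall h1)
    _ = _ := h2.liminf_eq

end

section

/-! ### Correlations of functions in dual Lebesgue spaces -/

instance : Fact ((1 : ℝ≥0∞) ≤ 3) := ⟨by norm_num⟩

instance : Fact ((1 : ℝ≥0∞) ≤ 3 / 2) :=
  ⟨by rw [ENNReal.le_div_iff_mul_le (by simp) (by simp)]; norm_num⟩

instance : ENNReal.HolderTriple (3 / 2) 3 1 := ⟨by
  rw [ENNReal.inv_div (by simp) (by simp), ← one_div, ENNReal.div_add_div_same,
    show (2 : ℝ≥0∞) + 1 = 3 by norm_num, ENNReal.div_self (by simp) (by simp), inv_one]⟩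

instance : ENNReal.HolderTriple 6 6 3 := ⟨by
  rw [← one_div, ENNReal.div_add_div_same, show (1 : ℝ≥0∞) + 1 = 2 by norm_num,
    show (6 : ℝ≥0∞) = 2 * 3 by norm_num, ← one_div, ← ENNReal.mul_div_mul_left 1 3 (c := 2) (by simp) (by simp),
    mul_one]⟩

instance : ENNReal.HolderTriple 2 6 (3 / 2) := ⟨by
  rw [ENNReal.inv_div (by simp) (by simp), ← one_div, ← one_div,
    ← ENNReal.mul_div_mul_left 1 2 (c := 3) (by simp) (by simp),
    show (3 : ℝ≥0∞) * 2 = 6 by norm_num, ENNReal.div_add_div_same,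
    show (3 : ℝ≥0∞) * 1 + 1 = 2 * 2 by norm_num, show (6 : ℝ≥0∞) = 2 * 3 by norm_num,
    ENNReal.mul_div_mul_left 2 3 (c := 2) (by simp) (by simp)]⟩

/-- The correlation `z ↦ ∫ a(x) b(x - z) dx`. -/
def corr (a b : R3 → ℝ) (z : R3) : ℝ := ∫ x, a x * b (x - z)

theorem corr_eq_convolution (a b : R3 → ℝ) :
    corr a b = convolution a (fun x => b (-x)) (ContinuousLinearMap.mul ℝ ℝ) volume := by
  ext z
  simp [corr, convolution]

theorem corr_neg (a b : R3 → ℝ) (z : R3) : corr a b (-z) = corr b a z := by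
  rw [corr, corr, ← integral_sub_right_eq_self _ z]
  refine integral_congr_ae (.of_forall fun x => ?_)
  simp only [sub_neg_eq_add, sub_add_cancel]
  ring

theorem corr_congr {a a' b b' : R3 → ℝ} (ha : a =ᵐ[volume] a') (hb : b =ᵐ[volume] b') :
    corr a b = corr a' b' := by
  ext z
  refine integral_congr_ae ?_
  filter_upwards [ha, (measurePreserving_sub_right volume z).quasiMeasurePreserving.ae_eq_comp hb]
    with x h1 h2
  simp only [Function.comp_apply] at h2
  rw [h1, h2]

/-- The translation of `b` by `z`, that is, `x ↦ b(x - z)`. -/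
def translate (z : R3) (b : Lp ℝ 3 (volume : Measure R3)) : Lp ℝ 3 (volume : Measure R3) :=
  DomAddAct.mk (-z) +ᵥ b

theorem coeFn_translate (z : R3) (b : Lp ℝ 3 (volume : Measure R3)) :
    translate z b =ᵐ[volume] fun x => b (x - z) := by
  filter_upwards [DomAddAct.vadd_Lp_ae_eq (DomAddAct.mk (-z)) b] with x hx
  rw [translate, hx]
  simp [neg_add_eq_sub]

theorem continuous_translate (b : Lp ℝ 3 (volume : Measure R3)) :
    Continuous fun z => translate z b :=
  have : Fact ((3 : ℝ≥0∞) ≠ ⊤) := ⟨by simp⟩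
  Continuous.vadd (DomAddAct.continuous_mk.comp continuous_neg) continuous_const

/-- The duality between `L^{3/2}` and `L³`. -/
def dualPairing : Lp ℝ (3 / 2) (volume : Measure R3) →L[ℝ] Lp ℝ 3 (volume : Measure R3) →L[ℝ] ℝ :=
  ContinuousLinearMap.lpPairing volume (3 / 2) 3 (ContinuousLinearMap.mul ℝ ℝ)

theorem corr_eq_dualPairing (a : Lp ℝ (3 / 2) (volume : Measure R3))
    (b : Lp ℝ 3 (volume : Measure R3)) (z : R3) : corr a b z = dualPairing a (translate z b) := by
  rw [dualPairing, ContinuousLinearMap.lpPairing_eq_integral, corr]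
  refine integral_congr_ae ?_
  filter_upwards [coeFn_translate z b] with x hx
  simp [hx]

theorem norm_dualPairing_le (a : Lp ℝ (3 / 2) (volume : Measure R3))
    (b : Lp ℝ 3 (volume : Measure R3)) : ‖dualPairing a b‖ ≤ ‖a‖ * ‖b‖ := by
  have h : dualPairing a b = L1.integral ((ContinuousLinearMap.mul ℝ ℝ).holder 1 a b) := by
    rw [dualPairing, ContinuousLinearMap.lpPairing_eq_integral, L1.integral_eq_integral]
    exact integral_congr_ae (ContinuousLinearMap.coeFn_holder _ _ _).symm
  rw [h]
  refine (L1.norm_integral_le _).trans ((ContinuousLinearMap.norm_holder_apply_apply_le _ _ _).trans ?_)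
  have := ContinuousLinearMap.opNorm_mul_le ℝ ℝ
  have h0 := norm_nonneg a
  have h1 := norm_nonneg b
  calc ‖ContinuousLinearMap.mul ℝ ℝ‖ * ‖a‖ * ‖b‖ ≤ 1 * ‖a‖ * ‖b‖ := by gcongr
    _ = _ := by ring

theorem abs_corr_le (a : Lp ℝ (3 / 2) (volume : Measure R3))
    (b : Lp ℝ 3 (volume : Measure R3)) (z : R3) : |corr a b z| ≤ ‖a‖ * ‖b‖ := by
  rw [corr_eq_dualPairing, ← Real.norm_eq_abs]
  refine (norm_dualPairing_le _ _).trans_eq ?_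
  rw [translate, DomAddAct.norm_vadd_Lp]

theorem continuous_corr (a : Lp ℝ (3 / 2) (volume : Measure R3))
    (b : Lp ℝ 3 (volume : Measure R3)) : Continuous (corr a b) := by
  rw [show corr a b = _ from funext (corr_eq_dualPairing a b)]
  exact (dualPairing a).continuous.comp (continuous_translate b)

theorem memLp_corr (a : Lp ℝ (3 / 2) (volume : Measure R3)) (b : Lp ℝ 3 (volume : Measure R3)) :
    MemLp (corr a b) ∞ (volume : Measure R3) :=
  memLp_top_of_bound (continuous_corr a b).aestronglyMeasurable _
    (.of_forall fun z => (Real.norm_eq_abs _).trans_le (abs_corr_le a b z))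

theorem corr_add_left (a a' : Lp ℝ (3 / 2) (volume : Measure R3))
    (b : Lp ℝ 3 (volume : Measure R3)) (z : R3) :
    corr (a + a' : Lp ℝ (3 / 2) volume) b z = corr a b z + corr a' b z := by
  rw [corr_eq_dualPairing, corr_eq_dualPairing, corr_eq_dualPairing, map_add, add_apply]

theorem corr_smul_left (c : ℝ) (a : Lp ℝ (3 / 2) (volume : Measure R3))
    (b : Lp ℝ 3 (volume : Measure R3)) (z : R3) :
    corr (c • a : Lp ℝ (3 / 2) volume) b z = c * corr a b z := by
  rw [corr_eq_dualPairing, corr_eq_dualPairing, map_smul, smul_apply, smul_eq_mul]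

theorem corr_add_right (a : Lp ℝ (3 / 2) (volume : Measure R3))
    (b b' : Lp ℝ 3 (volume : Measure R3)) (z : R3) :
    corr a (b + b' : Lp ℝ 3 volume) z = corr a b z + corr a b' z := by
  rw [corr_eq_dualPairing, corr_eq_dualPairing, corr_eq_dualPairing, translate,
    DomAddAct.vadd_Lp_add, map_add]
  rfl

theorem corr_smul_right (c : ℝ) (a : Lp ℝ (3 / 2) (volume : Measure R3))
    (b : Lp ℝ 3 (volume : Measure R3)) (z : R3) :
    corr a (c • b : Lp ℝ 3 volume) z = c * corr a b z := by
  have h : corr a (c • b : Lp ℝ 3 volume) z = corr a (fun x => c * b x) z :=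
    congrFun (corr_congr ae_eq_rfl (Lp.coeFn_smul c b)) z
  rw [h, corr, corr, ← integral_const_mul]
  exact integral_congr_ae (.of_forall fun x => by ring)

/-- The correlation, as a bilinear map `L^{3/2} × L³ → L^∞`. -/
def corrL : Lp ℝ (3 / 2) (volume : Measure R3) →L[ℝ] Lp ℝ 3 (volume : Measure R3) →L[ℝ]
    Lp ℝ ∞ (volume : Measure R3) :=
  LinearMap.mkContinuous₂
    (LinearMap.mk₂ ℝ (fun a b => (memLp_corr a b).toLp (corr a b))
      (fun a a' b => by
        rw [← MemLp.toLp_add (memLp_corr a b) (memLp_corr a' b)]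
        exact MemLp.toLp_congr _ _ (.of_forall fun z => corr_add_left a a' b z))
      (fun c a b => by
        rw [← MemLp.toLp_const_smul c (memLp_corr a b)]
        exact MemLp.toLp_congr _ _ (.of_forall fun z => corr_smul_left c a b z))
      (fun a b b' => by
        rw [← MemLp.toLp_add (memLp_corr a b) (memLp_corr a b')]
        exact MemLp.toLp_congr _ _ (.of_forall fun z => corr_add_right a b b' z))
      (fun c a b => by
        rw [← MemLp.toLp_const_smul c (memLp_corr a b)]
        exact MemLp.toLp_congr _ _ (.of_forall fun z => corr_smul_right c a b z)))
    1 fun a b => by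
      simp only [LinearMap.mk₂_apply, one_mul]
      rw [Lp.norm_toLp]
      refine ENNReal.toReal_le_of_le_ofReal (by positivity) ?_
      rw [eLpNorm_exponent_top]
      exact eLpNormEssSup_le_of_ae_bound
        (.of_forall fun z => (Real.norm_eq_abs _).trans_le (abs_corr_le a b z))

theorem coeFn_corrL (a : Lp ℝ (3 / 2) (volume : Measure R3)) (b : Lp ℝ 3 (volume : Measure R3)) :
    corrL a b =ᵐ[volume] corr a b :=
  (memLp_corr a b).coeFn_toLp

attribute [irreducible] corrL

/-- The substitution `z = x - y` in an integral over pairs. -/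
theorem measurePreserving_fst_sub :
    MeasurePreserving (fun p : R3 × R3 => (p.1, p.1 - p.2)) volume volume := by
  have h1 : MeasurePreserving (fun p : R3 × R3 => (p.1, -p.2)) volume volume :=
    (MeasurePreserving.id volume).prod (Measure.measurePreserving_neg volume)
  have h2 : MeasurePreserving (fun p : R3 × R3 => (p.1, p.1 + p.2)) volume volume :=
    measurePreserving_prod_add volume volume
  convert h2.comp h1 using 2 with p
  simp [sub_eq_add_neg]

theorem measurableEmbedding_fst_sub :
    MeasurableEmbedding (fun p : R3 × R3 => (p.1, p.1 - p.2)) := by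
  have h : MeasurableEmbedding ((MeasurableEquiv.mk
    ⟨fun p : R3 × R3 => (p.1, p.1 - p.2), fun p => (p.1, p.1 - p.2), fun p => by simp,
      fun p => by simp⟩ (show Measurable fun p : R3 × R3 => (p.1, p.1 - p.2) by fun_prop)
    (show Measurable fun p : R3 × R3 => (p.1, p.1 - p.2) by fun_prop)) : R3 × R3 ≃ᵐ R3 × R3) :=
    MeasurableEquiv.measurableEmbedding _
  exact h

section pairInteraction

variable {m ρ σ : R3 → ℝ} (hm : Integrable m) (hρ : MemLp ρ (3 / 2) volume)
  (hσ : MemLp σ 3 volume)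
include hm hρ hσ

theorem integrable_mul_corr : Integrable fun z => m z * corr ρ σ z := by
  rw [corr_congr hρ.coeFn_toLp.symm hσ.coeFn_toLp.symm]
  exact hm.mul_bdd (continuous_corr _ _).aestronglyMeasurable
    (.of_forall fun z => (Real.norm_eq_abs _).trans_le (abs_corr_le _ _ z))

theorem integrable_shifted_pair_and_integral_eq :
    Integrable (fun p : R3 × R3 => m p.2 * (ρ p.1 * σ (p.1 - p.2))) ∧
      ∫ p : R3 × R3, m p.2 * (ρ p.1 * σ (p.1 - p.2)) = ∫ z, m z * corr ρ σ z := by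
  have hmeas : AEStronglyMeasurable (fun p : R3 × R3 => m p.2 * (ρ p.1 * σ (p.1 - p.2)))
      ((volume : Measure R3).prod volume) :=
    hm.1.comp_snd.mul (hρ.1.comp_fst.mul (aestronglyMeasurable_comp_sub hσ.1))
  have hint : Integrable (fun p : R3 × R3 => m p.2 * (ρ p.1 * σ (p.1 - p.2))) := by
    refine (integrable_prod_iff' hmeas).2 ⟨.of_forall fun z => ?_, ?_⟩
    · exact ((hρ.integrable_mul
        (hσ.comp_measurePreserving (measurePreserving_sub_right volume z))).const_mul (m z))
    · have h := integrable_mul_corr hm.norm hρ.norm hσ.norm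
      refine h.congr (.of_forall fun z => ?_)
      simp only [corr, norm_mul]
      rw [integral_const_mul]
  refine ⟨hint, ?_⟩
  rw [Measure.volume_eq_prod, integral_prod_symm _ hint]
  simp only [corr, integral_const_mul]

/-- An interaction `m(x - y)` between two densities in dual Lebesgue spaces is integrable. -/
theorem integrable_pair : Integrable fun p : R3 × R3 => m (p.1 - p.2) * (ρ p.1 * σ p.2) := by
  refine (measurePreserving_fst_sub.integrable_comp_emb measurableEmbedding_fst_sub).1 ?_
  simpa [Function.comp_def] using (integrable_shifted_pair_and_integral_eq hm hρ hσ).1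

theorem integral_pair :
    ∫ p : R3 × R3, m (p.1 - p.2) * (ρ p.1 * σ p.2) = ∫ z, m z * corr ρ σ z := by
  rw [← (integrable_shifted_pair_and_integral_eq hm hρ hσ).2,
    ← measurePreserving_fst_sub.integral_comp measurableEmbedding_fst_sub]
  simp

theorem integral_corr_mul (heven : ∀ z, m (-z) = m z) :
    ∫ x, corr σ m x * ρ x = ∫ z, m z * corr ρ σ z := by
  rw [← integral_pair hm hρ hσ, Measure.volume_eq_prod, integral_prod _ (integrable_pair hm hρ hσ)]
  refine integral_congr_ae (.of_forall fun x => ?_)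
  simp only [corr]
  rw [← integral_mul_const]
  refine integral_congr_ae (.of_forall fun y => ?_)
  simp only
  rw [← heven (y - x), neg_sub]
  ring

end pairInteraction

end

section

/-! ### The Hartree nonlinearity on `H¹` -/

/-- The real inner product of complex numbers, as a bounded bilinear map
`L² × L⁶ → L^{3/2}`. -/
def innerL : L2 →L[ℝ] Lp ℂ 6 (volume : Measure R3) →L[ℝ] Lp ℝ (3 / 2) (volume : Measure R3) :=
  (innerSL ℝ : ℂ →L[ℝ] ℂ →L[ℝ] ℝ).holderL volume 2 6 (3 / 2)

/-- The density `Re (ū v)` in `L^{3/2}`. -/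
def density32 : H1 →L[ℝ] H1 →L[ℝ] Lp ℝ (3 / 2) (volume : Measure R3) :=
  innerL.bilinearComp (toL2.restrictScalars ℝ) (toL6.restrictScalars ℝ)

/-- The density `Re (ū v)` in `L³`. -/
def density3 : H1 →L[ℝ] H1 →L[ℝ] Lp ℝ 3 (volume : Measure R3) :=
  ((innerSL ℝ : ℂ →L[ℝ] ℂ →L[ℝ] ℝ).holderL volume 6 6 3).bilinearComp
    (toL6.restrictScalars ℝ) (toL6.restrictScalars ℝ)

/-- The density `∂ᵢ|u|² = 2 Re (∂ᵢū u)` in `L^{3/2}`. -/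
def gradDensity (i : Fin 3) (u : H1) : Lp ℝ (3 / 2) (volume : Measure R3) :=
  (2 : ℝ) • innerL (gradL i u) (toL6 u)

theorem coeFn_innerL (f : L2) (u : H1) :
    innerL f (toL6 u) =ᵐ[volume] fun x => inner ℝ (f x) (toL2 u x) := by
  filter_upwards [(innerSL ℝ : ℂ →L[ℝ] ℂ →L[ℝ] ℝ).coeFn_holder (r := 3 / 2) f (toL6 u), coeFn_toL6 u]
    with x h1 h2
  rw [← h2]
  exact h1

theorem coeFn_density32 (u v : H1) :
    density32 u v =ᵐ[volume] fun x => inner ℝ (toL2 u x) (toL2 v x) :=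
  coeFn_innerL (toL2 u) v

theorem coeFn_density3 (u v : H1) :
    density3 u v =ᵐ[volume] fun x => inner ℝ (toL2 u x) (toL2 v x) := by
  filter_upwards [(innerSL ℝ : ℂ →L[ℝ] ℂ →L[ℝ] ℝ).coeFn_holder (r := 3) (toL6 u) (toL6 v),
    coeFn_toL6 u, coeFn_toL6 v] with x h1 h2 h3
  rw [← h2, ← h3]
  exact h1

theorem coeFn_gradDensity (i : Fin 3) (u : H1) :
    gradDensity i u =ᵐ[volume] fun x => 2 * inner ℝ (gradL i u x) (toL2 u x) := by
  filter_upwards [Lp.coeFn_smul (2 : ℝ) (innerL (gradL i u) (toL6 u)), coeFn_innerL (gradL i u) u]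
    with x h1 h2
  rw [gradDensity, h1, Pi.smul_apply, h2, smul_eq_mul]

theorem coeFn_density32_self (u : H1) : density32 u u =ᵐ[volume] fun x => ‖toL2 u x‖ ^ 2 := by
  filter_upwards [coeFn_density32 u u] with x h
  rw [h, real_inner_self_eq_norm_sq]

theorem coeFn_density3_self (u : H1) : density3 u u =ᵐ[volume] fun x => ‖toL2 u x‖ ^ 2 := by
  filter_upwards [coeFn_density3 u u] with x h
  rw [h, real_inner_self_eq_norm_sq]

theorem continuous_density32_self : Continuous fun u : H1 => density32 u u :=
  (density32.continuous).clm_apply continuous_id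

theorem continuous_density3_self : Continuous fun u : H1 => density3 u u :=
  (density3.continuous).clm_apply continuous_id

theorem continuous_gradDensity (i : Fin 3) : Continuous (gradDensity i) :=
  ((innerL.continuous.comp (gradL i).continuous).clm_apply toL6.continuous).const_smul (2 : ℝ)

theorem re_inner_L2 (f g : L2) : (inner ℂ f g : ℂ).re = ∫ x, inner ℝ (f x) (g x) := by
  rw [L2.inner_def]
  have := integral_re (𝕜 := ℂ) (L2.integrable_inner (𝕜 := ℂ) f g)
  exact this.symm

/-- Multiplication of a function in `L²` by a bounded real function. -/
def boundedMul : Lp ℝ ∞ (volume : Measure R3) →L[ℝ] L2 →L[ℝ] L2 :=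
  (ContinuousLinearMap.lsmul ℝ ℝ : ℝ →L[ℝ] ℂ →L[ℝ] ℂ).holderL volume ∞ 2 2

theorem coeFn_boundedMul (c : Lp ℝ ∞ (volume : Measure R3)) (f : L2) :
    boundedMul c f =ᵐ[volume] fun x => c x • f x :=
  (ContinuousLinearMap.lsmul ℝ ℝ : ℝ →L[ℝ] ℂ →L[ℝ] ℂ).coeFn_holder (r := 2) c f

theorem coeFn_boundedMul_corrL (a : Lp ℝ (3 / 2) (volume : Measure R3))
    (b : Lp ℝ 3 (volume : Measure R3)) (f : L2) :
    boundedMul (corrL a b) f =ᵐ[volume] fun x => corr a b x • f x := by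
  filter_upwards [coeFn_boundedMul (corrL a b) f, coeFn_corrL a b] with x h1 h2
  rw [h1, h2]

/-- The function `(W * |u|²) u`, for even `W`: the convolution is then a correlation. -/
def hartreeL2 (W : Lp ℝ 3 (volume : Measure R3)) (u : H1) : L2 :=
  boundedMul (corrL (density32 u u) W) (toL2 u)

/-- The partial derivatives `(W * ∂ᵢ|u|²) u + (W * |u|²) ∂ᵢu` of `(W * |u|²) u`. -/
def hartreeGrad (W : Lp ℝ 3 (volume : Measure R3)) (u : H1) (i : Fin 3) : L2 :=
  boundedMul (corrL (gradDensity i u) W) (toL2 u) + boundedMul (corrL (density32 u u) W) (gradL i u)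

theorem continuous_hartreeL2 (W : Lp ℝ 3 (volume : Measure R3)) : Continuous (hartreeL2 W) :=
  (boundedMul.continuous.comp ((corrL.continuous.comp continuous_density32_self).clm_apply
    continuous_const)).clm_apply toL2.continuous

theorem continuous_hartreeGrad (W : Lp ℝ 3 (volume : Measure R3)) (i : Fin 3) :
    Continuous fun u => hartreeGrad W u i :=
  ((boundedMul.continuous.comp ((corrL.continuous.comp (continuous_gradDensity i)).clm_apply
    continuous_const)).clm_apply toL2.continuous).add
  ((boundedMul.continuous.comp ((corrL.continuous.comp continuous_density32_self).clm_apply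
    continuous_const)).clm_apply (gradL i).continuous)

section smooth

variable {n b : R3 → ℝ} (hn : ContDiff ℝ ∞ n) (hc : HasCompactSupport n)
  (hb : LocallyIntegrable b volume)

include hb in
theorem locallyIntegrable_comp_neg : LocallyIntegrable (fun x : R3 => b (-x)) volume := by
  rw [locallyIntegrable_iff]
  intro K hK
  have := hb.integrableOn_isCompact hK.neg
  exact ((Measure.measurePreserving_neg volume).integrableOn_comp_preimage
    (Homeomorph.neg R3).measurableEmbedding (f := b) (s := -K)).2 this |>.mono_set (by simp)

include hn hc hb

theorem contDiff_corr : ContDiff ℝ ∞ (corr n b) := by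
  rw [corr_eq_convolution]
  exact hc.contDiff_convolution_left _ hn (locallyIntegrable_comp_neg hb)

theorem pd_corr (i : Fin 3) : pd i (corr n b) = corr (pd i n) b := by
  rw [corr_eq_convolution, corr_eq_convolution,
    pd_convolution hn hc (locallyIntegrable_comp_neg hb)]

end smooth

section ofSmooth

variable {v : R3 → ℂ} (hv : ContDiff ℝ ∞ v) (hc : HasCompactSupport v)

include hv in
theorem contDiff_normSq : ContDiff ℝ ∞ fun y => ‖v y‖ ^ 2 := hv.norm_sq ℝ

include hc in
theorem hasCompactSupport_normSq : HasCompactSupport fun y => ‖v y‖ ^ 2 :=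
  hc.comp_left (g := fun z : ℂ => ‖z‖ ^ 2) (by simp)

theorem density32_ofSmooth : density32 (ofSmooth hv hc) (ofSmooth hv hc)
    =ᵐ[volume] fun y => ‖v y‖ ^ 2 := by
  filter_upwards [coeFn_density32_self (ofSmooth hv hc), coeFn_ofSmooth hv hc] with x h1 h2
  rw [h1, h2]

theorem gradDensity_ofSmooth (i : Fin 3) : gradDensity i (ofSmooth hv hc)
    =ᵐ[volume] pd i fun y => ‖v y‖ ^ 2 := by
  filter_upwards [coeFn_gradDensity i (ofSmooth hv hc), coeFn_ofSmooth hv hc,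
    coeFn_gradL_ofSmooth hv hc i] with x h1 h2 h3
  rw [h1, h2, h3, pd_norm_sq hv, real_inner_comm]

theorem corr_density32_ofSmooth (W : Lp ℝ 3 (volume : Measure R3)) :
    corr (density32 (ofSmooth hv hc) (ofSmooth hv hc)) W = corr (fun y => ‖v y‖ ^ 2) W :=
  corr_congr (density32_ofSmooth hv hc) ae_eq_rfl

include hv hc in
theorem contDiff_hartree_ofSmooth (W : Lp ℝ 3 (volume : Measure R3)) :
    ContDiff ℝ ∞ fun x => corr (fun y => ‖v y‖ ^ 2) W x • v x :=
  (contDiff_corr (contDiff_normSq hv) (hasCompactSupport_normSq hc)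
    ((Lp.memLp W).locallyIntegrable (by norm_num))).smul hv

include hc in
theorem hasCompactSupport_hartree_ofSmooth (W : Lp ℝ 3 (volume : Measure R3)) :
    HasCompactSupport fun x => corr (fun y => ‖v y‖ ^ 2) W x • v x :=
  hc.mono fun x hx => by
    simp only [Function.mem_support, ne_eq, smul_eq_zero, not_or] at hx ⊢
    exact hx.2

theorem hartreeL2_ofSmooth (W : Lp ℝ 3 (volume : Measure R3)) :
    hartreeL2 W (ofSmooth hv hc) = toL2 (ofSmooth (contDiff_hartree_ofSmooth hv hc W)
      (hasCompactSupport_hartree_ofSmooth hc W)) := by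
  refine Lp.ext ?_
  filter_upwards [coeFn_boundedMul_corrL (density32 (ofSmooth hv hc) (ofSmooth hv hc)) W
    (toL2 (ofSmooth hv hc)), coeFn_ofSmooth hv hc,
    coeFn_ofSmooth (contDiff_hartree_ofSmooth hv hc W) (hasCompactSupport_hartree_ofSmooth hc W)]
    with x h1 h2 h3
  rw [hartreeL2, h1, h3, h2, corr_density32_ofSmooth]

theorem hartreeGrad_ofSmooth (W : Lp ℝ 3 (volume : Measure R3)) (i : Fin 3) :
    hartreeGrad W (ofSmooth hv hc) i = gradL i (ofSmooth (contDiff_hartree_ofSmooth hv hc W)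
      (hasCompactSupport_hartree_ofSmooth hc W)) := by
  have hW := (Lp.memLp W).locallyIntegrable (by norm_num)
  have hn := contDiff_normSq hv
  have hnc := hasCompactSupport_normSq hc
  refine Lp.ext ?_
  filter_upwards [coeFn_boundedMul_corrL (density32 (ofSmooth hv hc) (ofSmooth hv hc)) W
    (gradL i (ofSmooth hv hc)), coeFn_boundedMul_corrL (gradDensity i (ofSmooth hv hc)) W
    (toL2 (ofSmooth hv hc)), coeFn_ofSmooth hv hc, coeFn_gradL_ofSmooth hv hc i,
    coeFn_gradL_ofSmooth (contDiff_hartree_ofSmooth hv hc W)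
      (hasCompactSupport_hartree_ofSmooth hc W) i,
    Lp.coeFn_add (boundedMul (corrL (gradDensity i (ofSmooth hv hc)) W) (toL2 (ofSmooth hv hc)))
      (boundedMul (corrL (density32 (ofSmooth hv hc) (ofSmooth hv hc)) W)
        (gradL i (ofSmooth hv hc)))] with x h1 h2 h3 h4 h5 h6
  rw [hartreeGrad, h6, Pi.add_apply, h1, h2, h5, h3, h4, pd_smul (contDiff_corr hn hnc hW) hv,
    pd_corr hn hnc hW, corr_density32_ofSmooth, corr_congr (gradDensity_ofSmooth hv hc i) ae_eq_rfl,
    add_comm]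

end ofSmooth

/-- The product rule for `(W * |u|²) u` passes from test functions to `H¹` because both sides are
continuous from `H¹` to `L²`. -/
theorem isWeakDeriv_hartree (W : Lp ℝ 3 (volume : Measure R3)) (u : H1) (i : Fin 3) :
    IsWeakDeriv univ (e i) (hartreeL2 W u) (hartreeGrad W u i) := by
  obtain ⟨v, hv, hc, hlim⟩ := exists_tendsto_ofSmooth u
  refine exists_H1_of_tendsto (u := fun n => ofSmooth (contDiff_hartree_ofSmooth (hv n) (hc n) W)
    (hasCompactSupport_hartree_ofSmooth (hc n) W)) ?_ (fun i => ?_) i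
  · simpa only [Function.comp_def, hartreeL2_ofSmooth] using
      ((continuous_hartreeL2 W).tendsto u).comp hlim
  · simpa only [Function.comp_def, hartreeGrad_ofSmooth] using
      ((continuous_hartreeGrad W i).tendsto u).comp hlim

/-- The nonlinearity `(W * |u|²) u`, for even `W` in `L³`, as a map of `H¹` into itself. -/
def hartree (W : Lp ℝ 3 (volume : Measure R3)) (u : H1) : H1 :=
  mkH1 (hartreeL2 W u) (hartreeGrad W u) (isWeakDeriv_hartree W u)

theorem toL2_hartree (W : Lp ℝ 3 (volume : Measure R3)) (u : H1) :
    toL2 (hartree W u) = hartreeL2 W u := rfl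

theorem continuous_hartree (W : Lp ℝ 3 (volume : Measure R3)) : Continuous (hartree W) :=
  continuous_iff_continuousAt.2 fun u => tendsto_H1 ((continuous_hartreeL2 W).tendsto u)
    fun i => (continuous_hartreeGrad W i).tendsto u

attribute [irreducible] innerL density32 density3 boundedMul

end

section

/-! ### Conservation of mass and energy -/

/-- The density `|u|²`. -/
def density (u : H1) (x : R3) : ℝ := ‖toL2 u x‖ ^ 2

/-- The correlation `Ψ(z) = ∫ |u(x)|² |u(x - z)|² dx` of the density with itself. -/
def densityCorr (u : H1) : R3 → ℝ := corr (density u) (density u)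

theorem densityCorr_eq (u : H1) : densityCorr u = corr (density32 u u) (density3 u u) :=
  (corr_congr (coeFn_density32_self u) (coeFn_density3_self u)).symm

theorem inner_L2_real (f g : L2) : inner ℝ f g = ∫ x, inner ℝ (f x) (g x) := rfl

theorem inner_I_smul_right (f g : L2) (c : R3 → ℝ) (h : f =ᵐ[volume] fun x => c x • g x) :
    inner ℝ f (Complex.I • g) = 0 := by
  rw [inner_L2_real, ← integral_zero R3 ℝ]
  refine integral_congr_ae ?_
  filter_upwards [h, Lp.coeFn_smul Complex.I g] with x h1 h2
  rw [h1, h2, Pi.smul_apply, real_inner_smul_left]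
  simp [Complex.inner]
  right
  ring

theorem inner_self_I_smul (g : L2) : inner ℝ g (Complex.I • g) = 0 :=
  inner_I_smul_right g g (fun _ => 1) (by simp)

theorem inner_I_smul_I_smul (f g : L2) :
    inner ℝ (Complex.I • f) (Complex.I • g) = inner ℝ f g := by
  rw [inner_L2_real, inner_L2_real]
  refine integral_congr_ae ?_
  filter_upwards [Lp.coeFn_smul Complex.I f, Lp.coeFn_smul Complex.I g] with x h1 h2
  rw [h1, h2, Pi.smul_apply, Pi.smul_apply]
  simp [Complex.inner]

theorem toL2_I_smul (v : H1) : toL2 (Complex.I • v) = Complex.I • toL2 v := map_smul _ _ _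

/-- The real part of the Dirichlet form `⟨∇u, ∇v⟩`. -/
def gradForm (u v : H1) : ℝ := ∑ i, inner ℝ (gradL i u) (gradL i v)

theorem continuous_gradForm : Continuous fun p : H1 × H1 => gradForm p.1 p.2 :=
  continuous_finsetSum _ fun i _ =>
    ((gradL i).continuous.comp continuous_fst).inner ((gradL i).continuous.comp continuous_snd)

theorem gradForm_I_smul_self (u : H1) : gradForm u (Complex.I • u) = 0 :=
  Finset.sum_eq_zero fun i _ => by rw [map_smul, inner_self_I_smul]

/-- The Hartree energy `‖∇u‖² + ½ ∫ W(z) Ψ(z) dz`. -/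
def hartreeEnergy (W : R3 → ℝ) (u : H1) : ℝ :=
  ∑ i, ‖gradL i u‖ ^ 2 + 1 / 2 * ∫ z, W z * densityCorr u z

section potential

variable {W : R3 → ℝ} (hW : IsPotential W)

/-- A potential as an element of `L³`. -/
def IsPotential.toL3 : Lp ℝ 3 (volume : Measure R3) := hW.memLp.toLp W

theorem coeFn_toL3 : hW.toL3 =ᵐ[volume] W := hW.memLp.coeFn_toLp

theorem convSq_eq_corr {m : R3 → ℝ} (heven : ∀ z, m (-z) = m z) (u : H1) :
    convSq m u = corr (density u) m := by
  ext x
  rw [corr_eq_convolution, convSq, ← convolution_flip]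
  simp only [convolution, ContinuousLinearMap.mul_apply', ContinuousLinearMap.flip_apply]
  refine integral_congr_ae (.of_forall fun y => ?_)
  simp only [← heven (x - y)]
  simp [mul_comm, density]

include hW in
theorem convSq_eq (u : H1) : convSq W u = corr (density32 u u) hW.toL3 := by
  rw [corr_congr (coeFn_density32_self u) (coeFn_toL3 hW), convSq_eq_corr hW.even]
  rfl

/-- Integration against the potential. -/
def IsPotential.pairing : Lp ℝ ∞ (volume : Measure R3) →L[ℝ] ℝ :=
  ContinuousLinearMap.lpPairing volume 1 ∞ (ContinuousLinearMap.mul ℝ ℝ)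
    ((hW.memLp_of_le (by norm_num : (1 : ℝ≥0∞) ≤ 3)).toLp W)

theorem pairing_corrL (a : Lp ℝ (3 / 2) (volume : Measure R3))
    (b : Lp ℝ 3 (volume : Measure R3)) : hW.pairing (corrL a b) = ∫ z, W z * corr a b z := by
  rw [IsPotential.pairing, ContinuousLinearMap.lpPairing_eq_integral]
  refine integral_congr_ae ?_
  filter_upwards [(hW.memLp_of_le (by norm_num : (1 : ℝ≥0∞) ≤ 3)).coeFn_toLp, coeFn_corrL a b]
    with z h1 h2
  rw [h1, h2]
  rfl

theorem integral_mul_densityCorr (u : H1) :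
    ∫ z, W z * densityCorr u z = hW.pairing (corrL (density32 u u) (density3 u u)) := by
  rw [pairing_corrL, densityCorr_eq]

theorem inner_hartreeL2 (u v : H1) : inner ℝ (hartreeL2 hW.toL3 u) (toL2 v)
    = ∫ x, corr (density u) W x * inner ℝ (toL2 u x) (toL2 v x) := by
  rw [inner_L2_real]
  refine integral_congr_ae ?_
  filter_upwards [coeFn_boundedMul_corrL (density32 u u) hW.toL3 (toL2 u)] with x h
  rw [hartreeL2, h, real_inner_smul_left,
    corr_congr (coeFn_density32_self u) (coeFn_toL3 hW)]
  rfl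

theorem pairing_corrL_density3_self (u v : H1) :
    hW.pairing (corrL (density32 u v) (density3 u u)) = inner ℝ (hartreeL2 hW.toL3 u) (toL2 v) := by
  rw [pairing_corrL, inner_hartreeL2, ← integral_corr_mul hW.integrable (Lp.memLp (density32 u v))
    (Lp.memLp (density3 u u)) hW.even, corr_congr (coeFn_density3_self u) ae_eq_rfl]
  refine integral_congr_ae ?_
  filter_upwards [coeFn_density32 u v] with x h
  rw [h]
  rfl

theorem pairing_corrL_density32_self (u v : H1) :
    hW.pairing (corrL (density32 u u) (density3 u v)) = inner ℝ (hartreeL2 hW.toL3 u) (toL2 v) := by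
  have h1 : corr (density3 u v) (density32 u u) = corr (density32 u v) (density3 u u) :=
    corr_congr ((coeFn_density3 u v).trans (coeFn_density32 u v).symm)
      ((coeFn_density32_self u).trans (coeFn_density3_self u).symm)
  have h3 := pairing_corrL hW (density32 u v) (density3 u u)
  rw [← h1, pairing_corrL_density3_self] at h3
  have h2 := integral_neg_eq_self (fun z => W z * corr (density32 u u) (density3 u v) z) volume
  simp only [hW.even, corr_neg] at h2
  exact (pairing_corrL hW _ _).trans (h2.symm.trans h3.symm)

theorem density32_comm (u v : H1) : density32 u v = density32 v u := by
  refine Lp.ext ?_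
  filter_upwards [coeFn_density32 u v, coeFn_density32 v u] with x h1 h2
  rw [h1, h2, real_inner_comm]

theorem density3_comm (u v : H1) : density3 u v = density3 v u := by
  refine Lp.ext ?_
  filter_upwards [coeFn_density3 u v, coeFn_density3 v u] with x h1 h2
  rw [h1, h2, real_inner_comm]

include hW in
theorem continuous_integral_mul_densityCorr :
    Continuous fun u => ∫ z, W z * densityCorr u z := by
  simp only [integral_mul_densityCorr hW]
  exact hW.pairing.continuous.comp ((corrL.continuous.comp continuous_density32_self).clm_apply
    continuous_density3_self)

include hW in
theorem continuous_hartreeEnergy : Continuous (hartreeEnergy W) :=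
  (continuous_finsetSum _ fun i _ => ((gradL i).continuous.norm.pow 2)).add
    (continuous_const.mul (continuous_integral_mul_densityCorr hW))

theorem hasDerivAt_bilinear {E F G : Type*} [NormedAddCommGroup E] [NormedSpace ℝ E]
    [NormedAddCommGroup F] [NormedSpace ℝ F] [NormedAddCommGroup G] [NormedSpace ℝ G]
    (B : E →L[ℝ] F →L[ℝ] G) {f : ℝ → E} {g : ℝ → F} {f' : E} {g' : F} {t : ℝ}
    (hf : HasDerivAt f f' t) (hg : HasDerivAt g g' t) :
    HasDerivAt (fun t => B (f t) (g t)) (B f' (g t) + B (f t) g') t :=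
  ((B.hasFDerivAt (x := f t)).comp_hasDerivAt t hf).clm_apply hg

/-- The chain rule for the energy along a differentiable curve in `H¹`. -/
theorem hasDerivAt_hartreeEnergy {c : ℝ → H1} {c' : H1} {t : ℝ} (hc : HasDerivAt c c' t) :
    HasDerivAt (fun t => hartreeEnergy W (c t))
      (2 * (gradForm (c t) c' + inner ℝ (hartreeL2 hW.toL3 (c t)) (toL2 c'))) t := by
  have h1 : HasDerivAt (fun t => ∑ i, ‖gradL i (c t)‖ ^ 2)
      (∑ i, 2 * inner ℝ (gradL i (c t)) (gradL i c')) t := by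
    refine HasDerivAt.fun_sum fun i _ => ?_
    exact ((((gradL i).restrictScalars ℝ).hasFDerivAt.comp_hasDerivAt t hc).norm_sq)
  have h32 : HasDerivAt (fun t => density32 (c t) (c t)) (2 • density32 (c t) c') t := by
    refine (hasDerivAt_bilinear density32 hc hc).congr_deriv ?_
    rw [two_nsmul]
    exact congrArg (· + density32 (c t) c') (density32_comm c' (c t))
  have h3 : HasDerivAt (fun t => density3 (c t) (c t)) (2 • density3 (c t) c') t := by
    refine (hasDerivAt_bilinear density3 hc hc).congr_deriv ?_
    rw [two_nsmul]
    exact congrArg (· + density3 (c t) c') (density3_comm c' (c t))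
  have h4 := hW.pairing.hasFDerivAt.comp_hasDerivAt t (hasDerivAt_bilinear corrL h32 h3)
  have h5 := h1.add (h4.const_mul (1 / 2))
  refine (h5.congr_deriv ?_).congr_of_eventuallyEq (.of_forall fun s => ?_)
  · simp only [map_add, map_nsmul, smul_apply, pairing_corrL_density3_self,
      pairing_corrL_density32_self, nsmul_eq_mul, gradForm]
    rw [← Finset.mul_sum]
    push_cast
    ring
  · simp only [hartreeEnergy, integral_mul_densityCorr hW]
    rfl

end potential

/-- The average `∫₀¹ u(t + δ s) ds` of a curve over a time interval of length `δ`. -/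
def timeAverage {E : Type*} [NormedAddCommGroup E] [NormedSpace ℝ E] (u : ℝ → E) (δ t : ℝ) : E :=
  ∫ s in (0 : ℝ)..1, u (t + δ * s)

section timeAverage

variable {E : Type*} [NormedAddCommGroup E] [NormedSpace ℝ E] [CompleteSpace E] {u : ℝ → E}
  (hu : Continuous u)

theorem timeAverage_zero (t : ℝ) : timeAverage u 0 t = u t := by simp [timeAverage]

include hu

theorem continuous_timeAverage : Continuous fun p : ℝ × ℝ => timeAverage u p.1 p.2 := by
  refine intervalIntegral.continuous_parametric_intervalIntegral_of_continuous' ?_ 0 1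
  exact hu.comp (by fun_prop)

theorem timeAverage_eq {δ : ℝ} (hδ : δ ≠ 0) (t : ℝ) :
    timeAverage u δ t = δ⁻¹ • ∫ s in t..(t + δ), u s := by
  rw [timeAverage, intervalIntegral.integral_comp_add_mul _ hδ]
  simp

theorem hasDerivAt_timeAverage {δ : ℝ} (hδ : δ ≠ 0) (t : ℝ) :
    HasDerivAt (timeAverage u δ) (δ⁻¹ • (u (t + δ) - u t)) t := by
  have hU : ∀ t, HasDerivAt (fun t => ∫ s in (0 : ℝ)..t, u s) (u t) t := fun t =>
    intervalIntegral.integral_hasDerivAt_right (hu.intervalIntegrable _ _)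
      hu.aestronglyMeasurable.stronglyMeasurableAtFilter hu.continuousAt
  have h := (((hU (t + δ)).comp_add_const t δ).fun_sub (hU t)).fun_const_smul δ⁻¹
  refine h.congr_of_eventuallyEq (.of_forall fun s => ?_)
  simp only
  rw [timeAverage_eq hu hδ, intervalIntegral.integral_interval_sub_left
    (hu.intervalIntegrable _ _) (hu.intervalIntegrable _ _)]

theorem timeAverage_clm {F : Type*} [NormedAddCommGroup F] [NormedSpace ℝ F] [CompleteSpace F]
    (L : E →L[ℝ] F) (δ t : ℝ) : timeAverage (fun s => L (u s)) δ t = L (timeAverage u δ t) :=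
  L.intervalIntegral_comp_comm ((hu.comp (by fun_prop)).intervalIntegrable _ _)

/-- If the derivative of `Φ` along the time averages of a curve tends to `0` with the length of the
averages, then `Φ` is constant along the curve. -/
theorem eq_of_hasDerivAt_timeAverage {Φ : E → ℝ} (hΦ : Continuous Φ) {D : ℝ → ℝ → ℝ}
    (hD : Continuous fun p : ℝ × ℝ => D p.1 p.2) (hD0 : ∀ t, D 0 t = 0)
    (h : ∀ δ, δ ≠ 0 → ∀ t, HasDerivAt (fun t => Φ (timeAverage u δ t)) (D δ t) t) (t : ℝ) :
    Φ (u t) = Φ (u 0) := by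
  have h1 : Continuous fun δ => Φ (timeAverage u δ t) - Φ (timeAverage u δ 0) :=
    (hΦ.comp ((continuous_timeAverage hu).comp (by fun_prop : Continuous fun δ : ℝ => (δ, t)))).sub
      (hΦ.comp ((continuous_timeAverage hu).comp (by fun_prop : Continuous fun δ : ℝ => (δ, (0 : ℝ)))))
  have h2 : Continuous fun δ => ∫ s in (0 : ℝ)..t, D δ s :=
    intervalIntegral.continuous_parametric_intervalIntegral_of_continuous' hD 0 t
  have h3 : (fun δ => Φ (timeAverage u δ t) - Φ (timeAverage u δ 0))
      = fun δ => ∫ s in (0 : ℝ)..t, D δ s := by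
    refine h1.ext_on (dense_compl_singleton (0 : ℝ)) h2 fun δ hδ => ?_
    refine (intervalIntegral.integral_eq_sub_of_hasDerivAt (fun s _ => h δ hδ s) ?_).symm
    exact (hD.comp (by fun_prop : Continuous fun s : ℝ => (δ, s))).intervalIntegrable _ _
  have h4 := congrFun h3 0
  simp only [timeAverage_zero, hD0, intervalIntegral.integral_zero] at h4
  linarith

end timeAverage

/-- A weak solution of the Hartree equation, with the equation in `H⁻¹` tested against `H¹`. -/
structure IsHartreeSolution {W : R3 → ℝ} (hW : IsPotential W) (u : ℝ → H1) : Prop where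
  continuous : Continuous u
  equation : ∀ t : ℝ, ∀ v : H1, HasDerivAt (fun s => inner ℝ (Complex.I • toL2 (u s)) (toL2 v))
    (gradForm (u t) v + inner ℝ (hartreeL2 hW.toL3 (u t)) (toL2 v)) t

namespace IsHartreeSolution

variable {W : R3 → ℝ} {hW : IsPotential W} {u : ℝ → H1} (h : IsHartreeSolution hW u)
include h

theorem continuous_hartree_comp : Continuous fun s => hartree hW.toL3 (u s) :=
  (continuous_hartree _).comp h.continuous

/-- The time average of the equation. -/
theorem averaged_equation {δ : ℝ} (hδ : δ ≠ 0) (t : ℝ) (v : H1) :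
    inner ℝ (Complex.I • toL2 (δ⁻¹ • (u (t + δ) - u t))) (toL2 v)
      = gradForm (timeAverage u δ t) v
        + inner ℝ (toL2 (timeAverage (fun s => hartree hW.toL3 (u s)) δ t)) (toL2 v) := by
  set L1 : H1 →L[ℝ] ℝ := ∑ i, ((innerSL ℝ).flip (gradL i v)).comp ((gradL i).restrictScalars ℝ)
  set L2 : H1 →L[ℝ] ℝ := ((innerSL ℝ).flip (toL2 v)).comp (toL2.restrictScalars ℝ)
  have e1 : ∀ w, L1 w = gradForm w v := fun w => by
    simp only [L1, gradForm, _root_.sum_apply]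
    rfl
  have e2 : ∀ w, L2 w = inner ℝ (toL2 w) (toL2 v) := fun w => rfl
  have c1 : Continuous fun s => L1 (u s) := L1.continuous.comp h.continuous
  have c2 : Continuous fun s => L2 (hartree hW.toL3 (u s)) :=
    L2.continuous.comp h.continuous_hartree_comp
  rw [← e1, ← e2, ← timeAverage_clm h.continuous L1, ← timeAverage_clm h.continuous_hartree_comp L2,
    timeAverage_eq c1 hδ, timeAverage_eq c2 hδ, ← smul_add,
    ← intervalIntegral.integral_add (c1.intervalIntegrable _ _) (c2.intervalIntegrable _ _),
    intervalIntegral.integral_eq_sub_of_hasDerivAt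
      (f := fun s => inner ℝ (Complex.I • toL2 (u s)) (toL2 v)) (fun s _ => ?_)
      ((c1.fun_add c2).intervalIntegrable _ _), ← inner_sub_left, ← smul_sub, ← map_sub]
  · have : toL2 (δ⁻¹ • (u (t + δ) - u t)) = δ⁻¹ • toL2 (u (t + δ) - u t) :=
      (toL2.restrictScalars ℝ).map_smul _ _
    rw [this, smul_comm, real_inner_smul_left, smul_eq_mul]
  · rw [e1, e2, toL2_hartree]
    exact h.equation s v

/-- The commutator of the nonlinearity with the time average. -/
theorem continuous_commutator : Continuous fun p : ℝ × ℝ => hartree hW.toL3 (timeAverage u p.1 p.2)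
    - timeAverage (fun s => hartree hW.toL3 (u s)) p.1 p.2 :=
  ((continuous_hartree _).comp (continuous_timeAverage h.continuous)).sub
    (continuous_timeAverage h.continuous_hartree_comp)

theorem hartree_inner_I (w : H1) : inner ℝ (toL2 (hartree hW.toL3 w)) (toL2 (Complex.I • w)) = 0 := by
  rw [toL2_I_smul]
  exact inner_I_smul_right _ _ _ (coeFn_boundedMul_corrL _ _ _)

/-- Conservation of mass: along the averages, only the commutator contributes to the derivative. -/
theorem norm_toL2_eq (t : ℝ) : ‖toL2 (u t)‖ = ‖toL2 (u 0)‖ := by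
  have key := eq_of_hasDerivAt_timeAverage h.continuous (Φ := fun w => ‖toL2 w‖ ^ 2)
    (D := fun δ t => -2 * inner ℝ (toL2 (hartree hW.toL3 (timeAverage u δ t)
      - timeAverage (fun s => hartree hW.toL3 (u s)) δ t)) (toL2 (Complex.I • timeAverage u δ t)))
    (toL2.continuous.norm.pow 2) ?_ ?_ ?_ t
  · exact (sq_eq_sq₀ (norm_nonneg _) (norm_nonneg _)).1 key
  · exact continuous_const.mul ((toL2.continuous.comp h.continuous_commutator).inner
      (toL2.continuous.comp ((continuous_timeAverage h.continuous).const_smul Complex.I)))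
  · intro t
    simp [timeAverage_zero]
  · intro δ hδ t
    have h1 := ((toL2.restrictScalars ℝ).hasFDerivAt.comp_hasDerivAt t
      (hasDerivAt_timeAverage h.continuous hδ t)).norm_sq
    refine h1.congr_deriv ?_
    have h2 := h.averaged_equation hδ t (Complex.I • timeAverage u δ t)
    rw [gradForm_I_smul_self, zero_add] at h2
    rw [map_sub, inner_sub_left, h.hartree_inner_I, zero_sub, ← h2, toL2_I_smul,
      inner_I_smul_I_smul, real_inner_comm]
    simp

/-- Conservation of energy. The derivative of the average `a` is characterized by the averaged
equation; testing it with the derivative itself and with `i` times the commutator leaves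
only terms with the commutator. -/
theorem hartreeEnergy_eq (t : ℝ) : hartreeEnergy W (u t) = hartreeEnergy W (u 0) := by
  refine eq_of_hasDerivAt_timeAverage h.continuous (Φ := hartreeEnergy W)
    (D := fun δ t => 2 * (gradForm (timeAverage u δ t)
        (Complex.I • (hartree hW.toL3 (timeAverage u δ t)
          - timeAverage (fun s => hartree hW.toL3 (u s)) δ t))
      + inner ℝ (toL2 (timeAverage (fun s => hartree hW.toL3 (u s)) δ t))
        (toL2 (Complex.I • (hartree hW.toL3 (timeAverage u δ t)
          - timeAverage (fun s => hartree hW.toL3 (u s)) δ t)))))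
    (continuous_hartreeEnergy hW) ?_ ?_ ?_ t
  · have hc := h.continuous_commutator.const_smul Complex.I
    exact continuous_const.mul ((continuous_gradForm.comp
      ((continuous_timeAverage h.continuous).prodMk hc)).add
      ((toL2.continuous.comp (continuous_timeAverage h.continuous_hartree_comp)).inner
        (toL2.continuous.comp hc)))
  · intro t
    simp [timeAverage_zero, gradForm]
  · intro δ hδ t
    refine (hasDerivAt_hartreeEnergy hW (hasDerivAt_timeAverage h.continuous hδ t)).congr_deriv ?_
    set a := timeAverage u δ t
    set a' := δ⁻¹ • (u (t + δ) - u t)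
    have h1 := h.averaged_equation hδ t a'
    rw [real_inner_comm, inner_self_I_smul] at h1
    rw [← h.averaged_equation hδ t, toL2_I_smul, inner_I_smul_I_smul, map_sub, inner_sub_right,
      toL2_hartree, real_inner_comm _ (toL2 a'), real_inner_comm _ (toL2 a')]
    linarith

end IsHartreeSolution

end

section

/-! ### The weak gradient of the kernel -/

theorem integrable_smul_of_memLp_two {X : Type*} [MeasurableSpace X] {m : Measure X} {a : X → ℝ}
    {w : X → ℂ} (ha : MemLp a 2 m) (hw : MemLp w 2 m) : Integrable (fun x => a x • w x) m :=
  memLp_one_iff_integrable.1 (MemLp.smul (p := 2) (q := 2) (r := 1) hw ha)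

theorem tendsto_integral_smul_L2 {ψ : R3 → ℝ} (hψ : Continuous ψ) (hc : HasCompactSupport ψ)
    {q : ℕ → R3 → ℝ} {q' : R3 → ℝ} {M : ℝ} (hq : ∀ n, Continuous (q n)) (hM : ∀ n x, |q n x| ≤ M)
    (hlim : ∀ x, Tendsto (fun n => q n x) atTop (𝓝 (q' x))) (u : L2) :
    Tendsto (fun n => ∫ x, (ψ x * q n x) • u x) atTop (𝓝 (∫ x, (ψ x * q' x) • u x)) := by
  refine tendsto_integral_of_dominated_convergence (fun x => ‖(ψ x) • u x‖ * M)
    (fun n => ((hψ.mul (hq n)).aestronglyMeasurable.smul (Lp.memLp u).1))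
    ((integrable_contDiff_smul_L2 hψ hc u).norm.mul_const M)
    (fun n => .of_forall fun x => ?_) (.of_forall fun x => ((hlim x).const_mul _).smul_const _)
  rw [mul_comm, mul_smul, norm_smul, mul_comm]
  exact mul_le_mul_of_nonneg_left (hM n x) (norm_nonneg _)

theorem tendsto_integral_smul_of_L2 {q : ℕ → R3 → ℝ} {q' : R3 → ℝ} (hq : ∀ n, MemLp (q n) 2 volume)
    (hq' : MemLp q' 2 volume) (h : Tendsto (fun n => eLpNorm (q n - q') 2 volume) atTop (𝓝 0))
    {w : R3 → ℂ} (hw : MemLp w 2 volume) :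
    Tendsto (fun n => ∫ x, q n x • w x) atTop (𝓝 (∫ x, q' x • w x)) := by
  have e : ∀ {q : R3 → ℝ} (hq : MemLp q 2 volume), ∫ x, q x • w x = ContinuousLinearMap.lpPairing
      volume 2 2 (ContinuousLinearMap.lsmul ℝ ℝ) (hq.toLp q) (hw.toLp w) := fun {q} hq => by
    rw [ContinuousLinearMap.lpPairing_eq_integral]
    refine integral_congr_ae ?_
    filter_upwards [hq.coeFn_toLp, hw.coeFn_toLp] with x h1 h2
    rw [h1, h2]
    rfl
  have h1 : Tendsto (fun n => (hq n).toLp (q n)) atTop (𝓝 (hq'.toLp q')) :=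
    (Lp.tendsto_Lp_iff_tendsto_eLpNorm'' q hq q' hq').2 h
  simp only [e (hq _)]
  rw [e hq']
  exact (((ContinuousLinearMap.lpPairing volume 2 2
    (ContinuousLinearMap.lsmul ℝ ℝ : ℝ →L[ℝ] ℂ →L[ℝ] ℂ)).flip (hw.toLp w)).continuous.tendsto _).comp
    h1

/-- The product rule for weak derivatives, by mollification of the bounded factor. -/
theorem IsWeakDeriv.smul_L2 {K κ : R3 → ℝ} {M : ℝ} {i : Fin 3} (hK : UniformContinuous K)
    (hM : ∀ x, |K x| ≤ M) (hκ : MemLp κ 2 volume) (hw : IsWeakDeriv univ (e i) K κ) {u du : L2}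
    (hu : IsWeakDeriv univ (e i) u du) :
    IsWeakDeriv univ (e i) (fun x => K x • u x) (fun x => κ x • u x + K x • du x) := by
  intro ψ hψ hc _
  have hKl := hK.continuous.locallyIntegrable (μ := (volume : Measure R3))
  have hcs : ∀ n, ContDiff ℝ ∞ (smoothen n K) := fun n => contDiff_smoothen n hKl
  have hbd : ∀ n x, |smoothen n K x| ≤ M := fun n x =>
    (Real.norm_eq_abs _).symm.trans_le (norm_smoothen_le (fun x => (Real.norm_eq_abs _).trans_le (hM x)) n x)
  have hlim : ∀ x, Tendsto (fun n => smoothen n K x) atTop (𝓝 (K x)) :=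
    fun x => (tendstoUniformly_smoothen hK).tendsto_at x
  have hdψ : Continuous (pd i ψ) := (contDiff_pd hψ i).continuous
  have hdc : HasCompactSupport (pd i ψ) := hasCompactSupport_pd hc i
  have hψu : MemLp (fun x => ψ x • u x) 2 volume := by
    obtain ⟨B, hB⟩ := hc.exists_bound_of_continuous hψ.continuous
    refine ((Lp.memLp u).const_smul B).mono (hψ.continuous.aestronglyMeasurable.smul (Lp.memLp u).1)
      (.of_forall fun x => ?_)
    rw [norm_smul, Pi.smul_apply, norm_smul]
    exact mul_le_mul_of_nonneg_right ((hB x).trans (le_abs_self B)) (norm_nonneg _)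
  have h1 := tendsto_integral_smul_L2 hdψ hdc (fun n => (hcs n).continuous) hbd hlim u
  have h2 := tendsto_integral_smul_L2 hψ.continuous hc (fun n => (hcs n).continuous) hbd hlim du
  have h3 := tendsto_integral_smul_of_L2 (fun n => memLp_smoothen hκ n) hκ
    (tendsto_eLpNorm_smoothen_sub hκ) hψu
  have key : ∀ n, (∫ x, (pd i ψ x * smoothen n K x) • u x)
      + ∫ x, smoothen n κ x • (ψ x • u x) = -∫ x, (ψ x * smoothen n K x) • du x := fun n => by
    have h4 := hu (fun x => ψ x * smoothen n K x) (hψ.mul (hcs n)) hc.mul_right (subset_univ _)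
    simp only [Measure.restrict_univ] at h4
    rw [← h4, ← integral_add (integrable_contDiff_smul_L2 (hdψ.fun_mul (hcs n).continuous)
      hdc.mul_right u) (integrable_smul_of_memLp_two (memLp_smoothen hκ n) hψu)]
    refine integral_congr_ae (.of_forall fun x => ?_)
    have h5 : fderiv ℝ (fun x => ψ x * smoothen n K x) x (e i)
        = pd i ψ x * smoothen n K x + ψ x * smoothen n κ x := by
      rw [((hψ.differentiable (by simp) x).hasFDerivAt.fun_mul
        ((hcs n).differentiable (by simp) x).hasFDerivAt).fderiv, ← fderiv_smoothen hKl hw]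
      simp [pd]
      ring
    simp only [h5, add_smul, smul_smul]
    rw [mul_comm (smoothen n κ x)]
  have h6 := tendsto_nhds_unique (h1.add h3) ((h2.neg).congr fun n => (key n).symm)
  simp only [Measure.restrict_univ]
  have e1 : ∫ x, ψ x • (κ x • u x + K x • du x)
      = (∫ x, κ x • (ψ x • u x)) + ∫ x, (ψ x * K x) • du x := by
    rw [← integral_add (integrable_smul_of_memLp_two hκ hψu)
      (integrable_contDiff_smul_L2 (hψ.continuous.fun_mul hK.continuous) hc.mul_right du)]
    refine integral_congr_ae (.of_forall fun x => ?_)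
    simp only [smul_add, smul_smul]
    rw [mul_comm (κ x)]
  have e2 : ∫ x, (fderiv ℝ ψ x (e i)) • (K x • u x) = ∫ x, (pd i ψ x * K x) • u x := by
    simp only [smul_smul]
    rfl
  rw [e1, e2]
  linear_combination h6

theorem IsWeakDeriv.comp_sub_right {K κ : R3 → ℝ} {v : R3} (hw : IsWeakDeriv univ v K κ) (y : R3) :
    IsWeakDeriv univ v (fun x => K (x - y)) (fun x => κ (x - y)) := by
  intro ψ hψ hc _
  have h := hw (fun x => ψ (x + y)) (hψ.comp (contDiff_id.add contDiff_const))
    (hc.comp_homeomorph (Homeomorph.addRight y)) (subset_univ _)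
  simp only [Measure.restrict_univ, fderiv_comp_add_right] at h ⊢
  rw [← integral_add_right_eq_self (fun x => (fderiv ℝ ψ x v) • K (x - y)) y,
    ← integral_add_right_eq_self (fun x => ψ x • κ (x - y)) y]
  simpa using h

theorem integrable_normSq_mul_normSq (f g : L2) :
    Integrable fun p : R3 × R3 => ‖f p.1‖ ^ 2 * ‖g p.2‖ ^ 2 :=
  (integrable_norm_sq_L2 f).mul_prod (integrable_norm_sq_L2 g)

theorem memLp_density (u : H1) : MemLp (density u) (3 / 2) volume :=
  (Lp.memLp (density32 u u)).ae_eq (coeFn_density32_self u)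

theorem memLp_density_three (u : H1) : MemLp (density u) 3 volume :=
  (Lp.memLp (density3 u u)).ae_eq (coeFn_density3_self u)

section kernel

variable {K : R3 → ℝ} {κ : Fin 3 → R3 → ℝ} {M : ℝ}

/-- The `x`-gradient of `-K(x - y) u(x) u(y)`, with `κ` the gradient of `K`. -/
def kernelGrad (K : R3 → ℝ) (κ : Fin 3 → R3 → ℝ) (u : H1) (i : Fin 3) (p : R3 × R3) : ℂ :=
  (κ i (p.1 - p.2) • toL2 u p.1 + K (p.1 - p.2) • gradL i u p.1) * (-toL2 u p.2)

theorem memLp_shift_mul_mul {m : R3 → ℝ} (hm : MemLp m 2 volume) (u : H1) :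
    MemLp (fun p : R3 × R3 => m (p.1 - p.2) • toL2 u p.1 * toL2 u p.2) 2 volume := by
  have hu := (Lp.memLp (toL2 u)).1
  refine (memLp_two_iff_integrable_sq_norm
    (((aestronglyMeasurable_comp_sub hm.1).smul hu.comp_fst).mul hu.comp_snd)).2 ?_
  refine (integrable_pair ((memLp_two_iff_integrable_sq hm.1).1 hm) (memLp_density u)
    (memLp_density_three u)).congr (.of_forall fun p => ?_)
  simp only [Pi.mul_apply, Pi.smul_apply', norm_mul, norm_smul, Real.norm_eq_abs, mul_pow, sq_abs, density]
  ring

theorem memLp_bounded_mul_mul {m : R3 → ℝ} (hm : AEStronglyMeasurable m volume)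
    (hM : ∀ x, |m x| ≤ M) (f g : L2) :
    MemLp (fun p : R3 × R3 => m (p.1 - p.2) • f p.1 * g p.2) 2 volume := by
  have hf := (Lp.memLp f).1
  have hg := (Lp.memLp g).1
  refine (memLp_two_iff_integrable_sq_norm
    (((aestronglyMeasurable_comp_sub hm).smul hf.comp_fst).mul hg.comp_snd)).2 ?_
  refine ((integrable_normSq_mul_normSq f g).const_mul (M ^ 2)).mono'
    ((((aestronglyMeasurable_comp_sub hm).smul hf.comp_fst).mul hg.comp_snd).norm.pow 2)
    (.of_forall fun p => ?_)
  rw [norm_pow, norm_norm, Pi.mul_apply, Pi.smul_apply', norm_mul, norm_smul, Real.norm_eq_abs, mul_pow, mul_pow, mul_assoc]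
  gcongr
  exact hM _

variable (hK : UniformContinuous K) (hM : ∀ x, |K x| ≤ M) (hκ : ∀ i, MemLp (κ i) 2 volume)
  (hw : ∀ i, IsWeakDeriv univ (e i) K (κ i)) (u : H1)
include hK hM hκ

theorem memLp_kernelGrad (i : Fin 3) : MemLp (kernelGrad K κ u i) 2 volume := by
  have h := ((memLp_shift_mul_mul (hκ i) u).add
    (memLp_bounded_mul_mul hK.continuous.aestronglyMeasurable hM (gradL i u) (toL2 u))).neg
  refine h.ae_eq (.of_forall fun p => ?_)
  simp only [kernelGrad, Pi.neg_apply, Pi.add_apply]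
  ring

include hw

/-- For almost every `y` this is the product rule in `x`; then integrate over `y`. -/
theorem isGradX_kernelGrad :
    IsGradX (fun p => K (p.1 - p.2) • toL2 u p.1 * (-toL2 u p.2)) (kernelGrad K κ u) := by
  refine fun i => ⟨memLp_kernelGrad hK hM hκ u i, fun ψ hψ hc _ => ?_⟩
  simp only [Measure.restrict_univ]
  have hdψ : Continuous fun p => fderiv ℝ ψ p (e i, 0) :=
    (hψ.continuous_fderiv (by simp)).clm_apply continuous_const
  have hdc : HasCompactSupport fun p => fderiv ℝ ψ p (e i, 0) := hc.fderiv_apply (𝕜 := ℝ) _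
  have hk : MemLp (fun p : R3 × R3 => K (p.1 - p.2) • toL2 u p.1 * (-toL2 u p.2)) 2 volume := by
    refine (memLp_bounded_mul_mul hK.continuous.aestronglyMeasurable hM (toL2 u) (toL2 u)).neg.ae_eq
      (.of_forall fun p => ?_)
    simp only [Pi.neg_apply]
    ring
  have i1 : Integrable fun p : R3 × R3 =>
      (fderiv ℝ ψ p (e i, 0)) • (K (p.1 - p.2) • toL2 u p.1 * (-toL2 u p.2)) :=
    integrable_smul_of_memLp_two (hdψ.memLp_of_hasCompactSupport hdc) hk
  have i2 : Integrable fun p : R3 × R3 => ψ p • kernelGrad K κ u i p :=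
    integrable_smul_of_memLp_two (hψ.continuous.memLp_of_hasCompactSupport hc)
      (memLp_kernelGrad hK hM hκ u i)
  rw [Measure.volume_eq_prod] at i1 i2 ⊢
  rw [integral_prod_symm _ i1, integral_prod_symm _ i2, ← integral_neg]
  refine integral_congr_ae (.of_forall fun y => ?_)
  simp only
  have hψy : ContDiff ℝ ∞ fun x => ψ (x, y) := hψ.comp (contDiff_id.prodMk contDiff_const)
  have hcy : HasCompactSupport fun x => ψ (x, y) := by
    obtain ⟨R, hR⟩ := hc.isCompact.isBounded.subset_closedBall (0 : R3 × R3)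
    refine HasCompactSupport.intro (isCompact_closedBall (0 : R3) R) fun x hx => ?_
    refine image_eq_zero_of_notMem_tsupport fun hmem => hx ?_
    have := hR hmem
    rw [mem_closedBall_zero_iff] at this ⊢
    exact (norm_fst_le (x, y)).trans this
  have hfd : ∀ x, fderiv ℝ (fun x => ψ (x, y)) x (e i) = fderiv ℝ ψ (x, y) (e i, 0) := fun x => by
    have h1 : HasFDerivAt (fun x : R3 => (x, y)) (ContinuousLinearMap.inl ℝ R3 R3) x :=
      hasFDerivAt_prodMk_left x y
    have h2 : fderiv ℝ (fun x => ψ (x, y)) x = _ :=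
      ((hψ.differentiable (by simp) (x, y)).hasFDerivAt.comp x h1).fderiv
    rw [h2]
    simp
  have hKy : UniformContinuous fun x => K (x - y) :=
    hK.comp (uniformContinuous_id.sub uniformContinuous_const)
  have h := IsWeakDeriv.smul_L2 hKy (fun x => hM (x - y))
    ((hκ i).comp_measurePreserving (measurePreserving_sub_right volume y))
    ((hw i).comp_sub_right y) (isWeakDeriv_gradL u i) _ hψy hcy (subset_univ _)
  simp only [Measure.restrict_univ, hfd] at h
  have h2 := congrArg (fun z => z * (-toL2 u y)) h
  simp only [neg_mul, ← integral_mul_const] at h2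
  simpa only [kernelGrad, smul_mul_assoc, Function.comp_apply, add_mul, smul_add, mul_neg, neg_mul,
    integral_neg, neg_neg, smul_neg, mul_smul] using h2

/-- The weak gradient is unique almost everywhere, so the integral does not depend on the choice made
in `gradXSq`. -/
theorem gradXSq_eq :
    gradXSq (fun p => K (p.1 - p.2) • toL2 u p.1 * (-toL2 u p.2))
      = ∫ p, ∑ i, ‖kernelGrad K κ u i p‖ ^ 2 := by
  have h0 := isGradX_kernelGrad hK hM hκ hw u
  have h : ∃ G, IsGradX (fun p => K (p.1 - p.2) • toL2 u p.1 * (-toL2 u p.2)) G := ⟨_, h0⟩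
  rw [gradXSq, dif_pos h]
  have hae : ∀ i, h.choose i =ᵐ[volume] kernelGrad K κ u i := fun i => by
    refine ae_eq_of_integral_contDiff_smul_eq
      ((h.choose_spec i).1.locallyIntegrable (by norm_num)) ((h0 i).1.locallyIntegrable (by norm_num))
      fun ψ hψ hc => ?_
    have h1 := (h.choose_spec i).2 ψ hψ hc (subset_univ _)
    have h2 := (h0 i).2 ψ hψ hc (subset_univ _)
    simp only [Measure.restrict_univ] at h1 h2
    exact neg_injective (h1.symm.trans h2)
  refine integral_congr_ae ?_
  filter_upwards [ae_all_iff.2 hae] with p hp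
  simp only [hp]

end kernel

end

section

/-! ### The energy of the correlation structure -/

section scaling

variable {s : ℝ} (hs : 0 < s)
include hs

theorem memLp_comp_smul {q : ℝ≥0∞} {u : R3 → ℝ} (hu : MemLp u q volume) :
    MemLp (fun z => u (s • z)) q volume := by
  have h := hu.smul_measure (c := ENNReal.ofReal |(s ^ Module.finrank ℝ R3)⁻¹|) ENNReal.ofReal_ne_top
  rw [← Measure.map_addHaar_smul _ hs.ne'] at h
  exact h.comp_of_map (by fun_prop)

theorem integral_comp_smul_R3 (F : R3 → ℝ) : ∫ z, F (s • z) = (s ^ 3)⁻¹ * ∫ z, F z := by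
  rw [Measure.integral_comp_smul_of_nonneg volume F s (hR := hs.le)]
  simp

theorem setIntegral_comp_smul_R3 (F : R3 → ℝ) (l : ℝ) :
    ∫ z in Metric.ball (0 : R3) l, F (s • z)
      = (s ^ 3)⁻¹ * ∫ z in Metric.ball (0 : R3) (s * l), F z := by
  rw [Measure.setIntegral_comp_smul_of_pos volume F _ hs, smul_ball hs.ne']
  simp [abs_of_pos hs]

theorem hasCompactSupport_comp_smul {u : R3 → ℝ} (hu : HasCompactSupport u) :
    HasCompactSupport fun z => u (s • z) :=
  hu.comp_homeomorph (Homeomorph.smulOfNeZero s hs.ne')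

theorem pd_comp_smul (ψ : R3 → ℝ) (i : Fin 3) (x : R3) :
    pd i (fun y => ψ (s • y)) x = s * pd i ψ (s • x) := by
  rw [pd, fderiv_comp_smul]
  simp [pd]

/-- A profile in the ball of radius `s l` becomes one in the ball of radius `l` under dilation. -/
theorem IsProfile.scale {V : R3 → ℝ} {l lam c : ℝ} {p : R3 → ℝ} {g : Fin 3 → R3 → ℝ}
    (h : IsProfile V (s * l) lam c p g) :
    IsProfile (fun z => s ^ 2 * V (s • z)) l (s ^ 2 * lam) c (fun z => p (s • z))
      (fun i z => s * g i (s • z)) := by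
  have hnorm : ∀ x : R3, l ≤ ‖x‖ → s * l ≤ ‖s • x‖ := fun x hx => by
    rw [norm_smul, Real.norm_of_nonneg hs.le]
    exact mul_le_mul_of_nonneg_left hx hs.le
  have hsi : 0 < s⁻¹ := inv_pos.2 hs
  -- The test functions correspond to each other under the dilation.
  have hψ : ∀ {ψ : R3 → ℝ}, ContDiff ℝ ∞ ψ → ContDiff ℝ ∞ fun y => ψ (s⁻¹ • y) := fun hψ =>
    hψ.comp (contDiff_const_smul _)
  have hpd : ∀ (ψ : R3 → ℝ) (i : Fin 3) (x : R3),
      pd i ψ x = s * pd i (fun y => ψ (s⁻¹ • y)) (s • x) := fun ψ i x => by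
    rw [pd_comp_smul hsi, smul_smul, inv_mul_cancel₀ hs.ne', one_smul, ← mul_assoc,
      mul_inv_cancel₀ hs.ne', one_mul]
  have hval : ∀ (ψ : R3 → ℝ) (x : R3), ψ x = (fun y => ψ (s⁻¹ • y)) (s • x) := fun ψ x => by
    simp [smul_smul, inv_mul_cancel₀ hs.ne']
  refine ⟨h.cont.comp (continuous_const_smul s), fun x hx => h.eq_c _ (hnorm x hx),
    fun i => (memLp_comp_smul hs (h.memLp i)).const_mul s,
    fun i x hx => by rw [h.g_zero i _ (hnorm x hx), mul_zero], fun i ψ h1 h2 _ => ?_,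
    fun ψ h1 => ?_⟩
  · have h3 := h.weak i _ (hψ h1) (hasCompactSupport_comp_smul hsi h2) (subset_univ _)
    simp only [Measure.restrict_univ, smul_eq_mul] at h3 ⊢
    have e1 : ∫ x, fderiv ℝ ψ x (e i) * p (s • x) = (s ^ 3)⁻¹ *
        ∫ y, s * (pd i (fun y => ψ (s⁻¹ • y)) y * p y) := by
      rw [← integral_comp_smul_R3 hs]
      refine integral_congr_ae (.of_forall fun x => ?_)
      change pd i ψ x * _ = _
      rw [hpd ψ]
      ring
    have e2 : ∫ x, ψ x * (s * g i (s • x)) = (s ^ 3)⁻¹ *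
        ∫ y, s * (ψ (s⁻¹ • y) * g i y) := by
      rw [← integral_comp_smul_R3 hs]
      refine integral_congr_ae (.of_forall fun x => ?_)
      simp only [smul_smul, inv_mul_cancel₀ hs.ne', one_smul]
      ring
    rw [e1, e2, integral_const_mul, integral_const_mul]
    change (s ^ 3)⁻¹ * (s * ∫ x, fderiv ℝ (fun y => ψ (s⁻¹ • y)) x (e i) * p x) = _
    rw [h3]
    ring
  · have h3 := h.eqn _ (hψ h1)
    have e1 : ∀ i, ∫ x, s * g i (s • x) * pd i ψ x = (s ^ 3)⁻¹ *
        (s ^ 2 * ∫ y, g i y * pd i (fun y => ψ (s⁻¹ • y)) y) := fun i => by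
      rw [← integral_const_mul, ← integral_comp_smul_R3 hs]
      refine integral_congr_ae (.of_forall fun x => ?_)
      simp only
      rw [hpd ψ]
      ring
    have e2 : ∫ x in Metric.ball 0 l, (1 / 2 * (s ^ 2 * V (s • x)) - s ^ 2 * lam)
        * (p (s • x) * ψ x) = (s ^ 3)⁻¹ * (s ^ 2 *
          ∫ y in Metric.ball 0 (s * l), (1 / 2 * V y - lam) * (p y * ψ (s⁻¹ • y))) := by
      rw [← integral_const_mul, ← setIntegral_comp_smul_R3 hs]
      refine integral_congr_ae (.of_forall fun x => ?_)
      simp only [smul_smul, inv_mul_cancel₀ hs.ne', one_smul]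
      ring
    rw [e2, Finset.sum_congr rfl fun i _ => e1 i, ← Finset.mul_sum, ← Finset.mul_sum, ← mul_add,
      ← mul_add, h3, mul_zero, mul_zero]

end scaling

/-- The correlation of `∂ᵢ|u|²` with `|u|²`, which is the partial derivative of `Ψ`. -/
def gradDensityCorr (u : H1) (i : Fin 3) : R3 → ℝ := corr (gradDensity i u) (density u)

theorem gradDensityCorr_eq (u : H1) (i : Fin 3) :
    gradDensityCorr u i = corr (gradDensity i u) (density3 u u) :=
  (corr_congr ae_eq_rfl (coeFn_density3_self u)).symm

theorem continuous_integral_mul_corr {X : Type*} [TopologicalSpace X] {m : R3 → ℝ}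
    (hm : Integrable m) {a : X → Lp ℝ (3 / 2) (volume : Measure R3)}
    {b : X → Lp ℝ 3 (volume : Measure R3)} (ha : Continuous a) (hb : Continuous b) :
    Continuous fun x => ∫ z, m z * corr (a x) (b x) z := by
  have h : ∀ x, ∫ z, m z * corr (a x) (b x) z = ContinuousLinearMap.lpPairing volume 1 ∞
      (ContinuousLinearMap.mul ℝ ℝ) ((memLp_one_iff_integrable.2 hm).toLp m) (corrL (a x) (b x)) := by
    intro x
    rw [ContinuousLinearMap.lpPairing_eq_integral]
    refine integral_congr_ae ?_
    filter_upwards [(memLp_one_iff_integrable.2 hm).coeFn_toLp, coeFn_corrL (a x) (b x)] with z h1 h2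
    rw [h1, h2]
    rfl
  simp only [h]
  exact (ContinuousLinearMap.lpPairing volume 1 ∞ _ _).continuous.comp
    ((corrL.continuous.comp ha).clm_apply hb)

theorem continuous_integral_mul_densityCorr_of_integrable {m : R3 → ℝ} (hm : Integrable m) :
    Continuous fun u => ∫ z, m z * densityCorr u z := by
  simp only [densityCorr_eq]
  exact continuous_integral_mul_corr hm continuous_density32_self continuous_density3_self

theorem continuous_integral_mul_gradDensityCorr {m : R3 → ℝ} (hm : Integrable m) (i : Fin 3) :
    Continuous fun u => ∫ z, m z * gradDensityCorr u i z := by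
  simp only [gradDensityCorr_eq]
  exact continuous_integral_mul_corr hm (continuous_gradDensity i) continuous_density3_self

section ofSmooth

variable {v : R3 → ℂ} (hv : ContDiff ℝ ∞ v) (hc : HasCompactSupport v)
include hv hc

theorem density_ofSmooth : density (ofSmooth hv hc) =ᵐ[volume] fun y => ‖v y‖ ^ 2 := by
  filter_upwards [coeFn_ofSmooth hv hc] with x h
  rw [density, h]

theorem densityCorr_ofSmooth :
    densityCorr (ofSmooth hv hc) = corr (fun y => ‖v y‖ ^ 2) (fun y => ‖v y‖ ^ 2) :=
  corr_congr (density_ofSmooth hv hc) (density_ofSmooth hv hc)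

theorem locallyIntegrable_normSq : LocallyIntegrable fun y => ‖v y‖ ^ 2 :=
  (contDiff_normSq hv).continuous.locallyIntegrable

theorem contDiff_densityCorr_ofSmooth : ContDiff ℝ ∞ (densityCorr (ofSmooth hv hc)) := by
  rw [densityCorr_ofSmooth]
  exact contDiff_corr (contDiff_normSq hv) (hasCompactSupport_normSq hc)
    (locallyIntegrable_normSq hv hc)

theorem hasCompactSupport_densityCorr_ofSmooth :
    HasCompactSupport (densityCorr (ofSmooth hv hc)) := by
  rw [densityCorr_ofSmooth, corr_eq_convolution]
  exact HasCompactSupport.convolution _ (hasCompactSupport_normSq hc)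
    ((hasCompactSupport_normSq hc).comp_homeomorph (Homeomorph.neg R3))

theorem pd_densityCorr_ofSmooth (i : Fin 3) :
    pd i (densityCorr (ofSmooth hv hc)) = gradDensityCorr (ofSmooth hv hc) i := by
  rw [densityCorr_ofSmooth, pd_corr (contDiff_normSq hv) (hasCompactSupport_normSq hc)
    (locallyIntegrable_normSq hv hc)]
  exact corr_congr (gradDensity_ofSmooth hv hc i).symm (density_ofSmooth hv hc).symm

end ofSmooth

namespace IsProfile

variable {V : R3 → ℝ} {l lam : ℝ} {p : R3 → ℝ} {g : Fin 3 → R3 → ℝ}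

theorem hasCompactSupport_one_sub (h : IsProfile V l lam 1 p g) :
    HasCompactSupport fun z => 1 - p z :=
  HasCompactSupport.intro (isCompact_closedBall (0 : R3) l) fun x hx => by
    rw [h.eq_c x (by simpa using (not_le.1 (by simpa using hx)).le), sub_self]

theorem memLp_one_sub (h : IsProfile V l lam 1 p g) : MemLp (fun z => 1 - p z) 2 volume :=
  (continuous_const.sub h.cont).memLp_of_hasCompactSupport h.hasCompactSupport_one_sub

theorem integrable_sq (h : IsProfile V l lam 1 p g) (i : Fin 3) : Integrable fun z => g i z ^ 2 :=
  (h.memLp i).integrable_sq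

theorem integrable_one_sub_mul (h : IsProfile V l lam 1 p g) (i : Fin 3) :
    Integrable fun z => (1 - p z) * g i z :=
  h.memLp_one_sub.integrable_mul (h.memLp i)

/-- The equation for the profile `p`, tested against `(1 - p) Ψ`. -/
theorem test_densityCorr (h : IsProfile V l lam 1 p g) (hV : Integrable V) (u : H1) :
    ∑ i, ((∫ z, g i z ^ 2 * densityCorr u z) - ∫ z, ((1 - p z) * g i z) * gradDensityCorr u i z)
      = ∫ z, (Metric.ball 0 l).indicator (fun z => (1 / 2 * V z - lam) * (p z * (1 - p z))) z
          * densityCorr u z := by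
  have hind : Integrable ((Metric.ball 0 l).indicator
      fun z => (1 / 2 * V z - lam) * (p z * (1 - p z))) :=
    (integrable_indicator_iff measurableSet_ball).2
      (integrableOn_potential hV (h.cont.mul (continuous_const.sub h.cont)) l lam)
  refine eq_of_eq_on_smooth (F := fun u => ∑ i, ((∫ z, g i z ^ 2 * densityCorr u z)
    - ∫ z, ((1 - p z) * g i z) * gradDensityCorr u i z)) (continuous_finsetSum _ fun i _ =>
    (continuous_integral_mul_densityCorr_of_integrable (h.integrable_sq i)).sub
      (continuous_integral_mul_gradDensityCorr (h.integrable_one_sub_mul i) i))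
    (continuous_integral_mul_densityCorr_of_integrable hind) (fun v hv hc => ?_) u
  simp only [← pd_densityCorr_ofSmooth hv hc]
  set Ψ := densityCorr (ofSmooth hv hc)
  have hΨ : ContDiff ℝ ∞ Ψ := contDiff_densityCorr_ofSmooth hv hc
  have hΨc : HasCompactSupport Ψ := hasCompactSupport_densityCorr_ofSmooth hv hc
  obtain ⟨B, hB⟩ := hΨc.exists_bound_of_continuous hΨ.continuous
  obtain ⟨M, hM⟩ := h.exists_bound
  have hMn : ∀ n x, |1 - smoothen n p x| ≤ 1 + M := fun n x => by
    have h1 : |smoothen n p x| ≤ M := (Real.norm_eq_abs _).symm.trans_le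
      (norm_smoothen_le (fun x => (Real.norm_eq_abs _).trans_le (hM x)) n x)
    calc |1 - smoothen n p x| ≤ |1| + |smoothen n p x| := abs_sub _ _
      _ ≤ 1 + M := by rw [abs_one]; gcongr
  have hgΨ : ∀ i, MemLp (fun z => g i z * Ψ z) 2 volume := fun i => by
    refine ((h.memLp i).const_mul B).mono ((h.memLp i).1.mul hΨ.continuous.aestronglyMeasurable)
      (.of_forall fun x => ?_)
    rw [norm_mul, norm_mul, mul_comm]
    exact mul_le_mul_of_nonneg_right ((hB x).trans (le_abs_self B)) (norm_nonneg _)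
  have hΨi : ∀ i, MemLp (pd i Ψ) 2 volume := fun i =>
    (contDiff_pd hΨ i).continuous.memLp_of_hasCompactSupport (hasCompactSupport_pd hΨc i)
  have i1 : ∀ n i, Integrable fun z => (g i z * Ψ z) * smoothen n (g i) z := fun n i =>
    (hgΨ i).integrable_mul (memLp_smoothen (h.memLp i) n)
  have hs : ∀ n, Continuous fun z => 1 - smoothen n p z := fun n =>
    continuous_const.sub (h.contDiff_smoothen n).continuous
  have i2 : ∀ n i, Integrable fun z => (1 - smoothen n p z) * (g i z * pd i Ψ z) := fun n i =>
    ((h.memLp i).integrable_mul (hΨi i)).bdd_mul (hs n).aestronglyMeasurable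
      (.of_forall fun x => (Real.norm_eq_abs _).trans_le (hMn n x))
  have hlim : ∀ x, Tendsto (fun n => 1 - smoothen n p x) atTop (𝓝 (1 - p x)) := fun x =>
    (h.tendsto_smoothen x).const_sub 1
  have h1 : ∀ i, Tendsto (fun n => ∫ z, (g i z * Ψ z) * smoothen n (g i) z) atTop
      (𝓝 (∫ z, (g i z * Ψ z) * g i z)) := fun i =>
    tendsto_integral_mul_of_L2 (fun _ => hgΨ i) (fun n => memLp_smoothen (h.memLp i) n) (hgΨ i)
      (h.memLp i) (by simp) (tendsto_eLpNorm_smoothen_sub (h.memLp i))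
  have h2 : ∀ i, Tendsto (fun n => ∫ z, (1 - smoothen n p z) * (g i z * pd i Ψ z)) atTop
      (𝓝 (∫ z, (1 - p z) * (g i z * pd i Ψ z))) := fun i => by
    refine tendsto_integral_of_dominated_convergence (fun z => (1 + M) * ‖g i z * pd i Ψ z‖)
      (fun n => (i2 n i).1) (((h.memLp i).integrable_mul (hΨi i)).norm.const_mul _)
      (fun n => .of_forall fun z => ?_) (.of_forall fun z => (hlim z).mul_const _)
    rw [norm_mul]
    exact mul_le_mul_of_nonneg_right (hMn n z) (norm_nonneg _)
  have h3 : Tendsto (fun n => ∫ z in Metric.ball 0 l,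
      (1 / 2 * V z - lam) * (p z * ((1 - smoothen n p z) * Ψ z))) atTop
      (𝓝 (∫ z in Metric.ball 0 l, (1 / 2 * V z - lam) * (p z * ((1 - p z) * Ψ z)))) := by
    refine tendsto_potential hV (M := M * ((1 + M) * B))
      (fun n => h.cont.mul ((hs n).mul hΨ.continuous)) (fun n x _ => ?_)
      fun x => ((hlim x).mul_const _).const_mul _
    rw [abs_mul, abs_mul]
    have hM0 : 0 ≤ M := (abs_nonneg _).trans (hM x)
    have hBx : |Ψ x| ≤ B := hB x
    gcongr
    · exact hM x
    · exact hMn n x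
  -- The test functions have to be smooth, so `1 - p` is mollified.
  have key : ∀ n, (∑ i, (-(∫ z, (g i z * Ψ z) * smoothen n (g i) z)
      + ∫ z, (1 - smoothen n p z) * (g i z * pd i Ψ z)))
      + ∫ z in Metric.ball 0 l, (1 / 2 * V z - lam) * (p z * ((1 - smoothen n p z) * Ψ z)) = 0 := by
    intro n
    have hps := h.contDiff_smoothen n
    rw [← h.eqn (fun z => (1 - smoothen n p z) * Ψ z) ((contDiff_const.sub hps).mul hΨ)]
    congr 1
    refine Finset.sum_congr rfl fun i _ => ?_
    rw [neg_add_eq_sub, ← integral_sub (i2 n i) (i1 n i)]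
    refine integral_congr_ae (.of_forall fun z => ?_)
    have h5 : pd i (fun z => (1 - smoothen n p z) * Ψ z) z
        = (1 - smoothen n p z) * pd i Ψ z - smoothen n (g i) z * Ψ z := by
      rw [← h.pd_smoothen, pd, (((hps.differentiable (by simp) z).hasFDerivAt.const_sub 1).fun_mul
        (hΨ.differentiable (by simp) z).hasFDerivAt).fderiv]
      simp [pd]
      ring
    simp only [h5]
    ring
  have h6 := tendsto_nhds_unique
    ((tendsto_finsetSum Finset.univ fun i _ => (h1 i).neg.add (h2 i)).add h3)
    (tendsto_const_nhds.congr fun n => (key n).symm)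
  have e1 : ∫ z, (Metric.ball 0 l).indicator (fun z => (1 / 2 * V z - lam) * (p z * (1 - p z))) z * Ψ z
      = ∫ z in Metric.ball 0 l, (1 / 2 * V z - lam) * (p z * ((1 - p z) * Ψ z)) := by
    rw [← integral_indicator measurableSet_ball]
    refine integral_congr_ae (.of_forall fun z => ?_)
    by_cases hz : z ∈ Metric.ball (0 : R3) l
    · simp only [indicator_of_mem hz]
      ring
    · simp only [indicator_of_notMem hz, zero_mul]
  rw [e1, ← sub_eq_zero, ← neg_eq_zero, ← h6, neg_sub, sub_eq_add_neg, add_comm, ← Finset.sum_neg_distrib]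
  congr 1
  refine Finset.sum_congr rfl fun i _ => ?_
  have e2 : ∫ z, g i z ^ 2 * Ψ z = ∫ z, (g i z * Ψ z) * g i z :=
    integral_congr_ae (.of_forall fun z => by ring)
  have e3 : ∫ z, ((1 - p z) * g i z) * pd i Ψ z = ∫ z, (1 - p z) * (g i z * pd i Ψ z) :=
    integral_congr_ae (.of_forall fun z => by ring)
  rw [e2, e3]
  ring

end IsProfile

/-- The part of `∫ |∇ₓ k|²` in which the derivative falls on `u`. -/
def remainder (K : R3 → ℝ) (u : H1) : ℝ :=
  ∑ i, ∫ p : R3 × R3, ‖K (p.1 - p.2) • gradL i u p.1 * toL2 u p.2‖ ^ 2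

theorem hardy_integral (u : H1) (x : R3) :
    Integrable (fun y => (‖x - y‖ ^ 2)⁻¹ * ‖toL2 u y‖ ^ 2) ∧
      ∫ y, (‖x - y‖ ^ 2)⁻¹ * ‖toL2 u y‖ ^ 2 ≤ 4 * ∑ i, ‖gradL i u‖ ^ 2 := by
  have h := hardy u x
  have h0 : ∀ y, 0 ≤ (‖x - y‖ ^ 2)⁻¹ * ‖toL2 u y‖ ^ 2 := fun y => by positivity
  have hm : AEStronglyMeasurable (fun y => (‖x - y‖ ^ 2)⁻¹ * ‖toL2 u y‖ ^ 2) volume :=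
    (by fun_prop : Measurable fun y : R3 => (‖x - y‖ ^ 2)⁻¹).aestronglyMeasurable.mul
      ((Lp.memLp (toL2 u)).1.norm.pow 2)
  refine ⟨⟨hm, ?_⟩, ?_⟩
  · rw [hasFiniteIntegral_iff_ofReal (.of_forall h0)]
    exact h.trans_lt ENNReal.ofReal_lt_top
  · rw [integral_eq_lintegral_of_nonneg_ae (.of_forall h0) hm]
    exact ENNReal.toReal_le_of_le_ofReal (by positivity) h

theorem remainder_nonneg (K : R3 → ℝ) (u : H1) : 0 ≤ remainder K u :=
  Finset.sum_nonneg fun _ _ => integral_nonneg fun _ => by positivity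

/-- The remainder is bounded by Hardy's inequality, as `|K(z)| ≤ C / |z|`. -/
theorem remainder_le {K : R3 → ℝ} {M C : ℝ} (hK : Continuous K) (hM : ∀ x, |K x| ≤ M)
    (hC : ∀ x, ‖x‖ * |K x| ≤ C) (u : H1) :
    remainder K u ≤ 4 * C ^ 2 * (∑ i, ‖gradL i u‖ ^ 2) ^ 2 := by
  set S := ∑ i, ‖gradL i u‖ ^ 2
  have hi : ∀ i, ∫ p : R3 × R3, ‖K (p.1 - p.2) • gradL i u p.1 * toL2 u p.2‖ ^ 2
      ≤ 4 * C ^ 2 * S * ‖gradL i u‖ ^ 2 := fun i => by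
    have hint : Integrable (fun p : R3 × R3 => ‖K (p.1 - p.2) • gradL i u p.1 * toL2 u p.2‖ ^ 2) :=
      (memLp_bounded_mul_mul hK.aestronglyMeasurable hM (gradL i u)
        (toL2 u)).integrable_norm_pow (by norm_num)
    rw [Measure.volume_eq_prod] at hint ⊢
    rw [integral_prod _ hint, norm_sq_L2, ← integral_const_mul]
    refine integral_mono_of_nonneg (.of_forall fun x => integral_nonneg fun y => by positivity)
      ((integrable_norm_sq_L2 _).const_mul _) (.of_forall fun x => ?_)
    obtain ⟨h1, h2⟩ := hardy_integral u x
    calc ∫ y, ‖K (x - y) • gradL i u x * toL2 u y‖ ^ 2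
        ≤ ∫ y, (C ^ 2 * ‖gradL i u x‖ ^ 2) * ((‖x - y‖ ^ 2)⁻¹ * ‖toL2 u y‖ ^ 2) := by
          refine integral_mono_of_nonneg (.of_forall fun y => by positivity) (h1.const_mul _) ?_
          have hne : ∀ᵐ y : R3, y ≠ x := by simp [ae_iff]
          filter_upwards [hne] with y hy
          have hpos : 0 < ‖x - y‖ := norm_pos_iff.2 (sub_ne_zero.2 hy.symm)
          have h3 : K (x - y) ^ 2 ≤ C ^ 2 * (‖x - y‖ ^ 2)⁻¹ := by
            rw [← div_eq_mul_inv, le_div_iff₀ (by positivity), ← sq_abs, ← mul_pow, mul_comm]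
            exact pow_le_pow_left₀ (by positivity) (hC _) 2
          rw [norm_mul, norm_smul, Real.norm_eq_abs, mul_pow, mul_pow, sq_abs]
          calc K (x - y) ^ 2 * ‖gradL i u x‖ ^ 2 * ‖toL2 u y‖ ^ 2
              ≤ C ^ 2 * (‖x - y‖ ^ 2)⁻¹ * ‖gradL i u x‖ ^ 2 * ‖toL2 u y‖ ^ 2 := by gcongr
            _ = _ := by ring
      _ = C ^ 2 * ‖gradL i u x‖ ^ 2 * ∫ y, (‖x - y‖ ^ 2)⁻¹ * ‖toL2 u y‖ ^ 2 :=
          integral_const_mul _ _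
      _ ≤ C ^ 2 * ‖gradL i u x‖ ^ 2 * (4 * S) := by gcongr
      _ = _ := by ring
  calc remainder K u ≤ ∑ i, 4 * C ^ 2 * S * ‖gradL i u‖ ^ 2 := Finset.sum_le_sum fun i _ => hi i
    _ = 4 * C ^ 2 * S ^ 2 := by rw [← Finset.mul_sum]; ring

/-- The integral of `|∇ₓ k|²`: the square of the gradient of `K` and the cross term combine to the
quadratic form of the equation for the profile. -/
theorem IsProfile.integral_kernelGrad {V : R3 → ℝ} {l lam : ℝ} {p : R3 → ℝ} {g : Fin 3 → R3 → ℝ}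
    (h : IsProfile V l lam 1 p g) (hV : Integrable V) (s : ℝ) (u : H1) :
    ∫ q, ∑ i, ‖kernelGrad (fun z => s * (1 - p z)) (fun i z => -(s * g i z)) u i q‖ ^ 2
      = s ^ 2 * (∫ z, (Metric.ball 0 l).indicator
          (fun z => (1 / 2 * V z - lam) * (p z * (1 - p z))) z * densityCorr u z)
        + remainder (fun z => s * (1 - p z)) u := by
  obtain ⟨M, hM⟩ := h.hasCompactSupport_one_sub.exists_bound_of_continuous
    (continuous_const.sub h.cont)
  have hKM : ∀ x, |s * (1 - p x)| ≤ |s| * M := fun x => by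
    rw [abs_mul]
    exact mul_le_mul_of_nonneg_left (hM x) (abs_nonneg _)
  have hK : Continuous fun z => s * (1 - p z) := continuous_const.mul (continuous_const.sub h.cont)
  have hgd : ∀ i, MemLp (fun x => 2 * inner ℝ (gradL i u x) (toL2 u x)) (3 / 2) volume := fun i =>
    (Lp.memLp (gradDensity i u)).ae_eq (coeFn_gradDensity i u)
  have i1 := fun i => integrable_pair (h.integrable_sq i) (memLp_density u) (memLp_density_three u)
  have i2 := fun i => integrable_pair (h.integrable_one_sub_mul i) (hgd i) (memLp_density_three u)
  have i3 : ∀ i, Integrable fun q : R3 × R3 =>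
      ‖(s * (1 - p (q.1 - q.2))) • gradL i u q.1 * toL2 u q.2‖ ^ 2 := fun i =>
    (memLp_bounded_mul_mul hK.aestronglyMeasurable hKM (gradL i u)
      (toL2 u)).integrable_norm_pow (by norm_num)
  -- the square, with `2 Re (∂ᵢū u) = ∂ᵢ|u|²` in the cross term
  have hpt : ∀ i q, ‖kernelGrad (fun z => s * (1 - p z)) (fun i z => -(s * g i z)) u i q‖ ^ 2
      = s ^ 2 * (g i (q.1 - q.2) ^ 2 * (density u q.1 * density u q.2))
        - s ^ 2 * ((1 - p (q.1 - q.2)) * g i (q.1 - q.2)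
          * (2 * inner ℝ (gradL i u q.1) (toL2 u q.1) * density u q.2))
        + ‖(s * (1 - p (q.1 - q.2))) • gradL i u q.1 * toL2 u q.2‖ ^ 2 := fun i q => by
    rw [kernelGrad, norm_mul, norm_neg, mul_pow, norm_add_sq_real, norm_mul, mul_pow, norm_smul,
      norm_smul, real_inner_smul_left, real_inner_smul_right, real_inner_comm, density, density,
      mul_pow, mul_pow, Real.norm_eq_abs, Real.norm_eq_abs, sq_abs, sq_abs]
    ring
  rw [integral_finsetSum _ fun i _ => ?_, ← h.test_densityCorr hV, Finset.mul_sum, remainder,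
    ← Finset.sum_add_distrib]
  · refine Finset.sum_congr rfl fun i _ => ?_
    simp only [hpt]
    rw [integral_add (Integrable.sub' ((i1 i).const_mul _) ((i2 i).const_mul _)) (i3 i),
      integral_sub ((i1 i).const_mul _) ((i2 i).const_mul _), integral_const_mul,
      integral_const_mul, integral_pair (h.integrable_sq i) (memLp_density u)
      (memLp_density_three u), integral_pair (h.integrable_one_sub_mul i) (hgd i)
      (memLp_density_three u), mul_sub, gradDensityCorr, densityCorr,
      corr_congr (coeFn_gradDensity i u) ae_eq_rfl]
  · simp only [hpt]
    exact (Integrable.sub' ((i1 i).const_mul _) ((i2 i).const_mul _)).fun_add (i3 i)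

end

section

/-! ### Bounds on the density correlation -/

theorem densityCorr_nonneg (u : H1) (z : R3) : 0 ≤ densityCorr u z :=
  integral_nonneg fun x => by unfold density; positivity

theorem continuous_densityCorr (u : H1) : Continuous (densityCorr u) := by
  rw [densityCorr_eq]
  exact continuous_corr _ _

theorem exists_norm_density32_le : ∃ B, 0 ≤ B ∧ ∀ u : H1, ‖density32 u u‖ ≤ B * ‖u‖ ^ 2 := by
  refine ⟨‖innerL‖ * ‖toL6‖, by positivity, fun u => ?_⟩
  have h : density32 u u = innerL (toL2 u) (toL6 u) := by
    rw [density32]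
    rfl
  rw [h]
  calc ‖innerL (toL2 u) (toL6 u)‖ ≤ ‖innerL‖ * ‖toL2 u‖ * ‖toL6 u‖ := innerL.le_opNorm₂ _ _
    _ ≤ ‖innerL‖ * ‖u‖ * (‖toL6‖ * ‖u‖) := by
        gcongr
        · exact norm_toL2_le u
        · exact toL6.le_opNorm u
    _ = _ := by ring

theorem exists_norm_density3_le : ∃ B, 0 ≤ B ∧ ∀ u : H1, ‖density3 u u‖ ≤ B * ‖u‖ ^ 2 := by
  set L := (innerSL ℝ : ℂ →L[ℝ] ℂ →L[ℝ] ℝ).holderL (volume : Measure R3) 6 6 3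
  refine ⟨‖L‖ * ‖toL6‖ * ‖toL6‖, by positivity, fun u => ?_⟩
  have h : density3 u u = L (toL6 u) (toL6 u) := by
    rw [density3]
    rfl
  rw [h]
  calc ‖L (toL6 u) (toL6 u)‖ ≤ ‖L‖ * ‖toL6 u‖ * ‖toL6 u‖ := L.le_opNorm₂ _ _
    _ ≤ ‖L‖ * (‖toL6‖ * ‖u‖) * (‖toL6‖ * ‖u‖) := by
        gcongr <;> exact toL6.le_opNorm u
    _ = _ := by ring

theorem exists_densityCorr_le :
    ∃ B, 0 ≤ B ∧ ∀ (u : H1) (z : R3), densityCorr u z ≤ B * (‖u‖ ^ 2) ^ 2 := by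
  obtain ⟨B₁, h₁, hB₁⟩ := exists_norm_density32_le
  obtain ⟨B₂, h₂, hB₂⟩ := exists_norm_density3_le
  refine ⟨B₁ * B₂, by positivity, fun u z => ?_⟩
  rw [densityCorr_eq]
  refine (le_abs_self _).trans ((abs_corr_le _ _ _).trans ?_)
  calc ‖density32 u u‖ * ‖density3 u u‖ ≤ (B₁ * ‖u‖ ^ 2) * (B₂ * ‖u‖ ^ 2) :=
        mul_le_mul (hB₁ u) (hB₂ u) (norm_nonneg _) (by positivity)
    _ = _ := by ring

theorem densityCorr_zero (u : H1) : densityCorr u 0 = ∫ x, ‖toL2 u x‖ ^ 4 := by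
  refine integral_congr_ae (.of_forall fun x => ?_)
  simp only [density, sub_zero]
  ring

theorem continuous_corr_apply {X : Type*} [TopologicalSpace X]
    {a : X → Lp ℝ (3 / 2) (volume : Measure R3)} {b : X → Lp ℝ 3 (volume : Measure R3)}
    (ha : Continuous a) (hb : Continuous b) (z : R3) : Continuous fun x => corr (a x) (b x) z := by
  simp only [corr_eq_dualPairing]
  refine (dualPairing.continuous.comp ha).clm_apply ?_
  have : Isometry (translate z) := Isometry.of_dist_eq fun f g => DomAddAct.dist_vadd_Lp _ f g
  exact this.continuous.comp hb

theorem abs_densityCorr_sub_le (u : H1) (z : R3) :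
    |densityCorr u z - densityCorr u 0| ≤ (∑ i, ‖gradDensity i u‖ * ‖density3 u u‖) * ‖z‖ := by
  have hc : ∀ z, Continuous fun u : H1 => densityCorr u z := fun z => by
    simp only [densityCorr_eq]
    exact continuous_corr_apply continuous_density32_self continuous_density3_self z
  refine le_of_le_on_smooth (F := fun u => |densityCorr u z - densityCorr u 0|)
    ((hc z).sub (hc 0)).abs ((continuous_finsetSum _ fun i _ =>
      (continuous_gradDensity i).norm.mul continuous_density3_self.norm).mul continuous_const)
    (fun v hv hcv => ?_) u
  set w := ofSmooth hv hcv
  have hd := (contDiff_densityCorr_ofSmooth hv hcv).differentiable (by simp)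
  have hbound : ∀ x, ‖fderiv ℝ (densityCorr w) x‖ ≤ ∑ i, ‖gradDensity i w‖ * ‖density3 w w‖ :=
    fun x => (norm_fderiv_le_sum x).trans (Finset.sum_le_sum fun i _ => by
      rw [pd_densityCorr_ofSmooth hv hcv, gradDensityCorr_eq, Real.norm_eq_abs]
      exact abs_corr_le _ _ _)
  have h := convex_univ.norm_image_sub_le_of_norm_fderiv_le (𝕜 := ℝ) (fun x _ => hd x)
    (fun x _ => hbound x) (mem_univ (0 : R3)) (mem_univ z)
  simpa using h

/-! ### The modified equation and the constant -/

/-- The potential `N³ V(N·)`. -/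
def dilated (V : R3 → ℝ) (N : ℕ) (z : R3) : ℝ := (N : ℝ) ^ 3 * V ((N : ℝ) • z)

section

variable {V : R3 → ℝ} {N : ℕ} (hN : 1 ≤ N) (hV : IsPotential V)
include hN

theorem cast_pos_of_one_le : (0 : ℝ) < N := by exact_mod_cast hN

include hV

theorem isPotential_dilated : IsPotential (dilated V N) where
  memLp := (memLp_comp_smul (cast_pos_of_one_le hN) hV.memLp).const_mul _
  nonneg x := mul_nonneg (by positivity) (hV.nonneg _)
  compact := (hasCompactSupport_comp_smul (cast_pos_of_one_le hN) hV.compact).mul_left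
  even x := by rw [dilated, dilated, smul_neg, hV.even]

theorem integral_dilated_mul (q : R3 → ℝ) :
    ∫ z, dilated V N z * q ((N : ℝ) • z) = ∫ z, V z * q z := by
  have hN0 := cast_pos_of_one_le hN
  have h := integral_comp_smul_R3 hN0 fun z => V z * q z
  simp only [dilated, mul_assoc]
  rw [integral_const_mul, h]
  field_simp

theorem integral_dilated : ∫ z, dilated V N z = ∫ z, V z := by
  simpa using integral_dilated_mul hN hV fun _ => 1

end

/-- The hypotheses on `V` and the bounds on `f` for a fixed `N`. -/
structure DilatedBounds (V : R3 → ℝ) (l a : ℝ) (N : ℕ) (C lam : ℝ) (f : R3 → ℝ) : Prop where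
  pos : 1 ≤ N
  potential : IsPotential V
  bounds : GroundStateBounds V l a N C lam f

namespace DilatedBounds

variable {V : R3 → ℝ} {l a : ℝ} {N : ℕ} {C lam : ℝ} {f : R3 → ℝ}
  (h : DilatedBounds V l a N C lam f)
include h

theorem continuous : Continuous f := by
  obtain ⟨g, hg⟩ := h.bounds.profile
  exact hg.cont

theorem continuous_dilate : Continuous fun z : R3 => f ((N : ℝ) • z) :=
  h.continuous.comp (continuous_const_smul _)

theorem dilated_potential : IsPotential (dilated V N) := isPotential_dilated h.pos h.potential

theorem integrable {q : R3 → ℝ} (hq : Continuous q) : Integrable fun z => dilated V N z * q z :=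
  h.dilated_potential.integrable_mul hq

theorem isPotential_modPotential : IsPotential (modPotential V f N) where
  memLp := by
    refine (h.dilated_potential.memLp.const_mul C).mono
      (h.dilated_potential.memLp.1.mul h.continuous_dilate.aestronglyMeasurable)
      (.of_forall fun z => ?_)
    change ‖dilated V N z * f ((N : ℝ) • z)‖ ≤ _
    rw [norm_mul, norm_mul, mul_comm]
    gcongr
    rw [Real.norm_of_nonneg (h.bounds.nonneg _)]
    exact (h.bounds.le _).trans (le_abs_self _)
  nonneg x := mul_nonneg (h.dilated_potential.nonneg x) (h.bounds.nonneg _)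
  compact := h.dilated_potential.compact.mul_right
  even x := by
    change dilated V N (-x) * f ((N : ℝ) • -x) = dilated V N x * f ((N : ℝ) • x)
    rw [h.dilated_potential.even, smul_neg, h.bounds.even]

theorem integrable_mul_densityCorr {m : R3 → ℝ} (hm : Integrable m) (u : H1) :
    Integrable fun z => m z * densityCorr u z :=
  integrable_mul_corr hm (memLp_density u) (memLp_density_three u)

/-- The expectation of a convolution with the density, in terms of the correlation of the density. -/
theorem integral_convSq {m : R3 → ℝ} (hm : Integrable m) (heven : ∀ z, m (-z) = m z) (u : H1) :
    ∫ x, convSq m u x * ‖toL2 u x‖ ^ 2 = ∫ z, m z * densityCorr u z := by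
  rw [densityCorr, ← integral_corr_mul hm (memLp_density u) (memLp_density_three u) heven,
    convSq_eq_corr heven]
  rfl

theorem kernel_eq (u : H1) : kernel f N u = fun p : R3 × R3 =>
    ((N : ℝ) * (1 - f ((N : ℝ) • (p.1 - p.2)))) • toL2 u p.1 * (-toL2 u p.2) := by
  funext p
  rw [kernel, Complex.real_smul]
  ring

/-- The kernel has a weak gradient `kernelGrad`, with the gradient of the dilated profile. -/
theorem exists_gradX_and_gradXSq_eq (u : H1) : (∃ G, IsGradX (kernel f N u) G) ∧
    gradXSq (kernel f N u)
    = N / 2 * (∫ z, (dilated V N z * (f ((N : ℝ) • z) * (1 - f ((N : ℝ) • z)))) * densityCorr u z)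
      - N ^ 4 * lam * (∫ z, (f ((N : ℝ) • z) * (1 - f ((N : ℝ) • z))) * densityCorr u z)
      + remainder (fun z => N * (1 - f ((N : ℝ) • z))) u := by
  obtain ⟨g, hg⟩ := h.bounds.profile
  have hN0 := cast_pos_of_one_le h.pos
  have hs := hg.scale hN0
  set p : R3 → ℝ := fun z => f ((N : ℝ) • z)
  set g' : Fin 3 → R3 → ℝ := fun i z => (N : ℝ) * g i ((N : ℝ) • z)
  obtain ⟨M, hM⟩ := hs.hasCompactSupport_one_sub.exists_bound_of_continuous
    (continuous_const.sub hs.cont)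
  have hKM : ∀ x, |(N : ℝ) * (1 - p x)| ≤ N * M := fun x => by
    rw [abs_mul, abs_of_pos hN0]
    exact mul_le_mul_of_nonneg_left (hM x) hN0.le
  have hK : UniformContinuous fun z => (N : ℝ) * (1 - p z) :=
    (continuous_const.mul (continuous_const.sub hs.cont)).uniformContinuous_of_tendsto_cocompact
      (x := 0) (HasCompactSupport.is_zero_at_infty (hs.hasCompactSupport_one_sub.mul_left))
  have hκ : ∀ i, MemLp (fun z => -((N : ℝ) * g' i z)) 2 volume := fun i =>
    ((hs.memLp i).const_mul (N : ℝ)).neg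
  have hw : ∀ i, IsWeakDeriv univ (e i) (fun z => (N : ℝ) * (1 - p z))
      (fun z => -((N : ℝ) * g' i z)) := fun i => by
    intro ψ hψ hc hsub
    have h1 := hs.weak i ψ hψ hc hsub
    have h2 := isWeakDeriv_of_contDiff (contDiff_const (c := (1 : ℝ))) (e i) ψ hψ hc hsub
    simp only [Measure.restrict_univ, smul_eq_mul, fderiv_fun_const, Pi.zero_apply,
      _root_.zero_apply, mul_zero, integral_zero, neg_zero] at h1 h2 ⊢
    have hd : Continuous fun x => fderiv ℝ ψ x (e i) := (contDiff_pd hψ i).continuous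
    have hdc : HasCompactSupport fun x => fderiv ℝ ψ x (e i) := hasCompactSupport_pd hc i
    have i1 : Integrable fun x => fderiv ℝ ψ x (e i) * 1 :=
      (hd.mul continuous_const).integrable_of_hasCompactSupport hdc.mul_right
    have i2 : Integrable fun x => fderiv ℝ ψ x (e i) * p x :=
      (hd.mul hs.cont).integrable_of_hasCompactSupport hdc.mul_right
    have e1 : ∫ x, fderiv ℝ ψ x (e i) * ((N : ℝ) * (1 - p x))
        = N * ((∫ x, fderiv ℝ ψ x (e i) * 1) - ∫ x, fderiv ℝ ψ x (e i) * p x) := by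
      rw [← integral_sub i1 i2, ← integral_const_mul]
      exact integral_congr_ae (.of_forall fun x => by ring)
    have e2 : ∫ x, ψ x * -((N : ℝ) * g' i x) = -(N * ∫ x, ψ x * g' i x) := by
      rw [← integral_const_mul, ← integral_neg]
      exact integral_congr_ae (.of_forall fun x => by ring)
    rw [e1, e2, h1, h2]
    ring
  rw [h.kernel_eq]
  refine ⟨⟨_, isGradX_kernelGrad hK hKM hκ hw u⟩, ?_⟩
  rw [gradXSq_eq hK hKM hκ hw u]
  have hVint : Integrable fun z => (N : ℝ) ^ 2 * V ((N : ℝ) • z) :=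
    (h.potential.integrable.comp_smul hN0.ne').const_mul _
  rw [hs.integral_kernelGrad hVint]
  have hω : Continuous fun z => p z * (1 - p z) := hs.cont.mul (continuous_const.sub hs.cont)
  have hωi : Integrable fun z => p z * (1 - p z) :=
    hω.integrable_of_hasCompactSupport hs.hasCompactSupport_one_sub.mul_left
  have i1 := h.integrable_mul_densityCorr (h.integrable hω) u
  have i2 := h.integrable_mul_densityCorr hωi u
  rw [← integral_const_mul, ← integral_const_mul, ← integral_const_mul,
    ← integral_sub (i1.const_mul _) (i2.const_mul _)]
  congr 1
  refine integral_congr_ae (.of_forall fun z => ?_)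
  by_cases hz : z ∈ Metric.ball (0 : R3) l
  · simp only [indicator_of_mem hz, dilated]
    ring
  · have hp : p z = 1 := hs.eq_c z (by simpa using hz)
    -- Outside the ball `p = 1`, so that the integrands vanish.
    simp [indicator_of_notMem hz, hp]

/-- The constant in terms of the correlation of the density: the leading part is `-(N/2) ∫ W Ψ`. -/
theorem constC_eq (u : H1) : constC V f N u
    = -(N / 2) * (∫ z, modPotential V f N z * densityCorr u z)
      - 1 / 2 * (∫ z, dilated V N z * densityCorr u z)
      - N ^ 4 * lam * (∫ z, (f ((N : ℝ) • z) * (1 - f ((N : ℝ) • z))) * densityCorr u z)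
      + remainder (fun z => N * (1 - f ((N : ℝ) • z))) u := by
  have hp := h.continuous_dilate
  set p : R3 → ℝ := fun z => f ((N : ℝ) • z)
  have hΨ := continuous_densityCorr u
  have hNpos := h.pos
  have hu := memLp_density u
  have hu3 := memLp_density_three u
  have i0 : ∀ {q : R3 → ℝ}, Continuous q → Integrable fun z => dilated V N z * q z :=
    fun hq => h.integrable hq
  have i1 : ∀ {q : R3 → ℝ}, Continuous q →
      Integrable fun z => dilated V N z * q z * densityCorr u z :=
    fun hq => h.integrable_mul_densityCorr (i0 hq) u
  have c1 : Continuous fun z => (N : ℝ) - 1 - 2 * N * p z := by fun_prop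
  have c2 : Continuous fun z => (1 - p z) ^ 2 := by fun_prop
  have c3 : Continuous fun z => 1 - p z := by fun_prop
  have t1 : ∫ x, convSq (fun z => (N : ℝ) ^ 3 * V ((N : ℝ) • z)
      * ((N : ℝ) - 1 - 2 * N * f ((N : ℝ) • z))) u x * ‖toL2 u x‖ ^ 2
      = ∫ z, dilated V N z * ((N : ℝ) - 1 - 2 * N * p z) * densityCorr u z :=
    h.integral_convSq (i0 c1) (fun z => by
      have h1 := h.dilated_potential.even z
      have h2 : p (-z) = p z := by simp only [p, smul_neg, h.bounds.even]
      change dilated V N (-z) * (_ - 2 * N * p (-z)) = _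
      rw [h1, h2]) u
  have t3 : ∫ q : R3 × R3, (N : ℝ) ^ 2 * V ((N : ℝ) • (q.1 - q.2)) * ‖kernel f N u q‖ ^ 2
      = N * ∫ z, dilated V N z * (1 - p z) ^ 2 * densityCorr u z := by
    rw [densityCorr, ← integral_pair (i0 c2) hu hu3, ← integral_const_mul]
    refine integral_congr_ae (.of_forall fun q => ?_)
    simp only [kernel, norm_mul, norm_neg, Complex.norm_real, mul_pow, Real.norm_eq_abs, sq_abs,
      dilated, density, p]
    ring
  have t4 : (∫ q : R3 × R3, (((N : ℝ) ^ 3 * V ((N : ℝ) • (q.1 - q.2)) : ℝ) : ℂ)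
      * (starRingEnd ℂ) (toL2 u q.1) * (starRingEnd ℂ) (toL2 u q.2) * kernel f N u q).re
      = -(N * ∫ z, dilated V N z * (1 - p z) * densityCorr u z) := by
    rw [densityCorr, ← integral_pair (i0 c3) hu hu3, ← integral_const_mul, ← integral_neg,
      ← Complex.ofReal_re (∫ _, _), ← integral_complex_ofReal]
    congr 1
    refine integral_congr_ae (.of_forall fun q => ?_)
    have e1 := Complex.conj_mul' (toL2 u q.1)
    have e2 := Complex.conj_mul' (toL2 u q.2)
    simp only [kernel, dilated, density, p]
    push_cast
    rw [← e1, ← e2]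
    ring
  rw [constC, t1, t3, t4, (h.exists_gradX_and_gradXSq_eq u).2]
  have e1 : ∫ z, modPotential V f N z * densityCorr u z
      = ∫ z, dilated V N z * p z * densityCorr u z := rfl
  have e2 : ∫ z, dilated V N z * densityCorr u z = ∫ z, dilated V N z * 1 * densityCorr u z := by
    simp
  rw [e1, e2]
  -- `1/2 - p + p (1 - p)/2 + (1 - p)²/2 - (1 - p) = -p/2`
  have key : 1 / 2 * (∫ z, dilated V N z * ((N : ℝ) - 1 - 2 * N * p z) * densityCorr u z)
      + N / 2 * (∫ z, dilated V N z * (p z * (1 - p z)) * densityCorr u z)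
      + 1 / 2 * (N * ∫ z, dilated V N z * (1 - p z) ^ 2 * densityCorr u z)
      + -(N * ∫ z, dilated V N z * (1 - p z) * densityCorr u z)
      = -(N / 2) * (∫ z, dilated V N z * p z * densityCorr u z)
        - 1 / 2 * ∫ z, dilated V N z * 1 * densityCorr u z := by
    rw [← mul_assoc (1 / 2 : ℝ) (N : ℝ), ← neg_mul, ← integral_const_mul, ← integral_const_mul,
      ← integral_const_mul, ← integral_const_mul, ← integral_const_mul, ← integral_const_mul,
      ← integral_add ((i1 c1).const_mul _) ((i1 (hp.fun_mul c3)).const_mul _),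
      ← integral_add (((i1 c1).const_mul _).fun_add ((i1 (hp.fun_mul c3)).const_mul _))
        ((i1 c2).const_mul _),
      ← integral_add ((((i1 c1).const_mul _).fun_add ((i1 (hp.fun_mul c3)).const_mul _)).fun_add
        ((i1 c2).const_mul _)) ((i1 c3).const_mul _),
      ← integral_sub ((i1 hp).const_mul _) ((i1 continuous_const).const_mul _)]
    refine integral_congr_ae (.of_forall fun z => ?_)
    simp only
    ring
  linear_combination key

end DilatedBounds

end

section

/-! ### Uniform bounds -/

theorem hasDerivAt_clm_comp {F : Type*} [NormedAddCommGroup F] [NormedSpace ℝ F] {g : ℝ → F}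
    {t : ℝ} (hg : DifferentiableAt ℝ g t) (L : F →L[ℝ] ℝ) :
    HasDerivAt (fun s => L (g s)) (L (deriv g t)) t :=
  L.hasFDerivAt.comp_hasDerivAt t hg.hasDerivAt

/-- The derivative in `H⁻¹` may be tested against a fixed element of `H¹`. The norm instances are
given explicitly because `Differentiable` on `HMinus1` elaborates with the defeq instances of the
space of continuous linear maps between topological vector spaces. -/
theorem hasDerivAt_re_apply {g : ℝ → HMinus1} (hg : Differentiable ℝ g) (t : ℝ) (v : H1) :
    HasDerivAt (fun s => (g s v).re) (deriv g t v).re t := by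
  let L : HMinus1 →ₗ[ℝ] ℝ :=
    { toFun := fun F => (F v).re
      map_add' := fun F G => by simp
      map_smul' := fun c F => by simp }
  let Lc := @LinearMap.mkContinuous ℝ ℝ HMinus1 ℝ _ _
    ContinuousLinearMap.toSeminormedAddCommGroup _ ContinuousLinearMap.toNormedSpace.toModule _ _
    L ‖v‖ fun F => by
      rw [mul_comm]
      exact (Complex.abs_re_le_norm _).trans (F.le_opNorm v)
  exact @hasDerivAt_clm_comp HMinus1 ContinuousLinearMap.toNormedAddCommGroup
    ContinuousLinearMap.toNormedSpace g t (hg t) Lc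

/-- The equation in `H⁻¹`, tested against `H¹`. The real part suffices, since `i v` may be tested
too. -/
theorem IsModifiedGPSolution.isHartreeSolution {V f : R3 → ℝ} {N : ℕ} {φ : H1} {u : ℝ → H1}
    (hu : IsModifiedGPSolution V f N φ u) (hW : IsPotential (modPotential V f N)) :
    IsHartreeSolution hW u where
  continuous := hu.continuous
  equation t v := by
    have h3 := hasDerivAt_re_apply hu.differentiable t v
    have e0 : ∀ f g : L2, (inner ℂ f g : ℂ).re = inner ℝ f g := re_inner_L2
    have e1 : (iTimeDeriv u t v).re
        = gradForm (u t) v + inner ℝ (hartreeL2 hW.toL3 (u t)) (toL2 v) := by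
      rw [hu.equation, Complex.add_re, inner_grad, Complex.re_sum, gradForm, ← e0]
      congr 1
      · exact Finset.sum_congr rfl fun i _ => e0 _ _
      rw [L2.inner_def]
      congr 1
      refine integral_congr_ae ?_
      filter_upwards [coeFn_boundedMul_corrL (density32 (u t) (u t)) hW.toL3 (toL2 (u t))] with x hx
      rw [hartreeL2, hx, convSq_eq hW, RCLike.inner_apply, Complex.real_smul, mul_comm]
    refine (h3.congr_deriv e1).congr_of_eventuallyEq (.of_forall fun s => ?_)
    exact (e0 _ _).symm

theorem integrable_density_sq (u : H1) : Integrable fun x => ‖toL2 u x‖ ^ 4 := by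
  refine ((memLp_density u).integrable_mul (memLp_density_three u)).congr (.of_forall fun x => ?_)
  simp only [density, Pi.mul_apply]
  ring

theorem energyGP_eq (a : ℝ) (φ : H1) :
    energyGP a φ = ∑ i, ‖gradL i φ‖ ^ 2 + 4 * Real.pi * a * densityCorr φ 0 := by
  have h : ∀ i, Integrable fun x => ‖gradL i φ x‖ ^ 2 := fun i => integrable_norm_sq_L2 _
  simp only [energyGP, ← gradL_apply]
  rw [integral_add (integrable_finsetSum _ fun i _ => h i) ((integrable_density_sq φ).const_mul _),
    integral_finsetSum _ fun i _ => h i, integral_const_mul, densityCorr_zero]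
  simp only [norm_sq_L2]

namespace DilatedBounds

variable {V : R3 → ℝ} {l a : ℝ} {N : ℕ} {C lam : ℝ} {f : R3 → ℝ}
  (h : DilatedBounds V l a N C lam f)
include h

theorem const_nonneg : 0 ≤ C := (h.bounds.nonneg 0).trans (h.bounds.le 0)

/-- The duality pairing of the solution with its time derivative. -/
theorem iTimeDeriv_self {φ : H1} {u : ℝ → H1} (hu : IsModifiedGPSolution V f N φ u) (t : ℝ) :
    iTimeDeriv u t (u t) = ((∑ i, ‖gradL i (u t)‖ ^ 2
      + ∫ z, modPotential V f N z * densityCorr (u t) z : ℝ) : ℂ) := by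
  have hW := h.isPotential_modPotential
  rw [hu.equation, inner_grad, ← h.integral_convSq hW.integrable hW.even, Complex.ofReal_add,
    ← integral_complex_ofReal, Complex.ofReal_sum]
  congr 1
  · refine Finset.sum_congr rfl fun i _ => ?_
    rw [inner_self_eq_norm_sq_to_K]
    simp
  · refine integral_congr_ae (.of_forall fun x => ?_)
    simp only [map_mul, Complex.conj_ofReal, Complex.ofReal_mul, Complex.ofReal_pow]
    rw [mul_assoc, Complex.conj_mul']

theorem modPotential_le (z : R3) : modPotential V f N z ≤ C * dilated V N z := by
  rw [mul_comm]
  exact mul_le_mul_of_nonneg_left (h.bounds.le _) (h.dilated_potential.nonneg z)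

theorem integral_dilated_mul_densityCorr_le {u : H1} {B : ℝ} (hB : ∀ z, densityCorr u z ≤ B) :
    ∫ z, dilated V N z * densityCorr u z ≤ B * ∫ z, V z := by
  rw [← integral_dilated h.pos h.potential, ← integral_const_mul]
  refine integral_mono (h.integrable (continuous_densityCorr u))
    (h.dilated_potential.integrable.const_mul B) fun z => ?_
  rw [mul_comm]
  exact mul_le_mul_of_nonneg_right (hB z) (h.dilated_potential.nonneg z)

theorem integral_modPotential_mul_densityCorr_le {u : H1} {B : ℝ} (hB : ∀ z, densityCorr u z ≤ B) :
    ∫ z, modPotential V f N z * densityCorr u z ≤ C * (B * ∫ z, V z) := by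
  refine le_trans ?_ (mul_le_mul_of_nonneg_left (h.integral_dilated_mul_densityCorr_le hB)
    h.const_nonneg)
  rw [← integral_const_mul]
  refine integral_mono (h.isPotential_modPotential.integrable_mul (continuous_densityCorr u))
    ((h.integrable (continuous_densityCorr u)).const_mul C) fun z => ?_
  simp only
  rw [← mul_assoc]
  exact mul_le_mul_of_nonneg_right (h.modPotential_le z) (densityCorr_nonneg u z)

/-- The eigenvalue term is bounded, since `lam` is of order `N⁻³` and `|1 - f(Nz)|` is at most
`C / (N |z|)`. -/
theorem abs_eigenvalue_term_le (hl : 0 < l) {u : H1} {B : ℝ} (hB : ∀ z, densityCorr u z ≤ B) :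
    |N ^ 4 * lam * ∫ z, (f ((N : ℝ) • z) * (1 - f ((N : ℝ) • z))) * densityCorr u z|
      ≤ C * (C * C * B) * (8 * Real.pi * l ^ 2) := by
  obtain ⟨g, hg⟩ := h.bounds.profile
  have hN0 := cast_pos_of_one_le h.pos
  have hC := h.const_nonneg
  have hs := hg.scale hN0
  have hB0 : 0 ≤ B := (densityCorr_nonneg u 0).trans (hB 0)
  obtain ⟨hi, hle⟩ := setIntegral_ball_inv_norm_le (r := l) hl.le (x := 0) (by simpa using hl.le)
  simp only [zero_sub, norm_neg] at hi hle
  have hne : ∀ᵐ y : R3, y ≠ 0 := by simp [ae_iff]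
  have h1 : ‖∫ z, (f ((N : ℝ) • z) * (1 - f ((N : ℝ) • z))) * densityCorr u z‖
      ≤ ∫ z, (Metric.ball (0 : R3) l).indicator (fun z => (N : ℝ)⁻¹ * (C * C * B) * ‖z‖⁻¹) z := by
    refine norm_integral_le_of_norm_le ((integrable_indicator_iff measurableSet_ball).2
      (hi.const_mul _)) ?_
    filter_upwards [hne] with z hz0
    by_cases hz : z ∈ Metric.ball (0 : R3) l
    · have hpos : 0 < ‖z‖ := norm_pos_iff.2 hz0
      have h2 : |1 - f ((N : ℝ) • z)| ≤ (N : ℝ)⁻¹ * C * ‖z‖⁻¹ := by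
        have h3 := h.bounds.one_sub_le ((N : ℝ) • z)
        rw [norm_smul, Real.norm_of_nonneg hN0.le] at h3
        rw [← div_eq_mul_inv, le_div_iff₀ hpos, ← div_eq_inv_mul, le_div_iff₀ hN0]
        linarith
      rw [indicator_of_mem hz, norm_mul, norm_mul, Real.norm_of_nonneg (h.bounds.nonneg _),
        Real.norm_of_nonneg (densityCorr_nonneg u z), Real.norm_eq_abs]
      calc f ((N : ℝ) • z) * |1 - f ((N : ℝ) • z)| * densityCorr u z
          ≤ C * ((N : ℝ)⁻¹ * C * ‖z‖⁻¹) * B := by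
            gcongr
            · exact densityCorr_nonneg u z
            · exact h.bounds.le _
            · exact hB z
        _ = _ := by ring
    · have hp : f ((N : ℝ) • z) = 1 := hs.eq_c z (by simpa using hz)
      simp [indicator_of_notMem hz, hp]
  rw [integral_indicator measurableSet_ball, integral_const_mul] at h1
  have hlam : (N : ℝ) ^ 4 * lam * (N : ℝ)⁻¹ ≤ C := by
    have := h.bounds.lam_le
    calc (N : ℝ) ^ 4 * lam * (N : ℝ)⁻¹ = lam * (N : ℝ) ^ 3 := by field_simp
      _ ≤ C := this
  have hlam0 := h.bounds.lam_nonneg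
  rw [abs_mul, abs_of_nonneg (by positivity : 0 ≤ (N : ℝ) ^ 4 * lam)]
  calc (N : ℝ) ^ 4 * lam * |∫ z, (f ((N : ℝ) • z) * (1 - f ((N : ℝ) • z))) * densityCorr u z|
      ≤ (N : ℝ) ^ 4 * lam * ((N : ℝ)⁻¹ * (C * C * B) * (8 * Real.pi * l ^ 2)) := by
        refine mul_le_mul_of_nonneg_left (h1.trans ?_) (by positivity)
        gcongr
    _ = ((N : ℝ) ^ 4 * lam * (N : ℝ)⁻¹) * (C * C * B) * (8 * Real.pi * l ^ 2) := by ring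
    _ ≤ _ := by gcongr

/-- The Hartree energy approximates the Gross-Pitaevskii energy: `W` acts like `8 π a` times the delta
function on the Lipschitz function `Ψ`. -/
theorem abs_hartreeEnergy_sub_energyGP_le (φ : H1) {L : ℝ}
    (hL : ∀ z, |densityCorr φ z - densityCorr φ 0| ≤ L * ‖z‖) :
    N * |hartreeEnergy (modPotential V f N) φ - energyGP a φ|
      ≤ C * densityCorr φ 0 + 1 / 2 * (C * L * ∫ z, V z * ‖z‖) := by
  have hN0 := cast_pos_of_one_le h.pos
  have hC := h.const_nonneg
  have hW := h.isPotential_modPotential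
  have hΨ := continuous_densityCorr φ
  have e1 : ∫ z, modPotential V f N z = ∫ z, V z * f z := integral_dilated_mul h.pos h.potential f
  have e2 : ∫ z, 1 / 2 * V z * f z = 1 / 2 * ∫ z, V z * f z := by
    rw [← integral_const_mul]
    exact integral_congr_ae (.of_forall fun z => by ring)
  have e3 : hartreeEnergy (modPotential V f N) φ - energyGP a φ
      = ((∫ z, 1 / 2 * V z * f z) - 4 * Real.pi * a) * densityCorr φ 0
        + 1 / 2 * ∫ z, modPotential V f N z * (densityCorr φ z - densityCorr φ 0) := by
    have e4 : ∫ z, modPotential V f N z * (densityCorr φ z - densityCorr φ 0)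
        = (∫ z, modPotential V f N z * densityCorr φ z)
          - (∫ z, modPotential V f N z) * densityCorr φ 0 := by
      rw [← integral_mul_const, ← integral_sub (hW.integrable_mul hΨ) (hW.integrable.mul_const _)]
      exact integral_congr_ae (.of_forall fun z => by ring)
    rw [e4, e1, e2, energyGP_eq, hartreeEnergy]
    ring
  have h1 : |∫ z, modPotential V f N z * (densityCorr φ z - densityCorr φ 0)|
      ≤ ∫ z, C * L * (N : ℝ)⁻¹ * (dilated V N z * ‖(N : ℝ) • z‖) := by
    rw [← Real.norm_eq_abs]
    refine norm_integral_le_of_norm_le ((h.integrable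
      (continuous_norm.comp (continuous_const_smul (N : ℝ)))).const_mul _) (.of_forall fun z => ?_)
    rw [norm_mul, Real.norm_of_nonneg (hW.nonneg z), Real.norm_eq_abs, norm_smul,
      Real.norm_of_nonneg hN0.le]
    have hd := h.dilated_potential.nonneg z
    calc modPotential V f N z * |densityCorr φ z - densityCorr φ 0|
        ≤ C * dilated V N z * (L * ‖z‖) :=
          mul_le_mul (h.modPotential_le z) (hL z) (abs_nonneg _) (by positivity)
      _ = _ := by field_simp
  rw [integral_const_mul, integral_dilated_mul h.pos h.potential fun z => ‖z‖] at h1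
  have h2 := h.bounds.scattering
  have h0 := densityCorr_nonneg φ 0
  rw [e3]
  calc (N : ℝ) * |((∫ z, 1 / 2 * V z * f z) - 4 * Real.pi * a) * densityCorr φ 0
        + 1 / 2 * ∫ z, modPotential V f N z * (densityCorr φ z - densityCorr φ 0)|
      ≤ N * (|(∫ z, 1 / 2 * V z * f z) - 4 * Real.pi * a| * densityCorr φ 0
        + 1 / 2 * (C * L * (N : ℝ)⁻¹ * ∫ z, V z * ‖z‖)) := by
        refine mul_le_mul_of_nonneg_left ((abs_add_le _ _).trans ?_) hN0.le
        rw [abs_mul, abs_mul, abs_of_nonneg h0, abs_of_pos (by norm_num : (0 : ℝ) < 1 / 2)]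
        gcongr
    _ = |(∫ z, 1 / 2 * V z * f z) - 4 * Real.pi * a| * N * densityCorr φ 0
        + 1 / 2 * (C * L * ∫ z, V z * ‖z‖) := by field_simp
    _ ≤ _ := by gcongr

/-- Conservation of the energy and of the mass bounds the `H¹`-norm of the solution. -/
theorem gradient_le_of_solution {φ : H1} {u : ℝ → H1} (hu : IsModifiedGPSolution V f N φ u)
    {B : ℝ} (hB : ∀ z, densityCorr φ z ≤ B) (t : ℝ) :
    ∑ i, ‖gradL i (u t)‖ ^ 2 ≤ ∑ i, ‖gradL i φ‖ ^ 2 + 1 / 2 * (C * (B * ∫ z, V z)) := by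
  have hW := h.isPotential_modPotential
  have h1 := (hu.isHartreeSolution hW).hartreeEnergy_eq t
  rw [hu.initial, hartreeEnergy, hartreeEnergy] at h1
  have h2 := h.integral_modPotential_mul_densityCorr_le hB
  have h3 : 0 ≤ ∫ z, modPotential V f N z * densityCorr (u t) z :=
    integral_nonneg fun z => mul_nonneg (hW.nonneg z) (densityCorr_nonneg _ z)
  linarith

/-- The estimate for fixed `N`, with all constants explicit. -/
theorem norm_constC_add_sub_le (hl : 0 < l) {φ : H1} {u : ℝ → H1}
    (hu : IsModifiedGPSolution V f N φ u) (t : ℝ) {B A L : ℝ}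
    (hB : ∀ z, densityCorr (u t) z ≤ B) (hA : ∑ i, ‖gradL i (u t)‖ ^ 2 ≤ A)
    (hL : ∀ z, |densityCorr φ z - densityCorr φ 0| ≤ L * ‖z‖) :
    ‖((constC V f N (u t) : ℂ) + (N : ℂ) * iTimeDeriv u t (u t)) - (N : ℂ) * (energyGP a φ : ℂ)‖
      ≤ 1 / 2 * (B * ∫ z, V z) + C * (C * C * B) * (8 * Real.pi * l ^ 2) + 4 * C ^ 2 * A ^ 2
        + (C * densityCorr φ 0 + 1 / 2 * (C * L * ∫ z, V z * ‖z‖)) := by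
  have hN0 := cast_pos_of_one_le h.pos
  have hW := h.isPotential_modPotential
  have h1 := (hu.isHartreeSolution hW).hartreeEnergy_eq t
  rw [hu.initial] at h1
  have hE := h.abs_hartreeEnergy_sub_energyGP_le φ hL
  rw [← abs_of_pos hN0, ← abs_mul] at hE
  have hK : Continuous fun z : R3 => (N : ℝ) * (1 - f ((N : ℝ) • z)) :=
    continuous_const.mul (continuous_const.sub h.continuous_dilate)
  have hKM : ∀ z : R3, |(N : ℝ) * (1 - f ((N : ℝ) • z))| ≤ N * (1 + C) := fun z => by
    rw [abs_mul, abs_of_pos hN0]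
    refine mul_le_mul_of_nonneg_left ?_ hN0.le
    have h2 := h.bounds.nonneg ((N : ℝ) • z)
    have h3 := h.bounds.le ((N : ℝ) • z)
    exact abs_le.2 ⟨by linarith, by linarith⟩
  have hKC : ∀ z : R3, ‖z‖ * |(N : ℝ) * (1 - f ((N : ℝ) • z))| ≤ C := fun z => by
    have h3 := h.bounds.one_sub_le ((N : ℝ) • z)
    rw [norm_smul, Real.norm_of_nonneg hN0.le] at h3
    rw [abs_mul, abs_of_pos hN0]
    linarith
  have hR0 := remainder_nonneg (fun z : R3 => (N : ℝ) * (1 - f ((N : ℝ) • z))) (u t)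
  have hR := remainder_le hK hKM hKC (u t)
  have hS0 : 0 ≤ ∑ i, ‖gradL i (u t)‖ ^ 2 := Finset.sum_nonneg fun i _ => sq_nonneg _
  have hRA : 4 * C ^ 2 * (∑ i, ‖gradL i (u t)‖ ^ 2) ^ 2 ≤ 4 * C ^ 2 * A ^ 2 := by gcongr
  have hU0 : 0 ≤ ∫ z, dilated V N z * densityCorr (u t) z :=
    integral_nonneg fun z => mul_nonneg (h.dilated_potential.nonneg z) (densityCorr_nonneg _ z)
  have hU := h.integral_dilated_mul_densityCorr_le hB
  have hT := h.abs_eigenvalue_term_le hl hB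
  have hc := h.constC_eq (u t)
  rw [h.iTimeDeriv_self hu t]
  norm_cast
  rw [Real.norm_eq_abs, hc]
  rw [hartreeEnergy] at h1
  rw [abs_le] at hE hT ⊢
  -- Energy conservation at time `t` turns the leading terms into `N` times the energy of `φ`.
  constructor <;> nlinarith

end DilatedBounds

end

end

end GP

theorem mainTheorem8 (V : GP.R3 → ℝ) (hV3 : MemLp V 3 volume) (hVnonneg : ∀ x, 0 ≤ V x)
    (hVsupp : HasCompactSupport V) (hVradial : ∀ x y, ‖x‖ = ‖y‖ → V x = V y)
    (a₀ : ℝ) (ha₀ : GP.IsScatteringLength V a₀) (ℓ : ℝ) (hℓ : 0 < ℓ) (φ : GP.H1) :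
    ∃ C : ℝ, 0 < C ∧ ∀ N : ℕ, 1 ≤ N →
      ∀ (lam : ℝ) (f : GP.R3 → ℝ), GP.IsNeumannGroundState V (N * ℓ) lam f →
      ∀ u : ℝ → GP.H1, GP.IsModifiedGPSolution V f N φ u →
      ∀ t : ℝ, (∃ G, GP.IsGradX (GP.kernel f N (u t)) G) ∧
        ‖((GP.constC V f N (u t) : ℂ) + (N : ℂ) * GP.iTimeDeriv u t (u t))
          - (N : ℂ) * (GP.energyGP a₀ φ : ℂ)‖ ≤ C := by
  have hV : GP.IsPotential V := ⟨hV3, hVnonneg, hVsupp, fun x => hVradial _ _ (norm_neg x)⟩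
  obtain ⟨C, hC⟩ := hV.exists_groundStateBounds hℓ ha₀
  obtain ⟨P, hP0, hP⟩ := GP.exists_densityCorr_le
  set I := ∫ z, V z
  set L := ∑ i, ‖GP.gradDensity i φ‖ * ‖GP.density3 φ φ‖
  set A := ∑ i, ‖GP.gradL i φ‖ ^ 2 + 1 / 2 * (C * (P * (‖φ‖ ^ 2) ^ 2 * I))
  set B := P * (‖GP.toL2 φ‖ ^ 2 + A) ^ 2
  set D := 1 / 2 * (B * I) + C * (C * C * B) * (8 * Real.pi * ℓ ^ 2) + 4 * C ^ 2 * A ^ 2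
    + (C * GP.densityCorr φ 0 + 1 / 2 * (C * L * ∫ z, V z * ‖z‖))
  refine ⟨max D 1, by positivity, fun N hN lam f hf u hu t => ?_⟩
  have h : GP.DilatedBounds V ℓ a₀ N C lam f := ⟨hN, hV, hC N hN lam f hf⟩
  have hA : ∑ i, ‖GP.gradL i (u t)‖ ^ 2 ≤ A := h.gradient_le_of_solution hu (hP φ) t
  have hmass := (hu.isHartreeSolution h.isPotential_modPotential).norm_toL2_eq t
  rw [hu.initial] at hmass
  have hB : ∀ z, GP.densityCorr (u t) z ≤ B := fun z => by
    refine (hP (u t) z).trans (mul_le_mul_of_nonneg_left (pow_le_pow_left₀ (sq_nonneg _) ?_ 2) hP0)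
    rw [GP.norm_sq_H1, hmass]
    linarith
  exact ⟨(h.exists_gradX_and_gradXSq_eq (u t)).1,
    (h.norm_constC_add_sub_le hℓ hu t hB hA (GP.abs_densityCorr_sub_le φ)).trans (le_max_left _ _)⟩
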